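/- **Setting.** Let $\varphi,\psi\in\mathbb Z[z]$ be coprime monic polynomials of degree $22$ with $z^{22}\varphi(z^{-1})=-\varphi(z)$ and $z^{22}\psi(z^{-1})=\psi(z)$. Let $\Phi,\Psi\in\mathbb Z[w]$ be their trace polynomials, that is, the monic polynomials of degrees $10$ and $11$ with $\varphi(z)=(z^2-1)z^{10}\Phi(z+z^{-1})$ and $\psi(z)=z^{11}\Psi(z+z^{-1})$. Let $A,B$ be the companion matrices of $\varphi,\psi$ (ones below the diagonal; last column formed by the negatives of the coefficients, the constant term at the top). There is a nonzero $\mathbf r\in\mathbb Q^{22}$ with $A^{-1}B\,\mathbf r=-\mathbf r$. For each such $\mathbf r$ there is a unique symmetric bilinear form $(\cdot,\cdot)$ on $\mathbb Q^{22}$ that is invariant under $A$ and $B$ and satisfies $(\mathbf r,\mathbf r)=2$. The hypergeometric lattice is $L=\langle \mathbf r,A\mathbf r,\dots,A^{21}\mathbf r\rangle_{\mathbb Z}$ with this form. *Renormalization* replaces the form by its negative if its index (number of positive minus number of negative squares) is positive. A *K3 lattice* is an even unimodular lattice of rank $22$ and signature $(3,19)$. A *Hodge structure* on $L$ is an orthogonal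 decomposition $L\otimes\mathbb C=H^{2,0}\oplus H^{1,1}\oplus H^{0,2}$, for the induced Hermitian form, of signatures $(1,0),(1,19),(1,0)$ and with $\overline{H^{i,j}}=H^{j,i}$. A *Hodge isometry* is an automorphism of $L$ preserving the decomposition. It is *positive* if it maps each of the two components of $\mathcal C=\{v\in H^{1,1}\cap L_{\mathbb R}:(v,v)>0\}$ to itself. It is *elliptic* if it preserves a line in $\mathcal C\cup\{0\}$, *parabolic* if it preserves a unique line in $\overline{\mathcal C}$ and that line lies on $\partial\mathcal C$, and *hyperbolic* if its eigenvalues off the unit circle are exactly $\lambda,\lambda^{-1}$ for some real $\lambda>1$. If $A$ is a Hodge isometry acting on $H^{2,0}$ as the scalar $\delta$ with $|\delta|=1$, its *special trace* is $\tau(A)=\delta+\delta^{-1}$. Let $\mathbf A_{\rm on},\mathbf A_{\rm off}$ be the multisets of complex roots of $\Phi$ on and off $[-2,2]$, let $\mathbf A_{>2}$ be that of its roots in $(2,\infty)$, and let $\mathbf B_{\rm on},\mathbf B_{\rm off}$ be the multisets for $\Psi$ on and off $[-2,2]$. The multisets $\mathbf A_{\rm on},\mathbf B_{\rm on}$ dissect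 each other into *trace clusters* $\mathbf A_{s+1}<\mathbf B_s<\mathbf A_s<\dots<\mathbf B_1<\mathbf A_1$, where only $\mathbf A_1$ and $\mathbf A_{s+1}$ may be empty ("null"). The symbol $[\mathbf A_{\rm on}]=0^{\nu_0}1^{\nu_1}2^{\nu_2}3^{\nu_3}$ means that among the clusters $\mathbf A_i$ exactly $\nu_j$ have $j$ elements for $j=0,1,2,3$ and no others occur; likewise for $[\mathbf B_{\rm on}]$. "Doubles adjacent" (AP) means that there are a unique double cluster $\mathbf A_i$ and a unique double cluster $\mathbf B_j$ and that they are adjacent, i.e. $i=j$ or $i=j+1$. **Theorem.** Assume that $L$ is unimodular. After renormalization, $L$ is a K3 lattice with a Hodge structure such that $A$ is a positive Hodge isometry, if and only if $\Phi(-2)\ne0$, all complex roots of $\Phi$ and of $\Psi$ are simple, and one of the following holds: * (E) the trace clusters form an entry of Table 1, and $\Phi(2)\neq0$; * (P) the trace clusters form an entry of Table 1, and $\Phi(2)=0$; * (H) the trace clusters form an entry of Table 2, and $\Phi(2)\neq0$. For every Hodge structure (on the renormalized $L$) for which $A$ is a positive Hodge isometry, $A$ is elliptic, parabolic or hyperbolic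 if and only if (E), (P) or (H) holds, respectively. Any two such Hodge structures are equal or complex conjugate to each other. If such a Hodge structure exists, then $\tau(A)$ is the same for all of them, and it lies where the last column of the tables says. There "middle of TC" is the middle element of the unique triple cluster $\mathbf A_i$, and "inner of AP" is that one of the two middle elements of the four-element set $\mathbf A_i\cup\mathbf B_j$ of the adjacent double clusters which belongs to $\mathbf A_i$. Table 1. | case | $s$ | $[\mathbf A_{\rm on}]$ | $[\mathbf B_{\rm on}]$ | $\mathbf A_1$ | $\lvert\mathbf B_{\rm off}\rvert$ | constraints | $\tau(A)$ | |---|---|---|---|---|---|---|---| | 1 | 8 | $0^11^73^1$ | $1^8$ | non-null | 3 | | middle of TC | | 2 | 8 | $0^11^73^1$ | $1^73^1$ | non-null | 1 | | middle of TC | | 3 | 9 | $0^21^73^1$ | $1^82^1$ | null | 1 | $\lvert\mathbf B_1\rvert=2$ | middle of TC | | 4 | 8 | $1^82^1$ | $1^8$ | non-null | 3 | $\lvert\mathbf A_9\rvert=2$ | $\min\mathbf A_9$ | | 5 | 8 | $1^82^1$ | $1^73^1$ | non-null | 1 | $\lvert\mathbf A_9\rvert=2$ | $\min\mathbf A_9$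 | | 6 | 9 | $0^11^82^1$ | $1^82^1$ | non-null | 1 | doubles adjacent | inner of AP | | 7 | 9 | $0^11^82^1$ | $1^82^1$ | null | 1 | $\lvert\mathbf A_{10}\rvert=2$, $\lvert\mathbf B_1\rvert=2$ | $\min\mathbf A_{10}$ | | 8 | 10 | $0^21^82^1$ | $1^{10}$ | null | 1 | $\lvert\mathbf A_2\rvert=2$ | $\max\mathbf A_2$ | | 9 | 9 | $1^{10}$ | $1^82^1$ | non-null | 1 | $\lvert\mathbf B_9\rvert=2$ | element of $\mathbf A_{10}$ | Table 2. | case | $s$ | $[\mathbf A_{\rm on}]$ | $[\mathbf B_{\rm on}]$ | $\lvert\mathbf A_{>2}\rvert$ | $\lvert\mathbf B_{\rm off}\rvert$ | constraints | $\tau(A)$ | |---|---|---|---|---|---|---|---| | 1 | 8 | $0^21^63^1$ | $1^8$ | 1 | 3 | | middle of TC | | 2 | 8 | $0^21^63^1$ | $1^73^1$ | 1 | 1 | | middle of TC | | 3 | 8 | $0^11^72^1$ | $1^8$ | 1 | 3 | $\lvert\mathbf A_1\rvert=2$ | $\max\mathbf A_1$ | | 4 | 8 | $0^11^72^1$ |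 $1^8$ | 1 | 3 | $\lvert\mathbf A_9\rvert=2$ | $\min\mathbf A_9$ | | 5 | 8 | $0^11^72^1$ | $1^73^1$ | 1 | 1 | $\lvert\mathbf A_1\rvert=2$ | $\max\mathbf A_1$ | | 6 | 8 | $0^11^72^1$ | $1^73^1$ | 1 | 1 | $\lvert\mathbf A_9\rvert=2$ | $\min\mathbf A_9$ | | 7 | 9 | $0^21^72^1$ | $1^82^1$ | 1 | 1 | doubles adjacent | inner of AP | | 8 | 9 | $0^11^9$ | $1^82^1$ | 1 | 1 | $\lvert\mathbf A_1\rvert=1$, $\lvert\mathbf B_1\rvert=2$ | element of $\mathbf A_1$ | | 9 | 9 | $0^11^9$ | $1^82^1$ | 1 | 1 | $\lvert\mathbf A_{10}\rvert=1$, $\lvert\mathbf B_9\rvert=2$ | element of $\mathbf A_{10}$ | -/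

import Mathlib

open Polynomial Matrix

noncomputable section

namespace HyperK3

/-! ### Companion matrices, the reflection vector, and the hypergeometric lattice -/

/-- The companion matrix of a monic polynomial `f = z ^ n + f₁ z ^ (n-1) + ⋯ + fₙ`: ones below the
diagonal, and last column `(-fₙ, …, -f₁)` from top to bottom, where `fₙ` is the constant term. -/
def companion (n : ℕ) (f : ℤ[X]) : Matrix (Fin n) (Fin n) ℚ :=
  Matrix.of fun i j =>
    if (j : ℕ) + 1 = n then -(f.coeff (i : ℕ) : ℚ)
    else if (i : ℕ) = (j : ℕ) + 1 then 1 else 0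

/-- `r ∈ ℚ ^ n` is a nonzero vector that the reflection `C = A⁻¹ B` sends to `-r`, where
`A` and `B` are the companion matrices of `φ` and `ψ`. -/
def IsReflectionVector (n : ℕ) (φ ψ : ℤ[X]) (r : Fin n → ℚ) : Prop :=
  r ≠ 0 ∧ ((companion n φ)⁻¹ * companion n ψ) *ᵥ r = -r

/-- The lattice `L = ⟨r, A r, …, A ^ (n-1) r⟩` over `ℤ`, inside `ℚ ^ n`. -/
def lattice (n : ℕ) (φ : ℤ[X]) (r : Fin n → ℚ) : Submodule ℤ (Fin n → ℚ) :=
  Submodule.span ℤ (Set.range fun i : Fin n => (companion n φ ^ (i : ℕ)) *ᵥ r)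

/-- `G` is the matrix (in the standard basis of `ℚ ^ n`) of a symmetric bilinear form
`(x, y) = xᵀ G y` that is invariant under the group generated by `A` and `B` and satisfies
`(r, r) = 2`. -/
def IsNormalizedInvariantForm (n : ℕ) (φ ψ : ℤ[X]) (r : Fin n → ℚ)
    (G : Matrix (Fin n) (Fin n) ℚ) : Prop :=
  G.IsSymm ∧ (companion n φ)ᵀ * G * companion n φ = G ∧
    (companion n ψ)ᵀ * G * companion n ψ = G ∧ r ⬝ᵥ (G *ᵥ r) = 2

/-- The lattice `L` is unimodular for the form `G`: it is equal to its dual lattice. -/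
def IsUnimodular {n : ℕ} (G : Matrix (Fin n) (Fin n) ℚ) (L : Submodule ℤ (Fin n → ℚ)) : Prop :=
  ∀ x : Fin n → ℚ, x ∈ L ↔ ∀ y ∈ L, ∃ k : ℤ, x ⬝ᵥ (G *ᵥ y) = k

/-- The lattice `L` is even for the form `G`. -/
def IsEven {n : ℕ} (G : Matrix (Fin n) (Fin n) ℚ) (L : Submodule ℤ (Fin n → ℚ)) : Prop :=
  ∀ x ∈ L, ∃ k : ℤ, x ⬝ᵥ (G *ᵥ x) = 2 * k

/-! ### Hermitian extension, signature, K3 lattices -/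

/-- Extension of scalars of a rational matrix to `𝕜 = ℝ` or `ℂ`. -/
def extendScalars {n : ℕ} (𝕜 : Type) [RCLike 𝕜] (M : Matrix (Fin n) (Fin n) ℚ) :
    Matrix (Fin n) (Fin n) 𝕜 :=
  M.map (fun q : ℚ => (q : 𝕜))

/-- The form induced by `G` on `𝕜 ^ n`: the bilinear form for `𝕜 = ℝ`, the Hermitian form for
`𝕜 = ℂ`. -/
def herm {n : ℕ} {𝕜 : Type} [RCLike 𝕜] (G : Matrix (Fin n) (Fin n) ℚ) (x y : Fin n → 𝕜) : 𝕜 :=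
  star x ⬝ᵥ (extendScalars 𝕜 G *ᵥ y)

/-- The restriction to the subspace `W` of the form induced by `G` is nondegenerate of
signature `(p, q)`. -/
def HasSignature {n : ℕ} {𝕜 : Type} [RCLike 𝕜] (G : Matrix (Fin n) (Fin n) ℚ)
    (W : Submodule 𝕜 (Fin n → 𝕜)) (p q : ℕ) : Prop :=
  ∃ P N : Submodule 𝕜 (Fin n → 𝕜), P ⊔ N = W ∧ Disjoint P N ∧
    (∀ x ∈ P, ∀ y ∈ N, herm G x y = 0) ∧
    (∀ x ∈ P, x ≠ 0 → 0 < RCLike.re (herm G x x)) ∧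
    (∀ x ∈ N, x ≠ 0 → RCLike.re (herm G x x) < 0) ∧
    Module.finrank 𝕜 P = p ∧ Module.finrank 𝕜 N = q

open Classical in
/-- Renormalization: the form is negated when its index `p - q` is positive. -/
def renormalize {n : ℕ} (G : Matrix (Fin n) (Fin n) ℚ) : Matrix (Fin n) (Fin n) ℚ :=
  if ∃ p q : ℕ, q < p ∧ HasSignature G (⊤ : Submodule ℝ (Fin n → ℝ)) p q then -G else G

/-- `L`, a full lattice in `ℚ ^ n` with the form `G`, is a K3 lattice: even, unimodular, of rank `22`
and signature `(3, 19)`. -/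
def IsK3Lattice {n : ℕ} (G : Matrix (Fin n) (Fin n) ℚ) (L : Submodule ℤ (Fin n → ℚ)) : Prop :=
  Module.finrank ℤ L = 22 ∧ Submodule.span ℚ (L : Set (Fin n → ℚ)) = ⊤ ∧
    IsEven G L ∧ IsUnimodular G L ∧ HasSignature G (⊤ : Submodule ℝ (Fin n → ℝ)) 3 19

/-! ### Hodge structures and Hodge isometries -/

/-- A Hodge structure on a lattice that spans `ℚ ^ n`, with form `G`: an orthogonal decomposition
`ℂ ^ n = H20 ⊕ H11 ⊕ H02` of signatures `(1, 0)`, `(1, 19)`, `(1, 0)`, with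
`H20` and `H02` complex conjugate and `H11` stable under complex conjugation. -/
structure HodgeStructure {n : ℕ} (G : Matrix (Fin n) (Fin n) ℚ) where
  H20 : Submodule ℂ (Fin n → ℂ)
  H11 : Submodule ℂ (Fin n → ℂ)
  H02 : Submodule ℂ (Fin n → ℂ)
  indep : iSupIndep ![H20, H11, H02]
  sup_eq_top : H20 ⊔ H11 ⊔ H02 = ⊤
  orth_20_11 : ∀ x ∈ H20, ∀ y ∈ H11, herm G x y = 0
  orth_20_02 : ∀ x ∈ H20, ∀ y ∈ H02, herm G x y = 0
  orth_11_02 : ∀ x ∈ H11, ∀ y ∈ H02, herm G x y = 0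
  sign_20 : HasSignature G H20 1 0
  sign_11 : HasSignature G H11 1 19
  sign_02 : HasSignature G H02 1 0
  conj_20 : ∀ x, star x ∈ H20 ↔ x ∈ H02
  conj_11 : ∀ x, star x ∈ H11 ↔ x ∈ H11

namespace HodgeStructure

variable {n : ℕ} {G : Matrix (Fin n) (Fin n) ℚ}

/-- The set `𝒞` of time-like vectors, that is, real vectors `v` in `H11` with `(v, v) > 0`. -/
def timeCone (H : HodgeStructure G) : Set (Fin n → ℝ) :=
  {v | (fun i => (v i : ℂ)) ∈ H.H11 ∧ 0 < herm G v v}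

/-- `P` is one of the two connected components of `𝒞`. -/
def IsHalfCone (H : HodgeStructure G) (P : Set (Fin n → ℝ)) : Prop :=
  ∃ v ∈ H.timeCone, P = connectedComponentIn H.timeCone v

/-- `F` is a Hodge isometry of the lattice `L`: an automorphism of `L` with its form that preserves
the Hodge structure. -/
def IsHodgeIsometry (H : HodgeStructure G) (L : Submodule ℤ (Fin n → ℚ))
    (F : Matrix (Fin n) (Fin n) ℚ) : Prop :=
  L.map (F.mulVecLin.restrictScalars ℤ) = L ∧ Fᵀ * G * F = G ∧
    H.H20.map (extendScalars ℂ F).mulVecLin = H.H20 ∧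
    H.H11.map (extendScalars ℂ F).mulVecLin = H.H11 ∧
    H.H02.map (extendScalars ℂ F).mulVecLin = H.H02

/-- `F` is a positive Hodge isometry: it maps each of the two components of `𝒞` onto itself. -/
def IsPositiveHodgeIsometry (H : HodgeStructure G) (L : Submodule ℤ (Fin n → ℚ))
    (F : Matrix (Fin n) (Fin n) ℚ) : Prop :=
  H.IsHodgeIsometry L F ∧ ∀ P, H.IsHalfCone P → (fun v => extendScalars ℝ F *ᵥ v) '' P = P

/-- The real line through `v` is preserved by `F`. -/
def PreservesLine (F : Matrix (Fin n) (Fin n) ℚ) (v : Fin n → ℝ) : Prop :=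
  v ≠ 0 ∧ ∃ c : ℝ, extendScalars ℝ F *ᵥ v = c • v

/-- Elliptic type: `F` preserves a line in `𝒞 ∪ {0}`. -/
def IsElliptic (H : HodgeStructure G) (F : Matrix (Fin n) (Fin n) ℚ) : Prop :=
  ∃ v ∈ H.timeCone, PreservesLine F v

/-- Parabolic type: there is a unique line in the closure of `𝒞` that `F` preserves, and this line
is on the boundary of `𝒞`. -/
def IsParabolic (H : HodgeStructure G) (F : Matrix (Fin n) (Fin n) ℚ) : Prop :=
  ∃ v ∈ closure H.timeCone, v ∉ H.timeCone ∧ PreservesLine F v ∧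
    ∀ w ∈ closure H.timeCone, PreservesLine F w → ∃ c : ℝ, w = c • v

/-- Hyperbolic type: for some real `l > 1`, the eigenvalues of `F` outside the unit circle are
exactly `l` and `l⁻¹`. -/
def IsHyperbolic (F : Matrix (Fin n) (Fin n) ℚ) : Prop :=
  ∃ l : ℝ, 1 < l ∧ ∀ μ : ℂ,
    (Module.End.HasEigenvalue (extendScalars ℂ F).mulVecLin μ ∧ ‖μ‖ ≠ 1) ↔ (μ = (l : ℂ) ∨ μ = (l : ℂ)⁻¹)

/-- `t` is the special trace `δ + δ⁻¹` of `F`, where `F` acts on `H20` as multiplication by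
`δ` with `|δ| = 1`. -/
def IsSpecialTrace (H : HodgeStructure G) (F : Matrix (Fin n) (Fin n) ℚ) (t : ℝ) : Prop :=
  ∃ δ : ℂ, ‖δ‖ = 1 ∧ (∀ x ∈ H.H20, extendScalars ℂ F *ᵥ x = δ • x) ∧ (t : ℂ) = δ + δ⁻¹

end HodgeStructure

/-! ### Roots of trace polynomials and trace clusters -/

/-- The complex number `z` lies on the real interval `[-2, 2]`. -/
def OnInterval (z : ℂ) : Prop := z.im = 0 ∧ -2 ≤ z.re ∧ z.re ≤ 2

open Classical in
/-- The roots of `f` on `[-2, 2]`, with multiplicities, as real numbers. -/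
def rootsOn (f : ℤ[X]) : Multiset ℝ := ((f.aroots ℂ).filter OnInterval).map Complex.re

open Classical in
/-- The complex roots of `f` off `[-2, 2]`, with multiplicities. -/
def rootsOff (f : ℤ[X]) : Multiset ℂ := (f.aroots ℂ).filter fun z => ¬ OnInterval z

open Classical in
/-- The roots of `f` in `(2, ∞)`, with multiplicities. -/
def rootsGtTwo (f : ℤ[X]) : Multiset ℂ := (f.aroots ℂ).filter fun z => z.im = 0 ∧ 2 < z.re

/-- All complex roots of `f` are simple. -/
def SimpleRoots (f : ℤ[X]) : Prop := (f.aroots ℂ).Nodup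

/-- The trace clusters `A (s+1) < B s < A s < ⋯ < B 1 < A 1` into which two multisets of reals
dissect each other; only the end clusters `A 1` and `A (s+1)` may be null. The values of `A` and `B`
at other indices play no role. -/
structure TraceClusters (Aon Bon : Multiset ℝ) where
  s : ℕ
  A : ℕ → Multiset ℝ
  B : ℕ → Multiset ℝ
  sum_A : ∑ i ∈ Finset.Icc 1 (s + 1), A i = Aon
  sum_B : ∑ i ∈ Finset.Icc 1 s, B i = Bon
  B_lt_A : ∀ i ∈ Finset.Icc 1 s, ∀ b ∈ B i, ∀ a ∈ A i, b < a
  A_lt_B : ∀ i ∈ Finset.Icc 1 s, ∀ a ∈ A (i + 1), ∀ b ∈ B i, a < b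
  A_ne_zero : ∀ i ∈ Finset.Icc 2 s, A i ≠ 0
  B_ne_zero : ∀ i ∈ Finset.Icc 1 s, B i ≠ 0

/-- The symbol `0^ν₀ 1^ν₁ 2^ν₂ 3^ν₃`, as the multiset of cluster sizes that it describes. -/
def sizes (ν₀ ν₁ ν₂ ν₃ : ℕ) : Multiset ℕ :=
  Multiset.replicate ν₀ 0 + Multiset.replicate ν₁ 1 + Multiset.replicate ν₂ 2 +
    Multiset.replicate ν₃ 3

namespace TraceClusters

variable {Aon Bon : Multiset ℝ}

/-- `[A_on]`: the multiset of the sizes of all `A`-clusters, null ones included. -/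
def typeA (T : TraceClusters Aon Bon) : Multiset ℕ :=
  (Finset.Icc 1 (T.s + 1)).val.map fun i => (T.A i).card

/-- `[B_on]`: the multiset of the sizes of all `B`-clusters. -/
def typeB (T : TraceClusters Aon Bon) : Multiset ℕ :=
  (Finset.Icc 1 T.s).val.map fun i => (T.B i).card

/-- `A i` is the unique double `A`-cluster, `B j` is the unique double `B`-cluster, and they are
adjacent. (The neighbours of `B j` are `A j` and `A (j+1)`.) -/
def IsAdjacentPair (T : TraceClusters Aon Bon) (i j : ℕ) : Prop :=
  (∀ k ∈ Finset.Icc 1 (T.s + 1), (T.A k).card = 2 ↔ k = i) ∧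
  (∀ k ∈ Finset.Icc 1 T.s, (T.B k).card = 2 ↔ k = j) ∧
  i ∈ Finset.Icc 1 (T.s + 1) ∧ j ∈ Finset.Icc 1 T.s ∧ (i = j ∨ i = j + 1)

/-- "Doubles adjacent". -/
def DoublesAdjacent (T : TraceClusters Aon Bon) : Prop := ∃ i j, T.IsAdjacentPair i j

/-- "Middle of TC": `t` is the middle element of the unique triple `A`-cluster. -/
def IsMiddleOfTriple (T : TraceClusters Aon Bon) (t : ℝ) : Prop :=
  ∃ i ∈ Finset.Icc 1 (T.s + 1), (∀ k ∈ Finset.Icc 1 (T.s + 1), (T.A k).card = 3 ↔ k = i) ∧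
    ∃ a b : ℝ, a < t ∧ t < b ∧ T.A i = {a, t, b}

/-- "Inner of AP": `t` is the inner element in `A_on` of the unique adjacent pair of double
clusters; the inner elements of `{l₁ < l₂ < l₃ < l₄}` are `l₂` and `l₃`. -/
def IsInnerOfAdjacentPair (T : TraceClusters Aon Bon) (t : ℝ) : Prop :=
  ∃ i j, T.IsAdjacentPair i j ∧ t ∈ T.A i ∧
    ∃ l₁ l₂ l₃ l₄ : ℝ, l₁ < l₂ ∧ l₂ < l₃ ∧ l₃ < l₄ ∧ T.A i + T.B j = {l₁, l₂, l₃, l₄} ∧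
      (t = l₂ ∨ t = l₃)

/-- `t = min (A i)`. -/
def IsMinOf (T : TraceClusters Aon Bon) (i : ℕ) (t : ℝ) : Prop := t ∈ T.A i ∧ ∀ a ∈ T.A i, t ≤ a

/-- `t = max (A i)`. -/
def IsMaxOf (T : TraceClusters Aon Bon) (i : ℕ) (t : ℝ) : Prop := t ∈ T.A i ∧ ∀ a ∈ T.A i, a ≤ t

/-- The nine entries of the elliptic/parabolic table, as conditions on the trace clusters and on
the number `bOff` of roots of `Ψ` off `[-2, 2]`. -/
def EPEntry (T : TraceClusters Aon Bon) (bOff : ℕ) : ℕ → Prop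
  | 1 => T.s = 8 ∧ T.typeA = sizes 1 7 0 1 ∧ T.typeB = sizes 0 8 0 0 ∧ T.A 1 ≠ 0 ∧ bOff = 3
  | 2 => T.s = 8 ∧ T.typeA = sizes 1 7 0 1 ∧ T.typeB = sizes 0 7 0 1 ∧ T.A 1 ≠ 0 ∧ bOff = 1
  | 3 => T.s = 9 ∧ T.typeA = sizes 2 7 0 1 ∧ T.typeB = sizes 0 8 1 0 ∧ T.A 1 = 0 ∧ bOff = 1 ∧
      (T.B 1).card = 2
  | 4 => T.s = 8 ∧ T.typeA = sizes 0 8 1 0 ∧ T.typeB = sizes 0 8 0 0 ∧ T.A 1 ≠ 0 ∧ bOff = 3 ∧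
      (T.A 9).card = 2
  | 5 => T.s = 8 ∧ T.typeA = sizes 0 8 1 0 ∧ T.typeB = sizes 0 7 0 1 ∧ T.A 1 ≠ 0 ∧ bOff = 1 ∧
      (T.A 9).card = 2
  | 6 => T.s = 9 ∧ T.typeA = sizes 1 8 1 0 ∧ T.typeB = sizes 0 8 1 0 ∧ T.A 1 ≠ 0 ∧ bOff = 1 ∧
      T.DoublesAdjacent
  | 7 => T.s = 9 ∧ T.typeA = sizes 1 8 1 0 ∧ T.typeB = sizes 0 8 1 0 ∧ T.A 1 = 0 ∧ bOff = 1 ∧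
      (T.A 10).card = 2 ∧ (T.B 1).card = 2
  | 8 => T.s = 10 ∧ T.typeA = sizes 2 8 1 0 ∧ T.typeB = sizes 0 10 0 0 ∧ T.A 1 = 0 ∧ bOff = 1 ∧
      (T.A 2).card = 2
  | 9 => T.s = 9 ∧ T.typeA = sizes 0 10 0 0 ∧ T.typeB = sizes 0 8 1 0 ∧ T.A 1 ≠ 0 ∧ bOff = 1 ∧
      (T.B 9).card = 2
  | _ => False

/-- The location of the special trace in the nine entries of the elliptic/parabolic table. -/
def EPLocation (T : TraceClusters Aon Bon) (t : ℝ) : ℕ → Prop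
  | 1 | 2 | 3 => T.IsMiddleOfTriple t
  | 4 | 5 => T.IsMinOf 9 t
  | 6 => T.IsInnerOfAdjacentPair t
  | 7 => T.IsMinOf 10 t
  | 8 => T.IsMaxOf 2 t
  | 9 => T.A 10 = {t}
  | _ => False

/-- The nine entries of the hyperbolic table, as conditions on the trace clusters, on the
number `aGt` of roots of `Φ` in `(2, ∞)`, and on the number `bOff` of roots of `Ψ` off `[-2, 2]`. -/
def HypEntry (T : TraceClusters Aon Bon) (aGt bOff : ℕ) : ℕ → Prop
  | 1 => T.s = 8 ∧ T.typeA = sizes 2 6 0 1 ∧ T.typeB = sizes 0 8 0 0 ∧ aGt = 1 ∧ bOff = 3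
  | 2 => T.s = 8 ∧ T.typeA = sizes 2 6 0 1 ∧ T.typeB = sizes 0 7 0 1 ∧ aGt = 1 ∧ bOff = 1
  | 3 => T.s = 8 ∧ T.typeA = sizes 1 7 1 0 ∧ T.typeB = sizes 0 8 0 0 ∧ aGt = 1 ∧ bOff = 3 ∧
      (T.A 1).card = 2
  | 4 => T.s = 8 ∧ T.typeA = sizes 1 7 1 0 ∧ T.typeB = sizes 0 8 0 0 ∧ aGt = 1 ∧ bOff = 3 ∧
      (T.A 9).card = 2
  | 5 => T.s = 8 ∧ T.typeA = sizes 1 7 1 0 ∧ T.typeB = sizes 0 7 0 1 ∧ aGt = 1 ∧ bOff = 1 ∧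
      (T.A 1).card = 2
  | 6 => T.s = 8 ∧ T.typeA = sizes 1 7 1 0 ∧ T.typeB = sizes 0 7 0 1 ∧ aGt = 1 ∧ bOff = 1 ∧
      (T.A 9).card = 2
  | 7 => T.s = 9 ∧ T.typeA = sizes 2 7 1 0 ∧ T.typeB = sizes 0 8 1 0 ∧ aGt = 1 ∧ bOff = 1 ∧
      T.DoublesAdjacent
  | 8 => T.s = 9 ∧ T.typeA = sizes 1 9 0 0 ∧ T.typeB = sizes 0 8 1 0 ∧ aGt = 1 ∧ bOff = 1 ∧
      (T.A 1).card = 1 ∧ (T.B 1).card = 2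
  | 9 => T.s = 9 ∧ T.typeA = sizes 1 9 0 0 ∧ T.typeB = sizes 0 8 1 0 ∧ aGt = 1 ∧ bOff = 1 ∧
      (T.A 10).card = 1 ∧ (T.B 9).card = 2
  | _ => False

/-- The location of the special trace in the nine entries of the hyperbolic table. -/
def HypLocation (T : TraceClusters Aon Bon) (t : ℝ) : ℕ → Prop
  | 1 | 2 => T.IsMiddleOfTriple t
  | 3 | 5 => T.IsMaxOf 1 t
  | 4 | 6 => T.IsMinOf 9 t
  | 7 => T.IsInnerOfAdjacentPair t
  | 8 => T.A 1 = {t}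
  | 9 => T.A 10 = {t}
  | _ => False

end TraceClusters

/-- The trace clusters of `Φ` and `Ψ` form an entry of the elliptic/parabolic table. -/
def MatchesEP (Φ Ψ : ℤ[X]) : Prop :=
  ∃ (T : TraceClusters (rootsOn Φ) (rootsOn Ψ)) (k : ℕ), T.EPEntry (rootsOff Ψ).card k

/-- The trace clusters of `Φ` and `Ψ` form an entry of the hyperbolic table. -/
def MatchesHyp (Φ Ψ : ℤ[X]) : Prop :=
  ∃ (T : TraceClusters (rootsOn Φ) (rootsOn Ψ)) (k : ℕ),
    T.HypEntry (rootsGtTwo Φ).card (rootsOff Ψ).card k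

/-- Configuration (E). -/
def ConfigE (Φ Ψ : ℤ[X]) : Prop := MatchesEP Φ Ψ ∧ Φ.eval 2 ≠ 0

/-- Configuration (P). -/
def ConfigP (Φ Ψ : ℤ[X]) : Prop := MatchesEP Φ Ψ ∧ Φ.eval 2 = 0

/-- Configuration (H). -/
def ConfigH (Φ Ψ : ℤ[X]) : Prop := MatchesHyp Φ Ψ ∧ Φ.eval 2 ≠ 0

end HyperK3

end

open HyperK3

/-!
Write `A` for the companion matrix of `φ` and identify `ℂ[z] / (φ)` with `ℂ ^ 22` by `p ↦ p (A) r`.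
The invariant form is given by the functional "last coordinate" (`IsHyperPair.exists_dual_form`,
`IsHyperPair.dual_of_invariant`), which gives its existence and uniqueness, and which makes it
computable on the eigenvectors `v_α = (φ / (z - α)) (A) r` of `A` (`isSpectral_of_normalized`).
For `|α| = 1` and `w = α + α⁻¹` it gives
`(v_α, v_α) = (w ^ 2 - 4) Φ' (w) Ψ (w)`, and `(v₁, v₁) = 2 Φ (2) Ψ (2)`,
`(v₋₁, v₋₁) = -2 Φ (-2) Ψ (-2)`. Unimodularity enters only through
`Ψ (2) = Ψ (-2) = ± 1` (`eval_two_of_unimodular`).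

Let `A` be a positive Hodge isometry. Then `H20` is spanned by some `v_δ` with `|δ| = 1`
(`exists_isPeriod`), and `H11` is its orthogonal complement together with that of its conjugate.
As `H11` has signature `(1, 19)`, it has no isotropic plane and no two orthogonal causal vectors that
are independent. Hence all roots of `Φ` are real and simple, at most one of them is off `(-2, 2)`, and
the sign of the form on all eigenvectors is prescribed; as `A` fixes the components of the time cone,
causal eigenvectors have positive eigenvalues, and so no root is `≤ -2`. These conditions
are collected in `IsPattern` (`IsPeriod.isPattern`). Conversely, for a sign pattern the
complement of `v_δ` and its conjugate contains enough negative eigenvectors (and, when `Φ (2) = 0`, a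
generalized eigenvector) to have signature `(1, 19)`, so that `v_δ` defines a Hodge structure
(`IsPattern.exists_hodgeStructure`); it is positive because there is a causal eigenvector with
positive eigenvalue.

By counting roots, the signs of `Φ' Ψ` at the roots of `Φ` become parities: `τ = δ + δ⁻¹` is the only
element of `A_on` with an odd number of elements of `A` and `B` above it, and `B_on` has an even number
of elements (`IsParity`). In particular, `τ` is determined by `Φ` and `Ψ`, and thus so is the Hodge
structure up to complex conjugation. The parities depend only on the sizes of the trace clusters, and a
finite enumeration shows that the possible sizes are those of the tables and that `τ` sits in the
clusters where the last column says (`IsPattern.configs`, `IsPattern.location`). That `Ψ` has simple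
roots follows as well: a square factor can be removed without changing the pattern, and then too few
roots are left (`IsPattern.simpleRoots_right`).

Finally, the type of `A` depends on the sign of `Φ (2)`: the eigenvector `v₁` is time-like, isotropic or
space-like, and in the last case there is a root of `Φ` in `(2, ∞)`, that is, a pair of isotropic
eigenvectors with real eigenvalues `λ`, `λ⁻¹`.
-/

namespace HyperK3

/-! ### Companion matrices over a commutative ring -/

/-- The companion matrix of `f` over an arbitrary commutative ring. -/
def cmat {K : Type*} [CommRing K] (n : ℕ) (f : K[X]) : Matrix (Fin n) (Fin n) K :=
  Matrix.of fun i j =>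
    if (j : ℕ) + 1 = n then -(f.coeff (i : ℕ))
    else if (i : ℕ) = (j : ℕ) + 1 then 1 else 0

/-- The first `n` coefficients of a polynomial, as a vector. -/
def coeffVec {K : Type*} [CommRing K] (n : ℕ) (f : K[X]) : Fin n → K := fun i => f.coeff i

section Ring
variable {K : Type*} [CommRing K]

theorem companion_eq_cmat (n : ℕ) (f : ℤ[X]) :
    companion n f = cmat n (f.map (Int.castRingHom ℚ)) := by
  ext i j
  simp [companion, cmat]

theorem cmat_map {S : Type*} [CommRing S] (σ : K →+* S) (n : ℕ) (f : K[X]) :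
    (cmat n f).map σ = cmat n (f.map σ) := by
  ext i j
  simp only [cmat, Matrix.map_apply, Matrix.of_apply, coeff_map]
  split_ifs <;> simp

theorem coeffVec_map {S : Type*} [CommRing S] (σ : K →+* S) (n : ℕ) (f : K[X]) :
    coeffVec n (f.map σ) = fun i => σ (coeffVec n f i) := by
  ext i; simp [coeffVec]

theorem coeffVec_add (n : ℕ) (f g : K[X]) : coeffVec n (f + g) = coeffVec n f + coeffVec n g := by
  ext i; simp [coeffVec]

theorem cmat_mulVec_apply {m : ℕ} (f : K[X]) (x : Fin (m + 1) → K) (i : Fin (m + 1)) :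
    (cmat (m + 1) f *ᵥ x) i =
      -f.coeff i * x (Fin.last m) + if h : (i : ℕ) = 0 then 0 else x ⟨i - 1, by omega⟩ := by
  rw [Matrix.mulVec, dotProduct, Fin.sum_univ_castSucc, add_comm]
  congr 1
  · simp [cmat]
  · have hne : ∀ j : Fin m, ((j.castSucc : Fin (m + 1)) : ℕ) + 1 ≠ m + 1 := by
      intro j; have := j.2; simp; omega
    simp only [cmat, Matrix.of_apply, if_neg (hne _)]
    split_ifs with h
    · refine Finset.sum_eq_zero fun j _ => ?_
      simp [h]
    · rw [Finset.sum_eq_single ⟨(i : ℕ) - 1, by omega⟩]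
      · have : (i : ℕ) = (i : ℕ) - 1 + 1 := by omega
        simp [← this]
      · intro j _ hj
        have : ¬ (i : ℕ) = (j.castSucc : Fin (m + 1)) + 1 := by
          intro h'; apply hj; ext; simp at h' ⊢; omega
        rw [if_neg this, zero_mul]
      · simp

theorem cmat_mulVec_coeffVec [Nontrivial K] {m : ℕ} {f p : K[X]} (hf : f.Monic)
    (hdeg : f.natDegree = m + 1) (hp : p.natDegree ≤ m) :
    cmat (m + 1) f *ᵥ coeffVec (m + 1) p = coeffVec (m + 1) ((X * p) %ₘ f) := by
  have hmod : (X * p) %ₘ f = X * p - C (p.coeff m) * f := by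
    have h := (div_modByMonic_unique (f := X * p) (C (p.coeff m)) (X * p - C (p.coeff m) * f) hf
      ⟨by ring, ?_⟩).2
    · exact h
    · rw [degree_eq_natDegree hf.ne_zero, hdeg, degree_lt_iff_coeff_zero]
      intro k hk
      rw [coeff_sub, coeff_C_mul]
      rcases hk.eq_or_lt with rfl | hk
      · rw [coeff_X_mul]
        have : f.coeff (m + 1) = 1 := by rw [← hdeg]; exact hf
        simp [this]
      · obtain ⟨k, rfl⟩ : ∃ j, k = j + 1 := ⟨k - 1, by omega⟩
        rw [coeff_X_mul, coeff_eq_zero_of_natDegree_lt (by omega : p.natDegree < k),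
          coeff_eq_zero_of_natDegree_lt (by omega : f.natDegree < k + 1)]
        simp
  ext i
  rw [cmat_mulVec_apply, hmod]
  simp only [coeffVec, coeff_sub, coeff_C_mul, Fin.val_last]
  split_ifs with h
  · rw [h]; simp; ring
  · obtain ⟨k, hk⟩ : ∃ j, (i : ℕ) = j + 1 := ⟨i - 1, by omega⟩
    rw [hk, coeff_X_mul]; simp; ring

/-- The first basis vector is cyclic for the companion matrix: applying `g (A)` to it gives the
coefficients of the remainder of `g` modulo the characteristic polynomial. -/
theorem aeval_cmat_mulVec_single [Nontrivial K] {m : ℕ} {f : K[X]} (hf : f.Monic)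
    (hdeg : f.natDegree = m + 1) (g : K[X]) :
    aeval (cmat (m + 1) f) g *ᵥ coeffVec (m + 1) 1 = coeffVec (m + 1) (g %ₘ f) := by
  have h1 : ∀ c : K, aeval (cmat (m + 1) f) (C c) *ᵥ coeffVec (m + 1) 1
      = coeffVec (m + 1) (C c %ₘ f) := by
    intro c
    have : C c %ₘ f = C c := by
      rw [modByMonic_eq_self_iff hf]
      refine lt_of_le_of_lt degree_C_le ?_
      rw [degree_eq_natDegree hf.ne_zero, hdeg]; exact_mod_cast Nat.succ_pos m
    rw [this, aeval_C, Algebra.algebraMap_eq_smul_one, Matrix.smul_mulVec, Matrix.one_mulVec]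
    ext i
    simp [coeffVec, coeff_C, coeff_one]
  have hX : ∀ g : K[X], aeval (cmat (m + 1) f) g *ᵥ coeffVec (m + 1) 1 = coeffVec (m + 1) (g %ₘ f) →
      aeval (cmat (m + 1) f) (X * g) *ᵥ coeffVec (m + 1) 1
        = coeffVec (m + 1) ((X * g) %ₘ f) := by
    intro g hg
    rw [map_mul, aeval_X, ← Matrix.mulVec_mulVec, hg, cmat_mulVec_coeffVec hf hdeg]
    · congr 1
      rw [← sub_eq_zero, ← sub_modByMonic, modByMonic_eq_zero_iff_dvd hf, ← mul_sub]
      refine Dvd.dvd.mul_left ?_ _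
      have := modByMonic_add_div g f
      exact ⟨-(g /ₘ f), by linear_combination this⟩
    · have := natDegree_modByMonic_lt g hf (by rintro rfl; simp at hdeg)
      omega
  induction g using Polynomial.induction_on with
  | C a => exact h1 a
  | add p q hp hq => rw [map_add, Matrix.add_mulVec, hp, hq, add_modByMonic, coeffVec_add]
  | monomial k a ih =>
    have : C a * X ^ (k + 1) = X * (C a * X ^ k) := by ring
    rw [this]; exact hX _ ih

theorem coeffVec_eq_zero_iff [Nontrivial K] {m : ℕ} {f : K[X]} (hf : f.Monic)
    (hdeg : f.natDegree = m + 1) (g : K[X]) : coeffVec (m + 1) (g %ₘ f) = 0 ↔ f ∣ g := by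
  rw [← modByMonic_eq_zero_iff_dvd hf]
  refine ⟨fun h => ?_, fun h => by rw [h]; ext i; simp [coeffVec]⟩
  ext k
  by_cases hk : k < m + 1
  · exact congrFun h ⟨k, hk⟩
  · have := natDegree_modByMonic_lt g hf (by rintro rfl; simp at hdeg)
    rw [coeff_eq_zero_of_natDegree_lt (by omega), coeff_zero]

theorem exists_coeffVec_eq {m : ℕ} (x : Fin (m + 1) → K) :
    ∃ g : K[X], g.degree < (m + 1 : ℕ) ∧ coeffVec (m + 1) g = x := by
  refine ⟨∑ i : Fin (m + 1), C (x i) * X ^ (i : ℕ), ?_, ?_⟩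
  · exact degree_sum_fin_lt x
  · ext j
    simp [coeffVec, coeff_X_pow, Fin.ext_iff.symm, Finset.sum_ite_eq]

/-- Every vector is `g (A)` applied to the first basis vector, for a suitable polynomial `g`. -/
theorem exists_aeval_cmat_mulVec_single_eq [Nontrivial K] {m : ℕ} {f : K[X]} (hf : f.Monic)
    (hdeg : f.natDegree = m + 1) (x : Fin (m + 1) → K) :
    ∃ g : K[X], aeval (cmat (m + 1) f) g *ᵥ coeffVec (m + 1) 1 = x := by
  obtain ⟨g, hg, rfl⟩ := exists_coeffVec_eq x
  refine ⟨g, ?_⟩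
  rw [aeval_cmat_mulVec_single hf hdeg, (modByMonic_eq_self_iff hf).2]
  rwa [degree_eq_natDegree hf.ne_zero, hdeg]

theorem aeval_cmat_self [Nontrivial K] {m : ℕ} {f : K[X]} (hf : f.Monic)
    (hdeg : f.natDegree = m + 1) : aeval (cmat (m + 1) f) f = 0 := by
  refine Matrix.ext_of_mulVec_single fun i => ?_
  obtain ⟨g, hg⟩ := exists_aeval_cmat_mulVec_single_eq hf hdeg (Pi.single i (1 : K))
  rw [← hg, Matrix.mulVec_mulVec, ← map_mul, mul_comm, map_mul, ← Matrix.mulVec_mulVec,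
    aeval_cmat_mulVec_single hf hdeg f, (coeffVec_eq_zero_iff hf hdeg f).2 dvd_rfl]
  simp

/-- Two companion matrices of the same size differ by a matrix of rank one. -/
theorem cmat_mulVec_eq_sub [Nontrivial K] {m : ℕ} {f g : K[X]} (hf : f.Monic)
    (hdeg : f.natDegree = m + 1) (hg : g.Monic) (hgdeg : g.natDegree = m + 1)
    (x : Fin (m + 1) → K) :
    cmat (m + 1) g *ᵥ x = cmat (m + 1) f *ᵥ x -
      x (Fin.last m) • (aeval (cmat (m + 1) f) g *ᵥ coeffVec (m + 1) 1) := by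
  have hmod : g %ₘ f = g - f := by
    refine (div_modByMonic_unique (f := g) 1 (g - f) hf ⟨by ring, ?_⟩).2
    refine lt_of_lt_of_eq (degree_sub_lt_left ?_ hg.ne_zero (by rw [hf.leadingCoeff, hg.leadingCoeff])) ?_
    · rw [degree_eq_natDegree hf.ne_zero, degree_eq_natDegree hg.ne_zero, hdeg, hgdeg]
    · rw [degree_eq_natDegree hf.ne_zero, degree_eq_natDegree hg.ne_zero, hdeg, hgdeg]
  ext i
  rw [aeval_cmat_mulVec_single hf hdeg, hmod, Pi.sub_apply, cmat_mulVec_apply, cmat_mulVec_apply]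
  simp [coeffVec]
  ring

/-- The last coordinate of `g (A) e₀` when `g` has degree less than the size. -/
theorem aeval_cmat_mulVec_last [Nontrivial K] {m : ℕ} {f g : K[X]} (hf : f.Monic)
    (hdeg : f.natDegree = m + 1) (hg : g.natDegree ≤ m) :
    (aeval (cmat (m + 1) f) g *ᵥ coeffVec (m + 1) 1) (Fin.last m) = g.coeff m := by
  rw [aeval_cmat_mulVec_single hf hdeg, (modByMonic_eq_self_iff hf).2]
  · simp [coeffVec]
  · rw [degree_eq_natDegree hf.ne_zero, hdeg]
    exact lt_of_le_of_lt degree_le_natDegree (by exact_mod_cast Nat.lt_succ_of_le hg)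

end Ring

/-! ### The invariant form of a hypergeometric pair -/

theorem aeval_reflect {R S : Type*} [CommRing R] [Ring S] [Algebra R S] {a b : S} (hab : b * a = 1)
    {N : ℕ} {g : R[X]} (hg : g.natDegree ≤ N) :
    aeval b (g.reflect N) = b ^ N * aeval a g := by
  refine induction_with_natDegree_le
    (motive := fun g : R[X] => aeval b (g.reflect N) = b ^ N * aeval a g) N ?_ ?_ ?_ g hg
  · simp
  · intro n c _ hn
    have hba : b ^ n * a ^ n = 1 := by
      induction n with
      | zero => simp
      | succ k ih =>
        rw [pow_succ, pow_succ', mul_assoc, ← mul_assoc b a, hab, one_mul]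
        exact ih (by omega)
    rw [reflect_C_mul_X_pow, revAt_le hn]
    have : b ^ N = b ^ (N - n) * b ^ n := by rw [← pow_add]; congr 1; omega
    simp only [map_mul, aeval_C, map_pow, aeval_X]
    rw [this, ← mul_assoc (b ^ (N - n) * b ^ n), ← Algebra.commutes, mul_assoc, mul_assoc, hba, mul_one]
  · intro p q _ _ hp hq
    rw [reflect_add, map_add, map_add, mul_add, hp, hq]

/-- Data of a hypergeometric pair over a field: monic polynomials `f` (anti-palindromic) and `g`
(palindromic) of degree `m + 1`, coprime to each other. -/
structure IsHyperPair {K : Type*} [Field K] (m : ℕ) (f g : K[X]) : Prop where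
  hm : 1 ≤ m
  f_monic : f.Monic
  g_monic : g.Monic
  f_deg : f.natDegree = m + 1
  g_deg : g.natDegree = m + 1
  f_reflect : f.reflect (m + 1) = -f
  g_reflect : g.reflect (m + 1) = g
  coprime : IsCoprime f g

namespace IsHyperPair
variable {K : Type*} [Field K] {m : ℕ} {f g : K[X]} (h : IsHyperPair m f g)
include h

theorem coeff_zero_f : f.coeff 0 = -1 := by
  have := congrArg (fun p => p.coeff 0) h.f_reflect
  simp only [coeff_reflect, coeff_neg] at this
  rw [revAt_le (Nat.zero_le _), Nat.sub_zero] at this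
  have h1 : f.coeff (m + 1) = 1 := by rw [← h.f_deg]; exact h.f_monic
  rw [h1] at this
  linear_combination this

theorem coeff_zero_g : g.coeff 0 = 1 := by
  have := congrArg (fun p => p.coeff 0) h.g_reflect
  simp only [coeff_reflect] at this
  rw [revAt_le (Nat.zero_le _), Nat.sub_zero] at this
  have h1 : g.coeff (m + 1) = 1 := by rw [← h.g_deg]; exact h.g_monic
  rw [h1] at this
  exact this.symm

theorem X_mul_divX : X * f.divX = f + 1 := by
  have := divX_mul_X_add f
  rw [h.coeff_zero_f] at this
  simp only [map_neg, map_one] at this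
  linear_combination this

theorem mul_aeval_divX {S : Type*} [Ring S] [Algebra K S] {a : S} (ha : aeval a f = 0) :
    a * aeval a f.divX = 1 := by
  have := congrArg (aeval a) h.X_mul_divX
  simpa [ha] using this

theorem aeval_divX_mul {S : Type*} [Ring S] [Algebra K S] {a : S} (ha : aeval a f = 0) :
    aeval a f.divX * a = 1 := by
  have := congrArg (aeval a) (show f.divX * X = f + 1 by rw [mul_comm, h.X_mul_divX])
  simpa [ha] using this

theorem aeval_self : aeval (cmat (m + 1) f) f = 0 := aeval_cmat_self h.f_monic h.f_deg

theorem mul_inv : cmat (m + 1) f * (cmat (m + 1) f)⁻¹ = 1 := by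
  rw [Matrix.inv_eq_right_inv (h.mul_aeval_divX h.aeval_self)]
  exact h.mul_aeval_divX h.aeval_self

theorem inv_mul : (cmat (m + 1) f)⁻¹ * cmat (m + 1) f = 1 := by
  rw [Matrix.inv_eq_right_inv (h.mul_aeval_divX h.aeval_self)]
  exact h.aeval_divX_mul h.aeval_self

theorem inv_eq : (cmat (m + 1) f)⁻¹ = aeval (cmat (m + 1) f) f.divX :=
  Matrix.inv_eq_right_inv (h.mul_aeval_divX h.aeval_self)

theorem aeval_inv_self : aeval (cmat (m + 1) f)⁻¹ f = 0 := by
  have := aeval_reflect h.inv_mul h.f_deg.le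
  rw [h.f_reflect, h.aeval_self, mul_zero, map_neg, neg_eq_zero] at this
  exact this

theorem inv_inv_eq : cmat (m + 1) f = aeval (cmat (m + 1) f)⁻¹ f.divX := by
  have h1 := h.mul_aeval_divX h.aeval_inv_self
  calc cmat (m + 1) f = cmat (m + 1) f * ((cmat (m + 1) f)⁻¹ * aeval (cmat (m + 1) f)⁻¹ f.divX) := by
        rw [h1, mul_one]
    _ = _ := by rw [← mul_assoc, h.mul_inv, one_mul]

theorem aeval_inv_g :
    aeval (cmat (m + 1) f)⁻¹ g = (cmat (m + 1) f)⁻¹ ^ (m + 1) * aeval (cmat (m + 1) f) g := by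
  have := aeval_reflect h.inv_mul h.g_deg.le
  rwa [h.g_reflect] at this

theorem commute_inv (p q : K[X]) :
    Commute (aeval (cmat (m + 1) f)⁻¹ p) (aeval (cmat (m + 1) f) q) := by
  rw [h.inv_eq, ← aeval_comp]
  exact (Commute.all _ _).map (aeval (cmat (m + 1) f))

theorem pow_mul_inv_pow (k : ℕ) : cmat (m + 1) f ^ k * (cmat (m + 1) f)⁻¹ ^ k = 1 := by
  have hc : Commute (cmat (m + 1) f) (cmat (m + 1) f)⁻¹ := by
    rw [commute_iff_eq, h.mul_inv, h.inv_mul]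
  rw [← hc.mul_pow, h.mul_inv, one_pow]

/-- The last coordinate functional composed with the inversion `A ↦ A⁻¹`. Both sides depend only
on `p` modulo `f`, and they agree on the monomials of degree at most `m`. -/
theorem last_inversion (p : K[X]) :
    ((cmat (m + 1) f ^ (m - 1) * aeval (cmat (m + 1) f)⁻¹ p) *ᵥ coeffVec (m + 1) 1) (Fin.last m) =
      (aeval (cmat (m + 1) f) p *ᵥ coeffVec (m + 1) 1) (Fin.last m) := by
  have hred : ∀ a : Matrix (Fin (m + 1)) (Fin (m + 1)) K, aeval a f = 0 →
      aeval a p = aeval a (p %ₘ f) := by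
    intro a ha
    have := congrArg (aeval a) (modByMonic_add_div p f)
    rw [map_add, map_mul, ha, zero_mul, add_zero] at this
    exact this.symm
  rw [hred _ h.aeval_self, hred _ h.aeval_inv_self]
  have hd : (p %ₘ f).natDegree ≤ m := by
    have := natDegree_modByMonic_lt p h.f_monic (by rintro rfl; have := h.f_deg; simp at this)
    rw [h.f_deg] at this; omega
  refine induction_with_natDegree_le (motive := fun p : K[X] =>
    ((cmat (m + 1) f ^ (m - 1) * aeval (cmat (m + 1) f)⁻¹ p) *ᵥ coeffVec (m + 1) 1) (Fin.last m) =
      (aeval (cmat (m + 1) f) p *ᵥ coeffVec (m + 1) 1) (Fin.last m)) m (by simp) ?_ ?_ _ hd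
  · intro n c _ hn
    have hm := h.hm
    rw [aeval_cmat_mulVec_last h.f_monic h.f_deg ((natDegree_C_mul_X_pow_le c n).trans hn)]
    -- `A ^ (m - 1 - n)` is a power of `A` except for `n = m`, when `A⁻¹ = (f.divX) (A)` is used
    have key : cmat (m + 1) f ^ (m - 1) * (cmat (m + 1) f)⁻¹ ^ n =
        aeval (cmat (m + 1) f) (if n = m then f.divX else X ^ (m - 1 - n)) := by
      split_ifs with hnm
      · rw [hnm, ← h.inv_eq]
        obtain ⟨k, rfl⟩ : ∃ k, m = k + 1 := ⟨m - 1, by omega⟩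
        rw [pow_succ, ← mul_assoc, Nat.add_sub_cancel, h.pow_mul_inv_pow, one_mul]
      · have : m - 1 = (m - 1 - n) + n := by omega
        rw [this, pow_add, mul_assoc, h.pow_mul_inv_pow, mul_one]
        simp
    have hdivX : f.divX.natDegree ≤ m := by rw [natDegree_divX_eq_natDegree_tsub_one, h.f_deg]; simp
    rw [map_mul, aeval_C, map_pow, aeval_X, ← mul_assoc, ← Algebra.commutes, mul_assoc, key,
      Algebra.algebraMap_eq_smul_one, smul_mul_assoc, one_mul, Matrix.smul_mulVec, Pi.smul_apply,
      aeval_cmat_mulVec_last h.f_monic h.f_deg]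
    · simp only [coeff_C_mul, coeff_X_pow, smul_eq_mul]
      split_ifs with h1 h2
      · rw [coeff_divX, ← h.f_deg]
        congr 1; exact h.f_monic
      · omega
      · omega
      · rw [coeff_X_pow, if_neg (by omega)]
    · split_ifs
      · exact hdivX
      · exact (natDegree_X_pow_le _).trans (by omega)
  · intro p q _ _ hp hq
    simp only [map_add, mul_add, Matrix.add_mulVec, Pi.add_apply] at *
    rw [hp, hq]

/-- The last coordinate of `A⁻¹ g (A) e₀`. -/
theorem last_inv_g :
    (((cmat (m + 1) f)⁻¹ * aeval (cmat (m + 1) f) g) *ᵥ coeffVec (m + 1) 1) (Fin.last m) = 2 := by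
  have hg : aeval (cmat (m + 1) f) g = aeval (cmat (m + 1) f) (X * (g - f).divX + C 2) := by
    have h1 := divX_mul_X_add (g - f)
    have h2 : (g - f).coeff 0 = 2 := by rw [coeff_sub, h.coeff_zero_f, h.coeff_zero_g]; ring
    rw [h2, mul_comm] at h1
    rw [h1, map_sub, h.aeval_self, sub_zero]
  have h3 : (cmat (m + 1) f)⁻¹ * aeval (cmat (m + 1) f) g =
      aeval (cmat (m + 1) f) ((g - f).divX + f.divX * C 2) := by
    rw [hg, map_add, mul_add, map_mul, aeval_X, ← mul_assoc, h.inv_mul, one_mul, h.inv_eq,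
      ← map_mul, ← map_add]
  have hdeg : (g - f).natDegree ≤ m := by
    have hlt : (g - f).degree < g.degree := by
      refine degree_sub_lt_left ?_ h.g_monic.ne_zero
        (by rw [h.f_monic.leadingCoeff, h.g_monic.leadingCoeff])
      rw [degree_eq_natDegree h.f_monic.ne_zero, degree_eq_natDegree h.g_monic.ne_zero, h.f_deg,
        h.g_deg]
    rw [degree_eq_natDegree h.g_monic.ne_zero, h.g_deg] at hlt
    have := (degree_lt_iff_coeff_zero _ _).1 hlt
    rw [natDegree_le_iff_coeff_eq_zero]
    intro k hk
    exact this k hk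
  have hm := h.hm
  have hfd : f.divX.natDegree ≤ m := by rw [natDegree_divX_eq_natDegree_tsub_one, h.f_deg]; simp
  rw [h3, aeval_cmat_mulVec_last h.f_monic h.f_deg]
  · have h4 : (g - f).coeff (m + 1) = 0 := coeff_eq_zero_of_natDegree_lt (by omega)
    have h5 : f.coeff (m + 1) = 1 := by rw [← h.f_deg]; exact h.f_monic
    rw [coeff_add, coeff_mul_C, coeff_divX, coeff_divX, h4, h5]; ring
  · refine (natDegree_add_le _ _).trans (max_le ?_ ?_)
    · rw [natDegree_divX_eq_natDegree_tsub_one]; omega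
    · exact (natDegree_mul_C_le _ _).trans hfd

/-- If `A r` is a nonzero multiple of `g (A) e₀`, then `p (A) r` vanishes exactly for the multiples
`p` of `f`. -/
theorem aeval_mulVec_eq_zero_iff {r : Fin (m + 1) → K} {κ : K} (hκ : κ ≠ 0)
    (hr : cmat (m + 1) f *ᵥ r = κ • (aeval (cmat (m + 1) f) g *ᵥ coeffVec (m + 1) 1)) (p : K[X]) :
    aeval (cmat (m + 1) f) p *ᵥ r = 0 ↔ f ∣ p := by
  have h1 : cmat (m + 1) f *ᵥ (aeval (cmat (m + 1) f) p *ᵥ r) =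
      κ • (aeval (cmat (m + 1) f) (p * g) *ᵥ coeffVec (m + 1) 1) := by
    rw [Matrix.mulVec_mulVec]
    have : cmat (m + 1) f * aeval (cmat (m + 1) f) p = aeval (cmat (m + 1) f) p * cmat (m + 1) f := by
      have := congrArg (aeval (cmat (m + 1) f)) (mul_comm X p)
      simpa using this
    rw [this, ← Matrix.mulVec_mulVec, hr, Matrix.mulVec_smul, Matrix.mulVec_mulVec, map_mul]
  have h2 : aeval (cmat (m + 1) f) p *ᵥ r = 0 ↔
      cmat (m + 1) f *ᵥ (aeval (cmat (m + 1) f) p *ᵥ r) = 0 := by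
    refine ⟨fun h => by rw [h]; simp, fun h' => ?_⟩
    have := congrArg (fun v => (cmat (m + 1) f)⁻¹ *ᵥ v) h'
    simpa only [Matrix.mulVec_mulVec, ← mul_assoc, h.inv_mul, one_mul, Matrix.mulVec_zero] using this
  rw [h2, h1, smul_eq_zero, or_iff_right hκ, aeval_cmat_mulVec_single h.f_monic h.f_deg,
    coeffVec_eq_zero_iff h.f_monic h.f_deg]
  exact ⟨fun h' => h.coprime.dvd_of_dvd_mul_right h', fun h' => h'.mul_right _⟩

theorem exists_aeval_mulVec_eq {r : Fin (m + 1) → K} {κ : K} (hκ : κ ≠ 0)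
    (hr : cmat (m + 1) f *ᵥ r = κ • (aeval (cmat (m + 1) f) g *ᵥ coeffVec (m + 1) 1))
    (x : Fin (m + 1) → K) : ∃ p : K[X], aeval (cmat (m + 1) f) p *ᵥ r = x := by
  obtain ⟨q, rfl⟩ := exists_aeval_cmat_mulVec_single_eq h.f_monic h.f_deg x
  obtain ⟨u, v, huv⟩ := h.coprime
  refine ⟨C κ⁻¹ * q * v * X, ?_⟩
  rw [map_mul, aeval_X, ← Matrix.mulVec_mulVec, hr, Matrix.mulVec_smul, Matrix.mulVec_mulVec,
    ← map_mul]
  have : C κ⁻¹ * q * v * g = C κ⁻¹ * (q - q * u * f) := by linear_combination C κ⁻¹ * q * huv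
  rw [this, map_mul, map_sub, map_mul _ (q * u), h.aeval_self, mul_zero, sub_zero, aeval_C,
    Algebra.algebraMap_eq_smul_one, smul_mul_assoc, one_mul, Matrix.smul_mulVec, smul_smul,
    mul_inv_cancel₀ hκ, one_smul]

end IsHyperPair

theorem Matrix.ext_of_dotProduct_mulVec {K ι : Type*} [CommRing K] [Fintype ι] [DecidableEq ι]
    {M N : Matrix ι ι K} (h : ∀ x y, x ⬝ᵥ (M *ᵥ y) = x ⬝ᵥ (N *ᵥ y)) : M = N := by
  ext i j
  have := h (Pi.single i 1) (Pi.single j 1)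
  simpa using this

theorem transpose_mul_mul_eq_iff {K ι : Type*} [CommRing K] [Fintype ι] [DecidableEq ι]
    {M G : Matrix ι ι K} :
    Mᵀ * G * M = G ↔ ∀ x y, (M *ᵥ x) ⬝ᵥ (G *ᵥ (M *ᵥ y)) = x ⬝ᵥ (G *ᵥ y) := by
  have key : ∀ x y, (M *ᵥ x) ⬝ᵥ (G *ᵥ (M *ᵥ y)) = x ⬝ᵥ ((Mᵀ * G * M) *ᵥ y) := by
    intro x y
    rw [← Matrix.mulVec_mulVec, ← Matrix.mulVec_mulVec, Matrix.dotProduct_mulVec x,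
      Matrix.vecMul_transpose]
  refine ⟨fun h x y => by rw [key, h], fun h => Matrix.ext_of_dotProduct_mulVec fun x y => ?_⟩
  rw [← key, h]

theorem dotProduct_mulVec_comm {K ι : Type*} [CommRing K] [Fintype ι]
    {G : Matrix ι ι K} (hG : G.IsSymm) (x y : ι → K) : x ⬝ᵥ (G *ᵥ y) = y ⬝ᵥ (G *ᵥ x) := by
  rw [Matrix.dotProduct_mulVec, ← Matrix.mulVec_transpose, hG.eq, dotProduct_comm]

namespace IsHyperPair
variable {K : Type*} [Field K] {m : ℕ} {f g : K[X]} (h : IsHyperPair m f g)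
include h

/-- There is a form `G` for which pairing with `p (A) r` is `κ⁻¹` times the last coordinate of
`p (A⁻¹) y`. -/
theorem exists_dual_form {r : Fin (m + 1) → K} {κ : K} (hκ : κ ≠ 0)
    (hr : cmat (m + 1) f *ᵥ r = κ • (aeval (cmat (m + 1) f) g *ᵥ coeffVec (m + 1) 1)) :
    ∃ G : Matrix (Fin (m + 1)) (Fin (m + 1)) K, ∀ (p : K[X]) (y : Fin (m + 1) → K),
      (aeval (cmat (m + 1) f) p *ᵥ r) ⬝ᵥ (G *ᵥ y) =
        κ⁻¹ * (aeval (cmat (m + 1) f)⁻¹ p *ᵥ y) (Fin.last m) := by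
  set A := cmat (m + 1) f
  -- the rows of `Q` are the vectors `A ^ k r`, those of `D` the functionals `κ⁻¹ ℓ (A⁻ᵏ ·)`
  let Q : Matrix (Fin (m + 1)) (Fin (m + 1)) K := Matrix.of fun k => A ^ (k : ℕ) *ᵥ r
  let D : Matrix (Fin (m + 1)) (Fin (m + 1)) K :=
    Matrix.of fun k j => κ⁻¹ * (A⁻¹ ^ (k : ℕ)) (Fin.last m) j
  have hvec : ∀ (M : Matrix (Fin (m + 1)) (Fin (m + 1)) K) (p : K[X]), p.natDegree ≤ m →
      aeval M p = ∑ k : Fin (m + 1), p.coeff k • M ^ (k : ℕ) := by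
    intro M p hp
    rw [aeval_eq_sum_range' (Nat.lt_succ_of_le hp), Finset.sum_range]
  have hQ : IsUnit Q.det := by
    rw [← Matrix.isUnit_iff_isUnit_det, ← Matrix.vecMul_injective_iff_isUnit]
    intro c d hcd
    rw [← sub_eq_zero] at hcd ⊢
    simp only [← Matrix.sub_vecMul] at hcd
    obtain ⟨p, hp, hpc⟩ := exists_coeffVec_eq (c - d)
    have hp' : p.natDegree ≤ m := by
      rcases eq_or_ne p 0 with rfl | h0
      · simp
      · rw [degree_eq_natDegree h0] at hp
        have : p.natDegree < m + 1 := by exact_mod_cast hp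
        omega
    have h0 : aeval A p *ᵥ r = 0 := by
      rw [← hcd, hvec A p hp', Matrix.sum_mulVec, Matrix.vecMul_eq_sum, ← hpc]
      simp only [Matrix.smul_mulVec, coeffVec]
      rfl
    rw [h.aeval_mulVec_eq_zero_iff hκ hr, ← coeffVec_eq_zero_iff h.f_monic h.f_deg,
      (modByMonic_eq_self_iff h.f_monic).2, hpc] at h0
    · exact h0
    · rwa [degree_eq_natDegree h.f_monic.ne_zero, h.f_deg]
  refine ⟨Q⁻¹ * D, fun p y => ?_⟩
  have hred : ∀ a : Matrix (Fin (m + 1)) (Fin (m + 1)) K, aeval a f = 0 →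
      aeval a p = aeval a (p %ₘ f) := by
    intro a ha
    have := congrArg (aeval a) (modByMonic_add_div p f)
    rw [map_add, map_mul, ha, zero_mul, add_zero] at this
    exact this.symm
  have hd : (p %ₘ f).natDegree ≤ m := by
    have := natDegree_modByMonic_lt p h.f_monic (by rintro rfl; have := h.f_deg; simp at this)
    rw [h.f_deg] at this; omega
  rw [hred A h.aeval_self, hred A⁻¹ h.aeval_inv_self, hvec _ _ hd, hvec _ _ hd, Matrix.sum_mulVec,
    Matrix.sum_mulVec]
  have hrow : ∀ k : Fin (m + 1), (A ^ (k : ℕ) *ᵥ r) ⬝ᵥ ((Q⁻¹ * D) *ᵥ y) =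
      κ⁻¹ * (A⁻¹ ^ (k : ℕ) *ᵥ y) (Fin.last m) := by
    intro k
    have h1 : (Q *ᵥ ((Q⁻¹ * D) *ᵥ y)) k = (D *ᵥ y) k := by
      rw [Matrix.mulVec_mulVec, ← mul_assoc, Matrix.mul_nonsing_inv _ hQ, one_mul]
    have h2 : (Q *ᵥ ((Q⁻¹ * D) *ᵥ y)) k = (A ^ (k : ℕ) *ᵥ r) ⬝ᵥ ((Q⁻¹ * D) *ᵥ y) := rfl
    rw [← h2, h1]
    simp only [Matrix.mulVec, dotProduct, D, Matrix.of_apply, Finset.mul_sum, mul_assoc]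
  simp only [Matrix.smul_mulVec, sum_dotProduct, smul_dotProduct, hrow, Finset.sum_apply,
    Pi.smul_apply, smul_eq_mul, Finset.mul_sum]
  exact Finset.sum_congr rfl fun k _ => by ring

section Dual
variable {r : Fin (m + 1) → K} {κ : K} (hκ : κ ≠ 0)
  (hr : cmat (m + 1) f *ᵥ r = κ • (aeval (cmat (m + 1) f) g *ᵥ coeffVec (m + 1) 1))
  {G : Matrix (Fin (m + 1)) (Fin (m + 1)) K}
  (hG : ∀ (p : K[X]) (y : Fin (m + 1) → K),
      (aeval (cmat (m + 1) f) p *ᵥ r) ⬝ᵥ (G *ᵥ y) =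
        κ⁻¹ * (aeval (cmat (m + 1) f)⁻¹ p *ᵥ y) (Fin.last m))
include hκ hr hG

omit hκ hG in
theorem eq_inv_mulVec :
    r = κ • (((cmat (m + 1) f)⁻¹ * aeval (cmat (m + 1) f) g) *ᵥ coeffVec (m + 1) 1) := by
  have := congrArg (fun v => (cmat (m + 1) f)⁻¹ *ᵥ v) hr
  simpa only [Matrix.mulVec_mulVec, ← mul_assoc, h.inv_mul, Matrix.one_mulVec,
    Matrix.mulVec_smul] using this

theorem dual_form_apply (p q : K[X]) :
    (aeval (cmat (m + 1) f) p *ᵥ r) ⬝ᵥ (G *ᵥ (aeval (cmat (m + 1) f) q *ᵥ r)) =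
      ((aeval (cmat (m + 1) f) (p.comp f.divX * q * f.divX * g)) *ᵥ coeffVec (m + 1) 1)
        (Fin.last m) := by
  rw [hG, Matrix.mulVec_mulVec]
  rw [h.eq_inv_mulVec hr]
  rw [Matrix.mulVec_smul, Matrix.mulVec_mulVec, Pi.smul_apply, smul_eq_mul, ← mul_assoc,
    inv_mul_cancel₀ hκ, one_mul]
  congr 2
  simp only [map_mul, aeval_comp, ← h.inv_eq, mul_assoc]

theorem dual_form_symm : G.IsSymm := by
  have key : ∀ p q : K[X], (aeval (cmat (m + 1) f) p *ᵥ r) ⬝ᵥ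
      (G *ᵥ (aeval (cmat (m + 1) f) q *ᵥ r)) =
      (aeval (cmat (m + 1) f) q *ᵥ r) ⬝ᵥ (G *ᵥ (aeval (cmat (m + 1) f) p *ᵥ r)) := by
    intro p q
    rw [h.dual_form_apply hκ hr hG, h.dual_form_apply hκ hr hG, ← h.last_inversion]
    congr 2
    set A := cmat (m + 1) f
    have hA : ∀ s : K[X], Commute A (aeval A s) := fun s => by
      have := (Commute.all X s).map (aeval A)
      simpa using this
    have h1 : A ^ (m - 1) * (A * aeval A⁻¹ g) = A⁻¹ * aeval A g := by
      rw [h.aeval_inv_g, ← mul_assoc, ← pow_succ, Nat.sub_add_cancel h.hm, pow_succ, ← mul_assoc,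
        ← mul_assoc, h.pow_mul_inv_pow, one_mul]
    have h2 : Commute (A ^ (m - 1)) (aeval A p * aeval A⁻¹ q) :=
      ((hA p).pow_left _).mul_right (by simpa using (h.commute_inv q (X ^ (m - 1))).symm)
    calc A ^ (m - 1) * aeval A⁻¹ (p.comp f.divX * q * f.divX * g)
        = A ^ (m - 1) * (aeval A p * aeval A⁻¹ q) * (A * aeval A⁻¹ g) := by
          simp only [map_mul, aeval_comp, ← h.inv_inv_eq, A, mul_assoc]
      _ = (aeval A p * aeval A⁻¹ q) * (A⁻¹ * aeval A g) := by rw [h2.eq, mul_assoc, h1]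
      _ = aeval A (q.comp f.divX * p * f.divX * g) := by
          rw [← (h.commute_inv q p).eq]
          simp only [map_mul, aeval_comp, ← h.inv_eq, A, mul_assoc]
  ext i j
  obtain ⟨p, hp⟩ := h.exists_aeval_mulVec_eq hκ hr (Pi.single i (1 : K))
  obtain ⟨q, hq⟩ := h.exists_aeval_mulVec_eq hκ hr (Pi.single j (1 : K))
  have := key q p
  rw [hp, hq] at this
  simpa using this

omit hκ in
theorem dual_form_self : r ⬝ᵥ (G *ᵥ r) = κ⁻¹ * (κ * 2) := by
  have := hG 1 r
  simp only [map_one, Matrix.one_mulVec] at this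
  rw [this]
  nth_rewrite 1 [h.eq_inv_mulVec hr]
  rw [Pi.smul_apply, h.last_inv_g, smul_eq_mul]

theorem dual_form_invariant : (cmat (m + 1) f)ᵀ * G * cmat (m + 1) f = G := by
  rw [transpose_mul_mul_eq_iff]
  intro x y
  obtain ⟨p, rfl⟩ := h.exists_aeval_mulVec_eq hκ hr x
  have := hG (X * p) (cmat (m + 1) f *ᵥ y)
  rw [map_mul, aeval_X, ← Matrix.mulVec_mulVec] at this
  rw [this, hG, mul_comm X p, map_mul, aeval_X, Matrix.mulVec_mulVec, mul_assoc, h.inv_mul, mul_one]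

omit hκ in
theorem cmat_g_mulVec (hκ : κ ≠ 0) (y : Fin (m + 1) → K) : cmat (m + 1) g *ᵥ y =
    cmat (m + 1) f *ᵥ (y - (r ⬝ᵥ (G *ᵥ y)) • r) := by
  have := hG 1 y
  simp only [map_one, Matrix.one_mulVec] at this
  rw [cmat_mulVec_eq_sub h.f_monic h.f_deg h.g_monic h.g_deg, this, Matrix.mulVec_sub,
    Matrix.mulVec_smul, hr, smul_smul]
  congr 2
  field_simp

theorem dual_form_invariant' : (cmat (m + 1) g)ᵀ * G * cmat (m + 1) g = G := by
  rw [transpose_mul_mul_eq_iff]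
  intro x y
  have hinv := transpose_mul_mul_eq_iff.1 (h.dual_form_invariant hκ hr hG)
  have hs := dotProduct_mulVec_comm (h.dual_form_symm hκ hr hG)
  have h2 : r ⬝ᵥ (G *ᵥ r) = 2 := by
    rw [h.dual_form_self hr hG, ← mul_assoc, inv_mul_cancel₀ hκ, one_mul]
  rw [h.cmat_g_mulVec hr hG hκ, h.cmat_g_mulVec hr hG hκ, hinv]
  simp only [Matrix.mulVec_sub, Matrix.mulVec_smul, sub_dotProduct, dotProduct_sub, smul_dotProduct,
    dotProduct_smul, smul_eq_mul, h2, hs x r]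
  ring

omit hκ hr hG in
/-- A form invariant under both companion matrices is determined by its value on the reflection
vector. -/
theorem dual_of_invariant (h2 : (2 : K) ≠ 0) (hκ : κ ≠ 0)
    (hr : cmat (m + 1) f *ᵥ r = κ • (aeval (cmat (m + 1) f) g *ᵥ coeffVec (m + 1) 1))
    {G' : Matrix (Fin (m + 1)) (Fin (m + 1)) K}
    (hA : (cmat (m + 1) f)ᵀ * G' * cmat (m + 1) f = G')
    (hB : (cmat (m + 1) g)ᵀ * G' * cmat (m + 1) g = G') (hrr : r ⬝ᵥ (G' *ᵥ r) = 2)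
    (p : K[X]) (y : Fin (m + 1) → K) :
      (aeval (cmat (m + 1) f) p *ᵥ r) ⬝ᵥ (G' *ᵥ y) =
        κ⁻¹ * (aeval (cmat (m + 1) f)⁻¹ p *ᵥ y) (Fin.last m) := by
  rw [transpose_mul_mul_eq_iff] at hA hB
  have hl : r (Fin.last m) = κ * 2 := by
    nth_rewrite 1 [h.eq_inv_mulVec hr]
    rw [Pi.smul_apply, h.last_inv_g, smul_eq_mul]
  have hBy : ∀ y, cmat (m + 1) g *ᵥ y =
      cmat (m + 1) f *ᵥ (y - (κ⁻¹ * y (Fin.last m)) • r) := by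
    intro y
    rw [cmat_mulVec_eq_sub h.f_monic h.f_deg h.g_monic h.g_deg, Matrix.mulVec_sub,
      Matrix.mulVec_smul, hr, smul_smul]
    congr 2
    field_simp
  have hpair : ∀ y, r ⬝ᵥ (G' *ᵥ y) = κ⁻¹ * y (Fin.last m) := by
    intro y
    have h1 := hB r y
    have h3 : κ⁻¹ * (κ * 2) = 2 := by field_simp
    rw [hBy, hBy, hA, hl, h3] at h1
    simp only [Matrix.mulVec_sub, Matrix.mulVec_smul, sub_dotProduct, dotProduct_sub,
      smul_dotProduct, dotProduct_smul, smul_eq_mul, hrr] at h1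
    have : 2 * (r ⬝ᵥ (G' *ᵥ y)) = 2 * (κ⁻¹ * y (Fin.last m)) := by linear_combination -h1
    exact mul_left_cancel₀ h2 this
  induction p using Polynomial.induction_on generalizing y with
  | C a =>
    simp only [aeval_C, Algebra.algebraMap_eq_smul_one, Matrix.smul_mulVec, Matrix.one_mulVec,
      smul_dotProduct, smul_eq_mul, Pi.smul_apply]
    rw [hpair]; ring
  | add p q hp hq =>
    simp only [map_add, Matrix.add_mulVec, add_dotProduct, hp, hq, Pi.add_apply, mul_add]
  | monomial k a ih =>
    have hXc : C a * X ^ (k + 1) = X * (C a * X ^ k) := by ring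
    have hXc' : C a * X ^ (k + 1) = C a * X ^ k * X := by ring
    have h4 : y = cmat (m + 1) f *ᵥ ((cmat (m + 1) f)⁻¹ *ᵥ y) := by
      rw [Matrix.mulVec_mulVec, h.mul_inv, Matrix.one_mulVec]
    nth_rewrite 1 [hXc]
    nth_rewrite 1 [h4]
    rw [map_mul, aeval_X, ← Matrix.mulVec_mulVec, hA, ih, hXc', map_mul _ _ X, aeval_X,
      Matrix.mulVec_mulVec]

theorem dual_form_unique {G' : Matrix (Fin (m + 1)) (Fin (m + 1)) K}
    (hG' : ∀ (p : K[X]) (y : Fin (m + 1) → K),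
      (aeval (cmat (m + 1) f) p *ᵥ r) ⬝ᵥ (G' *ᵥ y) =
        κ⁻¹ * (aeval (cmat (m + 1) f)⁻¹ p *ᵥ y) (Fin.last m)) : G' = G := by
  refine Matrix.ext_of_dotProduct_mulVec fun x y => ?_
  obtain ⟨p, rfl⟩ := h.exists_aeval_mulVec_eq hκ hr x
  rw [hG, hG']

end Dual

end IsHyperPair
/-! ### Hermitian extensions and signatures -/

section Herm
variable {n : ℕ} {𝕜 : Type} [RCLike 𝕜] {G : Matrix (Fin n) (Fin n) ℚ}

theorem herm_add_left (x y z : Fin n → 𝕜) : herm G (x + y) z = herm G x z + herm G y z := by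
  simp [herm, add_dotProduct]

theorem herm_add_right (x y z : Fin n → 𝕜) : herm G x (y + z) = herm G x y + herm G x z := by
  simp [herm, Matrix.mulVec_add, dotProduct_add]

theorem herm_smul_left (a : 𝕜) (x y : Fin n → 𝕜) : herm G (a • x) y = star a * herm G x y := by
  simp [herm]

theorem herm_smul_right (a : 𝕜) (x y : Fin n → 𝕜) : herm G x (a • y) = a * herm G x y := by
  simp [herm, Matrix.mulVec_smul]

theorem herm_zero_left (y : Fin n → 𝕜) : herm G 0 y = 0 := by simp [herm]

theorem herm_zero_right (y : Fin n → 𝕜) : herm G y 0 = 0 := by simp [herm]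

theorem herm_neg_form (x y : Fin n → 𝕜) : herm (-G) x y = -herm G x y := by
  have : extendScalars 𝕜 (-G) = -extendScalars 𝕜 G := by ext; simp [extendScalars]
  simp [herm, this, Matrix.neg_mulVec]

theorem herm_sum_left {ι : Type*} (s : Finset ι) (f : ι → Fin n → 𝕜) (y : Fin n → 𝕜) :
    herm G (∑ i ∈ s, f i) y = ∑ i ∈ s, herm G (f i) y := by
  classical
  induction s using Finset.induction_on with
  | empty => simp [herm_zero_left]
  | insert a s ha ih => rw [Finset.sum_insert ha, Finset.sum_insert ha, herm_add_left, ih]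

theorem herm_sum_right {ι : Type*} (s : Finset ι) (f : ι → Fin n → 𝕜) (y : Fin n → 𝕜) :
    herm G y (∑ i ∈ s, f i) = ∑ i ∈ s, herm G y (f i) := by
  classical
  induction s using Finset.induction_on with
  | empty => simp [herm_zero_right]
  | insert a s ha ih => rw [Finset.sum_insert ha, Finset.sum_insert ha, herm_add_right, ih]

theorem herm_comm (hG : G.IsSymm) (x y : Fin n → 𝕜) : herm G y x = star (herm G x y) := by
  have hs : (extendScalars 𝕜 G).IsSymm := by
    unfold extendScalars; exact hG.map _
  have hst : ∀ v : Fin n → 𝕜, star (extendScalars 𝕜 G *ᵥ v) = extendScalars 𝕜 G *ᵥ star v := by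
    intro v; ext i
    simp [Matrix.mulVec, dotProduct, extendScalars]
  rw [herm, herm, ← Matrix.star_dotProduct_star, hst, star_star, dotProduct_mulVec_comm hs]
  exact dotProduct_comm _ _

theorem herm_star_star (x y : Fin n → 𝕜) : herm G (star x) (star y) = star (herm G x y) := by
  have hst : ∀ v : Fin n → 𝕜, star (extendScalars 𝕜 G *ᵥ v) = extendScalars 𝕜 G *ᵥ star v := by
    intro v; ext i
    simp [Matrix.mulVec, dotProduct, extendScalars]
  rw [herm, herm, ← hst, star_star]
  simp [dotProduct]

theorem herm_eq_zero_comm (hG : G.IsSymm) {x y : Fin n → 𝕜} (h : herm G x y = 0) :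
    herm G y x = 0 := by rw [herm_comm hG, h, star_zero]

/-- The Hermitian square of `x + y` for orthogonal `x` and `y`. -/
theorem re_herm_add_of_orth (hG : G.IsSymm) {x y : Fin n → 𝕜} (h : herm G x y = 0) :
    RCLike.re (herm G (x + y) (x + y)) = RCLike.re (herm G x x) + RCLike.re (herm G y y) := by
  simp [herm_add_left, herm_add_right, h, herm_eq_zero_comm hG h]

theorem re_herm_smul (a : 𝕜) (x : Fin n → 𝕜) :
    RCLike.re (herm G (a • x) (a • x)) = ‖a‖ ^ 2 * RCLike.re (herm G x x) := by
  rw [herm_smul_left, herm_smul_right, ← mul_assoc]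
  have : star a * a = ((‖a‖ ^ 2 : ℝ) : 𝕜) := by
    rw [RCLike.star_def, RCLike.conj_mul]; norm_cast
  rw [this, RCLike.re_ofReal_mul]

/-- The form is positive definite on `U`. -/
def PosOn (G : Matrix (Fin n) (Fin n) ℚ) (U : Submodule 𝕜 (Fin n → 𝕜)) : Prop :=
  ∀ x ∈ U, x ≠ 0 → 0 < RCLike.re (herm G x x)

/-- The form is negative definite on `U`. -/
def NegOn (G : Matrix (Fin n) (Fin n) ℚ) (U : Submodule 𝕜 (Fin n → 𝕜)) : Prop :=
  ∀ x ∈ U, x ≠ 0 → RCLike.re (herm G x x) < 0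

theorem posOn_neg_iff {U : Submodule 𝕜 (Fin n → 𝕜)} : PosOn (-G) U ↔ NegOn G U := by
  simp [PosOn, NegOn, herm_neg_form]

theorem HasSignature.neg (hG : G.IsSymm) {W : Submodule 𝕜 (Fin n → 𝕜)} {p q : ℕ}
    (h : HasSignature G W p q) : HasSignature (-G) W q p := by
  obtain ⟨P, N, h1, h2, h3, h4, h5, h6, h7⟩ := h
  exact ⟨N, P, by rwa [sup_comm], h2.symm, fun x hx y hy => by
    rw [herm_neg_form, herm_eq_zero_comm hG (h3 y hy x hx), neg_zero], fun x hx h0 => by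
    simpa [herm_neg_form] using h5 x hx h0, fun x hx h0 => by
    simpa [herm_neg_form] using h4 x hx h0, h7, h6⟩

theorem HasSignature.finrank_eq {W : Submodule 𝕜 (Fin n → 𝕜)} {p q : ℕ}
    (h : HasSignature G W p q) : Module.finrank 𝕜 W = p + q := by
  obtain ⟨P, N, rfl, h2, -, -, -, rfl, rfl⟩ := h
  have := Submodule.finrank_sup_add_finrank_inf_eq P N
  rw [h2.eq_bot, finrank_bot, add_zero] at this
  exact this

/-- A subspace on which the form is nonnegative has dimension at most the positive index. -/
theorem HasSignature.finrank_le_of_nonneg {W U : Submodule 𝕜 (Fin n → 𝕜)} {p q : ℕ}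
    (h : HasSignature G W p q) (hUW : U ≤ W) (hU : ∀ x ∈ U, 0 ≤ RCLike.re (herm G x x)) :
    Module.finrank 𝕜 U ≤ p := by
  have hW := h.finrank_eq
  obtain ⟨P, N, rfl, h2, h3, h4, h5, h6, h7⟩ := h
  have hinf : U ⊓ N = ⊥ := by
    rw [eq_bot_iff]
    intro x hx
    by_contra h0
    exact absurd (h5 x hx.2 h0) (not_lt.2 (hU x hx.1))
  have h8 := Submodule.finrank_sup_add_finrank_inf_eq U N
  rw [hinf, finrank_bot, add_zero] at h8
  have h9 := Submodule.finrank_mono (sup_le hUW (le_sup_right : N ≤ P ⊔ N))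
  omega

/-- A subspace on which the form is nonpositive has dimension at most the negative index. -/
theorem HasSignature.finrank_le_of_nonpos {W U : Submodule 𝕜 (Fin n → 𝕜)} {p q : ℕ}
    (h : HasSignature G W p q) (hUW : U ≤ W) (hU : ∀ x ∈ U, RCLike.re (herm G x x) ≤ 0) :
    Module.finrank 𝕜 U ≤ q := by
  have hW := h.finrank_eq
  obtain ⟨P, N, rfl, h2, h3, h4, h5, h6, h7⟩ := h
  have hinf : U ⊓ P = ⊥ := by
    rw [eq_bot_iff]
    intro x hx
    by_contra h0
    exact absurd (h4 x hx.2 h0) (not_lt.2 (hU x hx.1))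
  have h8 := Submodule.finrank_sup_add_finrank_inf_eq U P
  rw [hinf, finrank_bot, add_zero] at h8
  have h9 := Submodule.finrank_mono (sup_le hUW (le_sup_left : P ≤ P ⊔ N))
  omega

/-- In a space of signature `(1, q)` two orthogonal vectors that are not negative are linearly
dependent. -/
theorem HasSignature.not_linearIndependent (hG : G.IsSymm) {W : Submodule 𝕜 (Fin n → 𝕜)} {q : ℕ}
    (h : HasSignature G W 1 q) {x y : Fin n → 𝕜} (hx : x ∈ W) (hy : y ∈ W)
    (hxy : herm G x y = 0) (hxx : 0 ≤ RCLike.re (herm G x x)) (hyy : 0 ≤ RCLike.re (herm G y y)) :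
    ¬ LinearIndependent 𝕜 ![x, y] := by
  intro hli
  have h1 := finrank_span_eq_card hli
  have h2 := h.finrank_le_of_nonneg (U := Submodule.span 𝕜 (Set.range ![x, y])) ?_ ?_
  · rw [h1] at h2; simp at h2
  · rw [Submodule.span_le]
    rintro _ ⟨i, rfl⟩
    fin_cases i <;> assumption
  · intro z hz
    rw [Matrix.range_cons, Matrix.range_cons, Matrix.range_empty, Set.union_empty,
      Set.singleton_union, Submodule.mem_span_pair] at hz
    obtain ⟨a, b, rfl⟩ := hz
    rw [re_herm_add_of_orth hG (by rw [herm_smul_left, herm_smul_right, hxy]; simp), re_herm_smul,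
      re_herm_smul]
    positivity

theorem HasSignature.unique {W : Submodule 𝕜 (Fin n → 𝕜)} {p q p' q' : ℕ}
    (h : HasSignature G W p q) (h' : HasSignature G W p' q') : p = p' ∧ q = q' := by
  have key : ∀ {p q p' q' : ℕ}, HasSignature G W p q → HasSignature G W p' q' → p ≤ p' := by
    intro p q p' q' h h'
    obtain ⟨P, N, h1, h2, h3, h4, h5, h6, h7⟩ := h
    rw [← h6]
    refine h'.finrank_le_of_nonneg (h1 ▸ le_sup_left) fun x hx => ?_
    rcases eq_or_ne x 0 with rfl | h0
    · simp [herm_zero_left]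
    · exact (h4 x hx h0).le
  have h1 := h.finrank_eq
  have h2 := h'.finrank_eq
  have h3 := key h h'
  have h4 := key h' h
  omega

/-- A family of pairwise orthogonal positive vectors spans a positive definite subspace, of
dimension the size of the family. -/
theorem posOn_span_range {ι : Type*} [Fintype ι] {v : ι → Fin n → 𝕜}
    (horth : ∀ i j, i ≠ j → herm G (v i) (v j) = 0) (hpos : ∀ i, 0 < RCLike.re (herm G (v i) (v i))) :
    PosOn G (Submodule.span 𝕜 (Set.range v)) ∧
      Module.finrank 𝕜 (Submodule.span 𝕜 (Set.range v)) = Fintype.card ι := by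
  have key : ∀ c : ι → 𝕜, RCLike.re (herm G (∑ i, c i • v i) (∑ i, c i • v i)) =
      ∑ i, ‖c i‖ ^ 2 * RCLike.re (herm G (v i) (v i)) := by
    intro c
    rw [herm_sum_left, map_sum]
    refine Finset.sum_congr rfl fun i _ => ?_
    rw [herm_sum_right, Finset.sum_eq_single i, re_herm_smul]
    · intro j _ hj
      rw [herm_smul_left, herm_smul_right, horth i j hj.symm]; simp
    · simp
  constructor
  · intro x hx h0
    obtain ⟨c, rfl⟩ := (Submodule.mem_span_range_iff_exists_fun 𝕜).1 hx
    rw [key]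
    have : ∃ i, c i ≠ 0 := by
      by_contra hc
      push Not at hc
      simp [hc] at h0
    obtain ⟨i, hi⟩ := this
    refine Finset.sum_pos' (fun j _ => mul_nonneg (sq_nonneg _) (hpos j).le) ⟨i, Finset.mem_univ _, ?_⟩
    exact mul_pos (pow_pos (norm_pos_iff.2 hi) 2) (hpos i)
  · apply finrank_span_eq_card
    rw [Fintype.linearIndependent_iff]
    intro c hc i
    have h1 := key c
    rw [hc, herm_zero_left, map_zero] at h1
    have h2 := (Finset.sum_eq_zero_iff_of_nonneg
      (fun j _ => mul_nonneg (sq_nonneg ‖c j‖) (hpos j).le)).1 h1.symm i (Finset.mem_univ _)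
    rcases mul_eq_zero.1 h2 with h3 | h3
    · simpa using h3
    · exact absurd h3 (hpos i).ne'

theorem negOn_span_range {ι : Type*} [Fintype ι] {v : ι → Fin n → 𝕜}
    (horth : ∀ i j, i ≠ j → herm G (v i) (v j) = 0) (hneg : ∀ i, RCLike.re (herm G (v i) (v i)) < 0) :
    NegOn G (Submodule.span 𝕜 (Set.range v)) ∧
      Module.finrank 𝕜 (Submodule.span 𝕜 (Set.range v)) = Fintype.card ι := by
  rw [← posOn_neg_iff]
  refine posOn_span_range (fun i j hij => ?_) fun i => ?_
  · rw [herm_neg_form, horth i j hij, neg_zero]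
  · simpa [herm_neg_form] using hneg i

/-- A subspace that contains a positive definite subspace of dimension `p` and a negative definite
one of dimension `q`, and has dimension `p + q`, has signature `(p, q)`. -/
theorem hasSignature_of_posOn_negOn (hG : G.IsSymm) {W U N : Submodule 𝕜 (Fin n → 𝕜)} {p q : ℕ}
    (hUW : U ≤ W) (hNW : N ≤ W) (hU : PosOn G U) (hN : NegOn G N) (hp : Module.finrank 𝕜 U = p)
    (hq : Module.finrank 𝕜 N = q) (hW : Module.finrank 𝕜 W = p + q) : HasSignature G W p q := by
  let b := Module.finBasis 𝕜 N
  let T : W →ₗ[𝕜] (Fin (Module.finrank 𝕜 N) → 𝕜) :=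
    { toFun := fun x j => herm G (b j : Fin n → 𝕜) x
      map_add' := fun x y => by ext j; simp [herm_add_right]
      map_smul' := fun a x => by ext j; simp [herm_smul_right] }
  let P : Submodule 𝕜 (Fin n → 𝕜) := (LinearMap.ker T).map W.subtype
  have hPW : P ≤ W := Submodule.map_subtype_le _ _
  have hPorth : ∀ x ∈ P, ∀ y ∈ N, herm G y x = 0 := by
    rintro _ ⟨x, hx, rfl⟩ y hy
    have h1 : ∀ j, herm G (b j : Fin n → 𝕜) x = 0 := fun j => congrFun (LinearMap.mem_ker.1 hx) j
    have h2 := congrArg (Subtype.val) (b.sum_repr ⟨y, hy⟩)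
    rw [← show _ = y from h2, AddSubmonoidClass.coe_finsetSum, herm_sum_left]
    refine Finset.sum_eq_zero fun j _ => ?_
    rw [Submodule.coe_smul, herm_smul_left]
    simp [h1 j]
  have hPN : P ⊓ N = ⊥ := by
    rw [eq_bot_iff]
    intro x hx
    by_contra h0
    have := hN x hx.2 h0
    rw [hPorth x hx.1 x hx.2] at this
    simp at this
  have hPdim : p ≤ Module.finrank 𝕜 P := by
    have h1 := LinearMap.finrank_range_add_finrank_ker T
    have h2 := Submodule.finrank_le (LinearMap.range T)
    rw [Module.finrank_fin_fun] at h2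
    have h3 : Module.finrank 𝕜 P = Module.finrank 𝕜 (LinearMap.ker T) :=
      Submodule.finrank_map_subtype_eq _ _
    omega
  have h8 := Submodule.finrank_sup_add_finrank_inf_eq P N
  rw [hPN, finrank_bot, add_zero] at h8
  have h9 := Submodule.finrank_mono (sup_le hPW hNW)
  refine ⟨P, N, ?_, disjoint_iff.2 hPN, fun x hx y hy => herm_eq_zero_comm hG (hPorth x hx y hy), ?_, hN,
    by omega, hq⟩
  · exact Submodule.eq_of_le_of_finrank_eq (sup_le hPW hNW) (by omega)
  · intro x hx h0
    by_contra hle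
    rw [not_lt] at hle
    -- `N ⊕ ⟨x⟩` would be a nonpositive subspace of dimension `q + 1`, hence would meet `U`
    have hxN : N ⊓ Submodule.span 𝕜 {x} = ⊥ := by
      rw [eq_bot_iff, ← hPN]
      exact le_inf (inf_le_right.trans ((Submodule.span_singleton_le_iff_mem _ _).2 hx)) inf_le_left
    have h10 := Submodule.finrank_sup_add_finrank_inf_eq N (Submodule.span 𝕜 {x})
    rw [hxN, finrank_bot, add_zero, finrank_span_singleton h0] at h10
    have h11 := Submodule.finrank_sup_add_finrank_inf_eq U (N ⊔ Submodule.span 𝕜 {x})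
    have h12 := Submodule.finrank_mono (sup_le hUW (sup_le hNW
      ((Submodule.span_singleton_le_iff_mem _ _).2 (hPW hx))))
    have h13 : U ⊓ (N ⊔ Submodule.span 𝕜 {x}) ≠ ⊥ := by
      intro h; rw [h, finrank_bot] at h11; omega
    obtain ⟨z, hz, hz0⟩ := Submodule.exists_mem_ne_zero_of_ne_bot h13
    obtain ⟨y, hy, w, hw, rfl⟩ := Submodule.mem_sup.1 hz.2
    obtain ⟨a, rfl⟩ := Submodule.mem_span_singleton.1 hw
    have h14 := hU _ hz.1 hz0
    rw [re_herm_add_of_orth hG (by rw [herm_smul_right, hPorth x hx y hy, mul_zero]),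
      re_herm_smul] at h14
    have h15 : RCLike.re (herm G y y) ≤ 0 := by
      rcases eq_or_ne y 0 with rfl | hy0
      · simp [herm_zero_left]
      · exact (hN y hy hy0).le
    have h16 := mul_nonneg (sq_nonneg ‖a‖) (neg_nonneg.2 hle)
    linarith

/-- A space of dimension `q + 2` with `q` orthogonal negative vectors, all orthogonal to an
isotropic vector `x` that is not in the radical, has signature `(1, q + 1)`. -/
theorem hasSignature_of_isotropic (hG : G.IsSymm) {W : Submodule 𝕜 (Fin n → 𝕜)}
    {ι : Type*} [Fintype ι] {v : ι → Fin n → 𝕜} (hvW : ∀ i, v i ∈ W)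
    (horth : ∀ i j, i ≠ j → herm G (v i) (v j) = 0) (hneg : ∀ i, RCLike.re (herm G (v i) (v i)) < 0)
    {x y : Fin n → 𝕜} (hx : x ∈ W) (hy : y ∈ W) (hxx : herm G x x = 0)
    (hxv : ∀ i, herm G (v i) x = 0) (hxy : herm G x y ≠ 0)
    (hW : Module.finrank 𝕜 W = Fintype.card ι + 2) : HasSignature G W 1 (Fintype.card ι + 1) := by
  classical
  have hne : ∀ i, herm G (v i) (v i) ≠ 0 := fun i h => by simpa [h] using hneg i
  set y' : Fin n → 𝕜 := y - ∑ i, (herm G (v i) y / herm G (v i) (v i)) • v i with hy'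
  have hy'W : y' ∈ W := W.sub_mem hy (W.sum_mem fun i _ => W.smul_mem _ (hvW i))
  have hsub : ∀ a b c : Fin n → 𝕜, herm G a (b - c) = herm G a b - herm G a c := by
    intro a b c
    rw [sub_eq_add_neg, herm_add_right, ← neg_one_smul 𝕜 c, herm_smul_right]; ring
  have hvy' : ∀ i, herm G (v i) y' = 0 := by
    intro i
    rw [hy', hsub, herm_sum_right, Finset.sum_eq_single i, herm_smul_right, div_mul_cancel₀ _ (hne i),
      sub_self]
    · intro j _ hj
      rw [herm_smul_right, horth i j hj.symm, mul_zero]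
    · simp
  have hxy' : herm G x y' ≠ 0 := by
    rw [hy', hsub, herm_sum_right, Finset.sum_eq_zero, sub_zero]
    · exact hxy
    · intro i _
      rw [herm_smul_right, herm_eq_zero_comm hG (hxv i), mul_zero]
  -- moving along `x`, the Hermitian square takes all real values on vectors orthogonal to the `v i`
  have hz : ∀ s : ℝ, ∃ z ∈ W, (∀ i, herm G (v i) z = 0) ∧ RCLike.re (herm G z z) = s := by
    intro s
    set t : ℝ := (s - RCLike.re (herm G y' y')) / (2 * ‖herm G x y'‖ ^ 2)
    refine ⟨y' + ((t : 𝕜) * herm G x y') • x, W.add_mem hy'W (W.smul_mem _ hx), fun i => ?_, ?_⟩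
    · rw [herm_add_right, hvy', herm_smul_right, hxv, mul_zero, add_zero]
    · have h1 : herm G y' x = star (herm G x y') := herm_comm hG _ _
      simp only [herm_add_left, herm_add_right, herm_smul_left, herm_smul_right, hxx, h1]
      have h2 : herm G x y' * star (herm G x y') = ((‖herm G x y'‖ ^ 2 : ℝ) : 𝕜) := by
        rw [RCLike.star_def, RCLike.mul_conj]; norm_cast
      have h3 : (t : 𝕜) * herm G x y' * star (herm G x y') =
          ((t * ‖herm G x y'‖ ^ 2 : ℝ) : 𝕜) := by rw [mul_assoc, h2]; norm_cast
      have h4 : star ((t : 𝕜) * herm G x y') * herm G x y' = ((t * ‖herm G x y'‖ ^ 2 : ℝ) : 𝕜) := by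
        rw [star_mul', RCLike.star_def, RCLike.conj_ofReal, mul_assoc, mul_comm ((starRingEnd 𝕜) _),
          ← RCLike.star_def, h2]; norm_cast
      rw [mul_zero, add_zero, h3, h4]
      simp only [map_add, RCLike.ofReal_re]
      have h5 : ‖herm G x y'‖ ≠ 0 := norm_ne_zero_iff.2 hxy'
      simp only [t]
      field_simp
      ring
  obtain ⟨z₁, hz₁W, -, hz₁⟩ := hz 1
  obtain ⟨z₂, hz₂W, hz₂v, hz₂⟩ := hz (-1)
  let u : Option ι → Fin n → 𝕜 := fun o => o.elim z₂ v
  have hN := negOn_span_range (G := G) (v := u) ?_ ?_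
  · have hP := posOn_span_range (G := G) (v := fun _ : Unit => z₁) (fun i j h => absurd rfl h)
      (fun _ => by rw [hz₁]; norm_num)
    refine hasSignature_of_posOn_negOn hG ?_ ?_ hP.1 hN.1 hP.2 ?_ (by rw [hW]; ring)
    · rw [Submodule.span_le]; rintro _ ⟨i, rfl⟩; exact hz₁W
    · rw [Submodule.span_le]; rintro _ ⟨i, rfl⟩
      cases i
      · exact hz₂W
      · exact hvW _
    · rw [hN.2, Fintype.card_option]
  · rintro (_ | i) (_ | j) hij
    · exact absurd rfl hij
    · exact herm_eq_zero_comm hG (hz₂v j)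
    · exact hz₂v i
    · exact horth i j (fun h => hij (by rw [h]))
  · rintro (_ | i)
    · change RCLike.re (herm G z₂ z₂) < 0
      rw [hz₂]; norm_num
    · exact hneg i

end Herm

/-! ### Comparison of the real and the complex signature -/

/-- The complex vector with the given real coordinates. -/
def toC {n : ℕ} (v : Fin n → ℝ) : Fin n → ℂ := fun i => (v i : ℂ)

section Real
variable {n : ℕ} {G : Matrix (Fin n) (Fin n) ℚ}

theorem extendScalars_mulVec_toC (M : Matrix (Fin n) (Fin n) ℚ) (v : Fin n → ℝ) :
    extendScalars ℂ M *ᵥ toC v = toC (extendScalars ℝ M *ᵥ v) := by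
  ext i
  simp [extendScalars, toC, Matrix.mulVec, dotProduct]

theorem herm_toC (v w : Fin n → ℝ) : herm G (toC v) (toC w) = ((herm G v w : ℝ) : ℂ) := by
  rw [herm, extendScalars_mulVec_toC, herm]
  simp [toC, dotProduct]

theorem toC_ne_zero {v : Fin n → ℝ} (h : v ≠ 0) : toC v ≠ 0 := by
  intro h0; apply h; ext i
  have := congrFun h0 i
  simpa [toC] using this

/-- The signature of the real form can be read off from definite subspaces of `ℂ ^ n`. -/
theorem hasSignature_real_of_complex (hG : G.IsSymm) {U N : Submodule ℂ (Fin n → ℂ)} {p q : ℕ}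
    (hU : PosOn G U) (hN : NegOn G N) (hp : Module.finrank ℂ U = p) (hq : Module.finrank ℂ N = q)
    (hn : n = p + q) : HasSignature G (⊤ : Submodule ℝ (Fin n → ℝ)) p q := by
  classical
  have hC : HasSignature G (⊤ : Submodule ℂ (Fin n → ℂ)) p q :=
    hasSignature_of_posOn_negOn hG le_top le_top hU hN hp hq (by simpa using hn)
  -- an orthogonal eigenbasis of the real symmetric matrix is orthogonal for the form, and also after
  -- extension of scalars, where the numbers of positive and negative vectors are bounded by `p`, `q`
  have hH : (extendScalars ℝ G).IsHermitian := by
    have : (extendScalars ℝ G).IsSymm := by unfold extendScalars; exact hG.map _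
    rw [Matrix.IsHermitian, Matrix.conjTranspose_eq_transpose_of_trivial]; exact this
  let u : Fin n → Fin n → ℝ := fun i => ⇑(hH.eigenvectorBasis i)
  have hGu : ∀ i, extendScalars ℝ G *ᵥ u i = hH.eigenvalues i • u i := hH.mulVec_eigenvectorBasis
  have hdot : ∀ i j, u i ⬝ᵥ u j = if i = j then 1 else 0 := by
    intro i j
    have := orthonormal_iff_ite.1 hH.eigenvectorBasis.orthonormal j i
    rw [EuclideanSpace.inner_eq_star_dotProduct] at this
    simpa [u, eq_comm] using this
  have hval : ∀ i j, herm G (u i) (u j) = if i = j then hH.eigenvalues j else 0 := by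
    intro i j
    rw [herm, hGu, dotProduct_smul, star_trivial, hdot]
    split_ifs <;> simp
  have hu0 : ∀ i, u i ≠ 0 := fun i h => by simpa [h] using hdot i i
  have hev : ∀ i, hH.eigenvalues i ≠ 0 := by
    intro i h0
    have h1 : extendScalars ℂ G *ᵥ toC (u i) = 0 := by
      rw [extendScalars_mulVec_toC, hGu, h0, zero_smul]; ext; simp [toC]
    have h2 : ∀ z, herm G z (toC (u i)) = 0 := by intro z; rw [herm, h1]; simp
    obtain ⟨P, M, h3, h4, h5, h6, h7, -, -⟩ := hC
    have h8 : toC (u i) ∈ P ⊔ M := h3 ▸ Submodule.mem_top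
    obtain ⟨a, ha, b, hb, hab⟩ := Submodule.mem_sup.1 h8
    have ha0 : a = 0 := by
      by_contra h9
      have := h2 a
      rw [← hab, herm_add_right, h5 a ha b hb, add_zero] at this
      have h10 := h6 a ha h9
      rw [this] at h10; simp at h10
    have hb0 : b = 0 := by
      by_contra h9
      have := h2 b
      rw [← hab, ha0, zero_add] at this
      have h10 := h7 b hb h9
      rw [this] at h10; simp at h10
    rw [ha0, hb0, zero_add] at hab
    exact toC_ne_zero (hu0 i) hab.symm
  let S := {i // 0 < hH.eigenvalues i}
  let S' := {i // ¬ 0 < hH.eigenvalues i}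
  have hcard : Fintype.card S + Fintype.card S' = n := by
    rw [Fintype.card_subtype_compl]
    have := Fintype.card_subtype_le (fun i => 0 < hH.eigenvalues i)
    simp only [Fintype.card_fin] at *
    simp only [S]
    omega
  have hPR := posOn_span_range (G := G) (v := fun i : S => u i)
    (fun i j hij => by rw [hval, if_neg (fun h => hij (Subtype.ext h))])
    (fun i => by rw [hval, if_pos rfl]; exact i.2)
  have hNR := negOn_span_range (G := G) (v := fun i : S' => u i)
    (fun i j hij => by rw [hval, if_neg (fun h => hij (Subtype.ext h))])
    (fun i => by rw [hval, if_pos rfl]; exact lt_of_le_of_ne (not_lt.1 i.2) (hev i))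
  have hPC := posOn_span_range (G := G) (v := fun i : S => toC (u i))
    (fun i j hij => by rw [herm_toC, hval, if_neg (fun h => hij (Subtype.ext h))]; simp)
    (fun i => by rw [herm_toC, hval, if_pos rfl]; simpa using i.2)
  have hNC := negOn_span_range (G := G) (v := fun i : S' => toC (u i))
    (fun i j hij => by rw [herm_toC, hval, if_neg (fun h => hij (Subtype.ext h))]; simp)
    (fun i => by
      rw [herm_toC, hval, if_pos rfl]
      simpa using lt_of_le_of_ne (not_lt.1 i.2) (hev i))
  have h1 : Fintype.card S ≤ p := by
    rw [← hPC.2]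
    refine hC.finrank_le_of_nonneg le_top fun x hx => ?_
    rcases eq_or_ne x 0 with rfl | h0
    · simp [herm_zero_left]
    · exact (hPC.1 x hx h0).le
  have h2 : Fintype.card S' ≤ q := by
    rw [← hNC.2]
    refine hC.finrank_le_of_nonpos le_top fun x hx => ?_
    rcases eq_or_ne x 0 with rfl | h0
    · simp [herm_zero_left]
    · exact (hNC.1 x hx h0).le
  exact hasSignature_of_posOn_negOn hG le_top le_top hPR.1 hNR.1 (by rw [hPR.2]; omega)
    (by rw [hNR.2]; omega) (by simpa using hn)

end Real

/-! ### Spectral description of the invariant form over the complex numbers -/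

theorem isHyperPair_map {K : Type} [Field K] [CharZero K] {φ ψ : ℤ[X]} (hφ : φ.Monic)
    (hφ_deg : φ.natDegree = 22)
    (hφ_anti : φ.reflect 22 = -φ) (hψ : ψ.Monic) (hψ_deg : ψ.natDegree = 22)
    (hψ_pal : ψ.reflect 22 = ψ)
    (hcop : IsCoprime (φ.map (Int.castRingHom ℚ)) (ψ.map (Int.castRingHom ℚ))) :
    IsHyperPair 21 (φ.map (Int.castRingHom K)) (ψ.map (Int.castRingHom K)) where
  hm := by norm_num
  f_monic := hφ.map _
  g_monic := hψ.map _
  f_deg := by rw [hφ.natDegree_map, hφ_deg]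
  g_deg := by rw [hψ.natDegree_map, hψ_deg]
  f_reflect := by rw [reflect_map, hφ_anti, Polynomial.map_neg]
  g_reflect := by rw [reflect_map, hψ_pal]
  coprime := by
    have h := hcop.map (mapRingHom (Rat.castHom K))
    simp only [coe_mapRingHom, Polynomial.map_map] at h
    have h2 : (Rat.castHom K).comp (Int.castRingHom ℚ) = Int.castRingHom K := RingHom.ext_int _ _
    rwa [h2] at h

/-- The characteristic polynomial over `ℂ`. -/
noncomputable abbrev cpoly (φ : ℤ[X]) : ℂ[X] := φ.map (Int.castRingHom ℂ)

/-- The complex vector `p (A) r`, for a complex polynomial `p`. -/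
noncomputable def polyVec (φ : ℤ[X]) (r : Fin 22 → ℚ) (p : ℂ[X]) : Fin 22 → ℂ :=
  aeval (extendScalars ℂ (companion 22 φ)) p *ᵥ fun i => (r i : ℂ)

/-- The eigenvector `(φ (z) / (z - α)) (A) r` of `A` with eigenvalue `α`. -/
noncomputable def eigVec (φ : ℤ[X]) (r : Fin 22 → ℚ) (α : ℂ) : Fin 22 → ℂ :=
  polyVec φ r (cpoly φ /ₘ (X - C α))

/-- The spectral properties of `G`, the matrix of `c` times the normalized invariant form: `A` is an
isometry, `p ↦ p (A) r` identifies `ℂ[z] / (φ)` with `ℂ ^ 22`, and the pairing of `r` with the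
eigenvectors is given by `ψ`. -/
structure IsSpectral (φ ψ : ℤ[X]) (r : Fin 22 → ℚ) (G : Matrix (Fin 22) (Fin 22) ℚ) (c : ℝ) :
    Prop where
  pair : IsHyperPair 21 (cpoly φ) (cpoly ψ)
  symm : G.IsSymm
  polyVec_eq_zero_iff : ∀ p, polyVec φ r p = 0 ↔ cpoly φ ∣ p
  exists_polyVec_eq : ∀ x, ∃ p, polyVec φ r p = x
  isom : ∀ x y : Fin 22 → ℂ, herm G (extendScalars ℂ (companion 22 φ) *ᵥ x)
    (extendScalars ℂ (companion 22 φ) *ᵥ y) = herm G x y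
  herm_eigVec : ∀ α, (cpoly φ).IsRoot α →
    α * herm G (fun i => (r i : ℂ)) (eigVec φ r α) = c * (cpoly ψ).eval α

theorem extendScalars_companion (𝕜 : Type) [RCLike 𝕜] (φ : ℤ[X]) :
    extendScalars 𝕜 (companion 22 φ) = cmat 22 (φ.map (Int.castRingHom 𝕜)) := by
  rw [companion_eq_cmat, extendScalars]
  have := cmat_map (Rat.castHom 𝕜) 22 (φ.map (Int.castRingHom ℚ))
  rw [Polynomial.map_map] at this
  have h2 : (Rat.castHom 𝕜).comp (Int.castRingHom ℚ) = Int.castRingHom 𝕜 := RingHom.ext_int _ _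
  rw [h2] at this
  exact this

theorem extendScalars_isom {𝕜 : Type} [RCLike 𝕜] {n : ℕ} {M G : Matrix (Fin n) (Fin n) ℚ}
    (h : Mᵀ * G * M = G) (x y : Fin n → 𝕜) :
    herm G (extendScalars 𝕜 M *ᵥ x) (extendScalars 𝕜 M *ᵥ y) = herm G x y := by
  have hst : star (extendScalars 𝕜 M *ᵥ x) = extendScalars 𝕜 M *ᵥ star x := by
    ext i; simp [Matrix.mulVec, dotProduct, extendScalars]
  have h' : (extendScalars 𝕜 M)ᵀ * extendScalars 𝕜 G * extendScalars 𝕜 M = extendScalars 𝕜 G := by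
    have := congrArg (extendScalars 𝕜) h
    unfold extendScalars at this ⊢
    have hc : (fun q : ℚ => (q : 𝕜)) = (Rat.castHom 𝕜 : ℚ → 𝕜) := rfl
    rw [hc] at this ⊢
    rw [Matrix.map_mul, Matrix.map_mul, Matrix.transpose_map] at this
    exact this
  rw [herm, herm, hst]
  exact transpose_mul_mul_eq_iff.1 h' _ _

/-- The reflection vectors are the vectors `κ A⁻¹ ψ (A) e₀` with `κ ≠ 0`. -/
theorem IsReflectionVector.exists_smul {φ ψ : ℤ[X]} {r : Fin 22 → ℚ}
    (h : IsHyperPair 21 (φ.map (Int.castRingHom ℚ)) (ψ.map (Int.castRingHom ℚ)))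
    (hr : IsReflectionVector 22 φ ψ r) : ∃ κ : ℚ, κ ≠ 0 ∧
      cmat (21 + 1) (φ.map (Int.castRingHom ℚ)) *ᵥ r =
        κ • (aeval (cmat (21 + 1) (φ.map (Int.castRingHom ℚ))) (ψ.map (Int.castRingHom ℚ)) *ᵥ
          coeffVec (21 + 1) 1) := by
  obtain ⟨h0, hr⟩ := hr
  rw [companion_eq_cmat, companion_eq_cmat] at hr
  have h1 : cmat (21 + 1) (ψ.map (Int.castRingHom ℚ)) *ᵥ r =
      -(cmat (21 + 1) (φ.map (Int.castRingHom ℚ)) *ᵥ r) := by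
    have := congrArg (fun v => cmat (21 + 1) (φ.map (Int.castRingHom ℚ)) *ᵥ v) hr
    simp only [Matrix.mulVec_mulVec, Matrix.mulVec_neg] at this
    rw [← mul_assoc, h.mul_inv, one_mul] at this
    exact this
  rw [cmat_mulVec_eq_sub h.f_monic h.f_deg h.g_monic h.g_deg] at h1
  have h2 : cmat (21 + 1) (φ.map (Int.castRingHom ℚ)) *ᵥ r = (r (Fin.last 21) / 2) •
      (aeval (cmat (21 + 1) (φ.map (Int.castRingHom ℚ))) (ψ.map (Int.castRingHom ℚ)) *ᵥ
          coeffVec (21 + 1) 1) := by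
    ext i
    have := congrFun h1 i
    simp only [Pi.sub_apply, Pi.smul_apply, Pi.neg_apply, smul_eq_mul] at this ⊢
    linear_combination this / 2
  refine ⟨_, fun hk => h0 ?_, h2⟩
  rw [hk, zero_smul] at h2
  have := congrArg (fun v => (cmat (21 + 1) (φ.map (Int.castRingHom ℚ)))⁻¹ *ᵥ v) h2
  simpa only [Matrix.mulVec_mulVec, h.inv_mul, Matrix.one_mulVec, Matrix.mulVec_zero] using this

theorem exists_isReflectionVector {φ ψ : ℤ[X]}
    (h : IsHyperPair 21 (φ.map (Int.castRingHom ℚ)) (ψ.map (Int.castRingHom ℚ))) :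
    ∃ r, IsReflectionVector 22 φ ψ r := by
  set A := cmat (21 + 1) (φ.map (Int.castRingHom ℚ)) with hA
  set u := (A⁻¹ * aeval A (ψ.map (Int.castRingHom ℚ))) *ᵥ coeffVec (21 + 1) 1 with hu
  have hlast : u (Fin.last 21) = 2 := h.last_inv_g
  refine ⟨u, fun h0 => by simp [h0] at hlast, ?_⟩
  rw [companion_eq_cmat, companion_eq_cmat, ← Matrix.mulVec_mulVec]
  have h1 := cmat_mulVec_eq_sub h.f_monic h.f_deg h.g_monic h.g_deg u
  rw [hlast] at h1
  have h2 : A *ᵥ u = aeval A (ψ.map (Int.castRingHom ℚ)) *ᵥ coeffVec (21 + 1) 1 := by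
    rw [hu, Matrix.mulVec_mulVec, ← mul_assoc, h.mul_inv, one_mul]
  change A⁻¹ *ᵥ (cmat (21 + 1) (ψ.map (Int.castRingHom ℚ)) *ᵥ u) = -u
  rw [h1, ← hA, ← h2, Matrix.mulVec_sub, Matrix.mulVec_smul, Matrix.mulVec_mulVec, h.inv_mul,
    Matrix.one_mulVec]
  module

theorem aeval_map_mulVec {n : ℕ} (σ : ℚ →+* ℂ) (A : Matrix (Fin n) (Fin n) ℚ) (p : ℚ[X])
    (x : Fin n → ℚ) : aeval (A.map σ) (p.map σ) *ᵥ (fun i => σ (x i)) =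
      fun i => σ ((aeval A p *ᵥ x) i) := by
  have h1 : aeval (A.map σ) (p.map σ) = (aeval A p).map σ := by
    induction p using Polynomial.induction_on with
    | C a =>
      ext i j
      by_cases hij : i = j <;> simp [Algebra.algebraMap_eq_smul_one, hij]
    | add p q hp hq => simp [hp, hq, Matrix.map_add]
    | monomial k a ih =>
      rw [pow_succ, ← mul_assoc, Polynomial.map_mul, map_mul, ih, map_mul, Matrix.map_mul]
      simp
  rw [h1]
  ext i
  simp [Matrix.mulVec, dotProduct]

/-- The normalized invariant form has the expected spectral properties. -/
theorem isSpectral_of_normalized {φ ψ : ℤ[X]} {r : Fin 22 → ℚ} {G : Matrix (Fin 22) (Fin 22) ℚ}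
    (hQ : IsHyperPair 21 (φ.map (Int.castRingHom ℚ)) (ψ.map (Int.castRingHom ℚ)))
    (hC : IsHyperPair 21 (cpoly φ) (cpoly ψ))
    (hr : IsReflectionVector 22 φ ψ r) (hG : IsNormalizedInvariantForm 22 φ ψ r G) :
    IsSpectral φ ψ r G 1 := by
  obtain ⟨κ, hκ, hrκ⟩ := hr.exists_smul hQ
  obtain ⟨hs, hA, hB, hrr⟩ := hG
  have hA' := hA
  rw [companion_eq_cmat] at hA hB
  have hdual := hQ.dual_of_invariant two_ne_zero hκ hrκ hA hB hrr
  let σ := Rat.castHom ℂ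
  have hσ : σ.comp (Int.castRingHom ℚ) = Int.castRingHom ℂ := RingHom.ext_int _ _
  have hmap : (cmat 22 (φ.map (Int.castRingHom ℚ))).map σ = cmat 22 (cpoly φ) := by
    rw [cmat_map, Polynomial.map_map, hσ]
  have hrC : cmat (21 + 1) (cpoly φ) *ᵥ (fun i => (r i : ℂ)) =
      (κ : ℂ) • (aeval (cmat (21 + 1) (cpoly φ)) (cpoly ψ) *ᵥ coeffVec (21 + 1) 1) := by
    have h1 := aeval_map_mulVec σ (cmat 22 (φ.map (Int.castRingHom ℚ))) X r
    have h2 := aeval_map_mulVec σ (cmat 22 (φ.map (Int.castRingHom ℚ)))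
      (ψ.map (Int.castRingHom ℚ)) (coeffVec 22 1)
    rw [Polynomial.map_X, aeval_X, aeval_X, hmap] at h1
    rw [hmap, Polynomial.map_map, hσ, ← coeffVec_map, Polynomial.map_one] at h2
    change cmat 22 (cpoly φ) *ᵥ (fun i => σ (r i)) = _
    rw [h1]
    change _ = (κ : ℂ) • (aeval (cmat 22 (cpoly φ)) (cpoly ψ) *ᵥ coeffVec 22 1)
    rw [h2]
    ext i
    have h3 := congrFun hrκ i
    change (cmat 22 (φ.map (Int.castRingHom ℚ)) *ᵥ r) i = κ * (aeval (cmat 22 (φ.map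
      (Int.castRingHom ℚ))) (ψ.map (Int.castRingHom ℚ)) *ᵥ coeffVec 22 1) i at h3
    rw [h3, map_mul]
    rfl
  have hκC : (κ : ℂ) ≠ 0 := by exact_mod_cast hκ
  refine ⟨hC, hs, fun p => ?_, fun x => ?_, extendScalars_isom hA', fun α hα => ?_⟩
  · rw [polyVec, extendScalars_companion]
    exact hC.aeval_mulVec_eq_zero_iff hκC hrC p
  · obtain ⟨p, hp⟩ := hC.exists_aeval_mulVec_eq hκC hrC x
    refine ⟨p, ?_⟩
    rw [polyVec, extendScalars_companion]
    exact hp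
  · have hpair : ∀ x : Fin 22 → ℂ, herm G (fun i => (r i : ℂ)) x = (κ : ℂ)⁻¹ * x (Fin.last 21) := by
      intro x
      have h1 : ∀ y : Fin 22 → ℚ, r ⬝ᵥ (G *ᵥ y) = κ⁻¹ * y (Fin.last 21) := by
        intro y
        have := hdual 1 y
        simpa only [map_one, Matrix.one_mulVec] using this
      have h2 : ∀ j, ∑ i, r i * G i j = κ⁻¹ * (Pi.single j (1 : ℚ) : Fin 22 → ℚ) (Fin.last 21) := by
        intro j
        rw [← h1]
        simp [dotProduct]
      rw [herm]
      simp only [dotProduct, Matrix.mulVec, Finset.mul_sum, extendScalars, Matrix.map_apply]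
      rw [Finset.sum_comm]
      have h3 : ∀ j, ∑ i, star (fun i => (r i : ℂ)) i * ((G i j : ℂ) * x j) =
          ((κ⁻¹ * (Pi.single j (1 : ℚ) : Fin 22 → ℚ) (Fin.last 21) : ℚ) : ℂ) * x j := by
        intro j
        rw [← h2, Rat.cast_sum, Finset.sum_mul]
        refine Finset.sum_congr rfl fun i _ => ?_
        simp [mul_assoc]
      rw [Finset.sum_congr rfl fun j _ => h3 j, Finset.sum_eq_single (Fin.last 21)]
      · simp
      · intro j _ hj
        rw [Pi.single_eq_of_ne hj.symm]; simp
      · simp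
    set q := cpoly φ /ₘ (X - C α) with hq
    have hfac : (X - C α) * q = cpoly φ := mul_divByMonic_eq_iff_isRoot.2 hα
    have hqm : q.Monic := (monic_X_sub_C α).of_mul_monic_left (by rw [hfac]; exact hC.f_monic)
    have hqd : q.natDegree = 21 := by
      have := congrArg natDegree hfac
      rw [(monic_X_sub_C α).natDegree_mul hqm, natDegree_X_sub_C, hC.f_deg] at this
      omega
    have hM : ∀ p : ℂ[X], aeval (cmat 22 (cpoly φ)) (p * q) =
        p.eval α • aeval (cmat 22 (cpoly φ)) q := by
      intro p
      have h1 : p * q = C (p.eval α) * q + (p /ₘ (X - C α)) * cpoly φ := by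
        have := modByMonic_add_div p (X - C α)
        rw [modByMonic_X_sub_C_eq_C_eval] at this
        rw [← hfac]
        linear_combination -q * this
      have h0 : aeval (cmat 22 (cpoly φ)) (cpoly φ) = 0 := hC.aeval_self
      rw [h1, map_add, map_mul _ (p /ₘ _), h0, mul_zero, add_zero, map_mul, aeval_C,
        Algebra.algebraMap_eq_smul_one, smul_mul_assoc, one_mul]
    have h3 : α • eigVec φ r α = ((κ : ℂ) * (cpoly ψ).eval α) •
        (aeval (cmat 22 (cpoly φ)) q *ᵥ coeffVec 22 1) := by
      rw [eigVec, polyVec, extendScalars_companion, ← hq, ← Matrix.smul_mulVec]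
      have h4 := hM X
      rw [eval_X, mul_comm, map_mul, aeval_X] at h4
      rw [← h4, ← Matrix.mulVec_mulVec]
      have h5 : cmat 22 (cpoly φ) *ᵥ (fun i => (r i : ℂ)) =
        (κ : ℂ) • (aeval (cmat 22 (cpoly φ)) (cpoly ψ) *ᵥ coeffVec 22 1) := hrC
      rw [h5, Matrix.mulVec_smul, Matrix.mulVec_mulVec, ← map_mul, mul_comm q, hM,
        Matrix.smul_mulVec, smul_smul]
    have h6 : (aeval (cmat 22 (cpoly φ)) q *ᵥ coeffVec 22 1) (Fin.last 21) = 1 := by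
      have := aeval_cmat_mulVec_last hC.f_monic hC.f_deg hqd.le
      rw [← hqm.coeff_natDegree, hqd]
      exact this
    rw [hpair]
    have h7 := congrFun h3 (Fin.last 21)
    rw [Pi.smul_apply, Pi.smul_apply, h6] at h7
    simp only [smul_eq_mul, mul_one] at h7
    rw [mul_left_comm, h7]
    push_cast
    field_simp

theorem IsSpectral.neg {φ ψ : ℤ[X]} {r : Fin 22 → ℚ} {G : Matrix (Fin 22) (Fin 22) ℚ} {c : ℝ}
    (h : IsSpectral φ ψ r G c) : IsSpectral φ ψ r (-G) (-c) where
  pair := h.pair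
  symm := h.symm.neg
  polyVec_eq_zero_iff := h.polyVec_eq_zero_iff
  exists_polyVec_eq := h.exists_polyVec_eq
  isom x y := by rw [herm_neg_form, herm_neg_form, h.isom]
  herm_eigVec α hα := by rw [herm_neg_form, mul_neg, h.herm_eigVec α hα]; push_cast; ring

/-! ### Eigenvectors and isotropic planes -/

/-- The companion matrix of `φ` over `ℂ`. -/
noncomputable abbrev cA (φ : ℤ[X]) : Matrix (Fin 22) (Fin 22) ℂ := extendScalars ℂ (companion 22 φ)

theorem polyVec_add (φ : ℤ[X]) (r : Fin 22 → ℚ) (p q : ℂ[X]) :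
    polyVec φ r (p + q) = polyVec φ r p + polyVec φ r q := by
  simp [polyVec, Matrix.add_mulVec]

theorem polyVec_mul (φ : ℤ[X]) (r : Fin 22 → ℚ) (p q : ℂ[X]) :
    polyVec φ r (p * q) = aeval (cA φ) p *ᵥ polyVec φ r q := by
  simp [polyVec, Matrix.mulVec_mulVec]

theorem polyVec_C_mul (φ : ℤ[X]) (r : Fin 22 → ℚ) (a : ℂ) (q : ℂ[X]) :
    polyVec φ r (C a * q) = a • polyVec φ r q := by
  rw [polyVec_mul, aeval_C, Algebra.algebraMap_eq_smul_one, Matrix.smul_mulVec, Matrix.one_mulVec]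

theorem polyVec_X_mul (φ : ℤ[X]) (r : Fin 22 → ℚ) (q : ℂ[X]) :
    polyVec φ r (X * q) = cA φ *ᵥ polyVec φ r q := by
  rw [polyVec_mul, aeval_X]

theorem polyVec_X_sub_C_mul (φ : ℤ[X]) (r : Fin 22 → ℚ) (a : ℂ) (q : ℂ[X]) :
    polyVec φ r ((X - C a) * q) = cA φ *ᵥ polyVec φ r q - a • polyVec φ r q := by
  rw [sub_eq_add_neg, ← C_neg, add_mul, polyVec_add, polyVec_X_mul, polyVec_C_mul, neg_smul,
    sub_eq_add_neg]

theorem star_extendScalars_mulVec {n : ℕ} (M : Matrix (Fin n) (Fin n) ℚ) (x : Fin n → ℂ) :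
    star (extendScalars ℂ M *ᵥ x) = extendScalars ℂ M *ᵥ star x := by
  ext i; simp [Matrix.mulVec, dotProduct, extendScalars]

theorem star_polyVec (φ : ℤ[X]) (r : Fin 22 → ℚ) (p : ℂ[X]) :
    star (polyVec φ r p) = polyVec φ r (p.map (starRingEnd ℂ)) := by
  induction p using Polynomial.induction_on with
  | C a =>
    have e : star (polyVec φ r 1) = polyVec φ r 1 := by ext i; simp [polyVec]
    have h1 := polyVec_C_mul φ r a 1
    have h2 := polyVec_C_mul φ r (starRingEnd ℂ a) 1
    rw [mul_one] at h1 h2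
    rw [map_C, h1, h2, star_smul, e, RCLike.star_def]
  | add p q hp hq => rw [polyVec_add, star_add, hp, hq, Polynomial.map_add, polyVec_add]
  | monomial k a ih =>
    have : C a * X ^ (k + 1) = X * (C a * X ^ k) := by ring
    rw [this, polyVec_X_mul, star_extendScalars_mulVec, ih, Polynomial.map_mul (p := X), map_X, polyVec_X_mul]

theorem cpoly_map_conj (φ : ℤ[X]) : (cpoly φ).map (starRingEnd ℂ) = cpoly φ := by
  rw [Polynomial.map_map]; congr 1; exact RingHom.ext_int _ _

theorem star_eigVec (φ : ℤ[X]) (r : Fin 22 → ℚ) (α : ℂ) :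
    star (eigVec φ r α) = eigVec φ r (starRingEnd ℂ α) := by
  rw [eigVec, star_polyVec, map_divByMonic _ (monic_X_sub_C α), cpoly_map_conj]
  simp [eigVec]

theorem eq_toC_of_star_eq {n : ℕ} {x : Fin n → ℂ} (h : star x = x) :
    x = toC fun i => (x i).re := by
  ext i
  have := congrFun h i
  rw [Pi.star_apply] at this
  exact (Complex.conj_eq_iff_re.1 this).symm

theorem isRoot_conj {φ : ℤ[X]} {α : ℂ} (h : (cpoly φ).IsRoot α) :
    (cpoly φ).IsRoot (starRingEnd ℂ α) := by
  have := eval_map_apply (starRingEnd ℂ) (p := cpoly φ) α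
  rw [cpoly_map_conj, h, map_zero] at this
  exact this

namespace IsSpectral
variable {φ ψ : ℤ[X]} {r : Fin 22 → ℚ} {G : Matrix (Fin 22) (Fin 22) ℚ} {c : ℝ}
  (h : IsSpectral φ ψ r G c)
include h

theorem root_ne_zero {α : ℂ} (hα : (cpoly φ).IsRoot α) : α ≠ 0 := by
  rintro rfl
  have := h.pair.coeff_zero_f
  rw [coeff_zero_eq_eval_zero] at this
  exact absurd (this.symm.trans hα) (by norm_num)

theorem mulVec_eigVec {α : ℂ} (hα : (cpoly φ).IsRoot α) :
    cA φ *ᵥ eigVec φ r α = α • eigVec φ r α := by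
  rw [← sub_eq_zero, eigVec, ← polyVec_X_sub_C_mul, mul_divByMonic_eq_iff_isRoot.2 hα,
    h.polyVec_eq_zero_iff]

theorem divByMonic_ne_zero {α : ℂ} (hα : (cpoly φ).IsRoot α) : cpoly φ /ₘ (X - C α) ≠ 0 := by
  intro h0
  have := mul_divByMonic_eq_iff_isRoot.2 hα
  rw [h0, mul_zero] at this
  exact h.pair.f_monic.ne_zero this.symm

theorem eigVec_ne_zero {α : ℂ} (hα : (cpoly φ).IsRoot α) : eigVec φ r α ≠ 0 := by
  rw [eigVec, Ne, h.polyVec_eq_zero_iff]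
  intro hd
  have h1 := mul_divByMonic_eq_iff_isRoot.2 hα
  have h2 := natDegree_le_of_dvd hd (h.divByMonic_ne_zero hα)
  have h3 := congrArg natDegree h1
  rw [natDegree_mul (X_sub_C_ne_zero α) (h.divByMonic_ne_zero hα), natDegree_X_sub_C] at h3
  omega

/-- Eigenspaces of the companion matrix are lines. -/
theorem exists_smul_eigVec {α : ℂ} (hα : (cpoly φ).IsRoot α) {x : Fin 22 → ℂ}
    (hx : cA φ *ᵥ x = α • x) : ∃ a : ℂ, x = a • eigVec φ r α := by
  obtain ⟨p, rfl⟩ := h.exists_polyVec_eq x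
  rw [← sub_eq_zero, ← polyVec_X_sub_C_mul, h.polyVec_eq_zero_iff,
    ← mul_divByMonic_eq_iff_isRoot.2 hα] at hx
  obtain ⟨s, hs⟩ := (mul_dvd_mul_iff_left (X_sub_C_ne_zero α)).1 hx
  refine ⟨s.eval α, ?_⟩
  have h1 := modByMonic_add_div s (X - C α)
  rw [modByMonic_X_sub_C_eq_C_eval] at h1
  have h2 := mul_divByMonic_eq_iff_isRoot.2 hα
  have h3 : p = C (s.eval α) * (cpoly φ /ₘ (X - C α)) + (s /ₘ (X - C α)) * cpoly φ := by
    rw [hs]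
    linear_combination (-(cpoly φ /ₘ (X - C α))) * h1 + (s /ₘ (X - C α)) * h2
  have h4 : polyVec φ r ((s /ₘ (X - C α)) * cpoly φ) = 0 :=
    (h.polyVec_eq_zero_iff _).2 (dvd_mul_left _ _)
  rw [h3, polyVec_add, h4, add_zero, polyVec_C_mul, eigVec]

theorem isRoot_of_mulVec_eq {α : ℂ} {x : Fin 22 → ℂ} (hx0 : x ≠ 0) (hx : cA φ *ᵥ x = α • x) :
    (cpoly φ).IsRoot α := by
  obtain ⟨p, rfl⟩ := h.exists_polyVec_eq x
  rw [← sub_eq_zero, ← polyVec_X_sub_C_mul, h.polyVec_eq_zero_iff] at hx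
  by_contra hα
  have hcop : IsCoprime (cpoly φ) (X - C α) := by
    rw [isCoprime_comm, (irreducible_X_sub_C α).coprime_iff_not_dvd, dvd_iff_isRoot]
    exact hα
  exact hx0 ((h.polyVec_eq_zero_iff p).2 (hcop.dvd_of_dvd_mul_left hx))

theorem herm_mulVec_right {α : ℂ} (hα : α ≠ 0) {x : Fin 22 → ℂ} (hx : cA φ *ᵥ x = α • x)
    (y : Fin 22 → ℂ) : herm G x (cA φ *ᵥ y) = (starRingEnd ℂ α)⁻¹ * herm G x y := by
  have h1 := h.isom x y
  rw [hx, herm_smul_left] at h1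
  have h2 : starRingEnd ℂ α ≠ 0 := by simpa using hα
  rw [← h1, RCLike.star_def, ← mul_assoc, inv_mul_cancel₀ h2, one_mul]

theorem herm_polyVec_right {α : ℂ} (hα : α ≠ 0) {x : Fin 22 → ℂ} (hx : cA φ *ᵥ x = α • x)
    (p : ℂ[X]) :
    herm G x (polyVec φ r p) = p.eval (starRingEnd ℂ α)⁻¹ * herm G x (polyVec φ r 1) := by
  induction p using Polynomial.induction_on with
  | C a => rw [← mul_one (C a), polyVec_C_mul, herm_smul_right]; simp
  | add p q hp hq => rw [polyVec_add, herm_add_right, hp, hq, eval_add]; ring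
  | monomial k a ih =>
    have : C a * X ^ (k + 1) = X * (C a * X ^ k) := by ring
    rw [this, polyVec_X_mul, h.herm_mulVec_right hα hx, ih, eval_mul (p := X), eval_X]; ring

theorem herm_eigVec_one {α : ℂ} (hα : (cpoly φ).IsRoot α) :
    herm G (eigVec φ r α) (polyVec φ r 1) = starRingEnd ℂ (c * (cpoly ψ).eval α / α) := by
  have h1 := h.herm_eigVec α hα
  have h2 := h.root_ne_zero hα
  have h3 : polyVec φ r 1 = fun i => (r i : ℂ) := by simp [polyVec]
  rw [herm_comm h.symm, h3, ← h1, mul_div_cancel_left₀ _ h2, RCLike.star_def]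

theorem herm_eigVec_polyVec {α : ℂ} (hα : (cpoly φ).IsRoot α) (p : ℂ[X]) :
    herm G (eigVec φ r α) (polyVec φ r p) =
      p.eval (starRingEnd ℂ α)⁻¹ * starRingEnd ℂ (c * (cpoly ψ).eval α / α) := by
  rw [h.herm_polyVec_right (h.root_ne_zero hα) (h.mulVec_eigVec hα), h.herm_eigVec_one hα]

/-- An eigenvector is not in the radical of the form. -/
theorem herm_eigVec_one_ne_zero (hc : c ≠ 0) {α : ℂ} (hα : (cpoly φ).IsRoot α) :
    herm G (eigVec φ r α) (polyVec φ r 1) ≠ 0 := by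
  rw [h.herm_eigVec_one hα, Ne, map_eq_zero, div_eq_zero_iff, not_or]
  refine ⟨mul_ne_zero (by exact_mod_cast hc) fun h0 => ?_, h.root_ne_zero hα⟩
  obtain ⟨u, v, huv⟩ := h.pair.coprime
  have := congrArg (eval α) huv
  rw [eval_add, eval_mul, eval_mul, h0, show (cpoly φ).eval α = 0 from hα] at this
  simp at this

theorem herm_eq_zero_of_eigen {α β : ℂ} (hα : α ≠ 0) (hαβ : starRingEnd ℂ α * β ≠ 1)
    {x y : Fin 22 → ℂ} (hx : cA φ *ᵥ x = α • x) (hy : cA φ *ᵥ y = β • y) : herm G x y = 0 := by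
  have h1 := h.herm_mulVec_right hα hx y
  rw [hy, herm_smul_right] at h1
  have h2 : starRingEnd ℂ α ≠ 0 := by simpa using hα
  have h3 : (starRingEnd ℂ α * β - 1) * herm G x y = 0 := by
    have : starRingEnd ℂ α * (β * herm G x y) = herm G x y := by
      rw [h1, ← mul_assoc, mul_inv_cancel₀ h2, one_mul]
    linear_combination this
  exact (mul_eq_zero.1 h3).resolve_left (sub_ne_zero.2 hαβ)

omit h in
theorem eval_divByMonic_self {α : ℂ} (hα : (cpoly φ).IsRoot α) :
    (cpoly φ /ₘ (X - C α)).eval α = (derivative (cpoly φ)).eval α := by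
  have h1 := mul_divByMonic_eq_iff_isRoot.2 hα
  have h2 := congrArg (fun p => (derivative p).eval α) h1
  simpa using h2

theorem herm_eigVec_self {α : ℂ} (hα : (cpoly φ).IsRoot α) (hn : ‖α‖ = 1) :
    herm G (eigVec φ r α) (eigVec φ r α) =
      (derivative (cpoly φ)).eval α * starRingEnd ℂ (c * (cpoly ψ).eval α / α) := by
  have h1 : (starRingEnd ℂ α)⁻¹ = α := by
    rw [inv_eq_iff_eq_inv, Complex.inv_def, Complex.normSq_eq_norm_sq, hn]; simp
  have := h.herm_eigVec_polyVec hα (cpoly φ /ₘ (X - C α))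
  rw [h1, eval_divByMonic_self hα] at this
  exact this

theorem adjoint_X_sub_C {α : ℂ} (hα : α ≠ 0) (p q : ℂ[X]) :
    herm G (polyVec φ r ((X - C (starRingEnd ℂ α)⁻¹) * p)) (polyVec φ r q) =
      -α⁻¹ * herm G (polyVec φ r (X * p)) (polyVec φ r ((X - C α) * q)) := by
  have h1 := h.isom (polyVec φ r p) (polyVec φ r q)
  rw [polyVec_X_sub_C_mul, polyVec_X_sub_C_mul, sub_eq_add_neg, sub_eq_add_neg, ← neg_smul,
    ← neg_smul, herm_add_left, herm_add_right, herm_smul_left, herm_smul_right, polyVec_X_mul, ← h1]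
  simp only [star_neg, RCLike.star_def, map_inv₀, Complex.conj_conj]
  field_simp
  ring

/-- If `(z - α) (z - β) (z - ᾱ⁻¹) (z - β̄⁻¹)` divides the characteristic polynomial, the kernel of
`(A - α) (A - β)` contains an isotropic plane. -/
theorem exists_isotropic_plane {α β : ℂ} (hα : α ≠ 0) (hβ : β ≠ 0)
    (hd : (X - C α) * (X - C β) * ((X - C (starRingEnd ℂ α)⁻¹) * (X - C (starRingEnd ℂ β)⁻¹)) ∣
      cpoly φ) :
    ∃ x y : Fin 22 → ℂ, LinearIndependent ℂ ![x, y] ∧ herm G x x = 0 ∧ herm G x y = 0 ∧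
      herm G y y = 0 ∧ aeval (cA φ) ((X - C α) * (X - C β)) *ᵥ x = 0 ∧
      aeval (cA φ) ((X - C α) * (X - C β)) *ᵥ y = 0 := by
  obtain ⟨q, hq⟩ := hd
  set k' := (X - C (starRingEnd ℂ α)⁻¹) * (X - C (starRingEnd ℂ β)⁻¹) with hk'
  have hq0 : q ≠ 0 := by rintro rfl; exact h.pair.f_monic.ne_zero (by rw [hq, mul_zero])
  have hk0 : k' ≠ 0 := mul_ne_zero (X_sub_C_ne_zero _) (X_sub_C_ne_zero _)
  have hker : ∀ s : ℂ[X], polyVec φ r ((X - C α) * (X - C β) * (s * (k' * q))) = 0 := by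
    intro s
    rw [h.polyVec_eq_zero_iff, hq]
    exact ⟨s, by ring⟩
  -- the adjoint of `k' (A)` is, up to a unit, `((z - α) (z - β)) (A)`, which vanishes on the plane
  have hiso : ∀ s t : ℂ[X], herm G (polyVec φ r (s * (k' * q))) (polyVec φ r (t * (k' * q))) = 0 := by
    intro s t
    have e1 : s * (k' * q) = (X - C (starRingEnd ℂ α)⁻¹) * ((X - C (starRingEnd ℂ β)⁻¹) * (s * q)) := by
      rw [hk']; ring
    rw [e1, h.adjoint_X_sub_C hα, mul_left_comm X, h.adjoint_X_sub_C hβ, ← mul_assoc (X - C β),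
      mul_comm (X - C β), hker, herm_zero_right, mul_zero, mul_zero]
  refine ⟨polyVec φ r (1 * (k' * q)), polyVec φ r (X * (k' * q)), ?_, hiso _ _, hiso _ _, hiso _ _,
    ?_, ?_⟩
  · rw [LinearIndependent.pair_iff]
    intro a b hab
    rw [← polyVec_C_mul, ← polyVec_C_mul, ← polyVec_add, h.polyVec_eq_zero_iff, hq] at hab
    have e2 : C a * (1 * (k' * q)) + C b * (X * (k' * q)) = (C a + C b * X) * (k' * q) := by ring
    rw [e2, mul_assoc, mul_dvd_mul_iff_right (mul_ne_zero hk0 hq0)] at hab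
    have h3 : C a + C b * X = 0 := by
      by_contra h0
      have h4 := natDegree_le_of_dvd hab h0
      rw [natDegree_mul (X_sub_C_ne_zero _) (X_sub_C_ne_zero _), natDegree_X_sub_C,
        natDegree_X_sub_C, add_comm (C a)] at h4
      have := natDegree_linear_le (a := b) (b := a)
      omega
    have h5 := congrArg (fun p => p.coeff 0) h3
    have h6 := congrArg (fun p => p.coeff 1) h3
    simp [coeff_C] at h5 h6
    exact ⟨h5, h6⟩
  · rw [← polyVec_mul]; exact hker 1
  · rw [← polyVec_mul]; exact hker X

end IsSpectral

/-! ### Trace polynomials -/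

theorem eval_cpoly (φ : ℤ[X]) (z : ℂ) : (cpoly φ).eval z = aeval z φ := by
  rw [cpoly, eval_map, aeval_def, algebraMap_int_eq]

theorem aeval_ofReal (f : ℤ[X]) (x : ℝ) : aeval (x : ℂ) f = ((aeval x f : ℝ) : ℂ) := by
  have := aeval_algebraMap_apply ℂ x f
  simpa using this

theorem aeval_conj (f : ℤ[X]) (z : ℂ) :
    aeval (starRingEnd ℂ z) f = starRingEnd ℂ (aeval z f) := by
  rw [← eval_cpoly, ← eval_cpoly]
  have := eval_map_apply (starRingEnd ℂ) (p := cpoly f) z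
  rwa [cpoly_map_conj] at this

/-- `Φ` and `Ψ` are the trace polynomials of `φ` and `ψ`. -/
structure IsTracePair (φ ψ Φ Ψ : ℤ[X]) : Prop where
  monic_left : Φ.Monic
  deg_left : Φ.natDegree = 10
  monic_right : Ψ.Monic
  deg_right : Ψ.natDegree = 11
  eq_left : ∀ z : ℂ, z ≠ 0 → aeval z φ = (z ^ 2 - 1) * z ^ 10 * aeval (z + z⁻¹) Φ
  eq_right : ∀ z : ℂ, z ≠ 0 → aeval z ψ = z ^ 11 * aeval (z + z⁻¹) Ψ

namespace IsTracePair
variable {φ ψ Φ Ψ : ℤ[X]} (t : IsTracePair φ ψ Φ Ψ)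
include t

theorem isRoot_iff {α : ℂ} (hα : α ≠ 0) :
    (cpoly φ).IsRoot α ↔ α ^ 2 = 1 ∨ aeval (α + α⁻¹) Φ = 0 := by
  rw [IsRoot, eval_cpoly, t.eq_left α hα, mul_eq_zero, mul_eq_zero, sub_eq_zero,
    or_iff_left (pow_ne_zero 10 hα)]

theorem isRoot_one : (cpoly φ).IsRoot 1 := (t.isRoot_iff one_ne_zero).2 (Or.inl (by norm_num))

theorem isRoot_neg_one : (cpoly φ).IsRoot (-1) :=
  (t.isRoot_iff (by norm_num)).2 (Or.inl (by norm_num))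

theorem hasDerivAt_left {α : ℂ} (hα : α ≠ 0) :
    (derivative (cpoly φ)).eval α = (2 * α * α ^ 10 + (α ^ 2 - 1) * (10 * α ^ 9)) *
      aeval (α + α⁻¹) Φ + (α ^ 2 - 1) * α ^ 10 *
        (aeval (α + α⁻¹) (derivative Φ) * (1 - (α ^ 2)⁻¹)) := by
  have h1 := (cpoly φ).hasDerivAt α
  have h2 : HasDerivAt (fun z : ℂ => (z ^ 2 - 1) * z ^ 10 * (cpoly Φ).eval (z + z⁻¹))
      ((2 * α * α ^ 10 + (α ^ 2 - 1) * (10 * α ^ 9)) * (cpoly Φ).eval (α + α⁻¹) +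
        (α ^ 2 - 1) * α ^ 10 * ((derivative (cpoly Φ)).eval (α + α⁻¹) * (1 + -(α ^ 2)⁻¹))) α := by
    have e1 : HasDerivAt (fun z : ℂ => z ^ 2 - 1) (2 * α) α := by
      simpa using (hasDerivAt_pow 2 α).sub_const 1
    have e2 : HasDerivAt (fun z : ℂ => z ^ 10) (10 * α ^ 9) α := by
      simpa using hasDerivAt_pow 10 α
    have e3 : HasDerivAt (fun z : ℂ => z + z⁻¹) (1 + -(α ^ 2)⁻¹) α :=
      (hasDerivAt_id α).add (hasDerivAt_inv hα)
    have e4 : HasDerivAt (fun z : ℂ => (cpoly Φ).eval (z + z⁻¹))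
        ((derivative (cpoly Φ)).eval (α + α⁻¹) * (1 + -(α ^ 2)⁻¹)) α :=
      HasDerivAt.comp α (h₂ := fun z => (cpoly Φ).eval z) ((cpoly Φ).hasDerivAt (α + α⁻¹)) e3
    exact (e1.mul e2).mul e4
  have h3 : (fun z : ℂ => (cpoly φ).eval z) =ᶠ[nhds α]
      fun z : ℂ => (z ^ 2 - 1) * z ^ 10 * (cpoly Φ).eval (z + z⁻¹) := by
    filter_upwards [isOpen_ne.mem_nhds hα] with z hz
    rw [eval_cpoly, eval_cpoly, t.eq_left z hz]
  have h4 := h1.unique (h2.congr_of_eventuallyEq h3)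
  rw [h4, eval_cpoly, derivative_map, ← eval_cpoly, ← eval_cpoly]
  ring

theorem derivative_eval {α : ℂ} (hα : α ≠ 0) (h0 : aeval (α + α⁻¹) Φ = 0) :
    (derivative (cpoly φ)).eval α = (α ^ 2 - 1) ^ 2 * α ^ 8 * aeval (α + α⁻¹) (derivative Φ) := by
  rw [t.hasDerivAt_left hα, h0]
  field_simp
  ring

theorem derivative_eval_one : (derivative (cpoly φ)).eval 1 = 2 * aeval (2 : ℂ) Φ := by
  rw [t.hasDerivAt_left one_ne_zero]
  norm_num

theorem derivative_eval_neg_one : (derivative (cpoly φ)).eval (-1) = -2 * aeval (-2 : ℂ) Φ := by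
  rw [t.hasDerivAt_left (by norm_num)]
  norm_num

theorem eval_right_one : (cpoly ψ).eval 1 = aeval (2 : ℂ) Ψ := by
  rw [eval_cpoly, t.eq_right 1 one_ne_zero]; norm_num

theorem eval_right_neg_one : (cpoly ψ).eval (-1) = -aeval (-2 : ℂ) Ψ := by
  rw [eval_cpoly, t.eq_right (-1) (by norm_num)]; norm_num

variable {r : Fin 22 → ℚ} {G : Matrix (Fin 22) (Fin 22) ℚ} {c : ℝ} (h : IsSpectral φ ψ r G c)
include h

/-- The Hermitian square of an eigenvector on the unit circle, in terms of the trace polynomials. -/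
theorem herm_eigVec_circle {α : ℂ} (hn : ‖α‖ = 1) {w : ℝ} (hw : α + α⁻¹ = w)
    (h0 : aeval w Φ = 0) :
    herm G (eigVec φ r α) (eigVec φ r α) =
      ((c * ((w ^ 2 - 4) * aeval w (derivative Φ) * aeval w Ψ) : ℝ) : ℂ) := by
  have hα : α ≠ 0 := by rintro rfl; simp at hn
  have h0' : aeval (α + α⁻¹) Φ = 0 := by rw [hw, aeval_ofReal, h0]; simp
  have hroot : (cpoly φ).IsRoot α := (t.isRoot_iff hα).2 (Or.inr h0')
  have hconj : starRingEnd ℂ α = α⁻¹ := by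
    rw [Complex.inv_def, Complex.normSq_eq_norm_sq, hn]; simp
  rw [h.herm_eigVec_self hroot hn, t.derivative_eval hα h0', eval_cpoly, t.eq_right α hα, hw,
    aeval_ofReal, aeval_ofReal]
  simp only [map_div₀, map_mul, map_pow, Complex.conj_ofReal, hconj]
  push_cast
  rw [← hw]
  field_simp
  ring

theorem herm_eigVec_one' : herm G (eigVec φ r 1) (eigVec φ r 1) =
    ((c * (2 * aeval (2 : ℝ) Φ * aeval (2 : ℝ) Ψ) : ℝ) : ℂ) := by
  have e : ∀ f : ℤ[X], aeval (2 : ℂ) f = ((aeval (2 : ℝ) f : ℝ) : ℂ) := fun f => by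
    rw [← aeval_ofReal]; norm_num
  rw [h.herm_eigVec_self t.isRoot_one (by simp), t.derivative_eval_one, t.eval_right_one, e, e]
  simp only [map_div₀, map_mul, Complex.conj_ofReal, map_one]
  push_cast; ring

theorem herm_eigVec_neg_one : herm G (eigVec φ r (-1)) (eigVec φ r (-1)) =
    ((c * (-2 * aeval (-2 : ℝ) Φ * aeval (-2 : ℝ) Ψ) : ℝ) : ℂ) := by
  have e : ∀ f : ℤ[X], aeval (-2 : ℂ) f = ((aeval (-2 : ℝ) f : ℝ) : ℂ) := fun f => by
    rw [← aeval_ofReal]; norm_num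
  rw [h.herm_eigVec_self t.isRoot_neg_one (by simp), t.derivative_eval_neg_one,
    t.eval_right_neg_one, e, e]
  simp only [map_div₀, map_mul, map_neg, Complex.conj_ofReal, map_one]
  push_cast; ring

end IsTracePair

/-! ### Complex numbers with a given trace -/

theorem exists_add_inv_eq (w : ℂ) : ∃ α : ℂ, α ≠ 0 ∧ α + α⁻¹ = w := by
  obtain ⟨s, hs⟩ := IsAlgClosed.exists_pow_nat_eq (w ^ 2 - 4) (n := 2) (by norm_num)
  have h1 : (w + s) / 2 * ((w - s) / 2) = 1 := by linear_combination (-1 / 4 : ℂ) * hs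
  have h0 : (w + s) / 2 ≠ 0 := by intro h; rw [h, zero_mul] at h1; norm_num at h1
  refine ⟨(w + s) / 2, h0, ?_⟩
  rw [inv_eq_of_mul_eq_one_right h1]; ring

theorem add_inv_eq_iff {α β : ℂ} (hα : α ≠ 0) (hβ : β ≠ 0) :
    α + α⁻¹ = β + β⁻¹ ↔ α = β ∨ α = β⁻¹ := by
  constructor
  · intro h
    have : (α - β) * (α - β⁻¹) = 0 := by
      have h2 : α * (α + α⁻¹) = α * (β + β⁻¹) := by rw [h]
      rw [mul_add, mul_inv_cancel₀ hα] at h2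
      have h3 := mul_inv_cancel₀ hβ
      linear_combination h2 + h3
    rcases mul_eq_zero.1 this with h | h
    · exact Or.inl (sub_eq_zero.1 h)
    · exact Or.inr (sub_eq_zero.1 h)
  · rintro (rfl | rfl)
    · rfl
    · rw [inv_inv, add_comm]

theorem conj_eq_inv_of_norm_eq_one {α : ℂ} (hn : ‖α‖ = 1) : starRingEnd ℂ α = α⁻¹ := by
  rw [Complex.inv_def, Complex.normSq_eq_norm_sq, hn]; simp

theorem add_inv_of_norm_eq_one {α : ℂ} (hn : ‖α‖ = 1) : α + α⁻¹ = ((2 * α.re : ℝ) : ℂ) := by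
  rw [← conj_eq_inv_of_norm_eq_one hn, Complex.add_conj]

/-- Every number in `[-2, 2]` is the trace of a number on the unit circle. -/
theorem exists_norm_eq_one_add_inv_eq {w : ℝ} (h1 : -2 ≤ w) (h2 : w ≤ 2) :
    ∃ α : ℂ, ‖α‖ = 1 ∧ α + α⁻¹ = w := by
  have h3 : (0 : ℝ) ≤ 1 - (w / 2) ^ 2 := by nlinarith
  refine ⟨⟨w / 2, Real.sqrt (1 - (w / 2) ^ 2)⟩, ?_, ?_⟩
  · rw [← sq_eq_sq₀ (norm_nonneg _) zero_le_one, ← Complex.normSq_eq_norm_sq, Complex.normSq_mk,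
      Real.mul_self_sqrt h3]
    ring
  · have hn : ‖(⟨w / 2, Real.sqrt (1 - (w / 2) ^ 2)⟩ : ℂ)‖ = 1 := by
      rw [← sq_eq_sq₀ (norm_nonneg _) zero_le_one, ← Complex.normSq_eq_norm_sq, Complex.normSq_mk,
        Real.mul_self_sqrt h3]
      ring
    rw [add_inv_of_norm_eq_one hn]
    push_cast
    ring

/-- A number with real trace is real or on the unit circle. -/
theorem im_eq_zero_or_norm_eq_one {α : ℂ} (hα : α ≠ 0) {w : ℝ} (hw : α + α⁻¹ = w) :
    α.im = 0 ∨ ‖α‖ = 1 := by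
  have h1 := congrArg (starRingEnd ℂ) hw
  rw [map_add, map_inv₀, Complex.conj_ofReal, ← hw] at h1
  have hc : starRingEnd ℂ α ≠ 0 := by simpa using hα
  rcases (add_inv_eq_iff hc hα).1 h1 with h2 | h2
  · exact Or.inl (Complex.conj_eq_iff_im.1 h2)
  · right
    have h3 : α * starRingEnd ℂ α = 1 := by rw [h2, mul_inv_cancel₀ hα]
    rw [Complex.mul_conj, Complex.normSq_eq_norm_sq] at h3
    have h4 : ‖α‖ ^ 2 = 1 := by exact_mod_cast h3
    exact (pow_eq_one_iff_of_nonneg (norm_nonneg α) two_ne_zero).1 h4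

/-! ### The lattice generated by the reflection vector -/

theorem aeval_map_int {S : Type*} [Field S] [CharZero S] {n : ℕ}
    (A : Matrix (Fin n) (Fin n) S) (p : ℤ[X]) :
    aeval A (p.map (Int.castRingHom S)) = aeval A p := by
  rw [aeval_def, aeval_def, eval₂_map]
  congr 1

/-- The vectors of the lattice are the `p (A) r` for integral polynomials `p`. -/
theorem mem_lattice_iff {φ : ℤ[X]} {r x : Fin 22 → ℚ} :
    x ∈ lattice 22 φ r ↔ ∃ p : ℤ[X], p.natDegree < 22 ∧ aeval (companion 22 φ) p *ᵥ r = x := by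
  constructor
  · intro hx
    obtain ⟨a, rfl⟩ := (Submodule.mem_span_range_iff_exists_fun ℤ).1 hx
    refine ⟨∑ i : Fin 22, C (a i) * X ^ (i : ℕ), ?_, ?_⟩
    · have h1 := degree_sum_fin_lt a
      rcases eq_or_ne (∑ i : Fin 22, C (a i) * X ^ (i : ℕ)) 0 with h0 | h0
      · rw [h0]; simp
      · rw [degree_eq_natDegree h0] at h1
        exact_mod_cast h1
    · rw [map_sum, Matrix.sum_mulVec]
      refine Finset.sum_congr rfl fun i _ => ?_
      rw [map_mul, aeval_C, map_pow, aeval_X, Algebra.algebraMap_eq_smul_one, smul_mul_assoc,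
        one_mul, Matrix.smul_mulVec]
  · rintro ⟨p, hp, rfl⟩
    rw [aeval_eq_sum_range' hp, Matrix.sum_mulVec]
    refine Submodule.sum_mem _ fun i hi => ?_
    rw [Matrix.smul_mulVec]
    exact Submodule.smul_mem _ _ (Submodule.subset_span ⟨⟨i, Finset.mem_range.1 hi⟩, rfl⟩)

section Lattice
variable {φ ψ : ℤ[X]} {r : Fin 22 → ℚ}
  (hφ : φ.Monic) (hφ_deg : φ.natDegree = 22)
  (hQ : IsHyperPair 21 (φ.map (Int.castRingHom ℚ)) (ψ.map (Int.castRingHom ℚ)))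
include hQ

theorem aeval_companion_self : aeval (companion 22 φ) φ = 0 := by
  rw [← aeval_map_int, companion_eq_cmat]
  exact hQ.aeval_self

include hφ hφ_deg

theorem aeval_companion_mem_lattice (p : ℤ[X]) :
    aeval (companion 22 φ) p *ᵥ r ∈ lattice 22 φ r := by
  rw [mem_lattice_iff]
  refine ⟨p %ₘ φ, ?_, ?_⟩
  · have := natDegree_modByMonic_lt p hφ (by rintro rfl; simp at hφ_deg)
    omega
  · have := congrArg (aeval (companion 22 φ)) (modByMonic_add_div p φ)
    rw [map_add, map_mul, aeval_companion_self hQ, zero_mul, add_zero] at this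
    rw [this]

theorem lattice_map_companion :
    (lattice 22 φ r).map ((companion 22 φ).mulVecLin.restrictScalars ℤ) = lattice 22 φ r := by
  apply le_antisymm
  · rintro _ ⟨x, hx, rfl⟩
    obtain ⟨p, -, rfl⟩ := mem_lattice_iff.1 hx
    have := aeval_companion_mem_lattice (r := r) hφ hφ_deg hQ (X * p)
    rw [map_mul, aeval_X, ← Matrix.mulVec_mulVec] at this
    exact this
  · intro x hx
    obtain ⟨p, -, rfl⟩ := mem_lattice_iff.1 hx
    refine ⟨_, aeval_companion_mem_lattice (r := r) hφ hφ_deg hQ (φ.divX * p), ?_⟩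
    have h1 : X * φ.divX = φ + 1 := by
      have h2 := divX_mul_X_add φ
      have h3 : φ.coeff 0 = -1 := by
        have := hQ.coeff_zero_f
        rw [coeff_map, eq_intCast] at this
        exact_mod_cast this
      rw [h3] at h2
      simp only [map_neg, map_one] at h2
      linear_combination h2
    change companion 22 φ *ᵥ (aeval (companion 22 φ) (φ.divX * p) *ᵥ r) = _
    have h4 : companion 22 φ * aeval (companion 22 φ) (φ.divX * p) =
        aeval (companion 22 φ) (X * φ.divX * p) := by
      rw [mul_assoc, map_mul _ X, aeval_X]
    rw [Matrix.mulVec_mulVec, h4, h1, map_mul, map_add, aeval_companion_self hQ, zero_add, map_one,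
      one_mul]

omit hφ hφ_deg in
theorem linearIndependent_pow_mulVec (hr : IsReflectionVector 22 φ ψ r) :
    LinearIndependent ℚ fun i : Fin 22 => (companion 22 φ ^ (i : ℕ)) *ᵥ r := by
  obtain ⟨κ, hκ, hrκ⟩ := hr.exists_smul hQ
  rw [Fintype.linearIndependent_iff]
  intro a ha i
  obtain ⟨p, hp, hpa⟩ := exists_coeffVec_eq (m := 21) a
  have hp' : p.natDegree < 22 := by
    rcases eq_or_ne p 0 with rfl | h0
    · simp
    · rw [degree_eq_natDegree h0] at hp
      exact_mod_cast hp
  have h1 : aeval (cmat (21 + 1) (φ.map (Int.castRingHom ℚ))) p *ᵥ r = 0 := by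
    rw [aeval_eq_sum_range' hp', Finset.sum_range, Matrix.sum_mulVec, ← ha]
    refine Finset.sum_congr rfl fun j _ => ?_
    rw [Matrix.smul_mulVec, companion_eq_cmat, ← hpa]
    rfl
  rw [hQ.aeval_mulVec_eq_zero_iff hκ hrκ] at h1
  have h2 : p = 0 := by
    by_contra h0
    have h3 := natDegree_le_of_dvd h1 h0
    rw [hQ.f_deg] at h3
    omega
  rw [← hpa, h2]
  simp [coeffVec]

omit hφ hφ_deg in
theorem finrank_lattice (hr : IsReflectionVector 22 φ ψ r) :
    Module.finrank ℤ (lattice 22 φ r) = 22 := by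
  have h1 := (linearIndependent_pow_mulVec hQ hr).restrict_scalars (R := ℤ)
    (by intro a b hab; simpa using hab)
  have := finrank_span_eq_card h1
  rw [Fintype.card_fin] at this
  exact this

omit hφ hφ_deg in
theorem span_lattice (hr : IsReflectionVector 22 φ ψ r) :
    Submodule.span ℚ (lattice 22 φ r : Set (Fin 22 → ℚ)) = ⊤ := by
  have h1 := (linearIndependent_pow_mulVec hQ hr).span_eq_top_of_card_eq_finrank (by simp)
  rw [eq_top_iff, ← h1]
  exact Submodule.span_mono (Submodule.subset_span)

omit hφ hφ_deg in
/-- The form is integral on the lattice. -/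
theorem exists_int_form_lattice (hφ : φ.Monic) (hr : IsReflectionVector 22 φ ψ r)
    {G : Matrix (Fin 22) (Fin 22) ℚ}
    (hG : IsNormalizedInvariantForm 22 φ ψ r G) {x y : Fin 22 → ℚ} (hx : x ∈ lattice 22 φ r)
    (hy : y ∈ lattice 22 φ r) : ∃ k : ℤ, x ⬝ᵥ (G *ᵥ y) = k := by
  obtain ⟨κ, hκ, hrκ⟩ := hr.exists_smul hQ
  obtain ⟨hs, hA, hB, hrr⟩ := hG
  rw [companion_eq_cmat] at hA hB
  have hdual := hQ.dual_of_invariant two_ne_zero hκ hrκ hA hB hrr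
  obtain ⟨p, -, rfl⟩ := mem_lattice_iff.1 hx
  obtain ⟨q, -, rfl⟩ := mem_lattice_iff.1 hy
  rw [← aeval_map_int, ← aeval_map_int, companion_eq_cmat]
  have h1 := hQ.dual_form_apply hκ hrκ hdual (p.map (Int.castRingHom ℚ)) (q.map (Int.castRingHom ℚ))
  have h2 : (p.map (Int.castRingHom ℚ)).comp (φ.map (Int.castRingHom ℚ)).divX *
      q.map (Int.castRingHom ℚ) * (φ.map (Int.castRingHom ℚ)).divX * ψ.map (Int.castRingHom ℚ) =
      (p.comp φ.divX * q * φ.divX * ψ).map (Int.castRingHom ℚ) := by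
    have h3 : (φ.map (Int.castRingHom ℚ)).divX = φ.divX.map (Int.castRingHom ℚ) := by
      ext k; simp [coeff_divX]
    simp only [h3, Polynomial.map_mul, Polynomial.map_comp]
  rw [h2, aeval_cmat_mulVec_single hQ.f_monic hQ.f_deg, ← map_modByMonic _ hφ] at h1
  refine ⟨((p.comp φ.divX * q * φ.divX * ψ) %ₘ φ).coeff 21, ?_⟩
  refine h1.trans ?_
  simp [coeffVec]

omit hφ hφ_deg in
theorem isEven_lattice (hφ : φ.Monic) (hr : IsReflectionVector 22 φ ψ r)
    {G : Matrix (Fin 22) (Fin 22) ℚ}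
    (hG : IsNormalizedInvariantForm 22 φ ψ r G) : IsEven G (lattice 22 φ r) := by
  have hinv := transpose_mul_mul_eq_iff.1 hG.2.1
  intro x hx
  have hpow : ∀ k : ℕ, (companion 22 φ ^ k *ᵥ r) ⬝ᵥ (G *ᵥ (companion 22 φ ^ k *ᵥ r)) = 2 := by
    intro k
    induction k with
    | zero => simpa using hG.2.2.2
    | succ k ih => rw [pow_succ', ← Matrix.mulVec_mulVec, hinv, ih]
  refine Submodule.span_induction (p := fun x _ => ∃ k : ℤ, x ⬝ᵥ (G *ᵥ x) = 2 * k)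
    ?_ ?_ ?_ ?_ hx
  · rintro _ ⟨i, rfl⟩
    exact ⟨1, by rw [hpow]; norm_num⟩
  · exact ⟨0, by simp⟩
  · rintro x y hx hy ⟨k, hk⟩ ⟨l, hl⟩
    obtain ⟨j, hj⟩ := exists_int_form_lattice hQ hφ hr hG hx hy
    refine ⟨k + l + j, ?_⟩
    rw [Matrix.mulVec_add, dotProduct_add, add_dotProduct, add_dotProduct, hk, hl, hj,
      dotProduct_mulVec_comm hG.1 y x, hj]
    push_cast; ring
  · rintro a x hx ⟨k, hk⟩
    refine ⟨a * a * k, ?_⟩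
    rw [Matrix.mulVec_smul, dotProduct_smul, smul_dotProduct, hk]
    simp only [zsmul_eq_mul]
    push_cast; ring

/-- On a unimodular lattice `ψ` takes a unit value at the eigenvalues `ε = ± 1` of `A`, since the
`ε`-eigenvector `(φ / (z - ε)) (A) r` is primitive and pairs with the lattice in `ψ (ε) ℤ`. -/
theorem isUnit_eval_of_unimodular (hr : IsReflectionVector 22 φ ψ r)
    {G : Matrix (Fin 22) (Fin 22) ℚ} (hS : IsSpectral φ ψ r G 1)
    (hU : IsUnimodular G (lattice 22 φ r)) {ε : ℤ} (hε : ε * ε = 1) (h0 : φ.eval ε = 0) :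
    IsUnit (ψ.eval ε) := by
  have hεC : ((ε : ℤ) : ℂ) * (ε : ℂ) = 1 := by exact_mod_cast hε
  have hε0 : (ε : ℂ) ≠ 0 := left_ne_zero_of_mul_eq_one hεC
  -- the primitive eigenvector `u = q (A) r`; it pairs with `p (A) r` to `± p (ε) ψ (ε)`
  set q := φ /ₘ (X - C ε) with hq
  have hfac : (X - C ε) * q = φ := mul_divByMonic_eq_iff_isRoot.2 h0
  have hqm : q.Monic := (monic_X_sub_C ε).of_mul_monic_left (by rw [hfac]; exact hφ)
  have hqd : q.natDegree = 21 := by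
    have := congrArg natDegree hfac
    rw [(monic_X_sub_C ε).natDegree_mul hqm, natDegree_X_sub_C, hφ_deg] at this
    omega
  have hcast : ∀ f : ℤ[X], (cpoly f).eval (ε : ℂ) = ((f.eval ε : ℤ) : ℂ) := by
    intro f
    rw [cpoly, eval_intCast_map]; simp
  have hroot : (cpoly φ).IsRoot (ε : ℂ) := by rw [IsRoot, hcast, h0]; simp
  have hψ0 : ψ.eval ε ≠ 0 := by
    intro h1
    have := hS.herm_eigVec_one_ne_zero one_ne_zero hroot
    rw [hS.herm_eigVec_one hroot, hcast, h1] at this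
    simp at this
  have hvec : ∀ p : ℤ[X], (fun i => (((aeval (companion 22 φ) p *ᵥ r) i : ℚ) : ℂ)) =
      polyVec φ r (cpoly p) := by
    intro p
    have h1 := aeval_map_mulVec (Rat.castHom ℂ) (companion 22 φ) (p.map (Int.castRingHom ℚ)) r
    rw [Polynomial.map_map, show (Rat.castHom ℂ).comp (Int.castRingHom ℚ) = Int.castRingHom ℂ from
      RingHom.ext_int _ _, aeval_map_int (companion 22 φ)] at h1
    exact h1.symm
  have hform : ∀ x y : Fin 22 → ℚ, ((x ⬝ᵥ (G *ᵥ y) : ℚ) : ℂ) =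
      herm G (fun i => (x i : ℂ)) (fun i => (y i : ℂ)) := by
    intro x y
    simp [herm, dotProduct, Matrix.mulVec, extendScalars]
  set u := aeval (companion 22 φ) q *ᵥ r with hu
  have huC : (fun i => ((u i : ℚ) : ℂ)) = eigVec φ r ε := by
    rw [hu, hvec, eigVec, hq, cpoly, map_divByMonic _ (monic_X_sub_C ε)]; simp
  have hpair : ∀ p : ℤ[X], ((u ⬝ᵥ (G *ᵥ (aeval (companion 22 φ) p *ᵥ r)) : ℚ) : ℂ) =
      ((p.eval ε * (ε * ψ.eval ε) : ℤ) : ℂ) := by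
    intro p
    rw [hform, huC, hvec, hS.herm_eigVec_polyVec hroot, hcast]
    have h1 : (starRingEnd ℂ (ε : ℂ))⁻¹ = ε := by
      rw [map_intCast]; exact inv_eq_of_mul_eq_one_right hεC
    have h2 : (ε : ℂ)⁻¹ = ε := inv_eq_of_mul_eq_one_right hεC
    rw [h1, hcast, div_eq_mul_inv, h2]
    simp only [map_mul, map_intCast, Complex.conj_ofReal]
    push_cast; ring
  -- so `u / ψ (ε)` is in the dual lattice, that is, in the lattice
  have hx : ((ψ.eval ε : ℤ) : ℚ)⁻¹ • u ∈ lattice 22 φ r := by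
    rw [hU]
    intro y hy
    obtain ⟨p, -, rfl⟩ := mem_lattice_iff.1 hy
    refine ⟨p.eval ε * ε, ?_⟩
    have h1 : u ⬝ᵥ (G *ᵥ (aeval (companion 22 φ) p *ᵥ r)) =
        ((p.eval ε * (ε * ψ.eval ε) : ℤ) : ℚ) := by
      have := hpair p
      exact_mod_cast this
    rw [smul_dotProduct, h1, smul_eq_mul]
    have h2 : ((ψ.eval ε : ℤ) : ℚ) ≠ 0 := by exact_mod_cast hψ0
    push_cast
    field_simp
  obtain ⟨s, hs, hsx⟩ := mem_lattice_iff.1 hx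
  have h3 : aeval (companion 22 φ) (C (ψ.eval ε) * s - q) *ᵥ r = 0 := by
    have h2 : ((ψ.eval ε : ℤ) : ℚ) ≠ 0 := by exact_mod_cast hψ0
    have h4 : aeval (companion 22 φ) (C (ψ.eval ε) * s) *ᵥ r = u := by
      rw [map_mul, aeval_C, Algebra.algebraMap_eq_smul_one, smul_mul_assoc, one_mul,
        Matrix.smul_mulVec, hsx, ← Int.cast_smul_eq_zsmul ℚ, smul_smul, mul_inv_cancel₀ h2, one_smul]
    rw [map_sub, Matrix.sub_mulVec, h4, hu, sub_self]
  obtain ⟨κ, hκ, hrκ⟩ := hr.exists_smul hQ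
  rw [← aeval_map_int, companion_eq_cmat] at h3
  have h4 := (hQ.aeval_mulVec_eq_zero_iff hκ hrκ _).1 h3
  -- compare the coefficients of `z ^ 21`, where that of `q` is `1`
  have h5 : C (ψ.eval ε) * s - q = 0 := by
    by_contra hne
    have h6 := natDegree_le_of_dvd h4 (by
      rwa [Ne, Polynomial.map_eq_zero_iff (Int.castRingHom ℚ).injective_int])
    have h7 : (C (ψ.eval ε) * s - q).natDegree ≤ 21 :=
      (natDegree_sub_le _ _).trans (max_le ((natDegree_C_mul_le _ _).trans (by omega)) hqd.le)
    rw [hQ.f_deg, natDegree_map_eq_of_injective (Int.castRingHom ℚ).injective_int] at h6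
    omega
  have h8 := congrArg (fun p => p.coeff 21) h5
  have h9 : q.coeff 21 = 1 := by rw [← hqd]; exact hqm
  simp only [coeff_sub, coeff_C_mul, h9, coeff_zero] at h8
  exact IsUnit.of_mul_eq_one (s.coeff 21) (by linear_combination h8)

/-- For a unimodular lattice, `Ψ (2) = Ψ (-2) = ± 1`: both values are units, and they agree
modulo `4`. -/
theorem eval_two_of_unimodular {Φ Ψ : ℤ[X]} (t : IsTracePair φ ψ Φ Ψ)
    (hr : IsReflectionVector 22 φ ψ r) {G : Matrix (Fin 22) (Fin 22) ℚ} (hS : IsSpectral φ ψ r G 1)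
    (hU : IsUnimodular G (lattice 22 φ r)) :
    IsUnit (Ψ.eval 2) ∧ Ψ.eval (-2) = Ψ.eval 2 := by
  have hcast : ∀ (f : ℤ[X]) (k : ℤ), aeval (k : ℂ) f = ((f.eval k : ℤ) : ℂ) := by
    intro f k
    rw [← eval_cpoly, cpoly, eval_intCast_map]; simp
  have hroot : ∀ k : ℤ, (cpoly φ).IsRoot (k : ℂ) → φ.eval k = 0 := by
    intro k hk
    rw [IsRoot, eval_cpoly, hcast] at hk
    exact_mod_cast hk
  have h1 := isUnit_eval_of_unimodular hφ hφ_deg hQ hr hS hU (ε := 1) (by norm_num)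
    (hroot 1 (by simpa using t.isRoot_one))
  have h2 := isUnit_eval_of_unimodular hφ hφ_deg hQ hr hS hU (ε := -1) (by norm_num)
    (hroot (-1) (by simpa using t.isRoot_neg_one))
  have h3 : ψ.eval 1 = Ψ.eval 2 := by
    have := t.eval_right_one
    rw [eval_cpoly, show (1 : ℂ) = ((1 : ℤ) : ℂ) by simp, show (2 : ℂ) = ((2 : ℤ) : ℂ) by simp,
      hcast, hcast] at this
    exact_mod_cast this
  have h4 : ψ.eval (-1) = -Ψ.eval (-2) := by
    have := t.eval_right_neg_one
    rw [eval_cpoly, show (-1 : ℂ) = ((-1 : ℤ) : ℂ) by simp, show (-2 : ℂ) = ((-2 : ℤ) : ℂ) by simp,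
      hcast, hcast] at this
    exact_mod_cast this
  rw [h3] at h1
  rw [h4, IsUnit.neg_iff] at h2
  refine ⟨h1, ?_⟩
  have h5 : (2 - (-2) : ℤ) ∣ Ψ.eval 2 - Ψ.eval (-2) := sub_dvd_eval_sub _ _ _
  rcases Int.isUnit_iff.1 h1 with h1 | h1 <;> rcases Int.isUnit_iff.1 h2 with h2 | h2 <;>
    rw [h1, h2] at h5 ⊢ <;> norm_num at h5

end Lattice

/-! ### Trace clusters: order, ranks, existence -/

/-- The number of elements of `M` that are larger than `x`. -/
noncomputable def above (M : Multiset ℝ) (x : ℝ) : ℕ := M.countP (x < ·)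

theorem above_add (M N : Multiset ℝ) (x : ℝ) : above (M + N) x = above M x + above N x :=
  Multiset.countP_add ..

theorem above_cons (a : ℝ) (M : Multiset ℝ) (x : ℝ) :
    above (a ::ₘ M) x = above M x + if x < a then 1 else 0 := Multiset.countP_cons ..

theorem above_sum {ι : Type*} (s : Finset ι) (f : ι → Multiset ℝ) (x : ℝ) :
    above (∑ i ∈ s, f i) x = ∑ i ∈ s, above (f i) x :=
  map_sum (Multiset.countPAddMonoidHom (x < ·)) f s

theorem above_eq_card {M : Multiset ℝ} {x : ℝ} (h : ∀ a ∈ M, x < a) : above M x = M.card :=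
  Multiset.countP_eq_card.2 h

theorem above_eq_zero {M : Multiset ℝ} {x : ℝ} : above M x = 0 ↔ ∀ a ∈ M, a ≤ x := by
  rw [above, Multiset.countP_eq_zero]
  simp

theorem above_lt_card {M : Multiset ℝ} {x : ℝ} (h : x ∈ M) : above M x < M.card := by
  obtain ⟨N, rfl⟩ := Multiset.exists_cons_of_mem h
  rw [above_cons, Multiset.card_cons, if_neg (lt_irrefl x)]
  have : above N x ≤ N.card := Multiset.countP_le_card ..
  omega

theorem above_lt_above {M : Multiset ℝ} {x y : ℝ} (hxy : x < y) (hy : y ∈ M) :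
    above M y < above M x := by
  obtain ⟨N, rfl⟩ := Multiset.exists_cons_of_mem hy
  rw [above_cons, above_cons, if_neg (lt_irrefl y), if_pos hxy]
  have : above N y ≤ above N x := by
    rw [above, above, Multiset.countP_eq_card_filter, Multiset.countP_eq_card_filter]
    exact Multiset.card_le_card (Multiset.monotone_filter_right N fun a h => hxy.trans h)
  omega

theorem eq_of_above_eq {M : Multiset ℝ} {x y : ℝ} (hx : x ∈ M) (hy : y ∈ M)
    (h : above M x = above M y) : x = y := by
  rcases lt_trichotomy x y with h1 | h1 | h1
  · have := above_lt_above h1 hy; omega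
  · exact h1
  · have := above_lt_above h1 hx; omega

theorem exists_max_cons {M : Multiset ℝ} (h : M ≠ 0) :
    ∃ a N, M = a ::ₘ N ∧ ∀ b ∈ N, b ≤ a := by
  have hne : M.toFinset.Nonempty := by
    obtain ⟨a, ha⟩ := Multiset.exists_mem_of_ne_zero h
    exact ⟨a, Multiset.mem_toFinset.2 ha⟩
  obtain ⟨a, ha, hmax⟩ := M.toFinset.exists_max_image id hne
  obtain ⟨N, hN⟩ := Multiset.exists_cons_of_mem (Multiset.mem_toFinset.1 ha)
  exact ⟨a, N, hN, fun b hb => hmax b (by rw [hN]; simp [hb])⟩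

/-- In a multiset without repetitions every rank is attained. -/
theorem exists_above_eq {M : Multiset ℝ} (hM : M.Nodup) {k : ℕ} (hk : k < M.card) :
    ∃ x ∈ M, above M x = k := by
  induction k generalizing M with
  | zero =>
    obtain ⟨a, N, rfl, hmax⟩ := exists_max_cons (M := M) (by rintro rfl; simp at hk)
    refine ⟨a, Multiset.mem_cons_self _ _, above_eq_zero.2 fun b hb => ?_⟩
    rcases Multiset.mem_cons.1 hb with rfl | hb
    · exact le_rfl
    · exact hmax b hb
  | succ k ih =>
    obtain ⟨a, N, rfl, hmax⟩ := exists_max_cons (M := M) (by rintro rfl; simp at hk)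
    rw [Multiset.nodup_cons] at hM
    obtain ⟨x, hx, hxk⟩ := ih hM.2 (by simpa using hk)
    refine ⟨x, Multiset.mem_cons_of_mem hx, ?_⟩
    rw [above_cons, if_pos, hxk]
    exact lt_of_le_of_ne (hmax x hx) (by rintro rfl; exact hM.1 hx)

theorem le_of_above_add_one_eq {M : Multiset ℝ} {x : ℝ} (hx : x ∈ M)
    (h : above M x + 1 = M.card) : ∀ a ∈ M, x ≤ a := by
  obtain ⟨N, rfl⟩ := Multiset.exists_cons_of_mem hx
  rw [above_cons, if_neg (lt_irrefl x), Multiset.card_cons, add_zero, add_left_inj, above,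
    Multiset.countP_eq_card] at h
  intro a ha
  rcases Multiset.mem_cons.1 ha with rfl | ha
  · exact le_rfl
  · exact (h a ha).le

theorem eq_of_card_three {M : Multiset ℝ} (hM : M.Nodup) (hc : M.card = 3) {x : ℝ} (hx : x ∈ M)
    (h : above M x = 1) : ∃ a b : ℝ, a < x ∧ x < b ∧ M = {a, x, b} := by
  obtain ⟨b, hb, hb0⟩ := exists_above_eq hM (k := 0) (by omega)
  obtain ⟨a, ha, ha2⟩ := exists_above_eq hM (k := 2) (by omega)
  have key : ∀ u ∈ M, ∀ v ∈ M, above M v < above M u → u < v := by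
    intro u hu v hv huv
    by_contra hle
    rcases (not_lt.1 hle).eq_or_lt with h1 | h1
    · rw [h1] at huv; omega
    · have := above_lt_above h1 hu; omega
  have hax := key a ha x hx (by omega)
  have hxb := key x hx b hb (by omega)
  refine ⟨a, b, hax, hxb, (Multiset.eq_of_le_of_card_le ?_ (by rw [hc]; simp)).symm⟩
  rw [Multiset.le_iff_subset]
  · intro z hz
    simp only [Multiset.insert_eq_cons, Multiset.mem_cons, Multiset.mem_singleton] at hz
    rcases hz with rfl | rfl | rfl <;> assumption
  · simp [hax.ne, hxb.ne, (hax.trans hxb).ne]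

theorem eq_pair_of_card_two {M : Multiset ℝ} (hM : M.Nodup) (hc : M.card = 2) :
    ∃ a b : ℝ, a < b ∧ M = {a, b} := by
  obtain ⟨a, b, rfl⟩ := Multiset.card_eq_two.1 hc
  have hab : a ≠ b := by simpa using hM
  rcases hab.lt_or_gt with h | h
  · exact ⟨a, b, h, rfl⟩
  · exact ⟨b, a, h, Multiset.pair_comm a b⟩

namespace TraceClusters
variable {Aon Bon : Multiset ℝ} (T : TraceClusters Aon Bon)
include T

theorem B_lt_A_of_le {i j : ℕ} (hi : 1 ≤ i) (hij : i ≤ j) (hj : j ≤ T.s) :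
    ∀ b ∈ T.B j, ∀ a ∈ T.A i, b < a := by
  induction j, hij using Nat.le_induction with
  | base => exact T.B_lt_A i (Finset.mem_Icc.2 ⟨hi, hj⟩)
  | succ j hij ih =>
    intro b hb a ha
    obtain ⟨a', ha'⟩ := Multiset.exists_mem_of_ne_zero
      (T.A_ne_zero (j + 1) (Finset.mem_Icc.2 ⟨by omega, hj⟩))
    obtain ⟨b', hb'⟩ := Multiset.exists_mem_of_ne_zero
      (T.B_ne_zero j (Finset.mem_Icc.2 ⟨by omega, by omega⟩))
    have h1 := T.B_lt_A (j + 1) (Finset.mem_Icc.2 ⟨by omega, hj⟩) b hb a' ha'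
    have h2 := T.A_lt_B j (Finset.mem_Icc.2 ⟨by omega, by omega⟩) a' ha' b' hb'
    exact h1.trans (h2.trans (ih (by omega) b' hb' a ha))

theorem A_lt_B_of_lt {i j : ℕ} (hi : 1 ≤ i) (hij : i < j) (hj : j ≤ T.s + 1) :
    ∀ a ∈ T.A j, ∀ b ∈ T.B i, a < b := by
  intro a ha b hb
  obtain ⟨k, rfl⟩ : ∃ k, j = k + 1 := ⟨j - 1, by omega⟩
  rcases (Nat.lt_succ_iff.1 hij).eq_or_lt with rfl | hik
  · exact T.A_lt_B i (Finset.mem_Icc.2 ⟨hi, by omega⟩) a ha b hb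
  · obtain ⟨b', hb'⟩ := Multiset.exists_mem_of_ne_zero
      (T.B_ne_zero k (Finset.mem_Icc.2 ⟨by omega, by omega⟩))
    obtain ⟨a', ha'⟩ := Multiset.exists_mem_of_ne_zero
      (T.A_ne_zero (i + 1) (Finset.mem_Icc.2 ⟨by omega, by omega⟩))
    have h1 := T.A_lt_B k (Finset.mem_Icc.2 ⟨by omega, by omega⟩) a ha b' hb'
    have h2 := T.B_lt_A_of_le (i := i + 1) (by omega) hik (by omega) b' hb' a' ha'
    exact h1.trans (h2.trans (T.A_lt_B i (Finset.mem_Icc.2 ⟨hi, by omega⟩) a' ha' b hb))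

theorem A_lt_A {i j : ℕ} (hi : 1 ≤ i) (hij : i < j) (hj : j ≤ T.s + 1) :
    ∀ a ∈ T.A j, ∀ a' ∈ T.A i, a < a' := by
  intro a ha a' ha'
  obtain ⟨b, hb⟩ := Multiset.exists_mem_of_ne_zero
    (T.B_ne_zero i (Finset.mem_Icc.2 ⟨hi, by omega⟩))
  exact (T.A_lt_B_of_lt hi hij hj a ha b hb).trans
    (T.B_lt_A i (Finset.mem_Icc.2 ⟨hi, by omega⟩) b hb a' ha')

theorem mem_Aon_iff {w : ℝ} : w ∈ Aon ↔ ∃ i, 1 ≤ i ∧ i ≤ T.s + 1 ∧ w ∈ T.A i := by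
  conv_lhs => rw [← T.sum_A]
  rw [Multiset.mem_sum]
  simp only [Finset.mem_Icc, and_assoc]

theorem above_Aon {i : ℕ} (hi : 1 ≤ i) (hi' : i ≤ T.s + 1) {w : ℝ} (hw : w ∈ T.A i) :
    above Aon w = ∑ j ∈ Finset.Ico 1 i, (T.A j).card + above (T.A i) w := by
  have h1 : above Aon w = ∑ j ∈ Finset.Icc 1 (T.s + 1), above (T.A j) w := by
    rw [← above_sum, T.sum_A]
  have h2 : Finset.Icc 1 (T.s + 1) = Finset.Ico 1 (T.s + 2) := rfl
  rw [h1, h2, ← Finset.sum_Ico_consecutive _ hi (by omega : i ≤ T.s + 2),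
    Finset.sum_eq_sum_Ico_succ_bot (by omega : i < T.s + 2)]
  congr 1
  · refine Finset.sum_congr rfl fun j hj => above_eq_card fun a ha => ?_
    rw [Finset.mem_Ico] at hj
    exact T.A_lt_A hj.1 hj.2 hi' w hw a ha
  · rw [Finset.sum_eq_zero, add_zero]
    intro j hj
    rw [Finset.mem_Ico] at hj
    exact above_eq_zero.2 fun a ha => (T.A_lt_A hi (by omega) (by omega) a ha w hw).le

theorem above_Bon {i : ℕ} (hi : 1 ≤ i) (hi' : i ≤ T.s + 1) {w : ℝ} (hw : w ∈ T.A i) :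
    above Bon w = ∑ j ∈ Finset.Ico 1 i, (T.B j).card := by
  have h1 : above Bon w = ∑ j ∈ Finset.Icc 1 T.s, above (T.B j) w := by
    rw [← above_sum, T.sum_B]
  have h2 : Finset.Icc 1 T.s = Finset.Ico 1 (T.s + 1) := rfl
  rw [h1, h2, ← Finset.sum_Ico_consecutive _ hi hi']
  rw [add_eq_left.2]
  · refine Finset.sum_congr rfl fun j hj => above_eq_card fun a ha => ?_
    rw [Finset.mem_Ico] at hj
    exact T.A_lt_B_of_lt hj.1 hj.2 hi' w hw a ha
  · refine Finset.sum_eq_zero fun j hj => above_eq_zero.2 fun a ha => ?_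
    rw [Finset.mem_Ico] at hj
    exact (T.B_lt_A_of_le hi hj.1 (by omega) a ha w hw).le

theorem nodup_A (hA : Aon.Nodup) {i : ℕ} (hi : i ∈ Finset.Icc 1 (T.s + 1)) : (T.A i).Nodup := by
  rw [← T.sum_A] at hA
  exact Multiset.nodup_of_le (Finset.single_le_sum (f := T.A) (fun _ _ => Multiset.zero_le _) hi) hA

theorem nodup_B (hB : Bon.Nodup) {i : ℕ} (hi : i ∈ Finset.Icc 1 T.s) : (T.B i).Nodup := by
  rw [← T.sum_B] at hB
  exact Multiset.nodup_of_le (Finset.single_le_sum (f := T.B) (fun _ _ => Multiset.zero_le _) hi) hB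

theorem card_Aon : Aon.card = ∑ i ∈ Finset.Icc 1 (T.s + 1), (T.A i).card := by
  rw [← Multiset.card_sum, T.sum_A]

theorem card_Bon : Bon.card = ∑ i ∈ Finset.Icc 1 T.s, (T.B i).card := by
  rw [← Multiset.card_sum, T.sum_B]

end TraceClusters

/-- Two multisets of reals without a common element dissect each other into trace clusters. The
clusters are built by adding the elements in increasing order. -/
theorem exists_traceClusters (n : ℕ) : ∀ Aon Bon : Multiset ℝ, (∀ a ∈ Aon, a ∉ Bon) →
    (Aon + Bon).card = n → Nonempty (TraceClusters Aon Bon) := by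
  induction n with
  | zero =>
    intro Aon Bon _ hn
    have h1 := Multiset.card_eq_zero.1 hn
    obtain ⟨rfl, rfl⟩ := add_eq_zero.1 h1
    exact ⟨⟨0, 0, 0, by simp, by simp, by simp, by simp, by simp, by simp⟩⟩
  | succ n ih =>
    intro Aon Bon hdis hn
    obtain ⟨M, R, hMR, hmax⟩ := exists_max_cons (M := Aon + Bon) (by intro h; simp [h] at hn)
    have hM : M ∈ Aon + Bon := by rw [hMR]; simp
    have hle : ∀ x ∈ Aon + Bon, x ≤ M := by
      intro x hx
      rw [hMR] at hx
      rcases Multiset.mem_cons.1 hx with rfl | hx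
      · exact le_rfl
      · exact hmax x hx
    rcases Multiset.mem_add.1 hM with hMA | hMB
    · obtain ⟨A', rfl⟩ := Multiset.exists_cons_of_mem hMA
      obtain ⟨T⟩ := ih A' Bon (fun a ha => hdis a (Multiset.mem_cons_of_mem ha))
        (by simpa using hn)
      have hBM : ∀ b ∈ Bon, b < M := fun b hb => lt_of_le_of_ne (hle b (by simp [hb]))
        (by rintro rfl; exact hdis b (by simp) hb)
      have hBi : ∀ i ∈ Finset.Icc 1 T.s, ∀ b ∈ T.B i, b < M := fun i hi b hb =>
        hBM b (by rw [← T.sum_B]; exact Multiset.mem_sum.2 ⟨i, hi, hb⟩)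
      refine ⟨⟨T.s, Function.update T.A 1 (M ::ₘ T.A 1), T.B, ?_, T.sum_B, ?_, ?_, ?_, T.B_ne_zero⟩⟩
      · have h1 : (1 : ℕ) ∈ Finset.Icc 1 (T.s + 1) := by simp
        refine Eq.trans ?_ (congrArg (M ::ₘ ·) T.sum_A)
        rw [← Finset.add_sum_erase _ _ h1, Function.update_self, Multiset.cons_add,
          ← Finset.add_sum_erase _ T.A h1]
        congr 2
        refine Finset.sum_congr rfl fun i hi => ?_
        rw [Function.update_of_ne (Finset.ne_of_mem_erase hi)]
      · intro i hi b hb a ha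
        by_cases h : i = 1
        · subst h
          rw [Function.update_self] at ha
          rcases Multiset.mem_cons.1 ha with rfl | ha
          · exact hBi 1 hi b hb
          · exact T.B_lt_A 1 hi b hb a ha
        · rw [Function.update_of_ne h] at ha
          exact T.B_lt_A i hi b hb a ha
      · intro i hi a ha b hb
        rw [Finset.mem_Icc] at hi
        rw [Function.update_of_ne (by omega)] at ha
        exact T.A_lt_B i (Finset.mem_Icc.2 hi) a ha b hb
      · intro i hi
        rw [Function.update_of_ne (by rw [Finset.mem_Icc] at hi; omega)]
        exact T.A_ne_zero i hi
    · obtain ⟨B', rfl⟩ := Multiset.exists_cons_of_mem hMB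
      obtain ⟨T⟩ := ih Aon B' (fun a ha h => hdis a ha (Multiset.mem_cons_of_mem h))
        (by simpa using hn)
      have hAM : ∀ a ∈ Aon, a < M := fun a ha => lt_of_le_of_ne (hle a (by simp [ha]))
        (by rintro rfl; exact hdis a ha (by simp))
      have hAi : ∀ i ∈ Finset.Icc 1 (T.s + 1), ∀ a ∈ T.A i, a < M := fun i hi a ha =>
        hAM a (by rw [← T.sum_A]; exact Multiset.mem_sum.2 ⟨i, hi, ha⟩)
      by_cases hc : T.A 1 = 0 ∧ 1 ≤ T.s
      · -- the new element joins the highest `B`-cluster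
        refine ⟨⟨T.s, T.A, Function.update T.B 1 (M ::ₘ T.B 1), T.sum_A, ?_, ?_, ?_, T.A_ne_zero, ?_⟩⟩
        · have h1 : (1 : ℕ) ∈ Finset.Icc 1 T.s := by simp [hc.2]
          refine Eq.trans ?_ (congrArg (M ::ₘ ·) T.sum_B)
          rw [← Finset.add_sum_erase _ _ h1, Function.update_self, Multiset.cons_add,
            ← Finset.add_sum_erase _ T.B h1]
          congr 2
          refine Finset.sum_congr rfl fun i hi => ?_
          rw [Function.update_of_ne (Finset.ne_of_mem_erase hi)]
        · intro i hi b hb a ha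
          by_cases h : i = 1
          · subst h; rw [hc.1] at ha; simp at ha
          · rw [Function.update_of_ne h] at hb
            exact T.B_lt_A i hi b hb a ha
        · intro i hi a ha b hb
          by_cases h : i = 1
          · subst h
            rw [Function.update_self] at hb
            rcases Multiset.mem_cons.1 hb with rfl | hb
            · exact hAi 2 (by simp; exact hc.2) a ha
            · exact T.A_lt_B 1 hi a ha b hb
          · rw [Function.update_of_ne h] at hb
            exact T.A_lt_B i hi a ha b hb
        · intro i hi
          by_cases h : i = 1
          · subst h; rw [Function.update_self]; exact Multiset.cons_ne_zero
          · rw [Function.update_of_ne h]; exact T.B_ne_zero i hi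
      · -- the new element forms a new `B`-cluster, with a null cluster above it
        refine ⟨⟨T.s + 1, fun i => if i ≤ 1 then 0 else T.A (i - 1),
          fun i => if i ≤ 1 then {M} else T.B (i - 1), ?_, ?_, ?_, ?_, ?_, ?_⟩⟩
        · refine Eq.trans ?_ T.sum_A
          change ∑ i ∈ Finset.Ico 1 (T.s + 1 + 1 + 1), _ = ∑ i ∈ Finset.Ico 1 (T.s + 1 + 1), _
          rw [Finset.sum_eq_sum_Ico_succ_bot (by omega), if_pos le_rfl, zero_add,
            ← Finset.sum_Ico_add' _ 1 (T.s + 1 + 1) 1]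
          refine Finset.sum_congr rfl fun i hi => ?_
          rw [Finset.mem_Ico] at hi
          rw [if_neg (by omega), Nat.add_sub_cancel]
        · refine Eq.trans ?_ (congrArg (M ::ₘ ·) T.sum_B)
          change ∑ i ∈ Finset.Ico 1 (T.s + 1 + 1), _ = M ::ₘ ∑ i ∈ Finset.Ico 1 (T.s + 1), _
          rw [Finset.sum_eq_sum_Ico_succ_bot (by omega), if_pos le_rfl, Multiset.singleton_add,
            ← Finset.sum_Ico_add' _ 1 (T.s + 1) 1]
          congr 1
          refine Finset.sum_congr rfl fun i hi => ?_
          rw [Finset.mem_Ico] at hi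
          rw [if_neg (by omega), Nat.add_sub_cancel]
        · intro i hi b hb a ha
          rw [Finset.mem_Icc] at hi
          split_ifs at ha hb with h
          · simp at ha
          · exact T.B_lt_A (i - 1) (Finset.mem_Icc.2 ⟨by omega, by omega⟩) b hb a ha
        · intro i hi a ha b hb
          rw [Finset.mem_Icc] at hi
          rw [if_neg (by omega), Nat.add_sub_cancel] at ha
          split_ifs at hb with h
          · rw [Multiset.mem_singleton] at hb
            subst hb
            exact hAi i (Finset.mem_Icc.2 ⟨by omega, by omega⟩) a ha
          · have h1 : i = (i - 1) + 1 := by omega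
            rw [h1] at ha
            exact T.A_lt_B (i - 1) (Finset.mem_Icc.2 ⟨by omega, by omega⟩) a ha b hb
        · intro i hi
          rw [Finset.mem_Icc] at hi
          rw [if_neg (by omega)]
          by_cases h2 : i = 2
          · subst h2
            intro h0
            exact hc ⟨h0, by omega⟩
          · exact T.A_ne_zero (i - 1) (Finset.mem_Icc.2 ⟨by omega, by omega⟩)
        · intro i hi
          rw [Finset.mem_Icc] at hi
          split_ifs with h
          · simp
          · exact T.B_ne_zero (i - 1) (Finset.mem_Icc.2 ⟨by omega, by omega⟩)

/-! ### The tables in terms of cluster sizes -/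

/-- "Doubles adjacent", at the indices `i` and `j`, for cluster sizes `a` and `b`. -/
def AdjSizes (s : ℕ) (a b : ℕ → ℕ) (i j : ℕ) : Prop :=
  (∀ k ∈ Finset.Icc 1 (s + 1), a k = 2 ↔ k = i) ∧ (∀ k ∈ Finset.Icc 1 s, b k = 2 ↔ k = j) ∧
    i ∈ Finset.Icc 1 (s + 1) ∧ j ∈ Finset.Icc 1 s ∧ (i = j ∨ i = j + 1)

instance (s : ℕ) (a b : ℕ → ℕ) (i j : ℕ) : Decidable (AdjSizes s a b i j) := by
  unfold AdjSizes; infer_instance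

/-- The two types of cluster sizes. -/
def HasTypes (s : ℕ) (a b : ℕ → ℕ) (α β : Multiset ℕ) : Prop :=
  (Finset.Icc 1 (s + 1)).val.map a = α ∧ (Finset.Icc 1 s).val.map b = β

instance (s : ℕ) (a b : ℕ → ℕ) (α β : Multiset ℕ) : Decidable (HasTypes s a b α β) := by
  unfold HasTypes; infer_instance

/-- "Doubles adjacent" for cluster sizes. -/
def DoublesAdjacentSizes (s : ℕ) (a b : ℕ → ℕ) : Prop :=
  ∃ i ∈ Finset.Icc 1 (s + 1), ∃ j ∈ Finset.Icc 1 s, AdjSizes s a b i j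

instance (s : ℕ) (a b : ℕ → ℕ) : Decidable (DoublesAdjacentSizes s a b) := by
  unfold DoublesAdjacentSizes; infer_instance

/-- The entries of the elliptic/parabolic table, as conditions on the cluster sizes. -/
def EPSizes (s : ℕ) (a b : ℕ → ℕ) (o : ℕ) : ℕ → Prop
  | 1 => s = 8 ∧ HasTypes s a b (sizes 1 7 0 1) (sizes 0 8 0 0) ∧ a 1 ≠ 0 ∧ o = 3
  | 2 => s = 8 ∧ HasTypes s a b (sizes 1 7 0 1) (sizes 0 7 0 1) ∧ a 1 ≠ 0 ∧ o = 1
  | 3 => s = 9 ∧ HasTypes s a b (sizes 2 7 0 1) (sizes 0 8 1 0) ∧ a 1 = 0 ∧ o = 1 ∧ b 1 = 2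
  | 4 => s = 8 ∧ HasTypes s a b (sizes 0 8 1 0) (sizes 0 8 0 0) ∧ a 1 ≠ 0 ∧ o = 3 ∧ a 9 = 2
  | 5 => s = 8 ∧ HasTypes s a b (sizes 0 8 1 0) (sizes 0 7 0 1) ∧ a 1 ≠ 0 ∧ o = 1 ∧ a 9 = 2
  | 6 => s = 9 ∧ HasTypes s a b (sizes 1 8 1 0) (sizes 0 8 1 0) ∧ a 1 ≠ 0 ∧ o = 1 ∧
      DoublesAdjacentSizes s a b
  | 7 => s = 9 ∧ HasTypes s a b (sizes 1 8 1 0) (sizes 0 8 1 0) ∧ a 1 = 0 ∧ o = 1 ∧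
      a 10 = 2 ∧ b 1 = 2
  | 8 => s = 10 ∧ HasTypes s a b (sizes 2 8 1 0) (sizes 0 10 0 0) ∧ a 1 = 0 ∧ o = 1 ∧ a 2 = 2
  | 9 => s = 9 ∧ HasTypes s a b (sizes 0 10 0 0) (sizes 0 8 1 0) ∧ a 1 ≠ 0 ∧ o = 1 ∧ b 9 = 2
  | _ => False

instance (s : ℕ) (a b : ℕ → ℕ) (o k : ℕ) : Decidable (EPSizes s a b o k) := by
  unfold EPSizes; split <;> infer_instance

/-- The entries of the hyperbolic table, as conditions on the cluster sizes. -/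
def HypSizes (s : ℕ) (a b : ℕ → ℕ) (o : ℕ) : ℕ → Prop
  | 1 => s = 8 ∧ HasTypes s a b (sizes 2 6 0 1) (sizes 0 8 0 0) ∧ o = 3
  | 2 => s = 8 ∧ HasTypes s a b (sizes 2 6 0 1) (sizes 0 7 0 1) ∧ o = 1
  | 3 => s = 8 ∧ HasTypes s a b (sizes 1 7 1 0) (sizes 0 8 0 0) ∧ o = 3 ∧ a 1 = 2
  | 4 => s = 8 ∧ HasTypes s a b (sizes 1 7 1 0) (sizes 0 8 0 0) ∧ o = 3 ∧ a 9 = 2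
  | 5 => s = 8 ∧ HasTypes s a b (sizes 1 7 1 0) (sizes 0 7 0 1) ∧ o = 1 ∧ a 1 = 2
  | 6 => s = 8 ∧ HasTypes s a b (sizes 1 7 1 0) (sizes 0 7 0 1) ∧ o = 1 ∧ a 9 = 2
  | 7 => s = 9 ∧ HasTypes s a b (sizes 2 7 1 0) (sizes 0 8 1 0) ∧ o = 1 ∧
      DoublesAdjacentSizes s a b
  | 8 => s = 9 ∧ HasTypes s a b (sizes 1 9 0 0) (sizes 0 8 1 0) ∧ o = 1 ∧ a 1 = 1 ∧ b 1 = 2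
  | 9 => s = 9 ∧ HasTypes s a b (sizes 1 9 0 0) (sizes 0 8 1 0) ∧ o = 1 ∧ a 10 = 1 ∧ b 9 = 2
  | _ => False

instance (s : ℕ) (a b : ℕ → ℕ) (o k : ℕ) : Decidable (HypSizes s a b o k) := by
  unfold HypSizes; split <;> infer_instance

/-! ### Enumeration of cluster sizes -/

/-- The ranks `ρ < a` at which the parity count `S + ρ` is odd, paired with the index `i`. -/
def odds (S i a : ℕ) : List (ℕ × ℕ) :=
  ((List.range a).filter fun ρ => (S + ρ) % 2 = 1).map fun ρ => (i, ρ)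

/-- The positions (cluster index, rank) of odd parity count, for the sizes `(aᵢ, bᵢ)` of the
clusters from the `i`-th on, the last `A`-cluster having `l` elements; `S` is the parity count of
all clusters before the `i`-th. -/
def oddPositions : ℕ → ℕ → List (ℕ × ℕ) → ℕ → List (ℕ × ℕ)
  | S, i, [], l => odds S i l
  | S, i, x :: W, l => odds S i x.1 ++ oddPositions (S + (x.1 + x.2)) (i + 1) W l

/-- The number of odd numbers among `S, S + 1, …, S + a - 1`. -/
def oddCount (S a : ℕ) : ℕ := (a + S % 2) / 2

/-- All sequences of cluster sizes with `m` elements in the `A`-clusters, at most `B` in the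
`B`-clusters, even final parity count and exactly `e` positions of odd parity count. Only the last
cluster, and the first one when `first` is set, may be null. The first argument bounds the number of
clusters. Branches with too many `A`-elements are cut off: among the elements of an `A`-cluster
with `a` elements at least `(a - 1) / 2` have odd parity count. -/
def sizeSequences : ℕ → Bool → ℕ → ℕ → ℕ → ℕ → List (List (ℕ × ℕ) × ℕ)
  | 0, _, _, _, _, _ => []
  | f + 1, first, m, B, S, e =>
    if B + 1 + 2 * e < m then [] else
    (if oddCount S m = e ∧ (S + m) % 2 = 0 then [([], m)] else []) ++
    (List.range (min m 3 + 1)).flatMap fun a =>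
      if (a = 0 ∧ first = false) ∨ e < oddCount S a then [] else
      (List.range B).flatMap fun b =>
        (sizeSequences f false (m - a) (B - (b + 1)) (S + (a + (b + 1))) (e - oddCount S a)).map
          fun x => ((a, b + 1) :: x.1, x.2)

/-- The function on the indices `1, 2, …` with the given list of values. -/
def ofList (l : List ℕ) (i : ℕ) : ℕ := l.getD (i - 1) 0

set_option maxRecDepth 100000 in
/-- Ten elements of `Φ` on the interval and an even number, at most `11`, of elements of `Ψ`: every
sequence of cluster sizes with one position of odd parity count is an entry of the table. -/
theorem exists_epSizes : ∀ x ∈ sizeSequences 12 true 10 11 0 1, ∃ k ∈ List.range 10,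
    EPSizes x.1.length (ofList (x.1.map Prod.fst ++ [x.2])) (ofList (x.1.map Prod.snd))
      (11 - (x.1.map Prod.snd).sum) k := by
  decide +kernel

set_option maxRecDepth 100000 in
/-- The same for nine elements of `Φ` on the interval and one above it, which is counted in the
initial parity count `1`. -/
theorem exists_hypSizes : ∀ x ∈ sizeSequences 12 true 9 11 1 1, ∃ k ∈ List.range 10,
    HypSizes x.1.length (ofList (x.1.map Prod.fst ++ [x.2])) (ofList (x.1.map Prod.snd))
      (11 - (x.1.map Prod.snd).sum) k := by
  decide +kernel
theorem mem_odds {S i a k ρ : ℕ} : (k, ρ) ∈ odds S i a ↔ k = i ∧ ρ < a ∧ (S + ρ) % 2 = 1 := by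
  simp only [odds, List.mem_map, List.mem_filter, List.mem_range, decide_eq_true_eq, Prod.mk.injEq]
  constructor
  · rintro ⟨x, ⟨h1, h2⟩, rfl, rfl⟩
    exact ⟨rfl, h1, h2⟩
  · rintro ⟨rfl, h1, h2⟩
    exact ⟨ρ, ⟨h1, h2⟩, rfl, rfl⟩

theorem length_odds (S i a : ℕ) : (odds S i a).length = oddCount S a := by
  simp only [odds, List.length_map, oddCount]
  induction a with
  | zero => simp
  | succ n ih =>
    rw [List.range_succ, List.filter_append, List.length_append, ih]
    by_cases h : (S + n) % 2 = 1
    · simp [h]; omega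
    · simp [h]; omega

theorem nodup_odds (S i a : ℕ) : (odds S i a).Nodup :=
  (List.Nodup.filter _ List.nodup_range).map fun _ _ h => (Prod.mk.inj h).2

theorem le_fst_of_mem_oddPositions {W : List (ℕ × ℕ)} {l : ℕ} : ∀ {S i : ℕ} {x : ℕ × ℕ},
    x ∈ oddPositions S i W l → i ≤ x.1 := by
  induction W with
  | nil =>
    rintro S i ⟨k, ρ⟩ h
    exact (mem_odds.1 h).1.ge
  | cons y W ih =>
    rintro S i ⟨k, ρ⟩ h
    rcases List.mem_append.1 h with h | h
    · exact (mem_odds.1 h).1.ge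
    · have := ih h
      dsimp at this ⊢
      omega

theorem nodup_oddPositions {W : List (ℕ × ℕ)} {l : ℕ} : ∀ S i : ℕ,
    (oddPositions S i W l).Nodup := by
  induction W with
  | nil => exact fun S i => nodup_odds S i l
  | cons y W ih =>
    intro S i
    refine List.Nodup.append (nodup_odds _ _ _) (ih _ _) ?_
    rintro ⟨k, ρ⟩ h1 h2
    have h3 := (mem_odds.1 h1).1
    have h4 := le_fst_of_mem_oddPositions h2
    dsimp at h4
    omega

/-- The cluster sizes `(aⱼ, bⱼ)` for `j = i, …, i + s - 1`. -/
def sizePairs (a b : ℕ → ℕ) (i s : ℕ) : List (ℕ × ℕ) :=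
  (List.range' i s).map fun j => (a j, b j)

theorem mem_oddPositions {a b : ℕ → ℕ} {s k ρ : ℕ} : ∀ {S i : ℕ},
    (k, ρ) ∈ oddPositions S i (sizePairs a b i s) (a (i + s)) ↔
      i ≤ k ∧ k ≤ i + s ∧ ρ < a k ∧ (S + ∑ t ∈ Finset.Ico i k, (a t + b t) + ρ) % 2 = 1 := by
  induction s with
  | zero =>
    intro S i
    simp only [sizePairs, List.range'_zero, List.map_nil, oddPositions, mem_odds, add_zero]
    constructor
    · rintro ⟨rfl, h⟩
      simpa using h
    · rintro ⟨h1, h2, h⟩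
      obtain rfl : k = i := by omega
      simpa using h
  | succ s ih =>
    intro S i
    have h1 : sizePairs a b i (s + 1) = (a i, b i) :: sizePairs a b (i + 1) s := by
      simp [sizePairs, List.range'_succ]
    rw [h1, oddPositions, List.mem_append, mem_odds, show i + (s + 1) = i + 1 + s by ring, ih]
    constructor
    · rintro (⟨rfl, h2, h3⟩ | ⟨h2, h3, h4, h5⟩)
      · simp [h2, h3]; omega
      · refine ⟨by omega, h3, h4, ?_⟩
        rw [Finset.sum_eq_sum_Ico_succ_bot (by omega)]
        dsimp only at h5
        omega
    · rintro ⟨h2, h3, h4, h5⟩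
      rcases h2.eq_or_lt with rfl | h2
      · left
        simpa [h4] using h5
      · right
        refine ⟨by omega, h3, h4, ?_⟩
        rw [Finset.sum_eq_sum_Ico_succ_bot (by omega)] at h5
        dsimp only
        omega

/-- The bound that justifies cutting off branches in `sizeSequences`. -/
theorem sum_fst_add_le {W : List (ℕ × ℕ)} {l : ℕ} (hb : ∀ x ∈ W, 1 ≤ x.2) : ∀ S i : ℕ,
    (W.map Prod.fst).sum + l ≤ (W.map Prod.snd).sum + 1 + 2 * (oddPositions S i W l).length := by
  induction W with
  | nil =>
    intro S i
    simp only [List.map_nil, List.sum_nil, oddPositions, length_odds, oddCount]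
    omega
  | cons y W ih =>
    intro S i
    have h1 := ih (fun x hx => hb x (List.mem_cons_of_mem _ hx)) (S + (y.1 + y.2)) (i + 1)
    have h2 := hb y List.mem_cons_self
    simp only [List.map_cons, List.sum_cons, oddPositions, List.length_append, length_odds]
    have h3 : y.1 ≤ 1 + 2 * oddCount S y.1 := by simp only [oddCount]; omega
    omega

/-- Completeness of the enumeration `sizeSequences`. -/
theorem mem_sizeSequences {l : ℕ} : ∀ {W : List (ℕ × ℕ)} {f : ℕ} {first : Bool} {m B S e i : ℕ},
    W.length < f → (W.map Prod.fst).sum + l = m → (W.map Prod.snd).sum ≤ B →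
    (∀ x ∈ W, 1 ≤ x.2) → (∀ x ∈ W.tail, 1 ≤ x.1) → (first = false → ∀ x ∈ W, 1 ≤ x.1) →
    (oddPositions S i W l).length = e → e ≤ 1 →
    (S + (W.map Prod.fst).sum + (W.map Prod.snd).sum + l) % 2 = 0 →
    (W, l) ∈ sizeSequences f first m B S e := by
  intro W
  induction W with
  | nil =>
    rintro (_ | f) first m B S e i hf hm hB hb ha ha' he he1 hp
    · simp at hf
    have h0 := sum_fst_add_le hb S i (l := l)
    rw [he] at h0
    rw [sizeSequences, if_neg (by omega)]
    simp only [oddPositions, length_odds] at he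
    simp only [List.map_nil, List.sum_nil, zero_add, add_zero] at hm hp
    subst hm
    simp [he, hp]
  | cons y W ih =>
    rintro (_ | f) first m B S e i hf hm hB hb ha ha' he he1 hp
    · simp at hf
    have h0 := sum_fst_add_le hb S i (l := l)
    rw [he] at h0
    rw [sizeSequences, if_neg (by omega)]
    obtain ⟨a, b⟩ := y
    simp only [oddPositions, length_odds, List.length_append] at he
    simp only [List.map_cons, List.sum_cons, List.length_cons] at *
    have hb1 := hb (a, b) List.mem_cons_self
    dsimp only at hb1
    obtain ⟨b, rfl⟩ : ∃ c, b = c + 1 := ⟨b - 1, by omega⟩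
    refine List.mem_append_right _ (List.mem_flatMap.2 ⟨a, ?_, ?_⟩)
    · simp only [oddCount] at he
      rw [List.mem_range]
      omega
    · rw [if_neg]
      · refine List.mem_flatMap.2 ⟨b, by rw [List.mem_range]; omega, ?_⟩
        refine List.mem_map.2 ⟨(W, l), ?_, rfl⟩
        refine ih (i := i + 1) (by omega) (by omega) (by omega)
          (fun x hx => hb x (List.mem_cons_of_mem _ hx)) (fun x hx => ha x (List.mem_of_mem_tail hx))
          (fun _ x hx => ha x hx) (by omega) (by omega) ?_
        rw [← hp]
        congr 1
        ring
      · rintro (⟨h1, h2⟩ | h1)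
        · have := ha' h2 (a, b + 1) List.mem_cons_self
          dsimp only at this
          omega
        · omega

theorem ofList_sizePairs_fst {a b : ℕ → ℕ} {s : ℕ} {i : ℕ} (hi : i ∈ Finset.Icc 1 (s + 1)) :
    ofList ((sizePairs a b 1 s).map Prod.fst ++ [a (1 + s)]) i = a i := by
  obtain ⟨h1, h2⟩ := Finset.mem_Icc.1 hi
  have : (sizePairs a b 1 s).map Prod.fst ++ [a (1 + s)] = (List.range' 1 (s + 1)).map a := by
    rw [List.range'_1_concat, List.map_append]
    simp [sizePairs, Function.comp_def]
  rw [this, ofList, List.getD_eq_getElem _ _ (by simp; omega)]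
  simp only [List.getElem_map, List.getElem_range']
  congr 1
  omega

theorem ofList_sizePairs_snd {a b : ℕ → ℕ} {s : ℕ} {i : ℕ} (hi : i ∈ Finset.Icc 1 s) :
    ofList ((sizePairs a b 1 s).map Prod.snd) i = b i := by
  obtain ⟨h1, h2⟩ := Finset.mem_Icc.1 hi
  have : (sizePairs a b 1 s).map Prod.snd = (List.range' 1 s).map b := by
    simp [sizePairs, Function.comp_def]
  rw [this, ofList, List.getD_eq_getElem _ _ (by simp; omega)]
  simp only [List.getElem_map, List.getElem_range']
  congr 1
  omega

theorem sum_sizePairs_fst (a b : ℕ → ℕ) (s : ℕ) :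
    ((sizePairs a b 1 s).map Prod.fst).sum + a (1 + s) = ∑ i ∈ Finset.Icc 1 (s + 1), a i := by
  have h : ((sizePairs a b 1 s).map Prod.fst).sum = ∑ i ∈ Finset.Icc 1 s, a i := by
    rw [sizePairs, List.map_map, ← Finset.sum_map_val]
    rfl
  rw [Finset.sum_Icc_succ_top (by omega), h, add_comm 1 s]

theorem sum_sizePairs_snd (a b : ℕ → ℕ) (s : ℕ) :
    ((sizePairs a b 1 s).map Prod.snd).sum = ∑ i ∈ Finset.Icc 1 s, b i := by
  rw [sizePairs, List.map_map, ← Finset.sum_map_val]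
  rfl

section Congr

variable {s : ℕ} {a b a' b' : ℕ → ℕ}

theorem AdjSizes.congr (ha : ∀ i ∈ Finset.Icc 1 (s + 1), a i = a' i)
    (hb : ∀ i ∈ Finset.Icc 1 s, b i = b' i) {i j : ℕ} (h : AdjSizes s a b i j) :
    AdjSizes s a' b' i j :=
  ⟨fun k hk => ha k hk ▸ h.1 k hk, fun k hk => hb k hk ▸ h.2.1 k hk, h.2.2⟩

theorem HasTypes.congr (ha : ∀ i ∈ Finset.Icc 1 (s + 1), a i = a' i)
    (hb : ∀ i ∈ Finset.Icc 1 s, b i = b' i) {α β : Multiset ℕ} (h : HasTypes s a b α β) :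
    HasTypes s a' b' α β :=
  ⟨(Multiset.map_congr rfl fun i hi => (ha i hi).symm).trans h.1,
    (Multiset.map_congr rfl fun i hi => (hb i hi).symm).trans h.2⟩

theorem DoublesAdjacentSizes.congr (ha : ∀ i ∈ Finset.Icc 1 (s + 1), a i = a' i)
    (hb : ∀ i ∈ Finset.Icc 1 s, b i = b' i) (h : DoublesAdjacentSizes s a b) :
    DoublesAdjacentSizes s a' b' := by
  obtain ⟨i, hi, j, hj, h⟩ := h
  exact ⟨i, hi, j, hj, h.congr ha hb⟩

theorem EPSizes.congr (ha : ∀ i ∈ Finset.Icc 1 (s + 1), a i = a' i)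
    (hb : ∀ i ∈ Finset.Icc 1 s, b i = b' i) {o k : ℕ} (h : EPSizes s a b o k) :
    EPSizes s a' b' o k := by
  rcases k with _ | _ | _ | _ | _ | _ | _ | _ | _ | _ | k
  on_goal 11 => exact h
  · exact h
  all_goals
    obtain ⟨rfl, ht, h⟩ := h
    refine ⟨rfl, ht.congr ha hb, ?_⟩
    try rw [← ha 1 (by decide)]
    try rw [← ha 2 (by decide)]
    try rw [← ha 9 (by decide)]
    try rw [← ha 10 (by decide)]
    try rw [← hb 1 (by decide)]
    try rw [← hb 9 (by decide)]
    first
    | exact h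
    | exact ⟨h.1, h.2.1, h.2.2.congr ha hb⟩

theorem HypSizes.congr (ha : ∀ i ∈ Finset.Icc 1 (s + 1), a i = a' i)
    (hb : ∀ i ∈ Finset.Icc 1 s, b i = b' i) {o k : ℕ} (h : HypSizes s a b o k) :
    HypSizes s a' b' o k := by
  rcases k with _ | _ | _ | _ | _ | _ | _ | _ | _ | _ | k
  on_goal 11 => exact h
  · exact h
  all_goals
    obtain ⟨rfl, ht, h⟩ := h
    refine ⟨rfl, ht.congr ha hb, ?_⟩
    try rw [← ha 1 (by decide)]
    try rw [← ha 9 (by decide)]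
    try rw [← ha 10 (by decide)]
    try rw [← hb 1 (by decide)]
    try rw [← hb 9 (by decide)]
    first
    | exact h
    | exact ⟨h.1, h.2.congr ha hb⟩

end Congr

/-- Sizes with a unique position of odd parity count form an entry of the tables. -/
theorem exists_sizes_of_oddPositions {s : ℕ} {a b : ℕ → ℕ} {m p : ℕ} (hp : p ≤ 1)
    (hm : ∑ i ∈ Finset.Icc 1 (s + 1), a i = m) (hm10 : m + p = 10)
    (hB : ∑ i ∈ Finset.Icc 1 s, b i ≤ 11) (hB2 : (∑ i ∈ Finset.Icc 1 s, b i) % 2 = 0)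
    (ha : ∀ i ∈ Finset.Icc 2 s, 1 ≤ a i) (hb : ∀ i ∈ Finset.Icc 1 s, 1 ≤ b i)
    (hodd : (oddPositions p 1 (sizePairs a b 1 s) (a (1 + s))).length = 1) :
    ∃ k, (p = 0 → EPSizes s a b (11 - ∑ i ∈ Finset.Icc 1 s, b i) k) ∧
      (p = 1 → HypSizes s a b (11 - ∑ i ∈ Finset.Icc 1 s, b i) k) := by
  have hs : s ≤ 11 := by
    have : ∑ i ∈ Finset.Icc 1 s, 1 ≤ ∑ i ∈ Finset.Icc 1 s, b i := Finset.sum_le_sum hb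
    simp at this
    omega
  have hmem : (sizePairs a b 1 s, a (1 + s)) ∈ sizeSequences 12 true m 11 p 1 := by
    refine mem_sizeSequences (i := 1) (by simp [sizePairs]; omega) ?_ ?_ ?_ ?_ (by simp) hodd le_rfl ?_
    · rw [sum_sizePairs_fst, hm]
    · rwa [sum_sizePairs_snd]
    · rintro x hx
      obtain ⟨j, hj, rfl⟩ := List.mem_map.1 hx
      rw [List.mem_range'_1] at hj
      exact hb j (Finset.mem_Icc.2 (by omega))
    · rintro x hx
      rcases s with _ | s
      · simp [sizePairs] at hx
      · rw [sizePairs, List.range'_succ, List.map_cons, List.tail_cons] at hx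
        obtain ⟨j, hj, rfl⟩ := List.mem_map.1 hx
        rw [List.mem_range'_1] at hj
        exact ha j (Finset.mem_Icc.2 (by omega))
    · have := sum_sizePairs_fst a b s
      rw [sum_sizePairs_snd]
      omega
  have hlen : (sizePairs a b 1 s).length = s := by simp [sizePairs]
  have key (i) (hi : i ∈ Finset.Icc 1 (s + 1)) := ofList_sizePairs_fst (a := a) (b := b) hi
  have key' (i) (hi : i ∈ Finset.Icc 1 s) := ofList_sizePairs_snd (a := a) (b := b) hi
  rcases (by omega : p = 0 ∨ p = 1) with rfl | rfl
  · obtain rfl : m = 10 := by omega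
    obtain ⟨k, -, hk⟩ := exists_epSizes _ hmem
    dsimp only at hk
    rw [hlen, sum_sizePairs_snd] at hk
    exact ⟨k, fun _ => hk.congr key key', by simp⟩
  · obtain rfl : m = 9 := by omega
    obtain ⟨k, -, hk⟩ := exists_hypSizes _ hmem
    dsimp only at hk
    rw [hlen, sum_sizePairs_snd] at hk
    exact ⟨k, by simp, fun _ => hk.congr key key'⟩

/-! ### Parity counts in the table entries -/

/-- All lists of `n` numbers, among which `z` zeros, `o` ones, `d` twos and `t` threes. -/
def arrangements : ℕ → ℕ → ℕ → ℕ → ℕ → List (List ℕ)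
  | 0, _, _, _, _ => [[]]
  | n + 1, z, o, d, t =>
    (if z = 0 then [] else (arrangements n (z - 1) o d t).map (List.cons 0)) ++
    (if o = 0 then [] else (arrangements n z (o - 1) d t).map (List.cons 1)) ++
    (if d = 0 then [] else (arrangements n z o (d - 1) t).map (List.cons 2)) ++
    (if t = 0 then [] else (arrangements n z o d (t - 1)).map (List.cons 3))

theorem mem_arrangements : ∀ {l : List ℕ} {z o d t : ℕ}, (l : Multiset ℕ) = sizes z o d t →
    l ∈ arrangements l.length z o d t := by
  have key : ∀ {l : List ℕ} {z o d t : ℕ}, (∀ x ∈ l, x ≤ 3) → l.count 0 = z → l.count 1 = o →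
      l.count 2 = d → l.count 3 = t → l ∈ arrangements l.length z o d t := by
    intro l
    induction l with
    | nil => intros; simp [arrangements]
    | cons x l ih =>
      intro z o d t hx h0 h1 h2 h3
      have hl : ∀ x ∈ l, x ≤ 3 := fun y hy => hx y (List.mem_cons_of_mem _ hy)
      have hx3 : x ≤ 3 := hx x List.mem_cons_self
      rw [List.length_cons, arrangements]
      simp only [List.count_cons] at h0 h1 h2 h3
      simp only [List.mem_append]
      interval_cases x
      · refine .inl (.inl (.inl ?_))
        simp at h0 h1 h2 h3
        rw [if_neg (by omega)]
        exact List.mem_map_of_mem (ih hl (by omega) h1 h2 h3)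
      · refine .inl (.inl (.inr ?_))
        simp at h0 h1 h2 h3
        rw [if_neg (by omega)]
        exact List.mem_map_of_mem (ih hl h0 (by omega) h2 h3)
      · refine .inl (.inr ?_)
        simp at h0 h1 h2 h3
        rw [if_neg (by omega)]
        exact List.mem_map_of_mem (ih hl h0 h1 (by omega) h3)
      · refine .inr ?_
        simp at h0 h1 h2 h3
        rw [if_neg (by omega)]
        exact List.mem_map_of_mem (ih hl h0 h1 h2 (by omega))
  intro l z o d t h
  refine key (fun x hx => ?_) ?_ ?_ ?_ ?_
  · have : x ∈ sizes z o d t := h ▸ Multiset.mem_coe.2 hx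
    simp only [sizes, Multiset.mem_add, Multiset.mem_replicate] at this
    omega
  all_goals
    rw [← Multiset.coe_count, h]
    simp [sizes, Multiset.count_replicate]

/-- The position (cluster index `i`, rank `ρ`) of the special trace in the entries of the
elliptic/parabolic table. -/
def EPPosition (s : ℕ) (a b : ℕ → ℕ) (i ρ : ℕ) : ℕ → Prop
  | 1 | 2 | 3 => a i = 3 ∧ ρ = 1 ∧ ∀ j ∈ Finset.Icc 1 (s + 1), a j = 3 ↔ j = i
  | 4 | 5 => i = 9 ∧ ρ = 1 ∧ a 9 = 2
  | 6 => ∃ j ∈ Finset.Icc 1 s, AdjSizes s a b i j ∧ (i = j ∧ ρ = 1 ∨ i = j + 1 ∧ ρ = 0)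
  | 7 => i = 10 ∧ ρ = 1 ∧ a 10 = 2
  | 8 => i = 2 ∧ ρ = 0
  | 9 => i = 10 ∧ a 10 = 1
  | _ => False

instance (s : ℕ) (a b : ℕ → ℕ) (i ρ k : ℕ) : Decidable (EPPosition s a b i ρ k) := by
  unfold EPPosition; split <;> infer_instance

/-- The position (cluster index `i`, rank `ρ`) of the special trace in the entries of the
hyperbolic table. -/
def HypPosition (s : ℕ) (a b : ℕ → ℕ) (i ρ : ℕ) : ℕ → Prop
  | 1 | 2 => a i = 3 ∧ ρ = 1 ∧ ∀ j ∈ Finset.Icc 1 (s + 1), a j = 3 ↔ j = i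
  | 3 | 5 => i = 1 ∧ ρ = 0
  | 4 | 6 => i = 9 ∧ ρ = 1 ∧ a 9 = 2
  | 7 => ∃ j ∈ Finset.Icc 1 s, AdjSizes s a b i j ∧ (i = j ∧ ρ = 1 ∨ i = j + 1 ∧ ρ = 0)
  | 8 => i = 1 ∧ a 1 = 1
  | 9 => i = 10 ∧ a 10 = 1
  | _ => False

instance (s : ℕ) (a b : ℕ → ℕ) (i ρ k : ℕ) : Decidable (HypPosition s a b i ρ k) := by
  unfold HypPosition; split <;> infer_instance

section Congr

variable {s : ℕ} {a b a' b' : ℕ → ℕ}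

theorem EPPosition.congr (ha : ∀ i ∈ Finset.Icc 1 (s + 1), a i = a' i)
    (hb : ∀ i ∈ Finset.Icc 1 s, b i = b' i) {i ρ k o : ℕ} (hi : i ∈ Finset.Icc 1 (s + 1))
    (hk : EPSizes s a b o k) (h : EPPosition s a b i ρ k) : EPPosition s a' b' i ρ k := by
  rcases k with _ | _ | _ | _ | _ | _ | _ | _ | _ | _ | k
  on_goal 11 => exact h
  · exact h
  on_goal 6 =>
    obtain ⟨j, hj, h, h'⟩ := h
    exact ⟨j, hj, h.congr ha hb, h'⟩
  on_goal 7 => exact h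
  on_goal 1 => exact ⟨ha i hi ▸ h.1, h.2.1, fun k hk => ha k hk ▸ h.2.2 k hk⟩
  on_goal 1 => exact ⟨ha i hi ▸ h.1, h.2.1, fun k hk => ha k hk ▸ h.2.2 k hk⟩
  on_goal 1 => exact ⟨ha i hi ▸ h.1, h.2.1, fun k hk => ha k hk ▸ h.2.2 k hk⟩
  all_goals
    obtain ⟨rfl, -⟩ := hk
    first
    | exact ⟨h.1, h.2.1, (ha 9 (by decide)).symm.trans h.2.2⟩
    | exact ⟨h.1, h.2.1, (ha 10 (by decide)).symm.trans h.2.2⟩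
    | exact ⟨h.1, (ha 10 (by decide)).symm.trans h.2⟩

theorem HypPosition.congr (ha : ∀ i ∈ Finset.Icc 1 (s + 1), a i = a' i)
    (hb : ∀ i ∈ Finset.Icc 1 s, b i = b' i) {i ρ k o : ℕ} (hi : i ∈ Finset.Icc 1 (s + 1))
    (hk : HypSizes s a b o k) (h : HypPosition s a b i ρ k) : HypPosition s a' b' i ρ k := by
  rcases k with _ | _ | _ | _ | _ | _ | _ | _ | _ | _ | k
  on_goal 11 => exact h
  · exact h
  on_goal 7 =>
    obtain ⟨j, hj, h, h'⟩ := h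
    exact ⟨j, hj, h.congr ha hb, h'⟩
  on_goal 3 => exact h
  on_goal 4 => exact h
  on_goal 1 => exact ⟨ha i hi ▸ h.1, h.2.1, fun k hk => ha k hk ▸ h.2.2 k hk⟩
  on_goal 1 => exact ⟨ha i hi ▸ h.1, h.2.1, fun k hk => ha k hk ▸ h.2.2 k hk⟩
  all_goals
    obtain ⟨rfl, -⟩ := hk
    first
    | exact ⟨h.1, h.2.1, (ha 9 (by decide)).symm.trans h.2.2⟩
    | exact ⟨h.1, (ha 1 (by decide)).symm.trans h.2⟩
    | exact ⟨h.1, (ha 10 (by decide)).symm.trans h.2⟩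

end Congr

/-- The positions of odd parity count, from the lists of sizes of the `A`- and `B`-clusters. -/
def oddPositionsOfLists (S : ℕ) (A B : List ℕ) : List (ℕ × ℕ) :=
  oddPositions S 1 (sizePairs (ofList A) (ofList B) 1 B.length) (ofList A (1 + B.length))

/-- The entry `k` of the elliptic/parabolic table has only one position of odd parity count, for all
sizes with the given symbols. -/
def UniqueOddEP (s z o d t o' d' t' k : ℕ) : Prop :=
  ∀ A ∈ arrangements (s + 1) z o d t, (∀ i ∈ Finset.Icc 2 s, ofList A i ≠ 0) →
    ∀ B ∈ arrangements s 0 o' d' t', EPSizes s (ofList A) (ofList B) (11 - (o' + 2 * d' + 3 * t')) k →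
      (o' + 2 * d' + 3 * t') % 2 = 0 ∧ ∃ x ∈ oddPositionsOfLists 0 A B,
        oddPositionsOfLists 0 A B = [x] ∧ EPPosition s (ofList A) (ofList B) x.1 x.2 k

instance (s z o d t o' d' t' k : ℕ) : Decidable (UniqueOddEP s z o d t o' d' t' k) := by
  unfold UniqueOddEP; infer_instance

/-- The entry `k` of the hyperbolic table has only one position of odd parity count, for all
sizes with the given symbols. -/
def UniqueOddHyp (s z o d t o' d' t' k : ℕ) : Prop :=
  ∀ A ∈ arrangements (s + 1) z o d t, (∀ i ∈ Finset.Icc 2 s, ofList A i ≠ 0) →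
    ∀ B ∈ arrangements s 0 o' d' t', HypSizes s (ofList A) (ofList B) (11 - (o' + 2 * d' + 3 * t')) k →
      (o' + 2 * d' + 3 * t') % 2 = 0 ∧ ∃ x ∈ oddPositionsOfLists 1 A B,
        oddPositionsOfLists 1 A B = [x] ∧ HypPosition s (ofList A) (ofList B) x.1 x.2 k

instance (s z o d t o' d' t' k : ℕ) : Decidable (UniqueOddHyp s z o d t o' d' t' k) := by
  unfold UniqueOddHyp; infer_instance

set_option maxRecDepth 100000 in
theorem uniqueOddEP : UniqueOddEP 8 1 7 0 1 8 0 0 1 ∧ UniqueOddEP 8 1 7 0 1 7 0 1 2 ∧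
    UniqueOddEP 9 2 7 0 1 8 1 0 3 ∧ UniqueOddEP 8 0 8 1 0 8 0 0 4 ∧ UniqueOddEP 8 0 8 1 0 7 0 1 5 ∧
    UniqueOddEP 9 1 8 1 0 8 1 0 6 ∧ UniqueOddEP 9 1 8 1 0 8 1 0 7 ∧ UniqueOddEP 10 2 8 1 0 10 0 0 8 ∧
    UniqueOddEP 9 0 10 0 0 8 1 0 9 := by
  decide +kernel

set_option maxRecDepth 100000 in
theorem uniqueOddHyp : UniqueOddHyp 8 2 6 0 1 8 0 0 1 ∧ UniqueOddHyp 8 2 6 0 1 7 0 1 2 ∧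
    UniqueOddHyp 8 1 7 1 0 8 0 0 3 ∧ UniqueOddHyp 8 1 7 1 0 8 0 0 4 ∧ UniqueOddHyp 8 1 7 1 0 7 0 1 5 ∧
    UniqueOddHyp 8 1 7 1 0 7 0 1 6 ∧ UniqueOddHyp 9 2 7 1 0 8 1 0 7 ∧ UniqueOddHyp 9 1 9 0 0 8 1 0 8 ∧
    UniqueOddHyp 9 1 9 0 0 8 1 0 9 := by
  decide +kernel

theorem exists_lists_of_hasTypes {s z o d t o' d' t' : ℕ} {a b : ℕ → ℕ}
    (ht : HasTypes s a b (sizes z o d t) (sizes 0 o' d' t')) :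
    ∃ A ∈ arrangements (s + 1) z o d t, ∃ B ∈ arrangements s 0 o' d' t', B.length = s ∧
      (∀ i ∈ Finset.Icc 1 (s + 1), a i = ofList A i) ∧ (∀ i ∈ Finset.Icc 1 s, b i = ofList B i) ∧
      ∑ i ∈ Finset.Icc 1 s, b i = o' + 2 * d' + 3 * t' := by
  have h1 : (((List.range' 1 (s + 1)).map a : List ℕ) : Multiset ℕ) = sizes z o d t := ht.1
  have h2 : (((List.range' 1 s).map b : List ℕ) : Multiset ℕ) = sizes 0 o' d' t' := ht.2
  have h3 := mem_arrangements h1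
  have h4 := mem_arrangements h2
  rw [List.length_map, List.length_range'] at h3 h4
  refine ⟨_, h3, _, h4, by simp, ?_, ?_, ?_⟩
  · intro i hi
    obtain ⟨h1, h2⟩ := Finset.mem_Icc.1 hi
    rw [ofList, List.getD_eq_getElem _ _ (by simp; omega)]
    simp only [List.getElem_map, List.getElem_range']
    congr 1
    omega
  · intro i hi
    obtain ⟨h1, h2⟩ := Finset.mem_Icc.1 hi
    rw [ofList, List.getD_eq_getElem _ _ (by simp; omega)]
    simp only [List.getElem_map, List.getElem_range']
    congr 1
    omega
  · rw [← Finset.sum_map_val, ht.2]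
    simp [sizes, mul_comm]

theorem oddPositionsOfLists_eq {s S : ℕ} {a b : ℕ → ℕ} {A B : List ℕ} (hB : B.length = s)
    (ha : ∀ i ∈ Finset.Icc 1 (s + 1), a i = ofList A i)
    (hb : ∀ i ∈ Finset.Icc 1 s, b i = ofList B i) :
    oddPositionsOfLists S A B = oddPositions S 1 (sizePairs a b 1 s) (a (1 + s)) := by
  rw [oddPositionsOfLists, hB, ha (1 + s) (Finset.mem_Icc.2 (by omega))]
  congr 1
  refine List.map_congr_left fun j hj => ?_
  rw [List.mem_range'_1] at hj
  rw [ha j (Finset.mem_Icc.2 (by omega)), hb j (Finset.mem_Icc.2 (by omega))]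

theorem UniqueOddEP.exists_position {s z o d t o' d' t' k : ℕ} {a b : ℕ → ℕ}
    (hc : UniqueOddEP s z o d t o' d' t' k)
    (ht : HasTypes s a b (sizes z o d t) (sizes 0 o' d' t'))
    (ha : ∀ i ∈ Finset.Icc 2 s, a i ≠ 0)
    {o : ℕ} (ho : o = 11 - (o' + 2 * d' + 3 * t')) (h : EPSizes s a b o k) :
    (∑ i ∈ Finset.Icc 1 s, b i) % 2 = 0 ∧ ∃ i ρ,
      oddPositions 0 1 (sizePairs a b 1 s) (a (1 + s)) = [(i, ρ)] ∧ EPPosition s a b i ρ k := by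
  obtain ⟨A, hA, B, hB, hlen, hA', hB', hsum⟩ := exists_lists_of_hasTypes ht
  subst ho
  have hmem {i} (hi : i ∈ Finset.Icc 2 s) : i ∈ Finset.Icc 1 (s + 1) := by
    rw [Finset.mem_Icc] at hi ⊢; omega
  have hEP := h.congr hA' hB'
  obtain ⟨h1, ⟨i, ρ⟩, -, h2, h3⟩ := hc A hA (fun i hi => hA' i (hmem hi) ▸ ha i hi) B hB hEP
  rw [oddPositionsOfLists_eq hlen hA' hB'] at h2
  refine ⟨hsum ▸ h1, i, ρ, h2, h3.congr (fun i hi => (hA' i hi).symm) (fun i hi => (hB' i hi).symm)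
    ?_ hEP⟩
  have := (mem_oddPositions (a := a) (b := b) (s := s) (k := i) (ρ := ρ)).1
    (h2 ▸ List.mem_singleton_self _)
  exact Finset.mem_Icc.2 (by omega)

theorem UniqueOddHyp.exists_position {s z o d t o' d' t' k : ℕ} {a b : ℕ → ℕ}
    (hc : UniqueOddHyp s z o d t o' d' t' k)
    (ht : HasTypes s a b (sizes z o d t) (sizes 0 o' d' t'))
    (ha : ∀ i ∈ Finset.Icc 2 s, a i ≠ 0)
    {o : ℕ} (ho : o = 11 - (o' + 2 * d' + 3 * t')) (h : HypSizes s a b o k) :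
    (∑ i ∈ Finset.Icc 1 s, b i) % 2 = 0 ∧ ∃ i ρ,
      oddPositions 1 1 (sizePairs a b 1 s) (a (1 + s)) = [(i, ρ)] ∧ HypPosition s a b i ρ k := by
  obtain ⟨A, hA, B, hB, hlen, hA', hB', hsum⟩ := exists_lists_of_hasTypes ht
  subst ho
  have hmem {i} (hi : i ∈ Finset.Icc 2 s) : i ∈ Finset.Icc 1 (s + 1) := by
    rw [Finset.mem_Icc] at hi ⊢; omega
  have hHyp := h.congr hA' hB'
  obtain ⟨h1, ⟨i, ρ⟩, -, h2, h3⟩ := hc A hA (fun i hi => hA' i (hmem hi) ▸ ha i hi) B hB hHyp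
  rw [oddPositionsOfLists_eq hlen hA' hB'] at h2
  refine ⟨hsum ▸ h1, i, ρ, h2, h3.congr (fun i hi => (hA' i hi).symm) (fun i hi => (hB' i hi).symm)
    ?_ hHyp⟩
  have := (mem_oddPositions (a := a) (b := b) (s := s) (k := i) (ρ := ρ)).1
    (h2 ▸ List.mem_singleton_self _)
  exact Finset.mem_Icc.2 (by omega)

theorem EPSizes.exists_position {s o k : ℕ} {a b : ℕ → ℕ} (h : EPSizes s a b o k)
    (ha : ∀ i ∈ Finset.Icc 2 s, a i ≠ 0) :
    (∑ i ∈ Finset.Icc 1 s, b i) % 2 = 0 ∧ ∃ i ρ,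
      oddPositions 0 1 (sizePairs a b 1 s) (a (1 + s)) = [(i, ρ)] ∧ EPPosition s a b i ρ k := by
  obtain ⟨h1, h2, h3, h4, h5, h6, h7, h8, h9⟩ := uniqueOddEP
  rcases k with _ | _ | _ | _ | _ | _ | _ | _ | _ | _ | k
  on_goal 11 => exact h.elim
  · exact h.elim
  · obtain rfl := h.1
    exact h1.exists_position h.2.1 ha (by rw [h.2.2.2]) h
  · obtain rfl := h.1
    exact h2.exists_position h.2.1 ha (by rw [h.2.2.2]) h
  · obtain rfl := h.1
    exact h3.exists_position h.2.1 ha (by rw [h.2.2.2.1]) h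
  · obtain rfl := h.1
    exact h4.exists_position h.2.1 ha (by rw [h.2.2.2.1]) h
  · obtain rfl := h.1
    exact h5.exists_position h.2.1 ha (by rw [h.2.2.2.1]) h
  · obtain rfl := h.1
    exact h6.exists_position h.2.1 ha (by rw [h.2.2.2.1]) h
  · obtain rfl := h.1
    exact h7.exists_position h.2.1 ha (by rw [h.2.2.2.1]) h
  · obtain rfl := h.1
    exact h8.exists_position h.2.1 ha (by rw [h.2.2.2.1]) h
  · obtain rfl := h.1
    exact h9.exists_position h.2.1 ha (by rw [h.2.2.2.1]) h

theorem HypSizes.exists_position {s o k : ℕ} {a b : ℕ → ℕ} (h : HypSizes s a b o k)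
    (ha : ∀ i ∈ Finset.Icc 2 s, a i ≠ 0) :
    (∑ i ∈ Finset.Icc 1 s, b i) % 2 = 0 ∧ ∃ i ρ,
      oddPositions 1 1 (sizePairs a b 1 s) (a (1 + s)) = [(i, ρ)] ∧ HypPosition s a b i ρ k := by
  obtain ⟨h1, h2, h3, h4, h5, h6, h7, h8, h9⟩ := uniqueOddHyp
  rcases k with _ | _ | _ | _ | _ | _ | _ | _ | _ | _ | k
  on_goal 11 => exact h.elim
  · exact h.elim
  · obtain rfl := h.1
    exact h1.exists_position h.2.1 ha (by rw [h.2.2]) h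
  · obtain rfl := h.1
    exact h2.exists_position h.2.1 ha (by rw [h.2.2]) h
  · obtain rfl := h.1
    exact h3.exists_position h.2.1 ha (by rw [h.2.2.1]) h
  · obtain rfl := h.1
    exact h4.exists_position h.2.1 ha (by rw [h.2.2.1]) h
  · obtain rfl := h.1
    exact h5.exists_position h.2.1 ha (by rw [h.2.2.1]) h
  · obtain rfl := h.1
    exact h6.exists_position h.2.1 ha (by rw [h.2.2.1]) h
  · obtain rfl := h.1
    exact h7.exists_position h.2.1 ha (by rw [h.2.2.1]) h
  · obtain rfl := h.1
    exact h8.exists_position h.2.1 ha (by rw [h.2.2.1]) h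
  · obtain rfl := h.1
    exact h9.exists_position h.2.1 ha (by rw [h.2.2.1]) h

/-! ### Trace clusters and parity -/

/-- The parity pattern: `τ` is the only element `w` of `Aon` for which `p` plus the number of
elements of `Aon` and `Bon` above `w` is odd, and `Bon` has an even number of elements. -/
structure IsParity (p : ℕ) (Aon Bon : Multiset ℝ) (τ : ℝ) : Prop where
  mem : τ ∈ Aon
  odd_iff : ∀ w ∈ Aon, (p + above Aon w + above Bon w) % 2 = 1 ↔ w = τ
  even : Bon.card % 2 = 0

theorem IsParity.unique {p : ℕ} {Aon Bon : Multiset ℝ} {τ τ' : ℝ} (h : IsParity p Aon Bon τ)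
    (h' : IsParity p Aon Bon τ') : τ = τ' :=
  (h'.odd_iff τ h.mem).1 ((h.odd_iff τ h.mem).2 rfl)

namespace TraceClusters

variable {Aon Bon : Multiset ℝ} (T : TraceClusters Aon Bon)

/-- The sizes of the `A`-clusters. -/
def sizeA (i : ℕ) : ℕ := (T.A i).card

/-- The sizes of the `B`-clusters. -/
def sizeB (i : ℕ) : ℕ := (T.B i).card

theorem doublesAdjacentSizes_iff :
    DoublesAdjacentSizes T.s T.sizeA T.sizeB ↔ T.DoublesAdjacent :=
  ⟨fun ⟨i, _, j, _, h⟩ => ⟨i, j, h⟩, fun ⟨i, j, h⟩ => ⟨i, h.2.2.1, j, h.2.2.2.1, h⟩⟩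

theorem sizeA_ne_zero {i : ℕ} : T.sizeA i ≠ 0 ↔ T.A i ≠ 0 := Multiset.card_eq_zero.not

theorem epSizes_iff {o k : ℕ} : EPSizes T.s T.sizeA T.sizeB o k ↔ T.EPEntry o k := by
  have h0 : T.sizeA 1 = 0 ↔ T.A 1 = 0 := Multiset.card_eq_zero
  rcases k with _ | _ | _ | _ | _ | _ | _ | _ | _ | _ | k
  all_goals
    simp only [EPSizes, EPEntry, HasTypes, T.doublesAdjacentSizes_iff, h0, and_assoc, ne_eq]
    try rfl

theorem hypSizes_iff {o k : ℕ} : HypSizes T.s T.sizeA T.sizeB o k ↔ T.HypEntry 1 o k := by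
  rcases k with _ | _ | _ | _ | _ | _ | _ | _ | _ | _ | k
  all_goals
    simp only [HypSizes, HypEntry, HasTypes, T.doublesAdjacentSizes_iff, and_assoc, true_and]
    try rfl

theorem HypEntry.aGt_eq {T : TraceClusters Aon Bon} {x o k : ℕ} (h : T.HypEntry x o k) :
    x = 1 := by
  rcases k with _ | _ | _ | _ | _ | _ | _ | _ | _ | _ | k
  on_goal 11 => exact h.elim
  · exact h.elim
  all_goals exact h.2.2.2.1

theorem mem_oddPositions_iff (hA : Aon.Nodup) {p k ρ : ℕ} :
    (k, ρ) ∈ oddPositions p 1 (sizePairs T.sizeA T.sizeB 1 T.s) (T.sizeA (1 + T.s)) ↔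
      1 ≤ k ∧ k ≤ T.s + 1 ∧ ∃ w ∈ T.A k, above (T.A k) w = ρ ∧
        (p + above Aon w + above Bon w) % 2 = 1 := by
  rw [HyperK3.mem_oddPositions, Finset.sum_add_distrib]
  constructor
  · rintro ⟨h1, h2, h3, h4⟩
    have h2' : k ≤ T.s + 1 := by omega
    obtain ⟨w, hw, hw'⟩ := exists_above_eq (T.nodup_A hA (Finset.mem_Icc.2 ⟨h1, h2'⟩)) h3
    refine ⟨h1, h2', w, hw, hw', ?_⟩
    rw [T.above_Aon h1 h2' hw, T.above_Bon h1 h2' hw, hw']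
    simp only [sizeA, sizeB] at h4
    omega
  · rintro ⟨h1, h2, w, hw, hw', h4⟩
    rw [T.above_Aon h1 h2 hw, T.above_Bon h1 h2 hw, hw'] at h4
    refine ⟨h1, by omega, hw' ▸ above_lt_card hw, ?_⟩
    simp only [sizeA, sizeB]
    omega

/-- The parity pattern forces an entry of the tables. -/
theorem exists_entry_of_isParity (hA : Aon.Nodup) {p : ℕ} {τ : ℝ} (h : IsParity p Aon Bon τ)
    (hp : p ≤ 1) (hcA : Aon.card + p = 10) (hcB : Bon.card ≤ 11) :
    ∃ k, (p = 0 → T.EPEntry (11 - Bon.card) k) ∧ (p = 1 → T.HypEntry 1 (11 - Bon.card) k) := by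
  have hodd : (oddPositions p 1 (sizePairs T.sizeA T.sizeB 1 T.s) (T.sizeA (1 + T.s))).length
      = 1 := by
    have hnd := nodup_oddPositions (W := sizePairs T.sizeA T.sizeB 1 T.s) (l := T.sizeA (1 + T.s))
      p 1
    obtain ⟨i, hi, hi', hτ⟩ := T.mem_Aon_iff.1 h.mem
    have : ∀ x, x ∈ oddPositions p 1 (sizePairs T.sizeA T.sizeB 1 T.s) (T.sizeA (1 + T.s)) ↔
        x ∈ [(i, above (T.A i) τ)] := by
      rintro ⟨k, ρ⟩
      rw [T.mem_oddPositions_iff hA, List.mem_singleton, Prod.mk.injEq]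
      constructor
      · rintro ⟨h1, h2, w, hw, hw', h3⟩
        obtain rfl := (h.odd_iff w (T.mem_Aon_iff.2 ⟨k, h1, h2, hw⟩)).1 h3
        have : k = i := by
          rcases lt_trichotomy k i with h4 | h4 | h4
          · exact absurd (T.A_lt_A h1 h4 hi' w hτ w hw) (lt_irrefl _)
          · exact h4
          · exact absurd (T.A_lt_A hi h4 h2 w hw w hτ) (lt_irrefl _)
        subst this
        exact ⟨rfl, hw'.symm⟩
      · rintro ⟨rfl, rfl⟩
        exact ⟨hi, hi', τ, hτ, rfl, (h.odd_iff τ h.mem).2 rfl⟩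
    rw [((List.perm_ext_iff_of_nodup hnd (List.nodup_singleton _)).2 this).length_eq]
    rfl
  have hcA' : ∑ i ∈ Finset.Icc 1 (T.s + 1), T.sizeA i = Aon.card := T.card_Aon.symm
  have hcB' : ∑ i ∈ Finset.Icc 1 T.s, T.sizeB i = Bon.card := T.card_Bon.symm
  obtain ⟨k, h0, h1⟩ := exists_sizes_of_oddPositions hp hcA' hcA (hcB'.le.trans hcB)
    (hcB' ▸ h.even)
    (fun i hi => Multiset.card_pos.2 (T.A_ne_zero i hi))
    (fun i hi => Multiset.card_pos.2 (T.B_ne_zero i hi)) hodd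
  rw [hcB'] at h0 h1
  exact ⟨k, fun h => T.epSizes_iff.1 (h0 h), fun h => T.hypSizes_iff.1 (h1 h)⟩

theorem isParity_of_oddPositions (hA : Aon.Nodup) {p i ρ : ℕ} (hB : Bon.card % 2 = 0)
    (h : oddPositions p 1 (sizePairs T.sizeA T.sizeB 1 T.s) (T.sizeA (1 + T.s)) = [(i, ρ)]) :
    ∃ τ, IsParity p Aon Bon τ ∧ i ∈ Finset.Icc 1 (T.s + 1) ∧ τ ∈ T.A i ∧ above (T.A i) τ = ρ := by
  obtain ⟨h1, h2, τ, hτ, hτ', h3⟩ := (T.mem_oddPositions_iff hA).1 (h ▸ List.mem_singleton_self _)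
  refine ⟨τ, ⟨T.mem_Aon_iff.2 ⟨i, h1, h2, hτ⟩, fun w hw => ⟨fun h4 => ?_, ?_⟩, hB⟩,
    Finset.mem_Icc.2 ⟨h1, h2⟩, hτ, hτ'⟩
  · obtain ⟨k, hk, hk', hwk⟩ := T.mem_Aon_iff.1 hw
    have := (T.mem_oddPositions_iff hA).2 ⟨hk, hk', w, hwk, rfl, h4⟩
    rw [h, List.mem_singleton, Prod.mk.injEq] at this
    obtain ⟨rfl, h5⟩ := this
    exact eq_of_above_eq hwk hτ (h5.trans hτ'.symm)
  · rintro rfl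
    exact h3

theorem eq_singleton_of_sizeA {i : ℕ} (h : T.sizeA i = 1) {τ : ℝ} (hτ : τ ∈ T.A i) :
    T.A i = {τ} := by
  obtain ⟨x, hx⟩ := Multiset.card_eq_one.1 h
  rw [hx, Multiset.mem_singleton] at hτ
  rw [hx, hτ]

theorem isInnerOfAdjacentPair (hA : Aon.Nodup) (hB : Bon.Nodup) {i j ρ : ℕ} {τ : ℝ}
    (hij : T.IsAdjacentPair i j) (hρ : i = j ∧ ρ = 1 ∨ i = j + 1 ∧ ρ = 0) (hτ : τ ∈ T.A i)
    (hτ' : above (T.A i) τ = ρ) : T.IsInnerOfAdjacentPair τ := by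
  have hij' := hij
  obtain ⟨h1, h2, h3, h4, -⟩ := hij'
  have hi := (h1 i h3).2 rfl
  have hj := (h2 j h4).2 rfl
  obtain ⟨x, y, hxy, hx⟩ := eq_pair_of_card_two (T.nodup_A hA h3) hi
  obtain ⟨u, v, huv, hu⟩ := eq_pair_of_card_two (T.nodup_B hB h4) hj
  have hj' := Finset.mem_Icc.1 h4
  refine ⟨i, j, hij, hτ, ?_⟩
  have hτxy : τ = x ∨ τ = y := by simpa [hx] using hτ
  have hab : above (T.A i) x = 1 ∧ above (T.A i) y = 0 := by
    rw [hx]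
    change above (x ::ₘ y ::ₘ 0) x = 1 ∧ above (x ::ₘ y ::ₘ 0) y = 0
    simp only [above_cons]
    simp [hxy, hxy.le, above]
  rcases hρ with ⟨rfl, rfl⟩ | ⟨rfl, rfl⟩
  · have h5 : v < x := T.B_lt_A i h4 v (by simp [hu]) x (by simp [hx])
    have : τ = x := by
      rcases hτxy with h | h
      · exact h
      · rw [h, hab.2] at hτ'
        omega
    refine ⟨u, v, x, y, huv, h5, hxy, ?_, .inr this⟩
    rw [hx, hu, add_comm]
    rfl
  · have h5 : y < u := T.A_lt_B j h4 y (by simp [hx]) u (by simp [hu])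
    have : τ = y := by
      rcases hτxy with h | h
      · rw [h, hab.1] at hτ'
        omega
      · exact h
    refine ⟨x, y, u, v, hxy, h5, huv, ?_, .inl this⟩
    rw [hx, hu]
    rfl

theorem isMiddleOfTriple (hA : Aon.Nodup) {i : ℕ} {τ : ℝ} (hi : i ∈ Finset.Icc 1 (T.s + 1))
    (hτ : τ ∈ T.A i) (h3 : T.sizeA i = 3) (hτ' : above (T.A i) τ = 1)
    (hu : ∀ j ∈ Finset.Icc 1 (T.s + 1), T.sizeA j = 3 ↔ j = i) : T.IsMiddleOfTriple τ :=
  ⟨i, hi, hu, eq_of_card_three (T.nodup_A hA hi) h3 hτ hτ'⟩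

/-- An entry of the elliptic/parabolic table has the parity pattern, whose special element is where
the table says. -/
theorem EPEntry.exists_isParity {T : TraceClusters Aon Bon} {o k : ℕ} (h : T.EPEntry o k)
    (hA : Aon.Nodup) (hB : Bon.Nodup) :
    ∃ τ, IsParity 0 Aon Bon τ ∧ T.EPLocation τ k := by
  obtain ⟨h1, i, ρ, h2, h3⟩ := EPSizes.exists_position (T.epSizes_iff.2 h)
    fun i hi => T.sizeA_ne_zero.2 (T.A_ne_zero i hi)
  obtain ⟨τ, hτ, hi, hτi, hτ'⟩ := T.isParity_of_oddPositions hA (T.card_Bon ▸ h1) h2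
  refine ⟨τ, hτ, ?_⟩
  rcases k with _ | _ | _ | _ | _ | _ | _ | _ | _ | _ | k
  on_goal 11 => exact h.elim
  · exact h.elim
  · exact T.isMiddleOfTriple hA hi hτi h3.1 (hτ'.trans h3.2.1) h3.2.2
  · exact T.isMiddleOfTriple hA hi hτi h3.1 (hτ'.trans h3.2.1) h3.2.2
  · exact T.isMiddleOfTriple hA hi hτi h3.1 (hτ'.trans h3.2.1) h3.2.2
  · obtain ⟨rfl, rfl, h4⟩ := h3
    exact ⟨hτi, le_of_above_add_one_eq hτi (by rw [hτ']; exact h4.symm)⟩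
  · obtain ⟨rfl, rfl, h4⟩ := h3
    exact ⟨hτi, le_of_above_add_one_eq hτi (by rw [hτ']; exact h4.symm)⟩
  · obtain ⟨j, hj, h4, h5⟩ := h3
    exact T.isInnerOfAdjacentPair hA hB h4 h5 hτi hτ'
  · obtain ⟨rfl, rfl, h4⟩ := h3
    exact ⟨hτi, le_of_above_add_one_eq hτi (by rw [hτ']; exact h4.symm)⟩
  · obtain ⟨rfl, rfl⟩ := h3
    exact ⟨hτi, above_eq_zero.1 hτ'⟩
  · obtain ⟨rfl, h4⟩ := h3
    exact T.eq_singleton_of_sizeA h4 hτi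

/-- An entry of the hyperbolic table has the parity pattern, whose special element is where
the table says. -/
theorem HypEntry.exists_isParity {T : TraceClusters Aon Bon} {o k : ℕ} (h : T.HypEntry 1 o k)
    (hA : Aon.Nodup) (hB : Bon.Nodup) :
    ∃ τ, IsParity 1 Aon Bon τ ∧ T.HypLocation τ k := by
  obtain ⟨h1, i, ρ, h2, h3⟩ := HypSizes.exists_position (T.hypSizes_iff.2 h)
    fun i hi => T.sizeA_ne_zero.2 (T.A_ne_zero i hi)
  obtain ⟨τ, hτ, hi, hτi, hτ'⟩ := T.isParity_of_oddPositions hA (T.card_Bon ▸ h1) h2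
  refine ⟨τ, hτ, ?_⟩
  rcases k with _ | _ | _ | _ | _ | _ | _ | _ | _ | _ | k
  on_goal 11 => exact h.elim
  · exact h.elim
  · exact T.isMiddleOfTriple hA hi hτi h3.1 (hτ'.trans h3.2.1) h3.2.2
  · exact T.isMiddleOfTriple hA hi hτi h3.1 (hτ'.trans h3.2.1) h3.2.2
  · obtain ⟨rfl, rfl⟩ := h3
    exact ⟨hτi, above_eq_zero.1 hτ'⟩
  · obtain ⟨rfl, rfl, h4⟩ := h3
    exact ⟨hτi, le_of_above_add_one_eq hτi (by rw [hτ']; exact h4.symm)⟩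
  · obtain ⟨rfl, rfl⟩ := h3
    exact ⟨hτi, above_eq_zero.1 hτ'⟩
  · obtain ⟨rfl, rfl, h4⟩ := h3
    exact ⟨hτi, le_of_above_add_one_eq hτi (by rw [hτ']; exact h4.symm)⟩
  · obtain ⟨j, hj, h4, h5⟩ := h3
    exact T.isInnerOfAdjacentPair hA hB h4 h5 hτi hτ'
  · obtain ⟨rfl, h4⟩ := h3
    exact T.eq_singleton_of_sizeA h4 hτi
  · obtain ⟨rfl, h4⟩ := h3
    exact T.eq_singleton_of_sizeA h4 hτi

/-- The entries of the tables have at least eight elements in `Bon`. -/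
theorem bOff_le_of_epEntry {T : TraceClusters Aon Bon} {o k : ℕ} (h : T.EPEntry o k) : o ≤ 3 := by
  rcases k with _ | _ | _ | _ | _ | _ | _ | _ | _ | _ | k
  on_goal 11 => exact h.elim
  · exact h.elim
  all_goals
    first
    | exact h.2.2.2.2.le.trans (by norm_num)
    | exact h.2.2.2.2.1.le.trans (by norm_num)

theorem bOff_le_of_hypEntry {T : TraceClusters Aon Bon} {x o k : ℕ} (h : T.HypEntry x o k) :
    o ≤ 3 := by
  rcases k with _ | _ | _ | _ | _ | _ | _ | _ | _ | _ | k
  on_goal 11 => exact h.elim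
  · exact h.elim
  all_goals
    first
    | exact h.2.2.2.2.le.trans (by norm_num)
    | exact h.2.2.2.2.1.le.trans (by norm_num)

end TraceClusters

/-! ### Signs of real polynomials and their roots -/

/-- A monic real polynomial without real roots is positive. -/
theorem eval_pos_of_monic_of_roots_eq_zero {q : ℝ[X]} (hq : q.Monic) (h0 : q.roots = 0) (x : ℝ) :
    0 < q.eval x := by
  have hne : ∀ y, q.eval y ≠ 0 := by
    intro y hy
    have : y ∈ q.roots := (mem_roots hq.ne_zero).2 hy
    simp [h0] at this
  rcases eq_or_ne q.natDegree 0 with hd | hd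
  · rw [hq.natDegree_eq_zero.1 hd]
    simp
  · by_contra hx
    have htop := q.tendsto_atTop_of_leadingCoeff_nonneg
      (natDegree_pos_iff_degree_pos.1 (Nat.pos_of_ne_zero hd)) (by rw [hq.leadingCoeff]; exact zero_le_one)
    obtain ⟨y, hy, hxy⟩ := ((htop.eventually_gt_atTop 0).and (Filter.eventually_ge_atTop x)).exists
    obtain ⟨z, -, hz⟩ := intermediate_value_Icc hxy q.continuous.continuousOn
      ⟨not_lt.1 hx, hy.le⟩
    exact hne z hz

theorem prod_sub_sign (M : Multiset ℝ) {x : ℝ} (hx : x ∉ M) :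
    0 < (-1) ^ above M x * (M.map fun a => x - a).prod := by
  induction M using Multiset.induction with
  | empty => simp [above]
  | cons a M ih =>
    rw [Multiset.mem_cons, not_or] at hx
    have := ih hx.2
    rw [above_cons, Multiset.map_cons, Multiset.prod_cons]
    split_ifs with h
    · rw [pow_succ]
      nlinarith [mul_pos this (sub_pos.2 h)]
    · have h2 : 0 < x - a := sub_pos.2 (lt_of_le_of_ne (not_lt.1 h) (Ne.symm hx.1))
      rw [add_zero]
      nlinarith [mul_pos this h2]

/-- The sign of a monic real polynomial at `x` is determined by the number of roots above `x`. -/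
theorem sign_eval {f : ℝ[X]} (hf : f.Monic) {x : ℝ} (hx : f.eval x ≠ 0) :
    0 < (-1) ^ above f.roots x * f.eval x := by
  obtain ⟨q, hq, -, hq0⟩ := f.exists_prod_multiset_X_sub_C_mul
  have hqm : q.Monic := (monic_multiset_prod_of_monic _ _ fun a _ => monic_X_sub_C a).of_mul_monic_left
    (hq.symm ▸ hf)
  have h1 : f.eval x = (f.roots.map fun a => x - a).prod * q.eval x := by
    conv_lhs => rw [← hq]
    rw [eval_mul, eval_multiset_prod, Multiset.map_map]
    congr 2
    refine Multiset.map_congr rfl fun a _ => ?_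
    simp
  have hx' : x ∉ f.roots := fun h => hx (isRoot_of_mem_roots h)
  rw [h1, ← mul_assoc]
  exact mul_pos (prod_sub_sign _ hx') (eval_pos_of_monic_of_roots_eq_zero hqm hq0 x)

/-- The sign of the derivative of a monic real polynomial at a simple root `x` is determined by the
number of roots above `x`. -/
theorem sign_derivative {f : ℝ[X]} (hf : f.Monic) {x : ℝ} (hx : f.eval x = 0)
    (hx' : (derivative f).eval x ≠ 0) : 0 < (-1) ^ above f.roots x * (derivative f).eval x := by
  obtain ⟨q, hq⟩ := dvd_iff_isRoot.2 hx
  have hqm : q.Monic := (monic_X_sub_C x).of_mul_monic_left (hq ▸ hf)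
  have h1 : (derivative f).eval x = q.eval x := by rw [hq]; simp
  have h2 : above f.roots x = above q.roots x := by
    rw [hq, roots_mul (hq ▸ hf.ne_zero), above_add, roots_X_sub_C,
      above_eq_zero.2 (by simp), zero_add]
  rw [h1] at hx' ⊢
  rw [h2]
  exact sign_eval hqm hx'

/-- The complex roots on a part of the real line are the real roots there. -/
theorem filter_aroots (f : ℤ[X]) (P : ℝ → Prop) [DecidablePred P]
    [DecidablePred fun z : ℂ => z.im = 0 ∧ P z.re] :
    (f.aroots ℂ).filter (fun z => z.im = 0 ∧ P z.re) =
      ((f.aroots ℝ).filter P).map Complex.ofReal := by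
  classical
  have hm : (f.map (algebraMap ℤ ℝ)).map Complex.ofRealHom = f.map (algebraMap ℤ ℂ) := by
    rw [Polynomial.map_map]; congr 1
  ext z
  rw [Multiset.count_filter]
  by_cases hz : z.im = 0
  · obtain ⟨x, rfl⟩ : ∃ x : ℝ, (x : ℂ) = z := ⟨z.re, Complex.ext rfl hz.symm⟩
    rw [Multiset.count_map_eq_count' _ _ Complex.ofReal_injective, Multiset.count_filter]
    simp only [Complex.ofReal_im, Complex.ofReal_re, true_and]
    congr 1
    rw [aroots, aroots, count_roots, count_roots, ← hm]
    exact (eq_rootMultiplicity_map (f := Complex.ofRealHom) Complex.ofReal_injective x).symm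
  · rw [if_neg (fun h => hz h.1), eq_comm, Multiset.count_eq_zero]
    intro h
    obtain ⟨x, -, rfl⟩ := Multiset.mem_map.1 h
    exact hz (Complex.ofReal_im x)

open Classical in
theorem rootsOn_eq (f : ℤ[X]) : rootsOn f = (f.aroots ℝ).filter fun x => -2 ≤ x ∧ x ≤ 2 := by
  have h : (f.aroots ℂ).filter OnInterval =
      ((f.aroots ℝ).filter fun x => -2 ≤ x ∧ x ≤ 2).map Complex.ofReal :=
    @filter_aroots f (fun x => -2 ≤ x ∧ x ≤ 2) _ fun _ => Classical.propDecidable _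
  rw [rootsOn, h, Multiset.map_map]
  simp

theorem card_rootsGtTwo (f : ℤ[X]) : (rootsGtTwo f).card = above (f.aroots ℝ) 2 := by
  classical
  unfold rootsGtTwo
  rw [filter_aroots f fun x => 2 < x, Multiset.card_map, above, Multiset.countP_eq_card_filter]

theorem mem_rootsOn {f : ℤ[X]} (hf : f.Monic) {x : ℝ} :
    x ∈ rootsOn f ↔ aeval x f = 0 ∧ -2 ≤ x ∧ x ≤ 2 := by
  classical
  rw [rootsOn_eq, Multiset.mem_filter, mem_aroots, and_iff_right hf.ne_zero]

theorem above_aroots {f : ℤ[X]} {x : ℝ} (h1 : -2 ≤ x) (h2 : x ≤ 2) :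
    above (f.aroots ℝ) x = above (rootsOn f) x + (rootsGtTwo f).card := by
  classical
  rw [rootsOn_eq, card_rootsGtTwo]
  induction f.aroots ℝ using Multiset.induction with
  | empty => simp [above]
  | cons a M ih =>
    rw [above_cons, above_cons, ih, Multiset.filter_cons, above_add]
    by_cases ha : -2 ≤ a ∧ a ≤ 2
    · rw [if_pos ha, if_neg (not_lt.2 ha.2)]
      change _ = above (a ::ₘ 0) x + _ + _
      rw [above_cons]
      simp only [above, Multiset.countP_zero]
      omega
    · rw [if_neg ha]
      simp only [above, Multiset.countP_zero]
      by_cases h3 : 2 < a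
      · rw [if_pos h3, if_pos (by linarith)]; omega
      · rw [if_neg h3, if_neg]
        · omega
        · intro h4
          exact ha ⟨by linarith, by linarith⟩

theorem card_rootsOff_add {f : ℤ[X]} (hf : f.Monic) :
    (rootsOff f).card + (rootsOn f).card = f.natDegree := by
  classical
  have h1 : (f.aroots ℂ).card = f.natDegree := by
    rw [aroots, ← hf.natDegree_map (algebraMap ℤ ℂ)]
    exact splits_iff_card_roots.1 (IsAlgClosed.splits _)
  rw [← h1, rootsOff, rootsOn, Multiset.card_map, add_comm, ← Multiset.card_add,
    Multiset.filter_add_not]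

theorem aeval_eq_eval_map (f : ℤ[X]) (x : ℝ) : aeval x f = (f.map (algebraMap ℤ ℝ)).eval x := by
  rw [eval_map, aeval_def]

/-- The sign of `f (x) f (2)` is determined by the number of roots in `(x, 2]`. -/
theorem sign_mul_eval_two {f : ℤ[X]} (hf : f.Monic) {x : ℝ} (h1 : -2 ≤ x) (h2 : x ≤ 2)
    (hx : aeval x f ≠ 0) (h0 : aeval (2 : ℝ) f ≠ 0) :
    0 < (-1) ^ above (rootsOn f) x * (aeval x f * aeval (2 : ℝ) f) := by
  have hm := hf.map (algebraMap ℤ ℝ)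
  have e2 : above (f.aroots ℝ) 2 = (rootsGtTwo f).card := (card_rootsGtTwo f).symm
  have h3 := sign_eval hm (x := x) (by rwa [← aeval_eq_eval_map])
  have h4 := sign_eval hm (x := 2) (by rwa [← aeval_eq_eval_map])
  rw [← aeval_eq_eval_map] at h3 h4
  change 0 < (-1) ^ above (f.aroots ℝ) x * _ at h3
  change 0 < (-1) ^ above (f.aroots ℝ) 2 * _ at h4
  rw [above_aroots h1 h2] at h3
  rw [e2] at h4
  have h5 := mul_pos h3 h4
  have h6 : ((-1 : ℝ) ^ (rootsGtTwo f).card) * (-1) ^ (rootsGtTwo f).card = 1 := by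
    rw [← mul_pow]; simp
  rw [pow_add] at h5
  calc (0 : ℝ) < _ := h5
    _ = ((-1 : ℝ) ^ (rootsGtTwo f).card * (-1) ^ (rootsGtTwo f).card) *
      ((-1) ^ above (rootsOn f) x * (aeval x f * aeval (2 : ℝ) f)) := by ring
    _ = _ := by rw [h6, one_mul]

theorem sign_derivative_rootsOn {f : ℤ[X]} (hf : f.Monic) {x : ℝ} (h1 : -2 ≤ x) (h2 : x ≤ 2)
    (hx : aeval x f = 0) (h0 : aeval x (derivative f) ≠ 0) :
    0 < (-1) ^ ((rootsGtTwo f).card + above (rootsOn f) x) * aeval x (derivative f) := by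
  have hm := hf.map (algebraMap ℤ ℝ)
  have h3 := sign_derivative hm (x := x) (by rwa [← aeval_eq_eval_map])
    (by rwa [derivative_map, ← aeval_eq_eval_map])
  rw [derivative_map, ← aeval_eq_eval_map] at h3
  change 0 < (-1) ^ above (f.aroots ℝ) x * _ at h3
  rwa [above_aroots h1 h2, add_comm] at h3

/-- At a root of a polynomial with simple roots the derivative does not vanish. -/
theorem SimpleRoots.derivative_ne_zero {f : ℤ[X]} (hs : SimpleRoots f) (hf : f.Monic) {z : ℂ}
    (hz : aeval z f = 0) : aeval z (derivative f) ≠ 0 := by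
  classical
  intro h
  have hm := (hf.map (algebraMap ℤ ℂ)).ne_zero
  have h1 : 1 < (f.map (algebraMap ℤ ℂ)).rootMultiplicity z := by
    rw [one_lt_rootMultiplicity_iff_isRoot hm, derivative_map]
    simp only [IsRoot, eval_map, ← aeval_def]
    exact ⟨hz, h⟩
  have h2 := Multiset.nodup_iff_count_le_one.1 hs z
  rw [aroots, count_roots] at h2
  omega

theorem simpleRoots_of_derivative_ne_zero {f : ℤ[X]} (hf : f.Monic)
    (h : ∀ z : ℂ, aeval z f = 0 → aeval z (derivative f) ≠ 0) : SimpleRoots f := by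
  classical
  refine Multiset.nodup_iff_count_le_one.2 fun z => ?_
  rw [aroots, count_roots]
  by_contra h1
  have hm := (hf.map (algebraMap ℤ ℂ)).ne_zero
  rw [not_le, one_lt_rootMultiplicity_iff_isRoot hm, derivative_map] at h1
  simp only [IsRoot, eval_map, ← aeval_def] at h1
  exact h z h1.1 h1.2

theorem SimpleRoots.nodup_rootsOn {f : ℤ[X]} (hs : SimpleRoots f) : (rootsOn f).Nodup := by
  classical
  have h2 : ((f.aroots ℂ).filter fun z => z.im = 0 ∧ -2 ≤ z.re ∧ z.re ≤ 2).Nodup :=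
    Multiset.Nodup.filter _ hs
  rw [rootsOn_eq]
  rw [filter_aroots f fun x => -2 ≤ x ∧ x ≤ 2] at h2
  exact h2.of_map _

/-- The sign pattern on the roots of `Φ` that makes `c` times the invariant form a K3 lattice with a
Hodge structure of special trace `τ`. The roots are simple, real, larger than `-2`, and at most one
of them is `≥ 2`. The eigenvectors with trace `w` in `(-2, 2)` have the sign of `-c Φ' (w) Ψ (w)`,
which has to be positive for `w = τ` only; the conditions at `± 2` concern the eigenvalues `± 1`. -/
structure IsPattern (Φ Ψ : ℤ[X]) (c τ : ℝ) : Prop where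
  real : ∀ z : ℂ, aeval z Φ = 0 → z.im = 0 ∧ -2 < z.re
  simple : SimpleRoots Φ
  two_le : ∀ x y : ℝ, aeval x Φ = 0 → aeval y Φ = 0 → 2 ≤ x → 2 ≤ y → x = y
  neg_two_lt : -2 < τ
  lt_two : τ < 2
  root : aeval τ Φ = 0
  neg : c * (aeval τ (derivative Φ) * aeval τ Ψ) < 0
  pos : ∀ w : ℝ, aeval w Φ = 0 → w < 2 → w ≠ τ → 0 < c * (aeval w (derivative Φ) * aeval w Ψ)
  pos_two : 0 < c * aeval (2 : ℝ) Ψ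
  pos_neg_two : 0 < c * aeval (-2 : ℝ) Ψ

theorem neg_one_pow_pos_iff {n : ℕ} {x : ℝ} (h : 0 < (-1) ^ n * x) : 0 < x ↔ n % 2 = 0 := by
  rcases Nat.even_or_odd n with hn | hn
  · rw [hn.neg_one_pow, one_mul] at h
    simp [h, Nat.even_iff.1 hn]
  · rw [hn.neg_one_pow] at h
    have := Nat.odd_iff.1 hn
    constructor
    · intro h'; linarith
    · omega

theorem neg_one_pow_neg_iff {n : ℕ} {x : ℝ} (h : 0 < (-1) ^ n * x) : x < 0 ↔ n % 2 = 1 := by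
  rcases Nat.even_or_odd n with hn | hn
  · rw [hn.neg_one_pow, one_mul] at h
    have := Nat.even_iff.1 hn
    constructor
    · intro h'; linarith
    · omega
  · rw [hn.neg_one_pow] at h
    simp only [Nat.odd_iff.1 hn, iff_true]
    linarith

/-- The sign of `Φ' Ψ Ψ(2)` at a root of `Φ` in `[-2, 2]`. -/
theorem sign_parity {Φ Ψ : ℤ[X]} (hΦ : Φ.Monic) (hΨ : Ψ.Monic) {w : ℝ} (h1 : -2 ≤ w) (h2 : w ≤ 2)
    (h0 : aeval w Φ = 0) (h0' : aeval w (derivative Φ) ≠ 0) (hw : aeval w Ψ ≠ 0)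
    (h3 : aeval (2 : ℝ) Ψ ≠ 0) :
    0 < (-1) ^ ((rootsGtTwo Φ).card + above (rootsOn Φ) w + above (rootsOn Ψ) w) *
      (aeval (2 : ℝ) Ψ * (aeval w (derivative Φ) * aeval w Ψ)) := by
  have h4 := mul_pos (sign_derivative_rootsOn hΦ h1 h2 h0 h0') (sign_mul_eval_two hΨ h1 h2 hw h3)
  rw [pow_add _ _ (above (rootsOn Ψ) w)]
  calc (0 : ℝ) < _ := h4
    _ = _ := by ring

theorem eval_neg_two_pos_iff {Ψ : ℤ[X]} (hΨ : Ψ.Monic) (h2 : aeval (2 : ℝ) Ψ ≠ 0)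
    (h2' : aeval (-2 : ℝ) Ψ ≠ 0) :
    0 < aeval (2 : ℝ) Ψ * aeval (-2 : ℝ) Ψ ↔ (rootsOn Ψ).card % 2 = 0 := by
  have h := sign_mul_eval_two hΨ (le_refl (-2)) (by norm_num) h2' h2
  rw [above_eq_card, mul_comm (aeval (-2 : ℝ) Ψ)] at h
  · exact neg_one_pow_pos_iff h
  · intro a ha
    obtain ⟨h3, h4, -⟩ := (mem_rootsOn hΨ).1 ha
    refine lt_of_le_of_ne h4 fun h5 => h2' ?_
    rw [h5]; exact h3

theorem card_rootsOn_add_of_real {Φ : ℤ[X]} (hΦ : Φ.Monic)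
    (hreal : ∀ z : ℂ, aeval z Φ = 0 → z.im = 0 ∧ -2 < z.re) :
    (rootsOn Φ).card + (rootsGtTwo Φ).card = Φ.natDegree := by
  classical
  rw [← card_rootsOff_add hΦ, add_comm]
  congr 2
  unfold rootsGtTwo rootsOff
  refine Multiset.filter_congr fun z hz => ?_
  obtain ⟨-, hz⟩ := mem_aroots.1 hz
  obtain ⟨h1, h2⟩ := hreal z hz
  simp only [OnInterval, h1, true_and, not_and, not_le]
  exact ⟨fun h3 _ => h3, fun h3 => h3 h2.le⟩

/-- A polynomial of even degree all of whose roots are real and greater than `-2` is positive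
at `-2`. -/
theorem eval_neg_two_pos {Φ : ℤ[X]} (hΦ : Φ.Monic) (hdeg : Φ.natDegree % 2 = 0)
    (hreal : ∀ z : ℂ, aeval z Φ = 0 → z.im = 0 ∧ -2 < z.re) : 0 < aeval (-2 : ℝ) Φ := by
  have hgt : ∀ w : ℝ, aeval w Φ = 0 → -2 < w := fun w hw => by
    simpa using (hreal w (by rw [aeval_ofReal, hw, Complex.ofReal_zero])).2
  have hm := hΦ.map (algebraMap ℤ ℝ)
  have hne : aeval (-2 : ℝ) Φ ≠ 0 := fun h0 => lt_irrefl _ (hgt _ h0)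
  have h5 := sign_eval hm (x := -2) (by rwa [← aeval_eq_eval_map])
  rw [← aeval_eq_eval_map] at h5
  change 0 < (-1) ^ above (Φ.aroots ℝ) (-2) * _ at h5
  rw [above_aroots le_rfl (by norm_num), above_eq_card] at h5
  · rw [neg_one_pow_pos_iff h5, card_rootsOn_add_of_real hΦ hreal, hdeg]
  · intro a ha
    exact hgt a ((mem_rootsOn hΦ).1 ha).1

namespace IsPattern

variable {Φ Ψ : ℤ[X]} {c τ : ℝ} (h : IsPattern Φ Ψ c τ)
include h

theorem right_ne_zero {w : ℝ} (hw : aeval w Φ = 0) (hw2 : w ≤ 2) : aeval w Ψ ≠ 0 := by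
  intro h0
  rcases hw2.eq_or_lt with rfl | hw2
  · have := h.pos_two
    simp [h0] at this
  · rcases eq_or_ne w τ with rfl | hne
    · have := h.neg
      simp [h0] at this
    · have := h.pos w hw hw2 hne
      simp [h0] at this

theorem card_rootsGtTwo_le : (rootsGtTwo Φ).card ≤ 1 := by
  classical
  have hmem : ∀ z ∈ rootsGtTwo Φ, ∃ x : ℝ, (x : ℂ) = z ∧ aeval x Φ = 0 ∧ 2 < x := by
    intro z hz
    simp only [rootsGtTwo, Multiset.mem_filter, mem_aroots] at hz
    obtain ⟨⟨-, hz⟩, hz0, hz2⟩ := hz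
    obtain ⟨x, rfl⟩ : ∃ x : ℝ, (x : ℂ) = z := ⟨z.re, Complex.ext rfl hz0.symm⟩
    rw [aeval_ofReal, Complex.ofReal_eq_zero] at hz
    exact ⟨x, rfl, hz, hz2⟩
  have hnd : (rootsGtTwo Φ).Nodup := Multiset.Nodup.filter _ h.simple
  rw [← Multiset.toFinset_card_of_nodup hnd, Finset.card_le_one]
  intro z hz w hw
  obtain ⟨x, rfl, hx, hx2⟩ := hmem z (Multiset.mem_toFinset.1 hz)
  obtain ⟨y, rfl, hy, hy2⟩ := hmem w (Multiset.mem_toFinset.1 hw)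
  rw [h.two_le x y hx hy hx2.le hy2.le]

theorem card_rootsGtTwo_eq_zero (h2 : aeval (2 : ℝ) Φ = 0) : (rootsGtTwo Φ).card = 0 := by
  classical
  rw [Multiset.card_eq_zero, Multiset.eq_zero_iff_forall_notMem]
  intro z hz
  simp only [rootsGtTwo, Multiset.mem_filter, mem_aroots] at hz
  obtain ⟨⟨-, hz⟩, hz0, hz2⟩ := hz
  obtain ⟨x, rfl⟩ : ∃ x : ℝ, (x : ℂ) = z := ⟨z.re, Complex.ext rfl hz0.symm⟩
  rw [aeval_ofReal, Complex.ofReal_eq_zero] at hz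
  rw [Complex.ofReal_re] at hz2
  exact hz2.ne (h.two_le _ _ h2 hz le_rfl hz2.le)

theorem card_rootsOn_add (hΦ : Φ.Monic) :
    (rootsOn Φ).card + (rootsGtTwo Φ).card = Φ.natDegree :=
  card_rootsOn_add_of_real hΦ h.real

theorem isParity (hΦ : Φ.Monic) (hΨ : Ψ.Monic) :
    IsParity (rootsGtTwo Φ).card (rootsOn Φ) (rootsOn Ψ) τ := by
  have h2 : aeval (2 : ℝ) Ψ ≠ 0 := fun h0 => by simpa [h0] using h.pos_two
  have h2' : aeval (-2 : ℝ) Ψ ≠ 0 := fun h0 => by simpa [h0] using h.pos_neg_two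
  have hc0 : c ≠ 0 := fun h0 => by simpa [h0] using h.pos_two
  have hc : 0 < c ^ 2 := by positivity
  refine ⟨(mem_rootsOn hΦ).2 ⟨h.root, h.neg_two_lt.le, h.lt_two.le⟩, fun w hw => ?_,
    (eval_neg_two_pos_iff hΨ h2 h2').1 ?_⟩
  · obtain ⟨hw0, hw1, hw2⟩ := (mem_rootsOn hΦ).1 hw
    have hd : aeval w (derivative Φ) ≠ 0 := by
      intro h0
      have := h.simple.derivative_ne_zero hΦ (z := w) (by rw [aeval_ofReal, hw0]; simp)
      rw [aeval_ofReal, h0] at this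
      simp at this
    rw [← neg_one_pow_neg_iff (sign_parity hΦ hΨ hw1 hw2 hw0 hd (h.right_ne_zero hw0 hw2) h2)]
    have key : aeval (2 : ℝ) Ψ * (aeval w (derivative Φ) * aeval w Ψ) < 0 ↔
        c * (aeval w (derivative Φ) * aeval w Ψ) < 0 := by
      have h5 := h.pos_two
      have h6 : c ^ 2 * (aeval (2 : ℝ) Ψ * (aeval w (derivative Φ) * aeval w Ψ)) =
        c * aeval (2 : ℝ) Ψ * (c * (aeval w (derivative Φ) * aeval w Ψ)) := by ring
      constructor
      · intro h7
        have h8 := mul_neg_of_pos_of_neg hc h7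
        rw [h6] at h8
        exact neg_of_mul_neg_right h8 h5.le
      · intro h7
        have h8 := mul_neg_of_pos_of_neg h5 h7
        rw [← h6] at h8
        exact neg_of_mul_neg_right h8 hc.le
    rw [key]
    constructor
    · intro h6
      by_contra hne
      rcases hw2.eq_or_lt with rfl | hw2
      · -- the largest root of `Φ` is `2`, where `Φ'` is positive
        have h7 : ∀ f : ℤ[X], f.Monic → above (rootsOn f) 2 = 0 := fun f hf =>
          above_eq_zero.2 fun a ha => ((mem_rootsOn hf).1 ha).2.2
        have h8 := (neg_one_pow_neg_iff (sign_parity hΦ hΨ hw1 le_rfl hw0 hd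
          (h.right_ne_zero hw0 le_rfl) h2)).1 (key.2 h6)
        rw [h7 Φ hΦ, h7 Ψ hΨ, h.card_rootsGtTwo_eq_zero hw0] at h8
        omega
      · exact absurd h6 (not_lt.2 (h.pos w hw0 hw2 hne).le)
    · rintro rfl
      exact h.neg
  · have := mul_pos h.pos_two h.pos_neg_two
    rw [show c * aeval (2 : ℝ) Ψ * (c * aeval (-2 : ℝ) Ψ) =
      c ^ 2 * (aeval (2 : ℝ) Ψ * aeval (-2 : ℝ) Ψ) by ring] at this
    exact pos_of_mul_pos_right this hc.le

end IsPattern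

/-! ### Sign patterns and table entries -/

namespace TraceClusters

variable {Aon Bon : Multiset ℝ} {T : TraceClusters Aon Bon}

theorem card_Aon_eq_sum_typeA (T : TraceClusters Aon Bon) : Aon.card = T.typeA.sum := by
  rw [T.card_Aon, typeA, Finset.sum_map_val]

theorem EPEntry.card_Aon {o k : ℕ} (h : T.EPEntry o k) : Aon.card = 10 := by
  rw [T.card_Aon_eq_sum_typeA]
  rcases k with _ | _ | _ | _ | _ | _ | _ | _ | _ | _ | k
  on_goal 11 => exact h.elim
  · exact h.elim
  all_goals
    rw [h.2.1]
    rfl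

theorem HypEntry.card_Aon {x o k : ℕ} (h : T.HypEntry x o k) : Aon.card = 9 := by
  rw [T.card_Aon_eq_sum_typeA]
  rcases k with _ | _ | _ | _ | _ | _ | _ | _ | _ | _ | k
  on_goal 11 => exact h.elim
  · exact h.elim
  all_goals
    rw [h.2.1]
    rfl

end TraceClusters

theorem aeval_two_eq (f : ℤ[X]) : aeval (2 : ℝ) f = ((f.eval 2 : ℤ) : ℝ) := by
  have := aeval_algebraMap_apply ℝ (2 : ℤ) f
  simpa using this

theorem aeval_neg_two_eq (f : ℤ[X]) : aeval (-2 : ℝ) f = ((f.eval (-2) : ℤ) : ℝ) := by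
  have := aeval_algebraMap_apply ℝ (-2 : ℤ) f
  simpa using this

namespace IsPattern

variable {Φ Ψ : ℤ[X]} {c τ : ℝ} (h : IsPattern Φ Ψ c τ)
include h

/-- A sign pattern gives an entry of the tables. -/
theorem exists_entry (hΦ : Φ.Monic) (hΦ_deg : Φ.natDegree = 10) (hΨ : Ψ.Monic)
    (hB : (rootsOn Ψ).card ≤ 11) :
    ∃ (T : TraceClusters (rootsOn Φ) (rootsOn Ψ)) (k : ℕ),
      ((rootsGtTwo Φ).card = 0 → T.EPEntry (11 - (rootsOn Ψ).card) k) ∧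
      ((rootsGtTwo Φ).card = 1 → T.HypEntry 1 (11 - (rootsOn Ψ).card) k) := by
  obtain ⟨T⟩ := exists_traceClusters _ (rootsOn Φ) (rootsOn Ψ) (fun a ha hb => by
    obtain ⟨h1, h2, h3⟩ := (mem_rootsOn hΦ).1 ha
    exact h.right_ne_zero h1 h3 ((mem_rootsOn hΨ).1 hb).1) rfl
  exact ⟨T, T.exists_entry_of_isParity h.simple.nodup_rootsOn (h.isParity hΦ hΨ)
    h.card_rootsGtTwo_le ((h.card_rootsOn_add hΦ).trans hΦ_deg) hB⟩

theorem eight_le_card (hΦ : Φ.Monic) (hΦ_deg : Φ.natDegree = 10) (hΨ : Ψ.Monic)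
    (hB : (rootsOn Ψ).card ≤ 11) : 8 ≤ (rootsOn Ψ).card := by
  obtain ⟨T, k, h0, h1⟩ := h.exists_entry hΦ hΦ_deg hΨ hB
  rcases (by have := h.card_rootsGtTwo_le; omega :
    (rootsGtTwo Φ).card = 0 ∨ (rootsGtTwo Φ).card = 1) with h2 | h2
  · have := TraceClusters.bOff_le_of_epEntry (h0 h2)
    omega
  · have := TraceClusters.bOff_le_of_hypEntry (h1 h2)
    omega

/-- Removing a square factor of `Ψ` keeps the sign pattern. -/
theorem of_sq_mul {f g : ℤ[X]} (hf : Ψ = f ^ 2 * g) : IsPattern Φ g c τ := by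
  have key : ∀ {x : ℝ} (y : ℝ), c * (y * aeval x Ψ) = aeval x f ^ 2 * (c * (y * aeval x g)) := by
    intro x y
    rw [hf, map_mul, map_pow]; ring
  have key' : ∀ {x : ℝ}, c * aeval x Ψ = aeval x f ^ 2 * (c * aeval x g) := by
    intro x
    rw [hf, map_mul, map_pow]; ring
  refine ⟨h.real, h.simple, h.two_le, h.neg_two_lt, h.lt_two, h.root, ?_, fun w hw hw2 hne => ?_,
    ?_, ?_⟩
  · exact neg_of_mul_neg_right (key _ ▸ h.neg) (sq_nonneg _)
  · exact pos_of_mul_pos_right (key _ ▸ h.pos w hw hw2 hne) (sq_nonneg _)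
  · exact pos_of_mul_pos_right (key' ▸ h.pos_two) (sq_nonneg _)
  · exact pos_of_mul_pos_right (key' ▸ h.pos_neg_two) (sq_nonneg _)

/-- A double root would give a square factor of `Ψ`. It is not linear since `Ψ (2)` and `Ψ (-2)` are
units, and otherwise the cofactor has too few roots for the sign pattern. -/
theorem simpleRoots_right (hΦ : Φ.Monic) (hΦ_deg : Φ.natDegree = 10) (hΨ : Ψ.Monic)
    (hΨ_deg : Ψ.natDegree = 11) (h2 : IsUnit (Ψ.eval 2)) (h2' : IsUnit (Ψ.eval (-2))) :
    SimpleRoots Ψ := by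
  -- the minimal polynomial `f` of a double root `z` divides `Ψ` twice
  refine simpleRoots_of_derivative_ne_zero hΨ fun z hz hz' => ?_
  have hint : IsIntegral ℤ z := ⟨Ψ, hΨ, hz⟩
  set f := minpoly ℤ z with hf
  have hfm : f.Monic := minpoly.monic hint
  have hdvd : ∀ {p : ℤ[X]}, aeval z p = 0 → f ∣ p := fun {p} hp =>
    minpoly.isIntegrallyClosed_dvd hint hp
  have hf1 : 1 ≤ f.natDegree := minpoly.natDegree_pos hint
  obtain ⟨q, hq⟩ := hdvd hz
  have hfz : aeval z f = 0 := minpoly.aeval ℤ z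
  have hfz' : aeval z (derivative f) ≠ 0 := by
    intro h0
    have h3 : derivative f ≠ 0 := by
      intro h4
      have := derivative_eq_zero.1 h4
      omega
    have h5 := natDegree_le_of_dvd (hdvd h0) h3
    have := natDegree_derivative_lt (p := f) (by omega)
    omega
  have hqz : aeval z q = 0 := by
    rw [hq, derivative_mul, map_add, map_mul, map_mul, hfz, zero_mul, add_zero] at hz'
    exact (mul_eq_zero.1 hz').resolve_left hfz'
  obtain ⟨g, hg⟩ := hdvd hqz
  have hfg : Ψ = f ^ 2 * g := by rw [hq, hg]; ring
  have hgm : g.Monic := (hfm.pow 2).of_mul_monic_left (hfg ▸ hΨ)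
  have hdeg : 2 * f.natDegree + g.natDegree = 11 := by
    rw [← hΨ_deg, hfg, (hfm.pow 2).natDegree_mul hgm, hfm.natDegree_pow]
  rcases hf1.eq_or_lt with hf1 | hf2
  -- a linear factor `X + a` would make `2 + a` and `-2 + a` units
  · have h3 : f = X + C (f.coeff 0) := hfm.eq_X_add_C hf1.symm
    have hu : ∀ x, IsUnit (Ψ.eval x) → IsUnit (x + f.coeff 0) := by
      intro x hx
      refine isUnit_of_dvd_unit ?_ hx
      rw [hfg, eval_mul, eval_pow]
      have : f.eval x = x + f.coeff 0 := by conv_lhs => rw [h3]; simp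
      rw [← this]
      exact (dvd_pow_self _ two_ne_zero).mul_right _
    have h4 := Int.isUnit_iff.1 (hu 2 h2)
    have h5 := Int.isUnit_iff.1 (hu (-2) h2')
    omega
  · have hcard := card_rootsOff_add hgm
    -- `g` has degree at most `7`, but the sign pattern of `Φ` and `g` requires eight roots
    have := (h.of_sq_mul hfg).eight_le_card hΦ hΦ_deg hgm (by omega)
    omega

/-- For a sign pattern the three configurations are told apart by the roots of `Φ` that are `≥ 2`. -/
theorem configs (hΦ : Φ.Monic) (hΦ_deg : Φ.natDegree = 10) (hΨ : Ψ.Monic)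
    (hΨ_deg : Ψ.natDegree = 11) :
    (ConfigE Φ Ψ ↔ (rootsGtTwo Φ).card = 0 ∧ Φ.eval 2 ≠ 0) ∧
    (ConfigP Φ Ψ ↔ Φ.eval 2 = 0) ∧ (ConfigH Φ Ψ ↔ (rootsGtTwo Φ).card = 1) := by
  have hoff := card_rootsOff_add hΨ
  rw [hΨ_deg] at hoff
  have hon := h.card_rootsOn_add hΦ
  rw [hΦ_deg] at hon
  have h2 : Φ.eval 2 = 0 → (rootsGtTwo Φ).card = 0 := fun h0 =>
    h.card_rootsGtTwo_eq_zero (by rw [aeval_two_eq, h0]; simp)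
  have hEP : MatchesEP Φ Ψ ↔ (rootsGtTwo Φ).card = 0 := by
    constructor
    · rintro ⟨T, k, hT⟩
      have := hT.card_Aon
      omega
    · intro h0
      obtain ⟨T, k, h3, -⟩ := h.exists_entry hΦ hΦ_deg hΨ (by omega)
      refine ⟨T, k, ?_⟩
      rw [show (rootsOff Ψ).card = 11 - (rootsOn Ψ).card by omega]
      exact h3 h0
  have hHyp : MatchesHyp Φ Ψ ↔ (rootsGtTwo Φ).card = 1 := by
    constructor
    · rintro ⟨T, k, hT⟩
      exact hT.aGt_eq
    · intro h0
      obtain ⟨T, k, -, h3⟩ := h.exists_entry hΦ hΦ_deg hΨ (by omega)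
      refine ⟨T, k, ?_⟩
      rw [show (rootsOff Ψ).card = 11 - (rootsOn Ψ).card by omega, h0]
      exact h3 h0
  rw [ConfigE, ConfigP, ConfigH, hEP, hHyp]
  refine ⟨Iff.rfl, ⟨fun h => h.2, fun h => ⟨h2 h, h⟩⟩, ⟨fun h => h.1, fun h => ⟨h, fun h0 => ?_⟩⟩⟩
  rw [h2 h0] at h
  omega

/-- The number `τ` of a sign pattern is where the tables say. -/
theorem location (hΦ : Φ.Monic) (hΨ : Ψ.Monic) (hs : SimpleRoots Ψ)
    (T : TraceClusters (rootsOn Φ) (rootsOn Ψ)) (k : ℕ) (hΦ_deg : Φ.natDegree = 10) :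
    (T.EPEntry (rootsOff Ψ).card k → T.EPLocation τ k) ∧
    (T.HypEntry (rootsGtTwo Φ).card (rootsOff Ψ).card k → T.HypLocation τ k) := by
  have hp := h.isParity hΦ hΨ
  have hon := h.card_rootsOn_add hΦ
  constructor
  · intro hT
    obtain ⟨τ', h1, h2⟩ := hT.exists_isParity h.simple.nodup_rootsOn hs.nodup_rootsOn
    have h3 : (rootsGtTwo Φ).card = 0 := by
      have := hT.card_Aon
      omega
    rw [h3] at hp
    rwa [hp.unique h1]
  · intro hT
    have h3 := hT.aGt_eq
    rw [h3] at hT hp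
    obtain ⟨τ', h1, h2⟩ := hT.exists_isParity h.simple.nodup_rootsOn hs.nodup_rootsOn
    rwa [hp.unique h1]

end IsPattern

/-- The parity pattern on the trace clusters gives the sign pattern. -/
theorem isPattern_of_isParity {Φ Ψ : ℤ[X]} (hΦ : Φ.Monic) (hΨ : Ψ.Monic)
    (hΦ2 : Φ.eval (-2) ≠ 0) (hs : SimpleRoots Φ)
    (hon : (rootsOn Φ).card + (rootsGtTwo Φ).card = Φ.natDegree)
    (hgt : (rootsGtTwo Φ).card = 0 ∨ (rootsGtTwo Φ).card = 1 ∧ Φ.eval 2 ≠ 0)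
    (hdisj : ∀ w : ℝ, aeval w Φ = 0 → aeval w Ψ ≠ 0) {c τ : ℝ} (hc : 0 < c * aeval (2 : ℝ) Ψ)
    (h2 : aeval (-2 : ℝ) Ψ ≠ 0)
    (hp : IsParity (rootsGtTwo Φ).card (rootsOn Φ) (rootsOn Ψ) τ) : IsPattern Φ Ψ c τ := by
  classical
  have h2' : aeval (2 : ℝ) Ψ ≠ 0 := fun h0 => by simp [h0] at hc
  have hc0 : c ≠ 0 := fun h0 => by simp [h0] at hc
  have hcc : 0 < c ^ 2 := by positivity
  have hab : ∀ f : ℤ[X], f.Monic → above (rootsOn f) 2 = 0 := fun f hf =>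
    above_eq_zero.2 fun a ha => ((mem_rootsOn hf).1 ha).2.2
  have hreal : ∀ z ∈ Φ.aroots ℂ, OnInterval z ∨ z.im = 0 ∧ 2 < z.re := by
    have hnot := card_rootsOff_add hΦ
    -- no root of `Φ` is off `[-2, 2]` but in `(2, ∞)`
    have h3 : rootsGtTwo Φ = rootsOff Φ := by
      refine Multiset.eq_of_le_of_card_le (Multiset.monotone_filter_right _ fun z hz h3 => ?_)
        (by omega)
      exact absurd h3.2.2 (not_le.2 hz.2)
    intro z hz
    by_contra hcon
    rw [not_or] at hcon
    have h4 : z ∈ rootsOff Φ := Multiset.mem_filter.2 ⟨hz, hcon.1⟩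
    rw [← h3] at h4
    exact hcon.2 (Multiset.mem_filter.1 h4).2
  have hneg2 : ∀ w : ℝ, aeval w Φ = 0 → w ≠ -2 := by
    rintro w hw rfl
    rw [aeval_neg_two_eq] at hw
    exact hΦ2 (by exact_mod_cast hw)
  have hre : ∀ z : ℂ, aeval z Φ = 0 → z.im = 0 ∧ -2 < z.re := by
    intro z hz
    have him : z.im = 0 := by
      rcases hreal z (mem_aroots.2 ⟨hΦ.ne_zero, hz⟩) with h | h
      · exact h.1
      · exact h.1
    refine ⟨him, ?_⟩
    rcases hreal z (mem_aroots.2 ⟨hΦ.ne_zero, hz⟩) with h | h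
    · refine lt_of_le_of_ne h.2.1 (Ne.symm (hneg2 _ ?_))
      rw [← Complex.ofReal_eq_zero, ← aeval_ofReal, ← hz]
      congr 2
      exact Complex.ext rfl him.symm
    · linarith [h.2]
  have hgt2 : ∀ x : ℝ, aeval x Φ = 0 → 2 < x → (x : ℂ) ∈ rootsGtTwo Φ := fun x hx hx2 =>
    Multiset.mem_filter.2 ⟨mem_aroots.2 ⟨hΦ.ne_zero, by rw [aeval_ofReal, hx]; simp⟩,
      Complex.ofReal_im x, hx2⟩
  have key : ∀ w, c ^ 2 * (aeval (2 : ℝ) Ψ * (aeval w (derivative Φ) * aeval w Ψ)) =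
      c * aeval (2 : ℝ) Ψ * (c * (aeval w (derivative Φ) * aeval w Ψ)) := fun w => by ring
  obtain ⟨hτ0, hτ1, hτ2⟩ := (mem_rootsOn hΦ).1 hp.mem
  have hτ := (hp.odd_iff τ hp.mem).2 rfl
  have hd : ∀ w : ℝ, aeval w Φ = 0 → aeval w (derivative Φ) ≠ 0 := by
    intro w hw h0
    have := hs.derivative_ne_zero hΦ (z := w) (by rw [aeval_ofReal, hw]; simp)
    rw [aeval_ofReal, h0] at this
    simp at this
  refine ⟨hre, hs, fun x y hx hy hx2 hy2 => ?_, lt_of_le_of_ne hτ1 (hneg2 τ hτ0).symm,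
    lt_of_le_of_ne hτ2 ?_, hτ0, ?_, fun w hw hw2 hne => ?_, hc, ?_⟩
  · rcases hgt with h0 | ⟨h1, h0⟩
    · have h3 : ∀ x : ℝ, aeval x Φ = 0 → 2 ≤ x → x = 2 := by
        intro x hx hx2
        by_contra hne
        have := hgt2 x hx (lt_of_le_of_ne hx2 (Ne.symm hne))
        rw [Multiset.card_eq_zero.1 h0] at this
        simp at this
      rw [h3 x hx hx2, h3 y hy hy2]
    · have h3 : ∀ x : ℝ, aeval x Φ = 0 → 2 ≤ x → 2 < x := by
        intro x hx hx2
        refine lt_of_le_of_ne hx2 ?_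
        rintro rfl
        rw [aeval_two_eq] at hx
        exact h0 (by exact_mod_cast hx)
      obtain ⟨z, hz⟩ := Multiset.card_eq_one.1 h1
      have hx' := hgt2 x hx (h3 x hx hx2)
      have hy' := hgt2 y hy (h3 y hy hy2)
      rw [hz, Multiset.mem_singleton] at hx' hy'
      exact Complex.ofReal_injective (hx'.trans hy'.symm)
  · rintro rfl
    rw [hab Φ hΦ, hab Ψ hΨ] at hτ
    rcases hgt with h0 | ⟨h1, h0⟩
    · rw [h0] at hτ
      omega
    · rw [aeval_two_eq] at hτ0
      exact h0 (by exact_mod_cast hτ0)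
  · have h3 := (neg_one_pow_neg_iff (sign_parity hΦ hΨ hτ1 hτ2 hτ0 (hd τ hτ0) (hdisj τ hτ0) h2')).2 hτ
    have h4 := mul_neg_of_pos_of_neg hcc h3
    rw [key] at h4
    exact neg_of_mul_neg_right h4 hc.le
  · have hw1 : -2 ≤ w := by
      have := (hre w (by rw [aeval_ofReal, hw]; simp)).2
      rw [Complex.ofReal_re] at this
      exact this.le
    have h3 := (hp.odd_iff w ((mem_rootsOn hΦ).2 ⟨hw, hw1, hw2.le⟩)).not.2 hne
    have h4 := (neg_one_pow_pos_iff (sign_parity hΦ hΨ hw1 hw2.le hw (hd w hw) (hdisj w hw) h2')).2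
      (by omega)
    have h5 := mul_pos hcc h4
    rw [key] at h5
    exact pos_of_mul_pos_right h5 hc.le
  · have h3 := mul_pos hcc ((eval_neg_two_pos_iff hΨ h2' h2).2 hp.even)
    rw [show c ^ 2 * (aeval (2 : ℝ) Ψ * aeval (-2 : ℝ) Ψ) =
      c * aeval (2 : ℝ) Ψ * (c * aeval (-2 : ℝ) Ψ) by ring] at h3
    exact pos_of_mul_pos_right h3 hc.le

/-- The configurations (E), (P), (H) give a sign pattern. -/
theorem exists_isPattern_of_config {Φ Ψ : ℤ[X]} (hΦ : Φ.Monic) (hΦ_deg : Φ.natDegree = 10)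
    (hΨ : Ψ.Monic) (hΦ2 : Φ.eval (-2) ≠ 0) (hs : SimpleRoots Φ) (hs' : SimpleRoots Ψ)
    (hdisj : ∀ w : ℝ, aeval w Φ = 0 → aeval w Ψ ≠ 0) {c : ℝ} (hc : 0 < c * aeval (2 : ℝ) Ψ)
    (h2 : aeval (-2 : ℝ) Ψ ≠ 0) (h : ConfigE Φ Ψ ∨ ConfigP Φ Ψ ∨ ConfigH Φ Ψ) :
    ∃ τ, IsPattern Φ Ψ c τ := by
  have hle : (rootsGtTwo Φ).card ≤ (rootsOff Φ).card := by
    classical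
    refine Multiset.card_le_card (Multiset.monotone_filter_right _ fun z hz h3 => ?_)
    exact absurd h3.2.2 (not_le.2 hz.2)
  have hnot := card_rootsOff_add hΦ
  have hEP : MatchesEP Φ Ψ → ∃ τ, IsPattern Φ Ψ c τ := by
    rintro ⟨T, k, hT⟩
    obtain ⟨τ, hτ, -⟩ := hT.exists_isParity hs.nodup_rootsOn hs'.nodup_rootsOn
    have h3 := hT.card_Aon
    have h4 : (rootsGtTwo Φ).card = 0 := by omega
    exact ⟨τ, isPattern_of_isParity hΦ hΨ hΦ2 hs (by omega) (.inl h4) hdisj hc h2 (h4 ▸ hτ)⟩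
  rcases h with h | h | ⟨⟨T, k, hT⟩, h⟩
  · exact hEP h.1
  · exact hEP h.1
  · have h4 := hT.aGt_eq
    rw [h4] at hT
    obtain ⟨τ, hτ, -⟩ := hT.exists_isParity hs.nodup_rootsOn hs'.nodup_rootsOn
    have h3 := hT.card_Aon
    exact ⟨τ, isPattern_of_isParity hΦ hΨ hΦ2 hs (by omega) (.inr ⟨h4, h⟩) hdisj hc h2 (h4 ▸ hτ)⟩

/-! ### Hodge structures and their time cones -/

section Parts
variable {n : ℕ} {G : Matrix (Fin n) (Fin n) ℚ}

/-- The real part of a complex vector. -/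
def rePart (z : Fin n → ℂ) : Fin n → ℝ := fun i => (z i).re

/-- The imaginary part of a complex vector. -/
def imPart (z : Fin n → ℂ) : Fin n → ℝ := fun i => (z i).im

theorem toC_add (x y : Fin n → ℝ) : toC (x + y) = toC x + toC y := by
  ext i; simp [toC]

theorem toC_smul (a : ℝ) (x : Fin n → ℝ) : toC (a • x) = (a : ℂ) • toC x := by
  ext i; simp [toC]

theorem toC_injective : Function.Injective (toC (n := n)) := fun x y h => by
  ext i
  exact Complex.ofReal_injective (congrFun h i)

theorem toC_rePart_add (z : Fin n → ℂ) : toC (rePart z) + Complex.I • toC (imPart z) = z := by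
  ext i
  simp only [toC, rePart, imPart, Pi.add_apply, Pi.smul_apply, smul_eq_mul]
  rw [mul_comm]
  exact Complex.re_add_im (z i)

theorem toC_rePart (z : Fin n → ℂ) : toC (rePart z) = (1 / 2 : ℂ) • (z + star z) := by
  ext i
  simp only [toC, rePart, Pi.add_apply, Pi.smul_apply, Pi.star_apply, smul_eq_mul, RCLike.star_def,
    Complex.add_conj]
  push_cast
  ring

theorem toC_imPart (z : Fin n → ℂ) :
    toC (imPart z) = (-Complex.I / 2) • (z + -star z) := by
  ext i
  simp only [toC, imPart, Pi.add_apply, Pi.neg_apply, Pi.smul_apply, Pi.star_apply, smul_eq_mul,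
    RCLike.star_def]
  rw [← sub_eq_add_neg, Complex.sub_conj]
  push_cast
  linear_combination ((z i).im : ℂ) * Complex.I_sq

theorem re_herm_eq_add (hG : G.IsSymm) (z : Fin n → ℂ) :
    (herm G z z).re = herm G (rePart z) (rePart z) + herm G (imPart z) (imPart z) := by
  have h1 := herm_comm hG (rePart z) (imPart z)
  rw [star_trivial] at h1
  conv_lhs => rw [← toC_rePart_add z]
  simp only [herm_add_left, herm_add_right, herm_smul_left, herm_smul_right, herm_toC, h1]
  simp

end Parts

namespace HodgeStructure

variable {n : ℕ} {G : Matrix (Fin n) (Fin n) ℚ} (H : HodgeStructure G)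

theorem mem_timeCone {v : Fin n → ℝ} : v ∈ H.timeCone ↔ toC v ∈ H.H11 ∧ 0 < herm G v v := Iff.rfl

theorem toC_rePart_mem {z : Fin n → ℂ} (hz : z ∈ H.H11) : toC (rePart z) ∈ H.H11 := by
  rw [toC_rePart]
  exact H.H11.smul_mem _ (H.H11.add_mem hz ((H.conj_11 z).2 hz))

theorem toC_imPart_mem {z : Fin n → ℂ} (hz : z ∈ H.H11) : toC (imPart z) ∈ H.H11 := by
  rw [toC_imPart]
  exact H.H11.smul_mem _ (H.H11.add_mem hz (H.H11.neg_mem ((H.conj_11 z).2 hz)))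

theorem timeCone_nonempty (hG : G.IsSymm) : H.timeCone.Nonempty := by
  obtain ⟨P, N, h1, -, -, h4, -, h6, -⟩ := H.sign_11
  obtain ⟨z, hz, hz0⟩ := Submodule.exists_mem_ne_zero_of_ne_bot
    (fun h => by rw [h, finrank_bot] at h6; omega : P ≠ ⊥)
  have hzH : z ∈ H.H11 := h1 ▸ Submodule.mem_sup_left hz
  have hpos := h4 z hz hz0
  change 0 < (herm G z z).re at hpos
  rw [re_herm_eq_add hG] at hpos
  by_cases h : 0 < herm G (rePart z) (rePart z)
  · exact ⟨_, H.toC_rePart_mem hzH, h⟩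
  · exact ⟨_, H.toC_imPart_mem hzH, by linarith⟩

section Causal

variable (hG : G.IsSymm) {x : Fin n → ℝ} (hx : toC x ∈ H.H11) (hx0 : x ≠ 0)
  (hxx : 0 ≤ herm G x x)
include hG hx hx0 hxx

/-- A causal vector is not orthogonal to a time-like vector. -/
theorem herm_ne_zero {y : Fin n → ℝ} (hy : y ∈ H.timeCone) : herm G x y ≠ 0 := by
  intro hxy
  refine H.sign_11.not_linearIndependent hG hx hy.1 (y := toC y)
    (by rw [herm_toC, hxy]; simp) (by rw [herm_toC]; simpa using hxx)
    (by rw [herm_toC]; simpa using hy.2.le) ?_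
  rw [LinearIndependent.pair_iff]
  intro a b hab
  have h1 := congrArg (herm G (toC y)) hab
  rw [herm_add_right, herm_smul_right, herm_smul_right, herm_zero_right, herm_toC, herm_toC,
    herm_eq_zero_comm hG hxy, Complex.ofReal_zero, mul_zero, zero_add, mul_eq_zero] at h1
  have hb : b = 0 := h1.resolve_right (by exact_mod_cast hy.2.ne')
  rw [hb, zero_smul, add_zero, smul_eq_zero] at hab
  exact ⟨hab.resolve_right (toC_ne_zero hx0), hb⟩

omit hG hx0 hxx hx in
theorem continuous_herm (x : Fin n → ℝ) : Continuous fun y => herm G x y := by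
  unfold herm
  exact Continuous.dotProduct continuous_const (continuous_const.matrix_mulVec continuous_id)

/-- The part of the time cone on which the pairing with a causal vector has the sign of `σ`. -/
theorem isPreconnected_halfCone (σ : ℝ) :
    IsPreconnected {y | y ∈ H.timeCone ∧ 0 < σ * herm G x y} := by
  refine Convex.isPreconnected ?_
  rw [convex_iff_forall_pos]
  rintro y ⟨hy, hσy⟩ z ⟨hz, hσz⟩ a b ha hb -
  -- two such vectors have a positive product, as `(x, z) y - (x, y) z` is orthogonal to `x`
  have hyz : 0 < herm G y z := by
    by_contra hle
    rw [not_lt] at hle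
    have hprod : 0 < herm G x y * herm G x z := by
      have : 0 < σ ^ 2 * (herm G x y * herm G x z) := by
        have := mul_pos hσy hσz
        nlinarith
      exact pos_of_mul_pos_right this (sq_nonneg σ)
    have hzy : herm G z y = herm G y z := by simpa using herm_comm hG y z
    set u : Fin n → ℝ := herm G x z • y + (-herm G x y) • z with hu
    refine H.herm_ne_zero hG hx hx0 hxx (y := u) ⟨?_, ?_⟩ ?_
    · change toC u ∈ H.H11
      rw [hu, toC_add, toC_smul, toC_smul]
      exact H.H11.add_mem (H.H11.smul_mem _ hy.1) (H.H11.smul_mem _ hz.1)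
    · rw [hu]
      simp only [herm_add_left, herm_add_right, herm_smul_left, herm_smul_right, hzy, star_trivial]
      have hxz0 : 0 < herm G x z ^ 2 := by
        have : herm G x z ≠ 0 := fun h => by simp [h] at hprod
        positivity
      have h1 := mul_pos hxz0 hy.2
      have h2 := mul_nonneg (sq_nonneg (herm G x y)) hz.2.le
      have h3 := mul_nonneg hprod.le (neg_nonneg.2 hle)
      nlinarith
    · rw [hu, herm_add_right, herm_smul_right, herm_smul_right]
      ring
  refine ⟨⟨?_, ?_⟩, ?_⟩
  · change toC (a • y + b • z) ∈ H.H11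
    rw [toC_add, toC_smul, toC_smul]
    exact H.H11.add_mem (H.H11.smul_mem _ hy.1) (H.H11.smul_mem _ hz.1)
  · have hzy : herm G z y = herm G y z := by simpa using herm_comm hG y z
    simp only [herm_add_left, herm_add_right, herm_smul_left, herm_smul_right, hzy, star_trivial]
    have h1 := mul_pos (mul_pos ha ha) hy.2
    have h2 := mul_pos (mul_pos hb hb) hz.2
    have h3 := mul_pos (mul_pos ha hb) hyz
    nlinarith
  · rw [herm_add_right, herm_smul_right, herm_smul_right]
    have h1 := mul_pos ha hσy
    have h2 := mul_pos hb hσz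
    nlinarith

/-- The components of the time cone are cut out by the sign of the pairing with a causal vector. -/
theorem connectedComponentIn_eq {v : Fin n → ℝ} (hv : v ∈ H.timeCone) :
    connectedComponentIn H.timeCone v =
      {y | y ∈ H.timeCone ∧ 0 < herm G x v * herm G x y} := by
  have hne : ∀ y ∈ H.timeCone, herm G x y ≠ 0 := fun y hy => H.herm_ne_zero hG hx hx0 hxx hy
  apply Set.Subset.antisymm
  · intro y hy
    have hyC := connectedComponentIn_subset _ _ hy
    refine ⟨hyC, ?_⟩
    by_contra hle
    have hpre := (isPreconnected_connectedComponentIn (F := H.timeCone) (x := v)).image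
      (fun y => herm G x v * herm G x y)
      (continuous_const.mul (continuous_herm x)).continuousOn
    have hvm : v ∈ connectedComponentIn H.timeCone v := mem_connectedComponentIn hv
    have h0 := hpre.ordConnected.out (Set.mem_image_of_mem _ hy) (Set.mem_image_of_mem _ hvm)
      ⟨not_lt.1 hle, mul_self_nonneg _⟩
    obtain ⟨w, hw, hw0⟩ := h0
    exact mul_ne_zero (hne v hv) (hne w (connectedComponentIn_subset _ _ hw)) hw0
  · exact (H.isPreconnected_halfCone hG hx hx0 hxx _).subset_connectedComponentIn
      ⟨hv, mul_self_pos.2 (hne v hv)⟩ fun y hy => hy.1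

/-- The eigenvalue of a causal eigenvector of a positive Hodge isometry is positive. -/
theorem eigenvalue_pos {L : Submodule ℤ (Fin n → ℚ)} {F : Matrix (Fin n) (Fin n) ℚ}
    (hF : H.IsPositiveHodgeIsometry L F) {a : ℝ} (ha : extendScalars ℝ F *ᵥ x = a • x) :
    0 < a := by
  obtain ⟨v, hv⟩ := H.timeCone_nonempty hG
  have h1 := hF.2 _ ⟨v, hv, rfl⟩
  have h2 : extendScalars ℝ F *ᵥ v ∈ connectedComponentIn H.timeCone v := by
    rw [← h1]
    exact ⟨v, mem_connectedComponentIn hv, rfl⟩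
  rw [H.connectedComponentIn_eq hG hx hx0 hxx hv] at h2
  have h3 := extendScalars_isom hF.1.2.1 x v
  rw [ha, herm_smul_left, star_trivial] at h3
  have h4 := h2.2
  rw [← h3, mul_assoc] at h4
  exact pos_of_mul_pos_left h4 (mul_self_nonneg _)

/-- A Hodge isometry with a causal eigenvector of positive eigenvalue is positive. -/
theorem isPositive {L : Submodule ℤ (Fin n → ℚ)} {F F' : Matrix (Fin n) (Fin n) ℚ}
    (hF : H.IsHodgeIsometry L F) {a : ℝ} (ha : extendScalars ℝ F *ᵥ x = a • x) (ha0 : 0 < a)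
    (hFF' : F * F' = 1) : H.IsPositiveHodgeIsometry L F := by
  refine ⟨hF, ?_⟩
  rintro _ ⟨v, hv, rfl⟩
  rw [H.connectedComponentIn_eq hG hx hx0 hxx hv]
  have hiso := extendScalars_isom (𝕜 := ℝ) hF.2.1
  have hmul : ∀ y, extendScalars ℝ F *ᵥ (extendScalars ℝ F' *ᵥ y) = y := by
    intro y
    rw [Matrix.mulVec_mulVec]
    have h1 : extendScalars ℝ F * extendScalars ℝ F' = extendScalars ℝ (F * F') :=
      (Matrix.map_mul (f := Rat.castHom ℝ)).symm
    rw [h1, hFF']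
    have : extendScalars ℝ (1 : Matrix (Fin n) (Fin n) ℚ) = 1 := by
      unfold extendScalars
      exact Matrix.map_one _ (by simp) (by simp)
    rw [this, Matrix.one_mulVec]
  have hinj : Function.Injective fun z : Fin n → ℂ => extendScalars ℂ F *ᵥ z := by
    have h1 : F' * F = 1 := mul_eq_one_comm.1 hFF'
    have h2 : extendScalars ℂ F' * extendScalars ℂ F = 1 := by
      have h3 : extendScalars ℂ F' * extendScalars ℂ F = extendScalars ℂ (F' * F) :=
        (Matrix.map_mul (f := Rat.castHom ℂ)).symm
      rw [h3, h1]
      unfold extendScalars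
      exact Matrix.map_one _ (by simp) (by simp)
    intro y z hyz
    have := congrArg (fun w => extendScalars ℂ F' *ᵥ w) hyz
    simpa [Matrix.mulVec_mulVec, h2] using this
  have key : ∀ y, y ∈ {y | y ∈ H.timeCone ∧ 0 < herm G x v * herm G x y} ↔
      extendScalars ℝ F *ᵥ y ∈ {y | y ∈ H.timeCone ∧ 0 < herm G x v * herm G x y} := by
    intro y
    have h3 := hiso x y
    rw [ha, herm_smul_left, star_trivial] at h3
    have h4 : toC y ∈ H.H11 ↔ toC (extendScalars ℝ F *ᵥ y) ∈ H.H11 := by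
      rw [← extendScalars_mulVec_toC]
      constructor
      · intro h
        rw [← hF.2.2.2.1]
        exact ⟨_, h, rfl⟩
      · intro h
        rw [← hF.2.2.2.1] at h
        obtain ⟨z, hz, hz'⟩ := h
        rwa [← hinj hz']
    simp only [Set.mem_ofPred_eq, mem_timeCone, hiso, ← h4]
    rw [← h3, mul_left_comm, mul_pos_iff_of_pos_left ha0]
  ext y
  constructor
  · rintro ⟨z, hz, rfl⟩
    exact (key z).1 hz
  · intro hy
    exact ⟨extendScalars ℝ F' *ᵥ y, (key _).2 (by rwa [hmul]), hmul y⟩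

end Causal

end HodgeStructure

/-! ### The sign pattern of a positive Hodge isometry -/

/-- The reciprocal polynomial of degree `2 n` with trace polynomial `Q`. -/
theorem exists_eval_eq_pow_mul {Q : ℂ[X]} {n : ℕ} (hQ : Q.natDegree ≤ n) :
    ∃ Q' : ℂ[X], ∀ z : ℂ, z ≠ 0 → Q'.eval z = z ^ n * Q.eval (z + z⁻¹) := by
  refine ⟨∑ i ∈ Finset.range (n + 1), C (Q.coeff i) * (X ^ 2 + 1) ^ i * X ^ (n - i), fun z hz => ?_⟩
  rw [eval_eq_sum_range' (Nat.lt_succ_of_le hQ), eval_finsetSum, Finset.mul_sum]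
  refine Finset.sum_congr rfl fun i hi => ?_
  have hin : i ≤ n := by rw [Finset.mem_range] at hi; omega
  have h2 : z + z⁻¹ = (z ^ 2 + 1) / z := by field_simp
  simp only [eval_mul, eval_C, eval_pow, eval_add, eval_X, eval_one]
  rw [h2, div_pow]
  have h3 : z ^ n = z ^ (n - i) * z ^ i := by rw [← pow_add]; congr 1; omega
  rw [h3]
  field_simp

/-- Two roots of the trace polynomial, with multiplicity, give four roots of `φ`. -/
theorem IsTracePair.dvd_of_mul_dvd {φ ψ Φ Ψ : ℤ[X]} (t : IsTracePair φ ψ Φ Ψ) {w₁ w₂ α β : ℂ}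
    (hd : (X - C w₁) * (X - C w₂) ∣ cpoly Φ) (hα : α ≠ 0) (hβ : β ≠ 0) (hw₁ : α + α⁻¹ = w₁)
    (hw₂ : β + β⁻¹ = w₂) :
    (X - C α) * (X - C α⁻¹) * ((X - C β) * (X - C β⁻¹)) ∣ cpoly φ := by
  obtain ⟨Q, hQ⟩ := hd
  have hm : (cpoly Φ).Monic := t.monic_left.map _
  have hQm : Q.Monic :=
    ((monic_X_sub_C w₁).mul (monic_X_sub_C w₂)).of_mul_monic_left (hQ ▸ hm)
  have hQd : Q.natDegree = 8 := by
    have h1 : (cpoly Φ).natDegree = 10 := (t.monic_left.natDegree_map _).trans t.deg_left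
    rw [hQ, ((monic_X_sub_C w₁).mul (monic_X_sub_C w₂)).natDegree_mul hQm,
      (monic_X_sub_C w₁).natDegree_mul (monic_X_sub_C w₂), natDegree_X_sub_C, natDegree_X_sub_C] at h1
    omega
  obtain ⟨Q', hev⟩ := exists_eval_eq_pow_mul hQd.le
  refine ⟨(X ^ 2 - 1) * Q', eq_of_infinite_eval_eq _ _ ?_⟩
  refine (Set.finite_singleton (0 : ℂ)).infinite_compl.mono fun z hz => ?_
  have hz : z ≠ 0 := hz
  change (cpoly φ).eval z = _
  rw [eval_cpoly, t.eq_left z hz, ← eval_cpoly, hQ]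
  simp only [eval_mul, eval_sub, eval_X, eval_C, eval_pow, eval_one, hev z hz]
  rw [← hw₁, ← hw₂]
  field_simp
  ring

section Hodge

variable {φ ψ : ℤ[X]} {r : Fin 22 → ℚ} {G : Matrix (Fin 22) (Fin 22) ℚ} {c : ℝ}
  (h : IsSpectral φ ψ r G c) (H : HodgeStructure G)

/-- `δ` is the eigenvalue of `A` on `H20`, which is spanned by the eigenvector of `δ`. -/
structure IsPeriod (φ : ℤ[X]) (r : Fin 22 → ℚ) {G : Matrix (Fin 22) (Fin 22) ℚ}
    (H : HodgeStructure G) (δ : ℂ) : Prop where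
  norm_eq : ‖δ‖ = 1
  im_ne : δ.im ≠ 0
  root : (cpoly φ).IsRoot δ
  H20_eq : H.H20 = Submodule.span ℂ {eigVec φ r δ}
  H02_eq : H.H02 = Submodule.span ℂ {eigVec φ r (starRingEnd ℂ δ)}
  pos : 0 < RCLike.re (herm G (eigVec φ r δ) (eigVec φ r δ))

include h in
theorem exists_isPeriod {L : Submodule ℤ (Fin 22 → ℚ)}
    (hF : H.IsHodgeIsometry L (companion 22 φ)) : ∃ δ, IsPeriod φ r H δ := by
  have h1 := H.sign_20.finrank_eq
  obtain ⟨⟨u, hu⟩, hu0, hspan⟩ := finrank_eq_one_iff'.1 h1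
  have hu0' : u ≠ 0 := fun h0 => hu0 (Subtype.ext h0)
  have hAu : cA φ *ᵥ u ∈ H.H20 := by
    rw [← hF.2.2.1]
    exact ⟨u, hu, rfl⟩
  obtain ⟨δ, hδ⟩ := hspan ⟨_, hAu⟩
  have hδ' : cA φ *ᵥ u = δ • u := (congrArg Subtype.val hδ).symm
  have hpos : 0 < RCLike.re (herm G u u) := by
    by_contra hle
    have := H.sign_20.finrank_le_of_nonpos (U := Submodule.span ℂ {u})
      ((Submodule.span_singleton_le_iff_mem _ _).2 hu) fun x hx => by
        obtain ⟨a, rfl⟩ := Submodule.mem_span_singleton.1 hx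
        rw [re_herm_smul]
        exact mul_nonpos_of_nonneg_of_nonpos (sq_nonneg _) (not_lt.1 hle)
    rw [finrank_span_singleton hu0'] at this
    omega
  have hn : ‖δ‖ = 1 := by
    have h2 := h.isom u u
    rw [hδ'] at h2
    have h3 := re_herm_smul (G := G) δ u
    rw [h2] at h3
    have h4 : ‖δ‖ ^ 2 = 1 := mul_right_cancel₀ hpos.ne' (by rw [one_mul]; exact h3.symm)
    exact (pow_eq_one_iff_of_nonneg (norm_nonneg δ) two_ne_zero).1 h4
  have hroot := h.isRoot_of_mulVec_eq hu0' hδ'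
  obtain ⟨a, ha⟩ := h.exists_smul_eigVec hroot hδ'
  have ha0 : a ≠ 0 := by rintro rfl; rw [zero_smul] at ha; exact hu0' ha
  have hvpos : 0 < RCLike.re (herm G (eigVec φ r δ) (eigVec φ r δ)) := by
    rw [ha, re_herm_smul] at hpos
    exact pos_of_mul_pos_right hpos (sq_nonneg _)
  have h20 : H.H20 = Submodule.span ℂ {eigVec φ r δ} := by
    ext x
    rw [Submodule.mem_span_singleton]
    constructor
    · intro hx
      obtain ⟨b, hb⟩ := hspan ⟨x, hx⟩
      refine ⟨b * a, ?_⟩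
      rw [← smul_smul, ← ha]
      exact congrArg Subtype.val hb
    · rintro ⟨b, rfl⟩
      have : eigVec φ r δ = a⁻¹ • u := by rw [ha, smul_smul, inv_mul_cancel₀ ha0, one_smul]
      rw [this]
      exact H.H20.smul_mem _ (H.H20.smul_mem _ hu)
  have h02 : H.H02 = Submodule.span ℂ {eigVec φ r (starRingEnd ℂ δ)} := by
    ext x
    rw [← H.conj_20, h20, Submodule.mem_span_singleton, Submodule.mem_span_singleton, ← star_eigVec]
    constructor
    · rintro ⟨b, hb⟩
      exact ⟨star b, by rw [← star_smul, hb, star_star]⟩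
    · rintro ⟨b, hb⟩
      exact ⟨star b, by rw [← hb, star_smul, star_star]⟩
  refine ⟨δ, hn, fun h0 => ?_, hroot, h20, h02, hvpos⟩
  rw [Complex.conj_eq_iff_im.2 h0, ← h20] at h02
  have hv : eigVec φ r δ ∈ H.H20 := h20 ▸ Submodule.mem_span_singleton_self _
  have := H.orth_20_02 _ hv _ (h02 ▸ hv)
  rw [this] at hvpos
  simp at hvpos

namespace IsPeriod

variable {H} {δ : ℂ} (hδ : IsPeriod φ r H δ)
include hδ

theorem mem_H20 : eigVec φ r δ ∈ H.H20 := hδ.H20_eq ▸ Submodule.mem_span_singleton_self _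

theorem mem_H02 : eigVec φ r (starRingEnd ℂ δ) ∈ H.H02 :=
  hδ.H02_eq ▸ Submodule.mem_span_singleton_self _

theorem herm_ne_zero : herm G (eigVec φ r δ) (eigVec φ r δ) ≠ 0 := fun h0 => by
  have := hδ.pos
  rw [h0] at this
  simp at this

theorem herm_conj_ne_zero : herm G (eigVec φ r (starRingEnd ℂ δ))
    (eigVec φ r (starRingEnd ℂ δ)) ≠ 0 := by
  rw [← star_eigVec, herm_star_star]
  exact star_ne_zero.2 hδ.herm_ne_zero

/-- `H11` is the orthogonal complement of `H20 + H02`. -/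
theorem mem_H11_iff (hG : G.IsSymm) {x : Fin 22 → ℂ} : x ∈ H.H11 ↔
    herm G (eigVec φ r δ) x = 0 ∧ herm G (eigVec φ r (starRingEnd ℂ δ)) x = 0 := by
  constructor
  · intro hx
    exact ⟨H.orth_20_11 _ hδ.mem_H20 _ hx, herm_eq_zero_comm hG (H.orth_11_02 _ hx _ hδ.mem_H02)⟩
  · rintro ⟨h1, h2⟩
    have hx : x ∈ H.H20 ⊔ H.H11 ⊔ H.H02 := H.sup_eq_top ▸ Submodule.mem_top
    obtain ⟨y, hy, z, hz, rfl⟩ := Submodule.mem_sup.1 hx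
    obtain ⟨a, ha, b, hb, rfl⟩ := Submodule.mem_sup.1 hy
    have h3 := H.orth_20_02 _ hδ.mem_H20 _ hz
    have h4 := H.orth_20_11 _ hδ.mem_H20 _ hb
    have h5 := herm_eq_zero_comm hG (H.orth_11_02 _ hb _ hδ.mem_H02)
    have h6 := herm_eq_zero_comm hG (H.orth_20_02 _ ha _ hδ.mem_H02)
    rw [herm_add_right, herm_add_right, h3, h4, add_zero, add_zero] at h1
    rw [herm_add_right, herm_add_right, h5, h6, add_zero, zero_add] at h2
    rw [hδ.H20_eq] at ha
    rw [hδ.H02_eq] at hz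
    obtain ⟨s, rfl⟩ := Submodule.mem_span_singleton.1 ha
    obtain ⟨t, rfl⟩ := Submodule.mem_span_singleton.1 hz
    rw [herm_smul_right] at h1 h2
    rw [(mul_eq_zero.1 h1).resolve_right hδ.herm_ne_zero,
      (mul_eq_zero.1 h2).resolve_right hδ.herm_conj_ne_zero, zero_smul, zero_smul, zero_add, add_zero]
    exact hb

theorem conj_root : (cpoly φ).IsRoot (starRingEnd ℂ δ) := isRoot_conj hδ.root

include h in
theorem mem_H11_of_aeval {k : ℂ[X]} (h1 : k.eval δ ≠ 0)
    (h2 : k.eval (starRingEnd ℂ δ) ≠ 0) {x : Fin 22 → ℂ} (hx : aeval (cA φ) k *ᵥ x = 0) :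
    x ∈ H.H11 := by
  have hn := hδ.norm_eq
  have key : ∀ α : ℂ, (cpoly φ).IsRoot α → ‖α‖ = 1 → k.eval α ≠ 0 →
      herm G (eigVec φ r α) x = 0 := by
    intro α hα hα1 hk
    obtain ⟨p, rfl⟩ := h.exists_polyVec_eq x
    have h3 : (starRingEnd ℂ α)⁻¹ = α := by rw [conj_eq_inv_of_norm_eq_one hα1, inv_inv]
    have h4 := h.herm_polyVec_right (h.root_ne_zero hα) (h.mulVec_eigVec hα) p
    have h5 := h.herm_polyVec_right (h.root_ne_zero hα) (h.mulVec_eigVec hα) (k * p)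
    rw [polyVec_mul, hx, herm_zero_right, h3, eval_mul, mul_assoc] at h5
    rw [h3] at h4
    rw [h4]
    exact (mul_eq_zero.1 h5.symm).resolve_left hk
  exact (hδ.mem_H11_iff h.symm).2 ⟨key δ hδ.root hn h1,
    key _ hδ.conj_root (by rw [RCLike.norm_conj]; exact hn) h2⟩

include h in
theorem mem_H11_of_eigen {α : ℂ} (h1 : α ≠ δ) (h2 : α ≠ starRingEnd ℂ δ)
    {x : Fin 22 → ℂ} (hx : cA φ *ᵥ x = α • x) : x ∈ H.H11 := by
  refine hδ.mem_H11_of_aeval h (k := X - C α) ?_ ?_ ?_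
  · rw [eval_sub, eval_X, eval_C]; exact sub_ne_zero.2 h1.symm
  · rw [eval_sub, eval_X, eval_C]; exact sub_ne_zero.2 h2.symm
  · rw [map_sub, aeval_X, aeval_C, Matrix.sub_mulVec, hx, Algebra.algebraMap_eq_smul_one,
      Matrix.smul_mulVec, Matrix.one_mulVec, sub_self]

include h in
/-- There is no isotropic plane in `H11`. -/
theorem not_dvd {α β : ℂ} (hα : α ≠ 0) (hβ : β ≠ 0)
    (h1 : α ≠ δ) (h1' : α ≠ starRingEnd ℂ δ) (h2 : β ≠ δ) (h2' : β ≠ starRingEnd ℂ δ) :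
    ¬ (X - C α) * (X - C β) * ((X - C (starRingEnd ℂ α)⁻¹) * (X - C (starRingEnd ℂ β)⁻¹)) ∣
      cpoly φ := by
  intro hd
  obtain ⟨x, y, hli, hxx, hxy, hyy, hx, hy⟩ := h.exists_isotropic_plane hα hβ hd
  have e1 : ((X - C α) * (X - C β)).eval δ ≠ 0 := by
    simp only [eval_mul, eval_sub, eval_X, eval_C]
    exact mul_ne_zero (sub_ne_zero.2 h1.symm) (sub_ne_zero.2 h2.symm)
  have e2 : ((X - C α) * (X - C β)).eval (starRingEnd ℂ δ) ≠ 0 := by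
    simp only [eval_mul, eval_sub, eval_X, eval_C]
    exact mul_ne_zero (sub_ne_zero.2 h1'.symm) (sub_ne_zero.2 h2'.symm)
  exact H.sign_11.not_linearIndependent h.symm (hδ.mem_H11_of_aeval h e1 e2 hx)
    (hδ.mem_H11_of_aeval h e1 e2 hy) hxy (by rw [hxx]; simp) (by rw [hyy]; simp) hli

end IsPeriod

end Hodge

theorem neg_of_mul_pos_of_neg {x y : ℝ} (hx : x < 0) (h : 0 < x * y) : y < 0 := by
  by_contra hy
  linarith [mul_nonpos_of_nonpos_of_nonneg hx.le (not_lt.1 hy)]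

theorem pos_of_mul_neg_of_neg {x y : ℝ} (hx : x < 0) (h : x * y < 0) : 0 < y := by
  by_contra hy
  linarith [mul_nonneg_of_nonpos_of_nonpos hx.le (not_lt.1 hy)]

theorem eq_one_or_neg_one_of_sq {α : ℂ} (h : α ^ 2 = 1) : α = 1 ∨ α = -1 := by
  have h1 : (α - 1) * (α + 1) = 0 := by linear_combination h
  rcases mul_eq_zero.1 h1 with h2 | h2
  · exact .inl (sub_eq_zero.1 h2)
  · exact .inr (eq_neg_of_add_eq_zero_left h2)

theorem ofReal_ne_of_im_ne {δ : ℂ} (h : δ.im ≠ 0) (x : ℝ) :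
    (x : ℂ) ≠ δ ∧ (x : ℂ) ≠ starRingEnd ℂ δ := by
  constructor
  · rintro rfl
    exact h (Complex.ofReal_im x)
  · intro h1
    have := congrArg Complex.im h1
    rw [Complex.ofReal_im, Complex.conj_im] at this
    exact h (by linarith)

/-- A real number of absolute value at least `2` is the trace of a real number of the same sign. -/
theorem exists_real_add_inv_eq {w : ℝ} (hw : 2 ≤ |w|) :
    ∃ a : ℝ, a ≠ 0 ∧ a + a⁻¹ = w ∧ (0 < a ↔ 0 < w) := by
  have h4 : 0 ≤ w ^ 2 - 4 := by
    have := sq_le_sq' (by linarith [abs_nonneg w]) hw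
    rw [sq_abs] at this
    linarith
  set s := Real.sqrt (w ^ 2 - 4) with hs
  have hss : s ^ 2 = w ^ 2 - 4 := Real.sq_sqrt h4
  have h1 : (w + s) / 2 * ((w - s) / 2) = 1 := by linear_combination (-1 / 4 : ℝ) * hss
  have h0 : (w + s) / 2 ≠ 0 := by intro h; rw [h, zero_mul] at h1; norm_num at h1
  refine ⟨(w + s) / 2, h0, ?_, ?_⟩
  · rw [inv_eq_of_mul_eq_one_right h1]; ring
  · have hs0 : 0 ≤ s := Real.sqrt_nonneg _
    have hsw : s ≤ |w| := by
      rw [← Real.sqrt_sq_eq_abs]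
      exact Real.sqrt_le_sqrt (by linarith)
    constructor
    · intro h
      by_contra hle
      rw [not_lt] at hle
      rw [abs_of_nonpos hle] at hsw
      linarith
    · intro h; linarith

theorem eigVec_ofReal_eq (φ : ℤ[X]) (r : Fin 22 → ℚ) (a : ℝ) :
    eigVec φ r (a : ℂ) = toC (rePart (eigVec φ r (a : ℂ))) :=
  eq_toC_of_star_eq (by rw [star_eigVec, Complex.conj_ofReal])

theorem IsSpectral.mulVec_rePart_eigVec {φ ψ : ℤ[X]} {r : Fin 22 → ℚ}
    {G : Matrix (Fin 22) (Fin 22) ℚ} {c : ℝ} (h : IsSpectral φ ψ r G c) {a : ℝ}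
    (ha : (cpoly φ).IsRoot (a : ℂ)) :
    extendScalars ℝ (companion 22 φ) *ᵥ rePart (eigVec φ r (a : ℂ)) =
      a • rePart (eigVec φ r (a : ℂ)) := by
  apply toC_injective
  rw [← extendScalars_mulVec_toC, toC_smul, ← eigVec_ofReal_eq]
  exact h.mulVec_eigVec ha

theorem IsSpectral.rePart_eigVec_ne_zero {φ ψ : ℤ[X]} {r : Fin 22 → ℚ}
    {G : Matrix (Fin 22) (Fin 22) ℚ} {c : ℝ} (h : IsSpectral φ ψ r G c) {a : ℝ}
    (ha : (cpoly φ).IsRoot (a : ℂ)) : rePart (eigVec φ r (a : ℂ)) ≠ 0 := by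
  intro h0
  apply h.eigVec_ne_zero ha
  rw [eigVec_ofReal_eq, h0]
  ext i
  simp [toC]

/-- Eigenvectors for real eigenvalues off the unit circle are isotropic. -/
theorem IsSpectral.herm_eigVec_real {φ ψ : ℤ[X]} {r : Fin 22 → ℚ}
    {G : Matrix (Fin 22) (Fin 22) ℚ} {c : ℝ} (h : IsSpectral φ ψ r G c) {a : ℝ}
    (ha : (cpoly φ).IsRoot (a : ℂ)) (ha2 : a ^ 2 ≠ 1) :
    herm G (eigVec φ r (a : ℂ)) (eigVec φ r (a : ℂ)) = 0 := by
  refine h.herm_eq_zero_of_eigen (h.root_ne_zero ha) ?_ (h.mulVec_eigVec ha) (h.mulVec_eigVec ha)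
  rw [Complex.conj_ofReal]
  intro h0
  apply ha2
  rw [sq]
  exact_mod_cast h0

theorem mul_dvd_cpoly_of_ne {Φ : ℤ[X]} {w₁ w₂ : ℂ} (h1 : aeval w₁ Φ = 0) (h2 : aeval w₂ Φ = 0)
    (hne : w₁ ≠ w₂) : (X - C w₁) * (X - C w₂) ∣ cpoly Φ := by
  refine IsCoprime.mul_dvd ?_ (dvd_iff_isRoot.2 ?_) (dvd_iff_isRoot.2 ?_)
  · exact isCoprime_X_sub_C_of_isUnit_sub (sub_ne_zero.2 hne).isUnit
  · rw [IsRoot, eval_cpoly, h1]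
  · rw [IsRoot, eval_cpoly, h2]

theorem mul_dvd_cpoly_of_derivative {Φ : ℤ[X]} {w : ℂ} (h1 : aeval w Φ = 0)
    (h2 : aeval w (derivative Φ) = 0) : (X - C w) * (X - C w) ∣ cpoly Φ := by
  obtain ⟨q, hq⟩ := dvd_iff_isRoot.2 (show (cpoly Φ).IsRoot w by rw [IsRoot, eval_cpoly, h1])
  have h3 : (derivative (cpoly Φ)).eval w = 0 := by
    rw [derivative_map, ← cpoly, eval_cpoly, h2]
  rw [hq] at h3 ⊢
  exact mul_dvd_mul_left _ (dvd_iff_isRoot.2 (by simpa using h3))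

section Forward

variable {φ ψ Φ Ψ : ℤ[X]} {r : Fin 22 → ℚ} {G : Matrix (Fin 22) (Fin 22) ℚ} {c : ℝ}
  {H : HodgeStructure G} {δ : ℂ}

theorem IsPeriod.add_inv (hδ : IsPeriod φ r H δ) : δ + δ⁻¹ = ((2 * δ.re : ℝ) : ℂ) :=
  add_inv_of_norm_eq_one hδ.norm_eq

theorem IsPeriod.abs_re_lt (hδ : IsPeriod φ r H δ) : |δ.re| < 1 := by
  have h1 := Complex.abs_re_lt_norm.2 hδ.im_ne
  rwa [hδ.norm_eq] at h1

theorem IsPeriod.aeval_eq_zero (hδ : IsPeriod φ r H δ) (t : IsTracePair φ ψ Φ Ψ) :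
    aeval (2 * δ.re) Φ = 0 := by
  have h0 : δ ≠ 0 := by rintro rfl; exact hδ.im_ne rfl
  rcases (t.isRoot_iff h0).1 hδ.root with h1 | h1
  · exfalso
    rcases eq_one_or_neg_one_of_sq h1 with h2 | h2
    all_goals exact hδ.im_ne (by rw [h2]; simp)
  · rw [hδ.add_inv, aeval_ofReal] at h1
    exact_mod_cast h1

/-- The numbers with the same trace as `δ` are `δ` and its conjugate. -/
theorem IsPeriod.ne_of_add_inv_ne (hδ : IsPeriod φ r H δ) {α : ℂ}
    (hne : α + α⁻¹ ≠ ((2 * δ.re : ℝ) : ℂ)) : α ≠ δ ∧ α ≠ starRingEnd ℂ δ := by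
  constructor
  · rintro rfl
    exact hne hδ.add_inv
  · rintro rfl
    rw [← map_inv₀, ← map_add, hδ.add_inv, Complex.conj_ofReal] at hne
    exact hne rfl

variable (h : IsSpectral φ ψ r G c) (t : IsTracePair φ ψ Φ Ψ) (hδ : IsPeriod φ r H δ)
include h t hδ

theorem IsPeriod.neg : c * (aeval (2 * δ.re) (derivative Φ) * aeval (2 * δ.re) Ψ) < 0 := by
  have h1 := t.herm_eigVec_circle h hδ.norm_eq hδ.add_inv (hδ.aeval_eq_zero t)
  have h2 := hδ.pos
  rw [h1] at h2
  change 0 < c * _ at h2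
  have h3 := abs_lt.1 hδ.abs_re_lt
  have h4 : (2 * δ.re) ^ 2 - 4 < 0 := by nlinarith
  rw [show c * (((2 * δ.re) ^ 2 - 4) * aeval (2 * δ.re) (derivative Φ) * aeval (2 * δ.re) Ψ) =
    ((2 * δ.re) ^ 2 - 4) * (c * (aeval (2 * δ.re) (derivative Φ) * aeval (2 * δ.re) Ψ)) by ring] at h2
  exact neg_of_mul_pos_of_neg h4 h2

theorem IsPeriod.not_dvd_trace {w : ℂ} (hw : w ≠ ((2 * δ.re : ℝ) : ℂ)) :
    ¬ (X - C w) * (X - C (starRingEnd ℂ w)) ∣ cpoly Φ := by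
  intro hd
  obtain ⟨α, hα, hαw⟩ := exists_add_inv_eq w
  have h1 := t.dvd_of_mul_dvd hd hα (β := (starRingEnd ℂ α)⁻¹) (by simpa using hα) hαw (by
    rw [← hαw, map_add, map_inv₀, inv_inv, add_comm])
  rw [inv_inv] at h1
  have h2 := hδ.ne_of_add_inv_ne (hαw ▸ hw : α + α⁻¹ ≠ _)
  have h3 := hδ.ne_of_add_inv_ne (α := α⁻¹) (by rw [inv_inv, add_comm, hαw]; exact hw)
  refine hδ.not_dvd h hα (inv_ne_zero hα) h2.1 h2.2 h3.1 h3.2 ?_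
  rwa [map_inv₀ (starRingEnd ℂ), inv_inv]

theorem IsPeriod.im_eq_zero {w : ℂ} (hw : aeval w Φ = 0) : w.im = 0 := by
  by_contra him
  refine hδ.not_dvd_trace h t (w := w) ?_ (mul_dvd_cpoly_of_ne hw ?_ ?_)
  · rintro rfl
    exact him (Complex.ofReal_im _)
  · rw [aeval_conj, hw, map_zero]
  · intro h1
    exact him (Complex.conj_eq_iff_im.1 h1.symm)

theorem IsPeriod.simpleRoots : SimpleRoots Φ := by
  refine simpleRoots_of_derivative_ne_zero t.monic_left fun w hw hw' => ?_
  have him := hδ.im_eq_zero h t hw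
  have hne : w ≠ ((2 * δ.re : ℝ) : ℂ) := by
    rintro rfl
    rw [aeval_ofReal, Complex.ofReal_eq_zero] at hw'
    have := hδ.neg h t
    simp [hw'] at this
  refine hδ.not_dvd_trace h t hne ?_
  rw [Complex.conj_eq_iff_im.2 him]
  exact mul_dvd_cpoly_of_derivative hw hw'

/-- There is at most one root of absolute value at least `2`. -/
theorem IsPeriod.eq_of_two_le_abs {x y : ℝ} (hx : aeval x Φ = 0) (hy : aeval y Φ = 0)
    (hx2 : 2 ≤ |x|) (hy2 : 2 ≤ |y|) : x = y := by
  by_contra hne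
  obtain ⟨a, ha, hax, -⟩ := exists_real_add_inv_eq hx2
  obtain ⟨b, hb, hby, -⟩ := exists_real_add_inv_eq hy2
  have hd := mul_dvd_cpoly_of_ne (Φ := Φ) (w₁ := x) (w₂ := y) (by rw [aeval_ofReal, hx]; simp)
    (by rw [aeval_ofReal, hy]; simp) (by exact_mod_cast hne)
  have h1 := t.dvd_of_mul_dvd hd (α := a) (β := b) (by exact_mod_cast ha) (by exact_mod_cast hb)
    (by rw [← hax]; push_cast; rfl) (by rw [← hby]; push_cast; rfl)
  obtain ⟨h2, h2'⟩ := ofReal_ne_of_im_ne hδ.im_ne a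
  obtain ⟨h3, h3'⟩ := ofReal_ne_of_im_ne hδ.im_ne b
  refine hδ.not_dvd h (α := a) (β := b) (by exact_mod_cast ha) (by exact_mod_cast hb) h2 h2' h3 h3' ?_
  rw [Complex.conj_ofReal, Complex.conj_ofReal]
  convert h1 using 1
  ring_nf

omit t in
/-- Eigenvectors for negative eigenvalues are space-like. -/
theorem IsPeriod.herm_neg_of_eigenvalue {L : Submodule ℤ (Fin 22 → ℚ)}
    (hF : H.IsPositiveHodgeIsometry L (companion 22 φ)) {a : ℝ} (ha : (cpoly φ).IsRoot (a : ℂ))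
    (ha0 : a ≤ 0) : RCLike.re (herm G (eigVec φ r (a : ℂ)) (eigVec φ r (a : ℂ))) < 0 := by
  by_contra hle
  obtain ⟨h2, h2'⟩ := ofReal_ne_of_im_ne hδ.im_ne a
  have hmem := hδ.mem_H11_of_eigen h h2 h2' (h.mulVec_eigVec ha)
  rw [eigVec_ofReal_eq] at hmem hle
  rw [herm_toC] at hle
  have := H.eigenvalue_pos h.symm hmem (h.rePart_eigVec_ne_zero ha) (not_lt.1 hle) hF
    (h.mulVec_rePart_eigVec ha)
  linarith

/-- A positive Hodge isometry gives a sign pattern. -/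
theorem IsPeriod.isPattern {L : Submodule ℤ (Fin 22 → ℚ)}
    (hF : H.IsPositiveHodgeIsometry L (companion 22 φ))
    (h2 : aeval (2 : ℝ) Ψ = aeval (-2 : ℝ) Ψ) : IsPattern Φ Ψ c (2 * δ.re) := by
  have hre := abs_lt.1 hδ.abs_re_lt
  have hroot : ∀ a w : ℝ, a ≠ 0 → a + a⁻¹ = w → aeval w Φ = 0 → (cpoly φ).IsRoot (a : ℂ) := by
    intro a w ha haw hw
    refine (t.isRoot_iff (by exact_mod_cast ha)).2 (.inr ?_)
    have : (a : ℂ) + (a : ℂ)⁻¹ = (w : ℂ) := by rw [← haw]; push_cast; rfl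
    rw [this, aeval_ofReal, hw, Complex.ofReal_zero]
  -- a root `w ≤ -2` would give a causal eigenvector with negative eigenvalue
  have hgt : ∀ w : ℝ, aeval w Φ = 0 → -2 < w := by
    intro w hw
    by_contra hle
    rw [not_lt] at hle
    obtain ⟨a, ha, haw, hsgn⟩ := exists_real_add_inv_eq (w := w) (by
      rw [abs_of_nonpos (by linarith)]; linarith)
    have ha0 : a ≤ 0 := by
      by_contra ha0
      have := hsgn.1 (not_le.1 ha0)
      linarith
    have h3 := hδ.herm_neg_of_eigenvalue h hF (hroot a w ha haw hw) ha0
    by_cases ha2 : a ^ 2 = 1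
    · have ha1 : a = -1 := by nlinarith
      have hw2 : w = -2 := by rw [← haw, ha1]; norm_num
      rw [ha1] at h3
      push_cast at h3
      rw [t.herm_eigVec_neg_one h, ← hw2, hw] at h3
      simp at h3
    · rw [h.herm_eigVec_real (hroot a w ha haw hw) ha2] at h3
      simp at h3
  have hreal : ∀ z : ℂ, aeval z Φ = 0 → z.im = 0 ∧ -2 < z.re := by
    intro z hz
    have him := hδ.im_eq_zero h t hz
    refine ⟨him, hgt _ ?_⟩
    rw [← Complex.ofReal_eq_zero, ← aeval_ofReal, ← hz]
    congr 2
    exact Complex.ext rfl him.symm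
  have hneg2 : 0 < c * aeval (-2 : ℝ) Ψ := by
    have h3 := hδ.herm_neg_of_eigenvalue h hF (a := -1) (by simpa using t.isRoot_neg_one)
      (by norm_num)
    push_cast at h3
    rw [t.herm_eigVec_neg_one h] at h3
    change c * _ < 0 at h3
    have h4 := eval_neg_two_pos t.monic_left (by rw [t.deg_left]) hreal
    have h6 : c * (-2 * aeval (-2 : ℝ) Φ * aeval (-2 : ℝ) Ψ) =
      -(2 * aeval (-2 : ℝ) Φ) * (c * aeval (-2 : ℝ) Ψ) := by ring
    rw [h6] at h3
    exact pos_of_mul_neg_of_neg (by linarith) h3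
  refine ⟨hreal, hδ.simpleRoots h t, fun x y hx hy hx2 hy2 => hδ.eq_of_two_le_abs h t hx hy
    (hx2.trans (le_abs_self x)) (hy2.trans (le_abs_self y)), by linarith, by linarith,
    hδ.aeval_eq_zero t, hδ.neg h t, fun w hw hw2 hne => ?_, h2 ▸ hneg2, hneg2⟩
  have hw1 := hgt w hw
  obtain ⟨α, hα1, hαw⟩ := exists_norm_eq_one_add_inv_eq hw1.le hw2.le
  have hα0 : α ≠ 0 := by rintro rfl; simp at hα1
  have hαim : α.im ≠ 0 := by
    intro h0
    have h3 := add_inv_of_norm_eq_one hα1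
    rw [hαw] at h3
    have h4 : w = 2 * α.re := by exact_mod_cast h3
    have h5 := Complex.abs_re_eq_norm.2 h0
    rw [hα1] at h5
    rcases (abs_eq zero_le_one).1 h5 with h6 | h6 <;> rw [h6] at h4 <;> linarith
  have hr : (cpoly φ).IsRoot α := (t.isRoot_iff hα0).2
    (.inr (by rw [hαw, aeval_ofReal, hw, Complex.ofReal_zero]))
  have hr' := isRoot_conj hr
  have hne' : α + α⁻¹ ≠ ((2 * δ.re : ℝ) : ℂ) := by rw [hαw]; exact_mod_cast hne
  have hne'' : starRingEnd ℂ α + (starRingEnd ℂ α)⁻¹ ≠ ((2 * δ.re : ℝ) : ℂ) := by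
    rw [← map_inv₀, ← map_add, hαw, Complex.conj_ofReal]; exact_mod_cast hne
  have h3 := hδ.ne_of_add_inv_ne hne'
  have h4 := hδ.ne_of_add_inv_ne hne''
  have hm := hδ.mem_H11_of_eigen h h3.1 h3.2 (h.mulVec_eigVec hr)
  have hm' := hδ.mem_H11_of_eigen h h4.1 h4.2 (h.mulVec_eigVec hr')
  -- the eigenvectors of `α` and its conjugate are orthogonal and have the same sign, which is
  -- negative since `H11` has signature `(1, 19)`
  have horth : herm G (eigVec φ r α) (eigVec φ r (starRingEnd ℂ α)) = 0 := by
    refine h.herm_eq_zero_of_eigen hα0 ?_ (h.mulVec_eigVec hr) (h.mulVec_eigVec hr')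
    intro h5
    have hsq : starRingEnd ℂ α ^ 2 = 1 := by rw [sq]; exact h5
    have h6 : α ^ 2 = 1 := by
      have := congrArg (starRingEnd ℂ) hsq
      simpa using this
    rcases eq_one_or_neg_one_of_sq h6 with h7 | h7
    all_goals exact hαim (by rw [h7]; simp)
  have hself := t.herm_eigVec_circle h hα1 hαw hw
  have hconj : herm G (eigVec φ r (starRingEnd ℂ α)) (eigVec φ r (starRingEnd ℂ α)) =
      herm G (eigVec φ r α) (eigVec φ r α) := by
    rw [← star_eigVec, herm_star_star, hself, RCLike.star_def, Complex.conj_ofReal]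
  have hlt : RCLike.re (herm G (eigVec φ r α) (eigVec φ r α)) < 0 := by
    by_contra hle
    rw [not_lt] at hle
    refine H.sign_11.not_linearIndependent h.symm hm hm' horth hle (by rwa [hconj]) ?_
    have hev := Module.End.eigenvectors_linearIndependent' (cA φ).mulVecLin ![α, starRingEnd ℂ α]
      (by
        intro i j hij
        have hne3 : α ≠ starRingEnd ℂ α := fun h5 => hαim (Complex.conj_eq_iff_im.1 h5.symm)
        fin_cases i <;> fin_cases j <;> simp_all)
      ![eigVec φ r α, eigVec φ r (starRingEnd ℂ α)]
      (by
        intro i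
        fin_cases i
        · exact ⟨Module.End.mem_eigenspace_iff.2 (h.mulVec_eigVec hr), h.eigVec_ne_zero hr⟩
        · exact ⟨Module.End.mem_eigenspace_iff.2 (h.mulVec_eigVec hr'), h.eigVec_ne_zero hr'⟩)
    exact hev
  rw [hself] at hlt
  change c * _ < 0 at hlt
  have h5 : w ^ 2 - 4 < 0 := by nlinarith
  rw [show c * ((w ^ 2 - 4) * aeval w (derivative Φ) * aeval w Ψ) =
    (w ^ 2 - 4) * (c * (aeval w (derivative Φ) * aeval w Ψ)) by ring] at hlt
  exact pos_of_mul_neg_of_neg h5 hlt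

end Forward

/-! ### The Hodge structure generated by a period -/

section Construct
variable {n : ℕ} {G : Matrix (Fin n) (Fin n) ℚ}

theorem posOn_sup (hG : G.IsSymm) {U V : Submodule ℂ (Fin n → ℂ)} (hU : PosOn G U) (hV : PosOn G V)
    (horth : ∀ x ∈ U, ∀ y ∈ V, herm G x y = 0) :
    PosOn G (U ⊔ V) ∧
      Module.finrank ℂ ↥(U ⊔ V) = Module.finrank ℂ U + Module.finrank ℂ V := by
  constructor
  · intro x hx hx0
    obtain ⟨y, hy, z, hz, rfl⟩ := Submodule.mem_sup.1 hx
    rw [re_herm_add_of_orth hG (horth y hy z hz)]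
    rcases eq_or_ne y 0 with rfl | hy0
    · rw [zero_add] at hx0
      simpa [herm_zero_left] using hV z hz hx0
    · rcases eq_or_ne z 0 with rfl | hz0
      · simpa [herm_zero_left] using hU y hy hy0
      · exact add_pos (hU y hy hy0) (hV z hz hz0)
  · have h1 := Submodule.finrank_sup_add_finrank_inf_eq U V
    have h2 : U ⊓ V = ⊥ := by
      rw [eq_bot_iff]
      intro x hx
      by_contra hx0
      have := hU x hx.1 hx0
      rw [horth x hx.1 x hx.2] at this
      simp at this
    rw [h2, finrank_bot, add_zero] at h1
    exact h1

theorem posOn_span_singleton {u : Fin n → ℂ} (hu : 0 < RCLike.re (herm G u u)) :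
    PosOn G (Submodule.span ℂ {u}) ∧ Module.finrank ℂ (Submodule.span ℂ {u}) = 1 := by
  have hu0 : u ≠ 0 := by rintro rfl; simp [herm_zero_left] at hu
  refine ⟨fun x hx hx0 => ?_, finrank_span_singleton hu0⟩
  obtain ⟨a, rfl⟩ := Submodule.mem_span_singleton.1 hx
  rw [re_herm_smul]
  have ha : a ≠ 0 := by rintro rfl; simp at hx0
  exact mul_pos (pow_pos (norm_pos_iff.2 ha) 2) hu

theorem hasSignature_span_singleton {u : Fin n → ℂ} (hu : 0 < RCLike.re (herm G u u)) :
    HasSignature G (Submodule.span ℂ {u}) 1 0 :=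
  ⟨_, ⊥, sup_bot_eq _, disjoint_bot_right, fun x _ y hy => by
    rw [(Submodule.mem_bot ℂ).1 hy, herm_zero_right], (posOn_span_singleton hu).1,
    fun x hx hx0 => absurd ((Submodule.mem_bot ℂ).1 hx) hx0, (posOn_span_singleton hu).2,
    finrank_bot ℂ _⟩

/-- The orthogonal complement of a vector `u` and its complex conjugate. -/
noncomputable def orthCompl (G : Matrix (Fin n) (Fin n) ℚ) (u : Fin n → ℂ) :
    Submodule ℂ (Fin n → ℂ) where
  carrier := {x | herm G u x = 0 ∧ herm G (star u) x = 0}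
  add_mem' := by
    rintro x y ⟨h1, h2⟩ ⟨h3, h4⟩
    exact ⟨by rw [herm_add_right, h1, h3, add_zero], by rw [herm_add_right, h2, h4, add_zero]⟩
  zero_mem' := ⟨herm_zero_right _, herm_zero_right _⟩
  smul_mem' := by
    rintro a x ⟨h1, h2⟩
    exact ⟨by rw [herm_smul_right, h1, mul_zero], by rw [herm_smul_right, h2, mul_zero]⟩

theorem mem_orthCompl {u x : Fin n → ℂ} :
    x ∈ orthCompl G u ↔ herm G u x = 0 ∧ herm G (star u) x = 0 := Iff.rfl

variable {u : Fin n → ℂ} (hG : G.IsSymm) (hu : 0 < RCLike.re (herm G u u))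
  (horth : herm G u (star u) = 0)
include hG hu horth

omit hG horth in
theorem herm_self_ne_zero : herm G u u ≠ 0 := fun h => by rw [h] at hu; simp at hu

omit hG horth in
theorem herm_star_self_ne_zero : herm G (star u) (star u) ≠ 0 := by
  rw [herm_star_star]
  exact star_ne_zero.2 (herm_self_ne_zero hu)

/-- The decomposition of a vector along `u`, its conjugate, and their orthogonal complement. -/
theorem sub_mem_orthCompl (x : Fin n → ℂ) :
    x + -(herm G u x / herm G u u) • u +
      -(herm G (star u) x / herm G (star u) (star u)) • star u ∈ orthCompl G u := by
  have h1 := herm_self_ne_zero hu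
  have h2 := herm_star_self_ne_zero hu
  have h3 := herm_eq_zero_comm hG horth
  rw [mem_orthCompl]
  simp only [herm_add_right, herm_smul_right, horth, h3]
  constructor
  · field_simp
    ring
  · field_simp
    ring

theorem finrank_orthCompl : Module.finrank ℂ (orthCompl G u) + 2 = n := by
  have h1 := herm_self_ne_zero hu
  have h2 := herm_star_self_ne_zero hu
  have h3 := herm_eq_zero_comm hG horth
  let T : (Fin n → ℂ) →ₗ[ℂ] ℂ × ℂ :=
    { toFun := fun x => (herm G u x, herm G (star u) x)
      map_add' := fun x y => by simp [herm_add_right]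
      map_smul' := fun a x => by simp [herm_smul_right] }
  have hsurj : Function.Surjective T := by
    rintro ⟨a, b⟩
    refine ⟨(a / herm G u u) • u + (b / herm G (star u) (star u)) • star u, ?_⟩
    change (herm G u _, herm G (star u) _) = (a, b)
    simp only [herm_add_right, herm_smul_right, horth, h3]
    rw [div_mul_cancel₀ _ h1, div_mul_cancel₀ _ h2]
    simp
  have hker : LinearMap.ker T = orthCompl G u := by
    ext x
    rw [LinearMap.mem_ker, mem_orthCompl]
    exact Prod.mk_eq_zero
  have h4 := LinearMap.finrank_range_add_finrank_ker T
  rw [LinearMap.range_eq_top.2 hsurj, finrank_top, hker] at h4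
  simp only [Module.finrank_prod, Module.finrank_self, Module.finrank_fin_fun] at h4
  omega

omit hG hu horth in
theorem star_mem_orthCompl {x : Fin n → ℂ} : star x ∈ orthCompl G u ↔ x ∈ orthCompl G u := by
  have h1 : herm G u (star x) = star (herm G (star u) x) := by
    rw [← herm_star_star, star_star]
  rw [mem_orthCompl, mem_orthCompl, h1, herm_star_star, star_eq_zero, star_eq_zero, and_comm]

/-- The Hodge structure with `H20` spanned by `u`, where `(u, u) > 0` and `u` is orthogonal to its
conjugate. -/
noncomputable def hodgeOfVector (hsig : HasSignature G (orthCompl G u) 1 19) :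
    HodgeStructure G where
  H20 := Submodule.span ℂ {u}
  H11 := orthCompl G u
  H02 := Submodule.span ℂ {star u}
  indep := by
    have h3 := herm_eq_zero_comm hG horth
    have hd : ∀ {U V : Submodule ℂ (Fin n → ℂ)}, (∀ x ∈ U, x ∈ V → x = 0) → Disjoint U V :=
      fun h => Submodule.disjoint_def.2 h
    rw [iSupIndep_def]
    intro i
    fin_cases i
    · refine Disjoint.mono_right (c := orthCompl G u ⊔ Submodule.span ℂ {star u}) ?_ (hd ?_)
      · refine iSup₂_le fun j hj => ?_
        fin_cases j
        · exact absurd rfl hj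
        · exact le_sup_left
        · exact le_sup_right
      · intro x hx hx'
        obtain ⟨a, rfl⟩ := Submodule.mem_span_singleton.1 hx
        obtain ⟨y, hy, z, hz, hyz⟩ := Submodule.mem_sup.1 hx'
        obtain ⟨b, rfl⟩ := Submodule.mem_span_singleton.1 hz
        have h4 := congrArg (herm G u) hyz
        rw [herm_add_right, herm_smul_right, herm_smul_right, horth, hy.1, mul_zero, add_zero] at h4
        rw [(mul_eq_zero.1 h4.symm).resolve_right (herm_self_ne_zero hu), zero_smul]
    · refine Disjoint.mono_right
        (c := Submodule.span ℂ {u} ⊔ Submodule.span ℂ {star u}) ?_ (hd ?_)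
      · refine iSup₂_le fun j hj => ?_
        fin_cases j
        · exact le_sup_left
        · exact absurd rfl hj
        · exact le_sup_right
      · intro x hx hx'
        obtain ⟨y, hy, z, hz, rfl⟩ := Submodule.mem_sup.1 hx'
        obtain ⟨a, rfl⟩ := Submodule.mem_span_singleton.1 hy
        obtain ⟨b, rfl⟩ := Submodule.mem_span_singleton.1 hz
        obtain ⟨h4, h5⟩ := hx
        rw [herm_add_right, herm_smul_right, herm_smul_right, horth, mul_zero, add_zero] at h4
        rw [herm_add_right, herm_smul_right, herm_smul_right, h3, mul_zero, zero_add] at h5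
        rw [(mul_eq_zero.1 h4).resolve_right (herm_self_ne_zero hu),
          (mul_eq_zero.1 h5).resolve_right (herm_star_self_ne_zero hu), zero_smul, zero_smul,
          add_zero]
    · refine Disjoint.mono_right (c := Submodule.span ℂ {u} ⊔ orthCompl G u) ?_ (hd ?_)
      · refine iSup₂_le fun j hj => ?_
        fin_cases j
        · exact le_sup_left
        · exact le_sup_right
        · exact absurd rfl hj
      · intro x hx hx'
        obtain ⟨a, rfl⟩ := Submodule.mem_span_singleton.1 hx
        obtain ⟨y, hy, z, hz, hyz⟩ := Submodule.mem_sup.1 hx'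
        obtain ⟨b, rfl⟩ := Submodule.mem_span_singleton.1 hy
        have h4 := congrArg (herm G (star u)) hyz
        rw [herm_add_right, herm_smul_right, herm_smul_right, h3, hz.2, mul_zero, add_zero] at h4
        rw [(mul_eq_zero.1 h4.symm).resolve_right (herm_star_self_ne_zero hu), zero_smul]
  sup_eq_top := by
    rw [eq_top_iff]
    intro x _
    have h1 := sub_mem_orthCompl hG hu horth x
    have h2 : x = ((herm G u x / herm G u u) • u +
        (x + -(herm G u x / herm G u u) • u +
          -(herm G (star u) x / herm G (star u) (star u)) • star u)) +
        (herm G (star u) x / herm G (star u) (star u)) • star u := by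
      module
    rw [h2]
    exact Submodule.add_mem_sup (Submodule.add_mem_sup
      (Submodule.smul_mem _ _ (Submodule.mem_span_singleton_self _)) h1)
      (Submodule.smul_mem _ _ (Submodule.mem_span_singleton_self _))
  orth_20_11 := by
    intro x hx y hy
    obtain ⟨a, rfl⟩ := Submodule.mem_span_singleton.1 hx
    rw [herm_smul_left, hy.1, mul_zero]
  orth_20_02 := by
    intro x hx y hy
    obtain ⟨a, rfl⟩ := Submodule.mem_span_singleton.1 hx
    obtain ⟨b, rfl⟩ := Submodule.mem_span_singleton.1 hy
    rw [herm_smul_left, herm_smul_right, horth, mul_zero, mul_zero]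
  orth_11_02 := by
    intro x hx y hy
    obtain ⟨b, rfl⟩ := Submodule.mem_span_singleton.1 hy
    rw [herm_smul_right, herm_eq_zero_comm hG hx.2, mul_zero]
  sign_20 := hasSignature_span_singleton hu
  sign_11 := hsig
  sign_02 := hasSignature_span_singleton (by
    rw [herm_star_star, RCLike.star_def, RCLike.conj_re]; exact hu)
  conj_20 := by
    intro x
    rw [Submodule.mem_span_singleton, Submodule.mem_span_singleton]
    constructor
    · rintro ⟨b, hb⟩
      exact ⟨star b, by rw [← star_smul, hb, star_star]⟩
    · rintro ⟨b, hb⟩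
      exact ⟨star b, by rw [← hb, star_smul, star_star]⟩
  conj_11 := fun x => star_mem_orthCompl

/-- The signature of the whole space. -/
theorem hasSignature_top_of_orthCompl (hsig : HasSignature G (orthCompl G u) 1 19) :
    HasSignature G (⊤ : Submodule ℝ (Fin n → ℝ)) 3 19 := by
  have hn := finrank_orthCompl hG hu horth
  rw [hsig.finrank_eq] at hn
  obtain ⟨P, N, h1, -, -, h4, h5, h6, h7⟩ := hsig
  have hu' : 0 < RCLike.re (herm G (star u) (star u)) := by
    rw [herm_star_star, RCLike.star_def, RCLike.conj_re]; exact hu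
  have e1 := posOn_span_singleton hu
  have e2 := posOn_span_singleton hu'
  have e3 := posOn_sup hG e1.1 e2.1 (by
    intro x hx y hy
    obtain ⟨a, rfl⟩ := Submodule.mem_span_singleton.1 hx
    obtain ⟨b, rfl⟩ := Submodule.mem_span_singleton.1 hy
    rw [herm_smul_left, herm_smul_right, horth, mul_zero, mul_zero])
  have e4 := posOn_sup hG e3.1 h4 (by
    intro x hx y hy
    obtain ⟨h8, h9⟩ := mem_orthCompl.1 (h1 ▸ Submodule.mem_sup_left hy : y ∈ orthCompl G u)
    obtain ⟨z, hz, w, hw, rfl⟩ := Submodule.mem_sup.1 hx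
    obtain ⟨a, rfl⟩ := Submodule.mem_span_singleton.1 hz
    obtain ⟨b, rfl⟩ := Submodule.mem_span_singleton.1 hw
    rw [herm_add_left, herm_smul_left, herm_smul_left, h8, h9, mul_zero, mul_zero, add_zero])
  refine hasSignature_real_of_complex hG e4.1 h5 ?_ h7 (by omega)
  rw [e4.2, e3.2, e1.2, e2.2, h6]

end Construct

/-! ### Invariance of the Hodge structure of a period -/

section Period

variable {φ ψ : ℤ[X]} {r : Fin 22 → ℚ} {G : Matrix (Fin 22) (Fin 22) ℚ} {c : ℝ}
  (h : IsSpectral φ ψ r G c) {δ : ℂ} (hδ : (cpoly φ).IsRoot δ) (hδ' : δ.im ≠ 0)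
include h hδ hδ'

theorem IsSpectral.herm_eigVec_star : herm G (eigVec φ r δ) (star (eigVec φ r δ)) = 0 := by
  rw [star_eigVec]
  refine h.herm_eq_zero_of_eigen (h.root_ne_zero hδ) ?_ (h.mulVec_eigVec hδ)
    (h.mulVec_eigVec (isRoot_conj hδ))
  intro h1
  have h2 : δ ^ 2 = 1 := by
    have := congrArg (starRingEnd ℂ) h1
    rw [map_mul, Complex.conj_conj, map_one] at this
    rw [sq]; exact this
  rcases eq_one_or_neg_one_of_sq h2 with h3 | h3
  all_goals exact hδ' (by rw [h3]; simp)

theorem IsSpectral.isHodgeIsometry {L : Submodule ℤ (Fin 22 → ℚ)}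
    (hL : L.map ((companion 22 φ).mulVecLin.restrictScalars ℤ) = L)
    (hA : (companion 22 φ)ᵀ * G * companion 22 φ = G)
    (hpos : 0 < RCLike.re (herm G (eigVec φ r δ) (eigVec φ r δ)))
    (hsig : HasSignature G (orthCompl G (eigVec φ r δ)) 1 19) :
    (hodgeOfVector h.symm hpos (h.herm_eigVec_star hδ hδ') hsig).IsHodgeIsometry L
      (companion 22 φ) := by
  have hδc := isRoot_conj hδ
  have hspan : ∀ {α : ℂ}, (cpoly φ).IsRoot α →
      (Submodule.span ℂ {eigVec φ r α}).map (cA φ).mulVecLin = Submodule.span ℂ {eigVec φ r α} := by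
    intro α hα
    rw [Submodule.map_span, Set.image_singleton, Matrix.mulVecLin_apply, h.mulVec_eigVec hα]
    exact Submodule.span_singleton_smul_eq (isUnit_iff_ne_zero.2 (h.root_ne_zero hα)) _
  have hiff : ∀ x, cA φ *ᵥ x ∈ orthCompl G (eigVec φ r δ) ↔ x ∈ orthCompl G (eigVec φ r δ) := by
    intro x
    rw [mem_orthCompl, mem_orthCompl, star_eigVec,
      h.herm_mulVec_right (h.root_ne_zero hδ) (h.mulVec_eigVec hδ),
      h.herm_mulVec_right (h.root_ne_zero hδc) (h.mulVec_eigVec hδc),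
      mul_eq_zero_iff_left (inv_ne_zero (h.root_ne_zero hδc)),
      mul_eq_zero_iff_left (inv_ne_zero (by simpa using h.root_ne_zero hδ))]
  refine ⟨hL, hA, hspan hδ, ?_, ?_⟩
  · ext x
    constructor
    · rintro ⟨y, hy, rfl⟩
      exact (hiff y).2 hy
    · intro hx
      have hmul : cA φ * (cmat 22 (cpoly φ))⁻¹ = 1 := by
        rw [cA, extendScalars_companion]
        exact h.pair.mul_inv
      have h1 : cA φ *ᵥ ((cmat 22 (cpoly φ))⁻¹ *ᵥ x) = x := by
        rw [Matrix.mulVec_mulVec, hmul, Matrix.one_mulVec]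
      refine ⟨(cmat 22 (cpoly φ))⁻¹ *ᵥ x, (hiff _).1 ?_, h1⟩
      rw [h1]
      exact hx
  · change (Submodule.span ℂ {star (eigVec φ r δ)}).map _ = Submodule.span ℂ {star (eigVec φ r δ)}
    rw [star_eigVec]
    exact hspan hδc

end Period

/-! ### The Hodge structure of a sign pattern -/

/-- If `2` is a root of `Φ`, then `1` is at least a triple root of `φ`. -/
theorem IsTracePair.exists_eq_cube_mul {φ ψ Φ Ψ : ℤ[X]} (t : IsTracePair φ ψ Φ Ψ)
    (h2 : aeval (2 : ℝ) Φ = 0) : ∃ q : ℂ[X], cpoly φ = (X - C 1) ^ 3 * q ∧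
      q.eval 1 = ((2 * aeval (2 : ℝ) (derivative Φ) : ℝ) : ℂ) := by
  have e : ∀ f : ℤ[X], aeval (2 : ℂ) f = ((aeval (2 : ℝ) f : ℝ) : ℂ) := fun f => by
    rw [← aeval_ofReal]; norm_num
  obtain ⟨Q, hQ⟩ := dvd_iff_isRoot.2 (show (cpoly Φ).IsRoot 2 by
    rw [IsRoot, eval_cpoly, e, h2, Complex.ofReal_zero])
  have hm : (cpoly Φ).Monic := t.monic_left.map _
  have hQm : Q.Monic := (monic_X_sub_C 2).of_mul_monic_left (hQ ▸ hm)
  have hQd : Q.natDegree = 9 := by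
    have h1 : (cpoly Φ).natDegree = 10 := (t.monic_left.natDegree_map _).trans t.deg_left
    rw [hQ, (monic_X_sub_C 2).natDegree_mul hQm, natDegree_X_sub_C] at h1
    omega
  obtain ⟨Q', hev⟩ := exists_eval_eq_pow_mul hQd.le
  refine ⟨(X + C 1) * Q', eq_of_infinite_eval_eq _ _ ?_, ?_⟩
  · refine (Set.finite_singleton (0 : ℂ)).infinite_compl.mono fun z hz => ?_
    have hz : z ≠ 0 := hz
    change (cpoly φ).eval z = _
    rw [eval_cpoly, t.eq_left z hz, ← eval_cpoly, hQ]
    simp only [eval_mul, eval_sub, eval_add, eval_X, eval_C, eval_pow, hev z hz]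
    field_simp
    ring
  · have h3 : (derivative (cpoly Φ)).eval 2 = Q.eval 2 := by rw [hQ]; simp
    rw [derivative_map, ← cpoly, eval_cpoly, e] at h3
    have h4 := hev 1 one_ne_zero
    have h5 : (1 : ℂ) + 1⁻¹ = 2 := by norm_num
    rw [h5, ← h3, one_pow, one_mul] at h4
    rw [eval_mul, h4]
    simp only [eval_add, eval_X, eval_C]
    push_cast
    ring

section Pattern

variable {φ ψ Φ Ψ : ℤ[X]} {r : Fin 22 → ℚ} {G : Matrix (Fin 22) (Fin 22) ℚ} {c τ : ℝ} {δ : ℂ}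

theorem im_ne_zero_of_trace {α : ℂ} (hα : ‖α‖ = 1) {w : ℝ} (hw : α + α⁻¹ = w) (h1 : -2 < w)
    (h2 : w < 2) : α.im ≠ 0 := by
  intro h0
  have h3 := add_inv_of_norm_eq_one hα
  rw [hw] at h3
  have h4 : w = 2 * α.re := by exact_mod_cast h3
  have h5 := Complex.abs_re_eq_norm.2 h0
  rw [hα] at h5
  rcases (abs_eq zero_le_one).1 h5 with h6 | h6 <;> rw [h6] at h4 <;> linarith

theorem ne_zero_of_norm {α : ℂ} (hα : ‖α‖ = 1) : α ≠ 0 := by rintro rfl; simp at hα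

namespace IsPattern

variable (p : IsPattern Φ Ψ c τ) (t : IsTracePair φ ψ Φ Ψ) (h : IsSpectral φ ψ r G c)
include p t

theorem derivative_eval_ne_zero {α : ℂ} (hα : (cpoly φ).IsRoot α)
    (hα0 : α ≠ 0) (h1 : α = 1 → aeval (2 : ℝ) Φ ≠ 0) : (derivative (cpoly φ)).eval α ≠ 0 := by
  have e2 : ∀ f : ℤ[X], aeval (2 : ℂ) f = ((aeval (2 : ℝ) f : ℝ) : ℂ) := fun f => by
    rw [← aeval_ofReal]; norm_num
  have e2' : ∀ f : ℤ[X], aeval (-2 : ℂ) f = ((aeval (-2 : ℝ) f : ℝ) : ℂ) := fun f => by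
    rw [← aeval_ofReal]; norm_num
  by_cases hsq : α ^ 2 = 1
  · rcases eq_one_or_neg_one_of_sq hsq with rfl | rfl
    · rw [t.derivative_eval_one, e2]
      exact mul_ne_zero two_ne_zero (by exact_mod_cast h1 rfl)
    · rw [t.derivative_eval_neg_one, e2']
      refine mul_ne_zero (by norm_num) ?_
      exact_mod_cast (eval_neg_two_pos t.monic_left (by rw [t.deg_left]) p.real).ne'
  · have hw := ((t.isRoot_iff hα0).1 hα).resolve_left hsq
    rw [t.derivative_eval hα0 hw]
    exact mul_ne_zero (mul_ne_zero (pow_ne_zero 2 (sub_ne_zero.2 hsq)) (pow_ne_zero 8 hα0))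
      (p.simple.derivative_ne_zero t.monic_left hw)

/-- The position of the roots of `φ` for a sign pattern. -/
theorem root_cases {α : ℂ} (hα : (cpoly φ).IsRoot α) (hα0 : α ≠ 0) :
    α = 1 ∨ α = -1 ∨ (∃ w : ℝ, ‖α‖ = 1 ∧ α + α⁻¹ = w ∧ aeval w Φ = 0 ∧ -2 < w ∧ w < 2) ∨
      ∃ w : ℝ, α + α⁻¹ = w ∧ aeval w Φ = 0 ∧ 2 < w := by
  rcases (t.isRoot_iff hα0).1 hα with h1 | h1
  · rcases eq_one_or_neg_one_of_sq h1 with h2 | h2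
    · exact .inl h2
    · exact .inr (.inl h2)
  · obtain ⟨h2, h3⟩ := p.real _ h1
    obtain ⟨w, hw⟩ : ∃ w : ℝ, α + α⁻¹ = w := ⟨(α + α⁻¹).re, Complex.ext rfl h2⟩
    rw [hw, Complex.ofReal_re] at h3
    rw [hw, aeval_ofReal, Complex.ofReal_eq_zero] at h1
    rcases lt_trichotomy w 2 with h4 | h4 | h4
    · refine .inr (.inr (.inl ⟨w, ?_, hw, h1, h3, h4⟩))
      obtain ⟨β, hβ, hβw⟩ := exists_norm_eq_one_add_inv_eq h3.le h4.le
      rcases (add_inv_eq_iff hα0 (ne_zero_of_norm hβ)).1 (hw.trans hβw.symm) with rfl | rfl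
      · exact hβ
      · rw [norm_inv, hβ, inv_one]
    · left
      have h5 : α + α⁻¹ = 1 + 1⁻¹ := by rw [hw, h4]; norm_num
      rcases (add_inv_eq_iff hα0 one_ne_zero).1 h5 with h6 | h6
      · exact h6
      · rw [h6, inv_one]
    · exact .inr (.inr (.inr ⟨w, hw, h1, h4⟩))

section Delta

variable (hδ1 : ‖δ‖ = 1) (hδτ : δ + δ⁻¹ = τ)
include hδ1 hδτ

omit t in
theorem im_ne : δ.im ≠ 0 := im_ne_zero_of_trace hδ1 hδτ p.neg_two_lt p.lt_two

theorem isRoot : (cpoly φ).IsRoot δ := (t.isRoot_iff (ne_zero_of_norm hδ1)).2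
  (.inr (by rw [hδτ, aeval_ofReal, p.root, Complex.ofReal_zero]))

include h

theorem herm_pos : 0 < RCLike.re (herm G (eigVec φ r δ) (eigVec φ r δ)) := by
  rw [t.herm_eigVec_circle h hδ1 hδτ p.root]
  change 0 < c * _
  have h1 : τ ^ 2 - 4 < 0 := by nlinarith [p.neg_two_lt, p.lt_two]
  rw [show c * ((τ ^ 2 - 4) * aeval τ (derivative Φ) * aeval τ Ψ) =
    (τ ^ 2 - 4) * (c * (aeval τ (derivative Φ) * aeval τ Ψ)) by ring]
  exact mul_pos_of_neg_of_neg h1 p.neg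

/-- The eigenvectors on the unit circle are negative, except for the eigenvalues `1`, `δ`, `δ̄`. -/
theorem herm_neg {α : ℂ} (hα : (cpoly φ).IsRoot α) (hα1 : ‖α‖ = 1) (h1 : α ≠ 1) (h2 : α ≠ δ)
    (h3 : α ≠ starRingEnd ℂ δ) : RCLike.re (herm G (eigVec φ r α) (eigVec φ r α)) < 0 := by
  rcases p.root_cases t hα (ne_zero_of_norm hα1) with h4 | rfl | ⟨w, -, hw, h5, h6, h7⟩ | ⟨w, hw, h5, h6⟩
  · exact absurd h4 h1
  · rw [t.herm_eigVec_neg_one h]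
    change c * _ < 0
    have h4 := eval_neg_two_pos t.monic_left (by rw [t.deg_left]) p.real
    rw [show c * (-2 * aeval (-2 : ℝ) Φ * aeval (-2 : ℝ) Ψ) =
      -(2 * aeval (-2 : ℝ) Φ * (c * aeval (-2 : ℝ) Ψ)) by ring, neg_lt_zero]
    exact mul_pos (mul_pos two_pos h4) p.pos_neg_two
  · rw [t.herm_eigVec_circle h hα1 hw h5]
    change c * _ < 0
    have hne : w ≠ τ := by
      rintro rfl
      rcases (add_inv_eq_iff (ne_zero_of_norm hα1) (ne_zero_of_norm hδ1)).1 (hw.trans hδτ.symm)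
        with h8 | h8
      · exact h2 h8
      · exact h3 (by rw [h8, conj_eq_inv_of_norm_eq_one hδ1])
    have h8 : w ^ 2 - 4 < 0 := by nlinarith
    rw [show c * ((w ^ 2 - 4) * aeval w (derivative Φ) * aeval w Ψ) =
      (w ^ 2 - 4) * (c * (aeval w (derivative Φ) * aeval w Ψ)) by ring]
    exact mul_neg_of_neg_of_pos h8 (p.pos w h5 h7 hne)
  · exfalso
    rw [add_inv_of_norm_eq_one hα1] at hw
    have h8 : 2 * α.re = w := by exact_mod_cast hw
    have h9 := (abs_le.1 (Complex.abs_re_le_norm α)).2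
    rw [hα1] at h9
    linarith

end Delta

end IsPattern

/-- The roots of `φ` on the unit circle, other than `1`, `δ` and `δ̄`. -/
noncomputable def negRoots (φ : ℤ[X]) (δ : ℂ) : Finset ℂ :=
  open Classical in (cpoly φ).roots.toFinset.filter fun α =>
    ‖α‖ = 1 ∧ α ≠ 1 ∧ α ≠ δ ∧ α ≠ starRingEnd ℂ δ

theorem mem_negRoots (hφ : φ.Monic) {α : ℂ} : α ∈ negRoots φ δ ↔
    (cpoly φ).IsRoot α ∧ ‖α‖ = 1 ∧ α ≠ 1 ∧ α ≠ δ ∧ α ≠ starRingEnd ℂ δ := by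
  classical
  rw [negRoots, Finset.mem_filter, Multiset.mem_toFinset, mem_roots (hφ.map _).ne_zero]

namespace IsPattern

variable (p : IsPattern Φ Ψ c τ) (t : IsTracePair φ ψ Φ Ψ) (h : IsSpectral φ ψ r G c)
  (hδ1 : ‖δ‖ = 1) (hδτ : δ + δ⁻¹ = τ) (hφ : φ.Monic)
include p t h hδ1 hδτ hφ

/-- The count of the `22` roots of `φ`: those in `negRoots`, the root `1` with its multiplicity, `δ`
and its conjugate, and a pair of real roots for a trace larger than `2`. -/
theorem card_negRoots : (negRoots φ δ).card + (cpoly φ).roots.count 1 + 2 +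
    2 * (rootsGtTwo Φ).card = 22 := by
  classical
  set M := (cpoly φ).roots with hM
  have hne := (hφ.map (Int.castRingHom ℂ)).ne_zero
  have hcard : M.card = 22 := by
    have h1 := splits_iff_card_roots.1 (IsAlgClosed.splits (cpoly φ))
    rw [hM, h1, h.pair.f_deg]
  have hmem : ∀ {α}, α ∈ M ↔ (cpoly φ).IsRoot α := fun {α} => mem_roots hne
  have hδr := p.isRoot t hδ1 hδτ
  have him := p.im_ne hδ1 hδτ
  -- all roots other than `1` are simple
  have hnd : (M.filter (· ≠ 1)).Nodup := by
    rw [Multiset.nodup_iff_count_le_one]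
    intro α
    rw [Multiset.count_filter]
    split_ifs with h1
    · by_contra h2
      rw [hM, count_roots, not_le, one_lt_rootMultiplicity_iff_isRoot hne] at h2
      exact p.derivative_eval_ne_zero t h2.1 (h.root_ne_zero h2.1) (fun h3 => absurd h3 h1) h2.2
    · exact zero_le_one
  have h1 : M.count 1 + (M.filter (· ≠ 1)).card = 22 := by
    rw [← hcard]
    conv_rhs => rw [← Multiset.filter_add_not (· = 1) M, Multiset.card_add]
    rw [Multiset.filter_eq', Multiset.card_replicate]
  set S := (M.filter (· ≠ 1)).toFinset with hS
  have h2 : S.card = (M.filter (· ≠ 1)).card := Multiset.toFinset_card_of_nodup hnd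
  have hmemS : ∀ {α}, α ∈ S ↔ (cpoly φ).IsRoot α ∧ α ≠ 1 := fun {α} => by
    rw [hS, Multiset.mem_toFinset, Multiset.mem_filter, hmem]
  have h3 := Finset.card_filter_add_card_filter_not (s := S) (fun α => ‖α‖ = 1)
  have hc1 : starRingEnd ℂ δ ≠ δ := fun h0 => him (Complex.conj_eq_iff_im.1 h0)
  have hne1 : ∀ {α : ℂ}, α.im ≠ 0 → α ≠ 1 := by rintro _ h0 rfl; exact h0 Complex.one_im
  have h4 : S.filter (fun α => ‖α‖ = 1) = insert δ (insert (starRingEnd ℂ δ) (negRoots φ δ)) := by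
    ext α
    rw [Finset.mem_filter, hmemS, Finset.mem_insert, Finset.mem_insert, mem_negRoots hφ]
    constructor
    · rintro ⟨⟨h5, h6⟩, h7⟩
      by_cases h8 : α = δ
      · exact .inl h8
      · by_cases h9 : α = starRingEnd ℂ δ
        · exact .inr (.inl h9)
        · exact .inr (.inr ⟨h5, h7, h6, h8, h9⟩)
    · rintro (rfl | rfl | h5)
      · exact ⟨⟨hδr, hne1 him⟩, hδ1⟩
      · exact ⟨⟨isRoot_conj hδr, hne1 (by rwa [Complex.conj_im, neg_ne_zero])⟩,
          by rw [RCLike.norm_conj, hδ1]⟩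
      · exact ⟨⟨h5.1, h5.2.2.1⟩, h5.2.1⟩
  have h5 : (S.filter (fun α => ‖α‖ = 1)).card = (negRoots φ δ).card + 2 := by
    rw [h4, Finset.card_insert_of_notMem, Finset.card_insert_of_notMem]
    · rw [mem_negRoots hφ]; tauto
    · rw [Finset.mem_insert, mem_negRoots hφ]
      have := hc1.symm
      tauto
  have hgt : ∀ {z}, z ∈ rootsGtTwo Φ ↔ aeval z Φ = 0 ∧ z.im = 0 ∧ 2 < z.re := fun {z} => by
    rw [rootsGtTwo, Multiset.mem_filter, mem_aroots, and_iff_right t.monic_left.ne_zero]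
  have hbig : ∀ {α : ℂ}, α ∈ S.filter (fun α => ¬ ‖α‖ = 1) ↔
      α ≠ 0 ∧ ∃ w : ℝ, α + α⁻¹ = w ∧ aeval w Φ = 0 ∧ 2 < w := by
    intro α
    rw [Finset.mem_filter, hmemS]
    constructor
    · rintro ⟨⟨h6, h7⟩, h8⟩
      refine ⟨h.root_ne_zero h6, ?_⟩
      rcases p.root_cases t h6 (h.root_ne_zero h6) with h9 | rfl | ⟨w, h9, -⟩ | h9
      · exact absurd h9 h7
      · simp at h8
      · exact absurd h9 h8
      · exact h9
    · rintro ⟨h0, w, hw, h6, h7⟩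
      refine ⟨⟨(t.isRoot_iff h0).2 (.inr (by rw [hw, aeval_ofReal, h6, Complex.ofReal_zero])), ?_⟩,
        fun h8 => ?_⟩
      · rintro rfl
        have : (2 : ℝ) = w := by
          have h9 : ((2 : ℝ) : ℂ) = w := by rw [← hw]; norm_num
          exact_mod_cast h9
        linarith
      · rw [add_inv_of_norm_eq_one h8] at hw
        have h9 : 2 * α.re = w := by exact_mod_cast hw
        have h10 := (abs_le.1 (Complex.abs_re_le_norm α)).2
        rw [h8] at h10
        linarith
  have h6 : (S.filter (fun α => ¬ ‖α‖ = 1)).card = 2 * (rootsGtTwo Φ).card := by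
    rcases (by have := p.card_rootsGtTwo_le; omega :
      (rootsGtTwo Φ).card = 0 ∨ (rootsGtTwo Φ).card = 1) with h7 | h7
    · rw [h7, mul_zero, Finset.card_eq_zero, Finset.eq_empty_iff_forall_notMem]
      intro α hα
      obtain ⟨-, w, -, h8, h9⟩ := hbig.1 hα
      have : (w : ℂ) ∈ rootsGtTwo Φ :=
        hgt.2 ⟨by rw [aeval_ofReal, h8, Complex.ofReal_zero], Complex.ofReal_im w, h9⟩
      rw [Multiset.card_eq_zero.1 h7] at this
      simp at this
    · obtain ⟨z, hz⟩ := Multiset.card_eq_one.1 h7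
      have hz' : z ∈ rootsGtTwo Φ := hz ▸ Multiset.mem_singleton_self z
      obtain ⟨h8, h9, h10⟩ := hgt.1 hz'
      obtain ⟨w, rfl⟩ : ∃ w : ℝ, (w : ℂ) = z := ⟨z.re, Complex.ext rfl h9.symm⟩
      rw [Complex.ofReal_re] at h10
      rw [aeval_ofReal, Complex.ofReal_eq_zero] at h8
      obtain ⟨β, hβ0, hβ⟩ := exists_add_inv_eq (w : ℂ)
      have h11 : S.filter (fun α => ¬ ‖α‖ = 1) = {β, β⁻¹} := by
        ext α
        rw [hbig, Finset.mem_insert, Finset.mem_singleton]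
        constructor
        · rintro ⟨h0, w', hw', h12, h13⟩
          rw [p.two_le w' w h12 h8 h13.le h10.le] at hw'
          exact (add_inv_eq_iff h0 hβ0).1 (hw'.trans hβ.symm)
        · rintro (rfl | rfl)
          · exact ⟨hβ0, w, hβ, h8, h10⟩
          · exact ⟨inv_ne_zero hβ0, w, by rw [inv_inv, add_comm, hβ], h8, h10⟩
      have h12 : β ≠ β⁻¹ := by
        intro h13
        have h14 : β ^ 2 = 1 := by
          rw [sq]
          nth_rw 2 [h13]
          exact mul_inv_cancel₀ hβ0
        rcases eq_one_or_neg_one_of_sq h14 with rfl | rfl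
        · have h15 : ((2 : ℝ) : ℂ) = w := by rw [← hβ]; norm_num
          have : (2 : ℝ) = w := by exact_mod_cast h15
          linarith
        · have h15 : ((-2 : ℝ) : ℂ) = w := by rw [← hβ]; norm_num
          have : (-2 : ℝ) = w := by exact_mod_cast h15
          linarith
      rw [h11, Finset.card_pair h12, h7]
  omega

omit h hδ1 hδτ in
theorem count_one_of_ne (h2 : aeval (2 : ℝ) Φ ≠ 0) : (cpoly φ).roots.count 1 = 1 := by
  classical
  have hne := (hφ.map (Int.castRingHom ℂ)).ne_zero
  have h1 : 1 ≤ (cpoly φ).roots.count 1 :=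
    Multiset.one_le_count_iff_mem.2 ((mem_roots hne).2 t.isRoot_one)
  by_contra h3
  have h4 : 1 < (cpoly φ).roots.count 1 := by omega
  rw [count_roots, one_lt_rootMultiplicity_iff_isRoot hne] at h4
  exact p.derivative_eval_ne_zero t h4.1 one_ne_zero (fun _ => h2) h4.2

omit h hδ1 hδτ in
theorem count_one_of_eq (h2 : aeval (2 : ℝ) Φ = 0) : (cpoly φ).roots.count 1 = 3 := by
  classical
  obtain ⟨q, hq, hq1⟩ := t.exists_eq_cube_mul h2
  have hne := (hφ.map (Int.castRingHom ℂ)).ne_zero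
  have hd : aeval (2 : ℝ) (derivative Φ) ≠ 0 := by
    intro h0
    have := p.simple.derivative_ne_zero t.monic_left (z := (2 : ℝ))
      (by rw [aeval_ofReal, h2, Complex.ofReal_zero])
    rw [aeval_ofReal, h0] at this
    simp at this
  have hq0 : q.eval 1 ≠ 0 := by
    rw [hq1]
    exact_mod_cast mul_ne_zero two_ne_zero hd
  change (cpoly φ) ≠ 0 at hne
  rw [hq] at hne
  rw [count_roots, hq, rootMultiplicity_mul hne, rootMultiplicity_X_sub_C_pow,
    rootMultiplicity_eq_zero hq0]

end IsPattern

end Pattern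

/-! ### The signature on the complement of the period -/

section Signature

variable {φ ψ Φ Ψ : ℤ[X]} {r : Fin 22 → ℚ} {G : Matrix (Fin 22) (Fin 22) ℚ} {c τ : ℝ} {δ : ℂ}

theorem eval_two_pos_of_card {Φ : ℤ[X]} (hΦ : Φ.Monic)
    (h0 : (rootsGtTwo Φ).card = 0) (h2 : aeval (2 : ℝ) Φ ≠ 0) : 0 < aeval (2 : ℝ) Φ := by
  have h5 := sign_eval (hΦ.map (algebraMap ℤ ℝ)) (x := 2) (by rwa [← aeval_eq_eval_map])
  rw [← aeval_eq_eval_map] at h5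
  change 0 < (-1) ^ above (Φ.aroots ℝ) 2 * _ at h5
  rwa [← card_rootsGtTwo, h0, pow_zero, one_mul] at h5

theorem IsPattern.eval_two_neg (p : IsPattern Φ Ψ c τ) (hΦ : Φ.Monic)
    (h0 : (rootsGtTwo Φ).card = 1) : aeval (2 : ℝ) Φ < 0 := by
  have h2 : aeval (2 : ℝ) Φ ≠ 0 := fun h2 => by
    rw [p.card_rootsGtTwo_eq_zero h2] at h0; omega
  have h5 := sign_eval (hΦ.map (algebraMap ℤ ℝ)) (x := 2) (by rwa [← aeval_eq_eval_map])
  rw [← aeval_eq_eval_map] at h5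
  change 0 < (-1) ^ above (Φ.aroots ℝ) 2 * _ at h5
  rw [← card_rootsGtTwo, h0, pow_one] at h5
  linarith

theorem IsPattern.derivative_two_pos (p : IsPattern Φ Ψ c τ) (hΦ : Φ.Monic)
    (h2 : aeval (2 : ℝ) Φ = 0) : 0 < aeval (2 : ℝ) (derivative Φ) := by
  have hd : aeval (2 : ℝ) (derivative Φ) ≠ 0 := by
    intro h0
    have := p.simple.derivative_ne_zero hΦ (z := (2 : ℝ))
      (by rw [aeval_ofReal, h2, Complex.ofReal_zero])
    rw [aeval_ofReal, h0] at this
    simp at this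
  have h5 := sign_derivative_rootsOn hΦ (by norm_num) le_rfl h2 hd
  rwa [p.card_rootsGtTwo_eq_zero h2, above_eq_zero.2 fun a ha => ((mem_rootsOn hΦ).1 ha).2.2,
    pow_zero, one_mul] at h5

/-- A trace greater than `2` is the trace of a positive eigenvalue. -/
theorem IsTracePair.exists_root_of_card (t : IsTracePair φ ψ Φ Ψ)
    (h0 : (rootsGtTwo Φ).card = 1) : ∃ a w : ℝ, 0 < a ∧ a + a⁻¹ = w ∧ a ^ 2 ≠ 1 ∧ 2 < w ∧
      aeval w Φ = 0 ∧ (cpoly φ).IsRoot (a : ℂ) := by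
  obtain ⟨z, hz⟩ := Multiset.card_eq_one.1 h0
  have hz' : z ∈ rootsGtTwo Φ := hz ▸ Multiset.mem_singleton_self z
  rw [rootsGtTwo, Multiset.mem_filter, mem_aroots, and_iff_right t.monic_left.ne_zero] at hz'
  obtain ⟨h8, h9, h10⟩ := hz'
  obtain ⟨w, rfl⟩ : ∃ w : ℝ, (w : ℂ) = z := ⟨z.re, Complex.ext rfl h9.symm⟩
  rw [Complex.ofReal_re] at h10
  obtain ⟨a, ha, haw, hsgn⟩ := exists_real_add_inv_eq (w := w) (h10.le.trans (le_abs_self w))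
  have ha0 : 0 < a := hsgn.2 (by linarith)
  refine ⟨a, w, ha0, haw, fun h3 => ?_, h10, ?_, (t.isRoot_iff (by exact_mod_cast ha)).2 (.inr ?_)⟩
  · have h4 : a = 1 := by nlinarith
    rw [h4] at haw
    norm_num at haw
    linarith
  · rw [aeval_ofReal] at h8
    exact_mod_cast h8
  · rw [← h8, ← haw]
    push_cast
    rfl

/-- If `φ = (z - 1) ^ 3 q`, the generalized eigenvector `((z - 1) q) (A) r`, of height two over the
isotropic eigenvector of `1`, has Hermitian square `-c ψ (1)` times the conjugate of `q (1)`. -/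
theorem IsSpectral.herm_genEigVec (h : IsSpectral φ ψ r G c) {q : ℂ[X]}
    (hq : cpoly φ = (X - C 1) ^ 3 * q) :
    herm G (polyVec φ r ((X - C 1) * q)) (polyVec φ r ((X - C 1) * q)) =
      -(starRingEnd ℂ (q.eval 1) * (c * (cpoly ψ).eval 1)) := by
  have hroot : (cpoly φ).IsRoot 1 := by rw [IsRoot, hq]; simp
  have hv : eigVec φ r 1 = polyVec φ r ((X - C 1) * ((X - C 1) * q)) := by
    rw [eigVec, hq]
    congr 1
    rw [show (X - C (1 : ℂ)) ^ 3 * q = (X - C 1) * ((X - C 1) * ((X - C 1) * q)) by ring]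
    exact mul_divByMonic_cancel_left _ (monic_X_sub_C 1)
  have h1 := h.adjoint_X_sub_C (α := 1) one_ne_zero q ((X - C 1) * q)
  rw [map_one, inv_one, ← hv] at h1
  rw [h1, herm_comm h.symm (eigVec φ r 1), h.herm_eigVec_polyVec hroot]
  simp

theorem mul_inv_extendScalars (h : IsSpectral φ ψ r G c) :
    companion 22 φ * (companion 22 φ)⁻¹ = 1 := by
  have h1 : cA φ * (cmat 22 (cpoly φ))⁻¹ = 1 := by
    rw [cA, extendScalars_companion]
    exact h.pair.mul_inv
  have h2 : (cA φ).det ≠ 0 := by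
    intro h0
    have := congrArg Matrix.det h1
    rw [Matrix.det_mul, h0, zero_mul, Matrix.det_one] at this
    exact zero_ne_one this
  refine Matrix.mul_nonsing_inv _ (isUnit_iff_ne_zero.2 fun h0 => h2 ?_)
  have h3 := (Rat.castHom ℂ).map_det (companion 22 φ)
  rw [h0, map_zero] at h3
  exact h3.symm

namespace IsPattern

variable (p : IsPattern Φ Ψ c τ) (t : IsTracePair φ ψ Φ Ψ) (h : IsSpectral φ ψ r G c)
  (hδ1 : ‖δ‖ = 1) (hδτ : δ + δ⁻¹ = τ) (hφ : φ.Monic)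
include p t h hδ1 hδτ

theorem mem_orthCompl_eigVec (q : ℂ[X]) (h1 : q.eval δ = 0)
    (h2 : q.eval (starRingEnd ℂ δ) = 0) : polyVec φ r q ∈ orthCompl G (eigVec φ r δ) := by
  have hr := p.isRoot t hδ1 hδτ
  have e : (starRingEnd ℂ δ)⁻¹ = δ := by rw [conj_eq_inv_of_norm_eq_one hδ1, inv_inv]
  have e' : δ⁻¹ = starRingEnd ℂ δ := (conj_eq_inv_of_norm_eq_one hδ1).symm
  rw [mem_orthCompl, star_eigVec, h.herm_eigVec_polyVec hr, h.herm_eigVec_polyVec (isRoot_conj hr),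
    Complex.conj_conj, e, e', h1, h2, zero_mul, zero_mul]
  exact ⟨rfl, rfl⟩

theorem eigVec_mem_orthCompl {α : ℂ} (hα : (cpoly φ).IsRoot α) (h1 : α ≠ δ)
    (h2 : α ≠ starRingEnd ℂ δ) : eigVec φ r α ∈ orthCompl G (eigVec φ r δ) := by
  have hr := p.isRoot t hδ1 hδτ
  have key : ∀ {β : ℂ}, (cpoly φ).IsRoot β → α ≠ β → (cpoly φ /ₘ (X - C α)).eval β = 0 := by
    intro β hβ hne
    have h3 := congrArg (eval β) (mul_divByMonic_eq_iff_isRoot.2 hα)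
    rw [eval_mul, show (cpoly φ).eval β = 0 from hβ] at h3
    refine (mul_eq_zero.1 h3).resolve_left ?_
    rw [eval_sub, eval_X, eval_C]
    exact sub_ne_zero.2 hne.symm
  exact p.mem_orthCompl_eigVec t h hδ1 hδτ _ (key hr h1) (key (isRoot_conj hr) h2)

include hφ

/-- The orthogonal complement of the period plane has signature `(1, 19)`, and contains a causal
eigenvector of `A` with positive eigenvalue. -/
theorem hasSignature_orthCompl : HasSignature G (orthCompl G (eigVec φ r δ)) 1 19 ∧
    ∃ a : ℝ, 0 < a ∧ (cpoly φ).IsRoot (a : ℂ) ∧ eigVec φ r (a : ℂ) ∈ orthCompl G (eigVec φ r δ) ∧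
      0 ≤ RCLike.re (herm G (eigVec φ r (a : ℂ)) (eigVec φ r (a : ℂ))) := by
  classical
  have hroot := p.isRoot t hδ1 hδτ
  have him := p.im_ne hδ1 hδτ
  have hreal : ∀ a : ℝ, (cpoly φ).IsRoot (a : ℂ) →
      eigVec φ r (a : ℂ) ∈ orthCompl G (eigVec φ r δ) := fun a ha =>
    p.eigVec_mem_orthCompl t h hδ1 hδτ ha (ofReal_ne_of_im_ne him a).1 (ofReal_ne_of_im_ne him a).2
  have hc0 : c ≠ 0 := fun h0 => by simpa [h0] using p.pos_two
  have hcard := p.card_negRoots t h hδ1 hδτ hφ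
  have hW : Module.finrank ℂ (orthCompl G (eigVec φ r δ)) + 2 = 22 :=
    finrank_orthCompl h.symm (p.herm_pos t h hδ1 hδτ) (h.herm_eigVec_star hroot him)
  let v : negRoots φ δ → Fin 22 → ℂ := fun α => eigVec φ r (α : ℂ)
  have hv (α : negRoots φ δ) := (mem_negRoots hφ).1 α.2
  have hvneg : ∀ α, RCLike.re (herm G (v α) (v α)) < 0 := fun α =>
    p.herm_neg t h hδ1 hδτ (hv α).1 (hv α).2.1 (hv α).2.2.1 (hv α).2.2.2.1 (hv α).2.2.2.2
  have hvW : ∀ α, v α ∈ orthCompl G (eigVec φ r δ) := fun α =>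
    p.eigVec_mem_orthCompl t h hδ1 hδτ (hv α).1 (hv α).2.2.2.1 (hv α).2.2.2.2
  have horth' : ∀ (α : negRoots φ δ) (β : ℂ), (cpoly φ).IsRoot β → (α : ℂ) ≠ β →
      herm G (v α) (eigVec φ r β) = 0 := by
    intro α β hβ hne
    refine h.herm_eq_zero_of_eigen (h.root_ne_zero (hv α).1) ?_ (h.mulVec_eigVec (hv α).1)
      (h.mulVec_eigVec hβ)
    rw [conj_eq_inv_of_norm_eq_one (hv α).2.1]
    intro h1
    exact hne (by
      have := congrArg (fun x => (α : ℂ) * x) h1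
      simpa [h.root_ne_zero (hv α).1] using this.symm)
  have hvorth : ∀ α β, α ≠ β → herm G (v α) (v β) = 0 := fun α β hne =>
    horth' α β (hv β).1 (fun h0 => hne (Subtype.ext h0))
  have h1root := t.isRoot_one
  have h11 := t.herm_eigVec_one' h
  have h1W : eigVec φ r 1 ∈ orthCompl G (eigVec φ r δ) := by
    have := hreal 1 (by simpa using h1root)
    simpa using this
  -- an eigenvector in the complement is not in the radical of the complement
  have hrad : ∀ α : ℂ, (cpoly φ).IsRoot α → eigVec φ r α ∈ orthCompl G (eigVec φ r δ) →
      ∃ y ∈ orthCompl G (eigVec φ r δ), herm G (eigVec φ r α) y ≠ 0 := by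
    intro α hα hαW
    refine ⟨_, sub_mem_orthCompl h.symm (p.herm_pos t h hδ1 hδτ) (h.herm_eigVec_star hroot him)
      (polyVec φ r 1), ?_⟩
    rw [herm_add_right, herm_add_right, herm_smul_right, herm_smul_right,
      herm_eq_zero_comm h.symm hαW.1, herm_eq_zero_comm h.symm hαW.2, mul_zero, mul_zero, add_zero,
      add_zero]
    exact h.herm_eigVec_one_ne_zero hc0 hα
  rcases (by have := p.card_rootsGtTwo_le; omega :
    (rootsGtTwo Φ).card = 0 ∨ (rootsGtTwo Φ).card = 1) with h0 | h0
  · by_cases h2 : aeval (2 : ℝ) Φ = 0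
    · -- `1` is a triple eigenvalue, with isotropic eigenvector
      obtain ⟨q, hq, hq1⟩ := t.exists_eq_cube_mul h2
      have hqe : ∀ {α : ℂ}, (cpoly φ).IsRoot α → α ≠ 1 → ((X - C 1) * q).eval α = 0 := by
        intro α hα hne
        rw [IsRoot, hq, eval_mul] at hα
        have : q.eval α = 0 := by
          refine (mul_eq_zero.1 hα).resolve_left ?_
          rw [eval_pow, eval_sub, eval_X, eval_C]
          exact pow_ne_zero 3 (sub_ne_zero.2 hne)
        rw [eval_mul, this, mul_zero]
      have hne1 : ∀ {α : ℂ}, α.im ≠ 0 → α ≠ 1 := by rintro _ h0 rfl; exact h0 Complex.one_im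
      have hNu := h.herm_genEigVec hq
      set u := polyVec φ r ((X - C 1) * q) with hu
      have hiso : herm G (eigVec φ r 1) (eigVec φ r 1) = 0 := by rw [h11, h2]; simp
      have huW : u ∈ orthCompl G (eigVec φ r δ) :=
        p.mem_orthCompl_eigVec t h hδ1 hδτ _ (hqe hroot (hne1 him))
          (hqe (isRoot_conj hroot) (hne1 (by rwa [Complex.conj_im, neg_ne_zero])))
      have huneg : RCLike.re (herm G u u) < 0 := by
        have e : aeval (2 : ℂ) Ψ = ((aeval (2 : ℝ) Ψ : ℝ) : ℂ) := by
          rw [← aeval_ofReal]; norm_num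
        rw [hNu, hq1, t.eval_right_one, e, Complex.conj_ofReal, ← Complex.ofReal_mul,
          ← Complex.ofReal_mul, ← Complex.ofReal_neg]
        change -_ < (0 : ℝ)
        rw [neg_lt_zero]
        exact mul_pos (mul_pos two_pos (p.derivative_two_pos t.monic_left h2)) p.pos_two
      have huv : ∀ α, herm G (v α) u = 0 := by
        intro α
        rw [hu, h.herm_eigVec_polyVec (hv α).1, conj_eq_inv_of_norm_eq_one (hv α).2.1, inv_inv,
          hqe (hv α).1 (hv α).2.2.1, zero_mul]
      have hu1 : herm G (eigVec φ r 1) u = 0 := by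
        rw [hu, h.herm_eigVec_polyVec h1root]
        simp
      rw [p.count_one_of_eq t hφ h2] at hcard
      obtain ⟨y, hy, hxy⟩ := hrad 1 h1root h1W
      refine ⟨?_, 1, one_pos, by simpa using h1root, by simpa using h1W, ?_⟩
      · have hfin : Fintype.card (Option (negRoots φ δ)) = 18 := by
          rw [Fintype.card_option, Fintype.card_coe]; omega
        have := hasSignature_of_isotropic h.symm (ι := Option (negRoots φ δ))
          (v := fun o => o.elim u v) (x := eigVec φ r 1) (y := y)
          (W := orthCompl G (eigVec φ r δ))
          (by rintro (_ | α); exacts [huW, hvW α])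
          (by
            rintro (_ | α) (_ | β) hne
            · exact absurd rfl hne
            · exact herm_eq_zero_comm h.symm (huv β)
            · exact huv α
            · exact hvorth α β fun h0 => hne (by rw [h0]))
          (by rintro (_ | α); exacts [huneg, hvneg α]) h1W hy hiso
          (by
            rintro (_ | α)
            · exact herm_eq_zero_comm h.symm hu1
            · exact horth' α 1 h1root (hv α).2.2.1)
          hxy (by rw [hfin]; omega)
        rwa [hfin] at this
      · rw [Complex.ofReal_one, hiso]
        simp
    · -- the eigenvector of the eigenvalue `1` is positive
      have hpos : 0 < RCLike.re (herm G (eigVec φ r 1) (eigVec φ r 1)) := by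
        rw [h11]
        change 0 < c * _
        rw [show c * (2 * aeval (2 : ℝ) Φ * aeval (2 : ℝ) Ψ) =
          2 * aeval (2 : ℝ) Φ * (c * aeval (2 : ℝ) Ψ) by ring]
        exact mul_pos (mul_pos two_pos (eval_two_pos_of_card t.monic_left h0 h2)) p.pos_two
      rw [p.count_one_of_ne t hφ h2] at hcard
      obtain ⟨hN, hNr⟩ := negOn_span_range hvorth hvneg
      obtain ⟨hP, hPr⟩ := posOn_span_singleton hpos
      refine ⟨hasSignature_of_posOn_negOn h.symm ?_ ?_ hP hN hPr (hNr.trans ?_) (by omega), 1,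
        one_pos, by simpa using h1root, by simpa using h1W, by simpa using hpos.le⟩
      · rw [Submodule.span_singleton_le_iff_mem]
        exact h1W
      · rw [Submodule.span_le]
        rintro _ ⟨α, rfl⟩
        exact hvW α
      · rw [Fintype.card_coe]; omega
  · -- there is an isotropic eigenvector with eigenvalue greater than `1`
    have h2 := p.eval_two_neg t.monic_left h0
    rw [p.count_one_of_ne t hφ h2.ne] at hcard
    obtain ⟨a, w, ha0, haw, ha2, -, -, haroot⟩ := t.exists_root_of_card h0
    have haW := hreal a haroot
    have hiso := h.herm_eigVec_real haroot ha2
    have hneg1 : RCLike.re (herm G (eigVec φ r 1) (eigVec φ r 1)) < 0 := by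
      rw [h11]
      change c * _ < 0
      rw [show c * (2 * aeval (2 : ℝ) Φ * aeval (2 : ℝ) Ψ) =
        2 * aeval (2 : ℝ) Φ * (c * aeval (2 : ℝ) Ψ) by ring]
      exact mul_neg_of_neg_of_pos (by linarith) p.pos_two
    have ha1 : (a : ℂ) ≠ 1 := by
      intro h3
      have : a = 1 := by exact_mod_cast h3
      exact ha2 (by rw [this]; norm_num)
    have hanorm : ∀ α : negRoots φ δ, (α : ℂ) ≠ a := by
      intro α h3
      have := (hv α).2.1
      rw [h3, Complex.norm_real, Real.norm_eq_abs, abs_of_pos ha0] at this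
      exact ha2 (by rw [this]; norm_num)
    obtain ⟨y, hy, hxy⟩ := hrad a haroot haW
    refine ⟨?_, a, ha0, haroot, haW, by rw [hiso]; simp⟩
    have hfin : Fintype.card (Option (negRoots φ δ)) = 18 := by
      rw [Fintype.card_option, Fintype.card_coe]; omega
    have := hasSignature_of_isotropic h.symm (ι := Option (negRoots φ δ))
      (v := fun o => o.elim (eigVec φ r 1) v) (x := eigVec φ r (a : ℂ)) (y := y)
      (W := orthCompl G (eigVec φ r δ))
      (by rintro (_ | α); exacts [h1W, hvW α])
      (by
        rintro (_ | α) (_ | β) hne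
        · exact absurd rfl hne
        · exact herm_eq_zero_comm h.symm (horth' β 1 h1root (hv β).2.2.1)
        · exact horth' α 1 h1root (hv α).2.2.1
        · exact hvorth α β fun h0 => hne (by rw [h0]))
      (by rintro (_ | α); exacts [hneg1, hvneg α]) haW hy hiso
      (by
        rintro (_ | α)
        · refine h.herm_eq_zero_of_eigen one_ne_zero ?_ (h.mulVec_eigVec h1root)
            (h.mulVec_eigVec haroot)
          simpa using ha1
        · exact horth' α a haroot (hanorm α))
      hxy (by rw [hfin]; omega)
    rwa [hfin] at this

/-- A sign pattern gives a K3 signature and a Hodge structure for which `A` is a positive Hodge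
isometry. -/
theorem exists_hodgeStructure {L : Submodule ℤ (Fin 22 → ℚ)}
    (hL : L.map ((companion 22 φ).mulVecLin.restrictScalars ℤ) = L)
    (hA : (companion 22 φ)ᵀ * G * companion 22 φ = G) :
    HasSignature G (⊤ : Submodule ℝ (Fin 22 → ℝ)) 3 19 ∧
      ∃ H : HodgeStructure G, H.IsPositiveHodgeIsometry L (companion 22 φ) := by
  have hroot := p.isRoot t hδ1 hδτ
  have him := p.im_ne hδ1 hδτ
  have hpos := p.herm_pos t h hδ1 hδτ
  have horth := h.herm_eigVec_star hroot him
  obtain ⟨hsig, a, ha0, haroot, haW, hacausal⟩ := p.hasSignature_orthCompl t h hδ1 hδτ hφ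
  refine ⟨hasSignature_top_of_orthCompl h.symm hpos horth hsig,
    hodgeOfVector h.symm hpos horth hsig, ?_⟩
  have hiso := h.isHodgeIsometry hroot him hL hA hpos hsig
  rw [eigVec_ofReal_eq] at haW hacausal
  rw [herm_toC] at hacausal
  exact HodgeStructure.isPositive _ h.symm haW (h.rePart_eigVec_ne_zero haroot) hacausal hiso
    (h.mulVec_rePart_eigVec haroot) ha0 (mul_inv_extendScalars h)

end IsPattern

end Signature

/-! ### Elliptic, parabolic and hyperbolic types -/

namespace HodgeStructure

variable {n : ℕ} {G : Matrix (Fin n) (Fin n) ℚ} (H : HodgeStructure G)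

theorem continuous_herm_self : Continuous fun y : Fin n → ℝ => herm G y y := by
  unfold herm
  exact Continuous.dotProduct continuous_id.star (continuous_const.matrix_mulVec continuous_id)

/-- The closure of the time cone consists of the causal vectors. -/
theorem mem_closure_timeCone (hG : G.IsSymm) {x : Fin n → ℝ} :
    x ∈ closure H.timeCone ↔ toC x ∈ H.H11 ∧ 0 ≤ herm G x x := by
  constructor
  · intro hx
    have hcont : Continuous (toC (n := n)) :=
      continuous_pi fun i => Complex.continuous_ofReal.comp (continuous_apply i)
    have hclosed : IsClosed {y : Fin n → ℝ | toC y ∈ H.H11 ∧ 0 ≤ herm G y y} :=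
      (H.H11.closed_of_finiteDimensional.preimage hcont).inter
        (isClosed_le continuous_const continuous_herm_self)
    have hsub : H.timeCone ⊆ {y : Fin n → ℝ | toC y ∈ H.H11 ∧ 0 ≤ herm G y y} :=
      fun y hy => show _ ∧ _ from ⟨hy.1, hy.2.le⟩
    exact closure_minimal hsub hclosed hx
  · rintro ⟨hx, hxx⟩
    obtain ⟨y, hy, hxy⟩ : ∃ y ∈ H.timeCone, 0 ≤ herm G x y := by
      obtain ⟨y, hy⟩ := H.timeCone_nonempty hG
      rcases le_total 0 (herm G x y) with h0 | h0
      · exact ⟨y, hy, h0⟩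
      · refine ⟨(-1 : ℝ) • y, ⟨?_, ?_⟩, ?_⟩
        · change toC ((-1 : ℝ) • y) ∈ H.H11
          rw [toC_smul]
          exact H.H11.smul_mem _ hy.1
        · rw [herm_smul_left, herm_smul_right]
          simpa using hy.2
        · rw [herm_smul_right]
          linarith
    have hlim : Filter.Tendsto (fun ε : ℝ => x + ε • y) (nhdsWithin 0 (Set.Ioi 0)) (nhds x) := by
      have h1 : Continuous fun ε : ℝ => x + ε • y := by fun_prop
      have h2 := h1.tendsto 0
      simp only [zero_smul, add_zero] at h2
      exact h2.mono_left nhdsWithin_le_nhds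
    refine mem_closure_of_tendsto hlim ?_
    filter_upwards [self_mem_nhdsWithin] with ε hε
    refine ⟨?_, ?_⟩
    · change toC (x + ε • y) ∈ H.H11
      rw [toC_add, toC_smul]
      exact H.H11.add_mem hx (H.H11.smul_mem _ hy.1)
    · have hyx : herm G y x = herm G x y := by simpa using herm_comm hG x y
      simp only [herm_add_left, herm_add_right, herm_smul_left, herm_smul_right, hyx, star_trivial]
      have h1 := mul_pos (mul_pos hε hε) hy.2
      have h2 := mul_nonneg hε.le hxy
      nlinarith

end HodgeStructure

section Types

variable {φ ψ Φ Ψ : ℤ[X]} {r : Fin 22 → ℚ} {G : Matrix (Fin 22) (Fin 22) ℚ} {c τ : ℝ}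
  {H : HodgeStructure G} {δ : ℂ}

theorem IsSpectral.hasEigenvalue_iff (h : IsSpectral φ ψ r G c) {α : ℂ} :
    Module.End.HasEigenvalue (cA φ).mulVecLin α ↔ (cpoly φ).IsRoot α := by
  constructor
  · intro hα
    obtain ⟨x, hx⟩ := hα.exists_hasEigenvector
    exact h.isRoot_of_mulVec_eq hx.2 (Module.End.mem_eigenspace_iff.1 hx.1)
  · intro hα
    exact Module.End.hasEigenvalue_of_hasEigenvector
      ⟨Module.End.mem_eigenspace_iff.2 (h.mulVec_eigVec hα), h.eigVec_ne_zero hα⟩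

theorem IsSpectral.preservesLine (h : IsSpectral φ ψ r G c) {a : ℝ}
    (ha : (cpoly φ).IsRoot (a : ℂ)) :
    HodgeStructure.PreservesLine (companion 22 φ) (rePart (eigVec φ r (a : ℂ))) :=
  ⟨h.rePart_eigVec_ne_zero ha, a, h.mulVec_rePart_eigVec ha⟩

theorem IsTracePair.isRoot_ofReal_one (t : IsTracePair φ ψ Φ Ψ) :
    (cpoly φ).IsRoot ((1 : ℝ) : ℂ) := by
  simpa using t.isRoot_one

theorem IsTracePair.herm_rePart_eigVec_one (t : IsTracePair φ ψ Φ Ψ)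
    (h : IsSpectral φ ψ r G c) :
    herm G (rePart (eigVec φ r ((1 : ℝ) : ℂ))) (rePart (eigVec φ r ((1 : ℝ) : ℂ))) =
      c * (2 * aeval (2 : ℝ) Φ * aeval (2 : ℝ) Ψ) := by
  have h1 := t.herm_eigVec_one' h
  rw [← Complex.ofReal_one, eigVec_ofReal_eq, herm_toC] at h1
  exact_mod_cast h1

theorem IsSpectral.herm_rePart_eigVec (h : IsSpectral φ ψ r G c) {a : ℝ}
    (ha : (cpoly φ).IsRoot (a : ℂ)) (ha2 : a ^ 2 ≠ 1) :
    herm G (rePart (eigVec φ r (a : ℂ))) (rePart (eigVec φ r (a : ℂ))) = 0 := by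
  have h1 := h.herm_eigVec_real ha ha2
  rw [eigVec_ofReal_eq, herm_toC] at h1
  exact_mod_cast h1

theorem IsPattern.eval_two_pos_iff (p : IsPattern Φ Ψ c τ) (hΦ : Φ.Monic) :
    0 < aeval (2 : ℝ) Φ ↔ (rootsGtTwo Φ).card = 0 ∧ aeval (2 : ℝ) Φ ≠ 0 := by
  refine ⟨fun h0 => ⟨?_, h0.ne'⟩, fun h0 => eval_two_pos_of_card hΦ h0.1 h0.2⟩
  have h1 := p.card_rootsGtTwo_le
  by_contra h2
  linarith [p.eval_two_neg hΦ (by omega)]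

theorem IsPattern.card_eq_one_of_root (p : IsPattern Φ Ψ c τ) (hΦ : Φ.Monic) {w : ℝ}
    (hw : aeval w Φ = 0) (hw2 : 2 < w) : (rootsGtTwo Φ).card = 1 := by
  have h1 := p.card_rootsGtTwo_le
  have h2 : (w : ℂ) ∈ rootsGtTwo Φ := by
    rw [rootsGtTwo, Multiset.mem_filter, mem_aroots, and_iff_right hΦ.ne_zero, aeval_ofReal, hw]
    exact ⟨Complex.ofReal_zero, Complex.ofReal_im w, hw2⟩
  have := Multiset.card_pos_iff_exists_mem.2 ⟨_, h2⟩
  omega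

theorem IsPattern.isHyperbolic_iff (p : IsPattern Φ Ψ c τ) (t : IsTracePair φ ψ Φ Ψ)
    (h : IsSpectral φ ψ r G c) :
    HodgeStructure.IsHyperbolic (companion 22 φ) ↔ (rootsGtTwo Φ).card = 1 := by
  constructor
  · rintro ⟨l, hl, hiff⟩
    obtain ⟨h1, h2⟩ := (hiff l).2 (.inl rfl)
    have h3 := h.hasEigenvalue_iff.1 h1
    rcases p.root_cases t h3 (h.root_ne_zero h3) with h4 | h4 | ⟨w, h4, -⟩ | ⟨w, -, hw, hw2⟩
    · rw [h4] at h2; simp at h2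
    · rw [h4] at h2; simp at h2
    · exact absurd h4 h2
    · exact p.card_eq_one_of_root t.monic_left hw hw2
  · intro h0
    obtain ⟨l, w, hl, hlw, hw2, hw, hroot⟩ : ∃ l w : ℝ, 1 < l ∧ l + l⁻¹ = w ∧ 2 < w ∧
        aeval w Φ = 0 ∧ (cpoly φ).IsRoot (l : ℂ) := by
      obtain ⟨a, w, ha0, haw, ha2, hw2, hw, hroot⟩ := t.exists_root_of_card h0
      rcases lt_trichotomy a 1 with h1 | h1 | h1
      · refine ⟨a⁻¹, w, (one_lt_inv₀ ha0).2 h1, by rw [inv_inv, add_comm, haw], hw2, hw, ?_⟩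
        have ha0' : (a : ℂ) ≠ 0 := by exact_mod_cast ha0.ne'
        rw [Complex.ofReal_inv, t.isRoot_iff (inv_ne_zero ha0')]
        right
        rw [inv_inv, add_comm, ← Complex.ofReal_inv, ← Complex.ofReal_add, haw, aeval_ofReal, hw,
          Complex.ofReal_zero]
      · rw [h1] at ha2; norm_num at ha2
      · exact ⟨a, w, h1, haw, hw2, hw, hroot⟩
    have hl0 : (l : ℂ) ≠ 0 := h.root_ne_zero hroot
    have hlw' : (l : ℂ) + (l : ℂ)⁻¹ = w := by rw [← hlw]; push_cast; rfl
    have hnorm : ‖(l : ℂ)‖ = l := by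
      rw [Complex.norm_real, Real.norm_eq_abs, abs_of_pos (by linarith)]
    refine ⟨l, hl, fun μ => ?_⟩
    rw [h.hasEigenvalue_iff]
    constructor
    · rintro ⟨h1, h2⟩
      rcases p.root_cases t h1 (h.root_ne_zero h1) with h4 | h4 | ⟨v, h4, -⟩ | ⟨v, hμ, hv, hv2⟩
      · rw [h4] at h2; simp at h2
      · rw [h4] at h2; simp at h2
      · exact absurd h4 h2
      · rw [p.two_le v w hv hw hv2.le hw2.le, ← hlw'] at hμ
        exact (add_inv_eq_iff (h.root_ne_zero h1) hl0).1 hμ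
    · rintro (rfl | rfl)
      · exact ⟨hroot, by rw [hnorm]; exact hl.ne'⟩
      · refine ⟨(t.isRoot_iff (inv_ne_zero hl0)).2 (.inr ?_), ?_⟩
        · rw [inv_inv, add_comm, hlw', aeval_ofReal, hw, Complex.ofReal_zero]
        · rw [norm_inv, hnorm, Ne, inv_eq_one]
          exact hl.ne'

section Period

variable (hδ : IsPeriod φ r H δ) (h : IsSpectral φ ψ r G c)
include hδ h

theorem IsPeriod.toC_rePart_eigVec_mem {a : ℝ} (ha : (cpoly φ).IsRoot (a : ℂ)) :
    toC (rePart (eigVec φ r (a : ℂ))) ∈ H.H11 := by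
  obtain ⟨h1, h2⟩ := ofReal_ne_of_im_ne hδ.im_ne a
  rw [← eigVec_ofReal_eq]
  exact hδ.mem_H11_of_eigen h h1 h2 (h.mulVec_eigVec ha)

omit hδ in
/-- A causal line that is preserved by `A` is spanned by an eigenvector with positive eigenvalue. -/
theorem exists_eq_smul_of_preservesLine {L : Submodule ℤ (Fin 22 → ℚ)}
    (hF : H.IsPositiveHodgeIsometry L (companion 22 φ)) {w : Fin 22 → ℝ} (hw : toC w ∈ H.H11)
    (hww : 0 ≤ herm G w w) (hl : HodgeStructure.PreservesLine (companion 22 φ) w) :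
    ∃ a b : ℝ, 0 < a ∧ (cpoly φ).IsRoot (a : ℂ) ∧ w = b • rePart (eigVec φ r (a : ℂ)) := by
  obtain ⟨hw0, a, ha⟩ := hl
  have h1 : cA φ *ᵥ toC w = (a : ℂ) • toC w := by
    rw [extendScalars_mulVec_toC, ha, toC_smul]
  have hroot := h.isRoot_of_mulVec_eq (toC_ne_zero hw0) h1
  obtain ⟨b, hb⟩ := h.exists_smul_eigVec hroot h1
  refine ⟨a, b.re, H.eigenvalue_pos h.symm hw hw0 hww hF ha, hroot, ?_⟩
  rw [eigVec_ofReal_eq] at hb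
  ext i
  have := congrArg Complex.re (congrFun hb i)
  simpa [toC] using this

variable (t : IsTracePair φ ψ Φ Ψ) (p : IsPattern Φ Ψ c τ) {L : Submodule ℤ (Fin 22 → ℚ)}
  (hF : H.IsPositiveHodgeIsometry L (companion 22 φ))
include t p

theorem IsPeriod.rePart_eigVec_one_mem_timeCone (h0 : 0 < aeval (2 : ℝ) Φ) :
    rePart (eigVec φ r ((1 : ℝ) : ℂ)) ∈ H.timeCone := by
  refine ⟨hδ.toC_rePart_eigVec_mem h t.isRoot_ofReal_one, ?_⟩
  rw [t.herm_rePart_eigVec_one h]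
  have := mul_pos h0 p.pos_two
  linarith

include hF

theorem IsPeriod.isElliptic_iff :
    H.IsElliptic (companion 22 φ) ↔ 0 < aeval (2 : ℝ) Φ := by
  constructor
  · rintro ⟨v, ⟨hv, hvv⟩, hl⟩
    obtain ⟨a, b, ha, hroot, rfl⟩ := exists_eq_smul_of_preservesLine h hF hv hvv.le hl
    rw [herm_smul_left, herm_smul_right, star_trivial] at hvv
    by_cases ha1 : a = 1
    · rw [ha1, t.herm_rePart_eigVec_one h] at hvv
      by_contra h0
      have h1 := mul_nonneg (neg_nonneg.2 (not_lt.1 h0)) p.pos_two.le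
      have h2 := mul_nonneg (mul_self_nonneg b) h1
      linarith
    · rw [h.herm_rePart_eigVec hroot fun h0 => ha1 (by nlinarith)] at hvv
      simp at hvv
  · intro h0
    exact ⟨_, hδ.rePart_eigVec_one_mem_timeCone h t p h0, h.preservesLine t.isRoot_ofReal_one⟩

theorem IsPeriod.isParabolic_iff :
    H.IsParabolic (companion 22 φ) ↔ aeval (2 : ℝ) Φ = 0 := by
  constructor
  · rintro ⟨v, hv, hv', hl, huniq⟩
    obtain ⟨hvH, hvv⟩ := (H.mem_closure_timeCone h.symm).1 hv
    have hvv0 : herm G v v = 0 := le_antisymm (not_lt.1 fun h0 => hv' ⟨hvH, h0⟩) hvv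
    rcases lt_trichotomy (aeval (2 : ℝ) Φ) 0 with h0 | h0 | h0
    · exfalso
      -- the eigenvectors of two inverse eigenvalues span two distinct isotropic lines
      have hcard : (rootsGtTwo Φ).card = 1 := by
        have h1 := p.card_rootsGtTwo_le
        by_contra h2
        linarith [eval_two_pos_of_card t.monic_left (by omega) h0.ne]
      obtain ⟨a, w, ha0, haw, ha2, -, hw, hroot⟩ := t.exists_root_of_card hcard
      have hroot' : (cpoly φ).IsRoot ((a⁻¹ : ℝ) : ℂ) := by
        rw [t.isRoot_iff (by exact_mod_cast (inv_pos.2 ha0).ne')]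
        right
        rw [← Complex.ofReal_inv, inv_inv, ← Complex.ofReal_add, add_comm, haw, aeval_ofReal, hw,
          Complex.ofReal_zero]
      obtain ⟨k, hk⟩ := hl.2
      have key : ∀ b : ℝ, b ^ 2 ≠ 1 → (cpoly φ).IsRoot (b : ℂ) → b = k := by
        intro b hb2 hb
        obtain ⟨s, hs⟩ := huniq _ ((H.mem_closure_timeCone h.symm).2
          ⟨hδ.toC_rePart_eigVec_mem h hb, (h.herm_rePart_eigVec hb hb2).ge⟩) (h.preservesLine hb)
        have h1 := h.mulVec_rePart_eigVec hb
        have h2 := h.rePart_eigVec_ne_zero hb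
        rw [hs, Matrix.mulVec_smul, hk, ← smul_comm, ← hs] at h1
        exact (smul_left_injective ℝ h2 h1).symm
      have h3 : a = a⁻¹ := (key a ha2 hroot).trans (key a⁻¹ (by
        rw [inv_pow, Ne, inv_eq_one]; exact ha2) hroot').symm
      apply ha2
      rw [sq]
      nth_rewrite 2 [h3]
      exact mul_inv_cancel₀ ha0.ne'
    · exact h0
    · exfalso
      have h1 := hδ.rePart_eigVec_one_mem_timeCone h t p h0
      obtain ⟨s, hs⟩ := huniq _ (subset_closure h1) (h.preservesLine t.isRoot_ofReal_one)
      have h2 := h1.2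
      rw [hs, herm_smul_left, herm_smul_right, hvv0] at h2
      simp at h2
  · intro h0
    have hself := t.herm_rePart_eigVec_one h
    rw [h0] at hself
    simp only [mul_zero, zero_mul] at hself
    refine ⟨rePart (eigVec φ r ((1 : ℝ) : ℂ)), (H.mem_closure_timeCone h.symm).2
      ⟨hδ.toC_rePart_eigVec_mem h t.isRoot_ofReal_one, hself.ge⟩, fun h1 => h1.2.ne' hself,
      h.preservesLine t.isRoot_ofReal_one, fun w hw hl => ?_⟩
    obtain ⟨hwH, hww⟩ := (H.mem_closure_timeCone h.symm).1 hw
    obtain ⟨a, b, ha, hroot, rfl⟩ := exists_eq_smul_of_preservesLine h hF hwH hww hl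
    obtain rfl : a = 1 := by
      rcases p.root_cases t hroot (h.root_ne_zero hroot) with h4 | h4 | ⟨w, h4, -⟩ | ⟨w, -, hw, hw2⟩
      · exact_mod_cast h4
      · have : a = -1 := by exact_mod_cast h4
        linarith
      · rwa [Complex.norm_real, Real.norm_eq_abs, abs_of_pos ha] at h4
      · have h5 := p.card_eq_one_of_root t.monic_left hw hw2
        rw [p.card_rootsGtTwo_eq_zero h0] at h5
        omega
    exact ⟨b, rfl⟩

end Period

/-! ### Uniqueness of the Hodge structure -/

theorem IsPeriod.isSpecialTrace_iff (hδ : IsPeriod φ r H δ) (h : IsSpectral φ ψ r G c) {x : ℝ} :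
    H.IsSpecialTrace (companion 22 φ) x ↔ x = 2 * δ.re := by
  constructor
  · rintro ⟨ε, -, h1, h2⟩
    have h3 := h1 _ hδ.mem_H20
    have h4 : ε = δ := smul_left_injective ℂ (h.eigVec_ne_zero hδ.root)
      (h3.symm.trans (h.mulVec_eigVec hδ.root))
    rw [h4, hδ.add_inv] at h2
    exact_mod_cast h2
  · rintro rfl
    refine ⟨δ, hδ.norm_eq, fun x hx => ?_, hδ.add_inv.symm⟩
    rw [hδ.H20_eq] at hx
    obtain ⟨s, rfl⟩ := Submodule.mem_span_singleton.1 hx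
    change cA φ *ᵥ _ = _
    rw [Matrix.mulVec_smul, h.mulVec_eigVec hδ.root, smul_comm]

/-- The Hodge structure is determined by the special trace, up to complex conjugation. -/
theorem IsPeriod.eq_or_conj (hδ : IsPeriod φ r H δ) (hG : G.IsSymm) {H' : HodgeStructure G} {δ' : ℂ}
    (hδ' : IsPeriod φ r H' δ') (hre : δ'.re = δ.re) :
    (H'.H20 = H.H20 ∧ H'.H11 = H.H11 ∧ H'.H02 = H.H02) ∨
      (H'.H20 = H.H02 ∧ H'.H11 = H.H11 ∧ H'.H02 = H.H20) := by
  have h1 : δ' + δ'⁻¹ = δ + δ⁻¹ := by rw [hδ.add_inv, hδ'.add_inv, hre]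
  rcases (add_inv_eq_iff (ne_zero_of_norm hδ'.norm_eq) (ne_zero_of_norm hδ.norm_eq)).1 h1 with
    rfl | h2
  · left
    refine ⟨hδ'.H20_eq.trans hδ.H20_eq.symm, ?_, hδ'.H02_eq.trans hδ.H02_eq.symm⟩
    ext x
    rw [hδ'.mem_H11_iff hG, hδ.mem_H11_iff hG]
  · right
    rw [← conj_eq_inv_of_norm_eq_one hδ.norm_eq] at h2
    subst h2
    have h3 := hδ'.H02_eq
    rw [Complex.conj_conj] at h3
    refine ⟨hδ'.H20_eq.trans hδ.H02_eq.symm, ?_, h3.trans hδ.H20_eq.symm⟩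
    ext x
    rw [hδ'.mem_H11_iff hG, hδ.mem_H11_iff hG, Complex.conj_conj, and_comm]

end Types

/-! ### The criterion -/

section Criterion

variable {φ ψ Φ Ψ : ℤ[X]} {r : Fin 22 → ℚ} {G : Matrix (Fin 22) (Fin 22) ℚ}

/-- The normalized invariant form exists and is unique. -/
theorem IsReflectionVector.existsUnique_form
    (hQ : IsHyperPair 21 (φ.map (Int.castRingHom ℚ)) (ψ.map (Int.castRingHom ℚ)))
    (hr : IsReflectionVector 22 φ ψ r) : ∃ G, IsNormalizedInvariantForm 22 φ ψ r G ∧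
      ∀ G', IsNormalizedInvariantForm 22 φ ψ r G' → G' = G := by
  obtain ⟨κ, hκ, hrκ⟩ := hr.exists_smul hQ
  obtain ⟨G, hG⟩ := hQ.exists_dual_form hκ hrκ
  refine ⟨G, ⟨hQ.dual_form_symm hκ hrκ hG, ?_, ?_, ?_⟩, ?_⟩
  · rw [companion_eq_cmat]; exact hQ.dual_form_invariant hκ hrκ hG
  · rw [companion_eq_cmat]; exact hQ.dual_form_invariant' hκ hrκ hG
  · rw [hQ.dual_form_self hrκ hG, ← mul_assoc, inv_mul_cancel₀ hκ, one_mul]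
  · rintro G' ⟨-, hA, hB, hrr⟩
    rw [companion_eq_cmat] at hA hB
    exact hQ.dual_form_unique hκ hrκ hG (hQ.dual_of_invariant two_ne_zero hκ hrκ hA hB hrr)

theorem IsUnimodular.neg {n : ℕ} {G : Matrix (Fin n) (Fin n) ℚ} {L : Submodule ℤ (Fin n → ℚ)}
    (h : IsUnimodular G L) : IsUnimodular (-G) L := by
  intro x
  rw [h x]
  refine forall₂_congr fun y _ => ?_
  rw [Matrix.neg_mulVec, dotProduct_neg]
  constructor <;> rintro ⟨k, hk⟩ <;> refine ⟨-k, ?_⟩ <;> push_cast <;> linarith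

theorem IsEven.neg {n : ℕ} {G : Matrix (Fin n) (Fin n) ℚ} {L : Submodule ℤ (Fin n → ℚ)}
    (h : IsEven G L) : IsEven (-G) L := by
  intro x hx
  obtain ⟨k, hk⟩ := h x hx
  refine ⟨-k, ?_⟩
  rw [Matrix.neg_mulVec, dotProduct_neg, hk]
  push_cast
  ring

theorem renormalize_eq_or {n : ℕ} (G : Matrix (Fin n) (Fin n) ℚ) :
    renormalize G = G ∨ renormalize G = -G := by
  unfold renormalize
  split_ifs
  · exact .inr rfl
  · exact .inl rfl

theorem renormalize_eq_self {n : ℕ} {G : Matrix (Fin n) (Fin n) ℚ} {p q : ℕ} (hpq : p ≤ q)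
    (h : HasSignature G (⊤ : Submodule ℝ (Fin n → ℝ)) p q) : renormalize G = G := by
  refine if_neg ?_
  rintro ⟨p', q', hlt, h'⟩
  obtain ⟨rfl, rfl⟩ := h.unique h'
  omega

theorem renormalize_eq_neg {n : ℕ} {G : Matrix (Fin n) (Fin n) ℚ} {p q : ℕ} (hpq : q < p)
    (h : HasSignature G (⊤ : Submodule ℝ (Fin n → ℝ)) p q) : renormalize G = -G :=
  if_pos ⟨p, q, hpq, h⟩

/-- The renormalized form is `± 1` times the normalized one. -/
theorem IsSpectral.exists_renormalize (h : IsSpectral φ ψ r G 1) :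
    ∃ c : ℝ, IsSpectral φ ψ r (renormalize G) c := by
  rcases renormalize_eq_or G with h1 | h1 <;> rw [h1]
  · exact ⟨1, h⟩
  · exact ⟨-1, h.neg⟩

theorem IsTracePair.right_ne_zero (t : IsTracePair φ ψ Φ Ψ) (hC : IsCoprime (cpoly φ) (cpoly ψ))
    {w : ℝ} (hw : aeval w Φ = 0) : aeval w Ψ ≠ 0 := by
  intro hw'
  obtain ⟨α, hα, hαw⟩ := exists_add_inv_eq (w : ℂ)
  obtain ⟨a, b, hab⟩ := hC
  have h1 := congrArg (eval α) hab
  rw [eval_add, eval_mul, eval_mul, eval_cpoly, eval_cpoly, t.eq_left α hα, t.eq_right α hα, hαw,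
    aeval_ofReal, aeval_ofReal, hw, hw'] at h1
  simp at h1

/-- A sign pattern for `± 1` times the normalized form gives, after renormalization, a K3 lattice
with a Hodge structure for which `A` is a positive Hodge isometry. -/
theorem IsPattern.isK3Lattice {ε : ℤ} (hε : ε = 1 ∨ ε = -1) {τ : ℝ}
    (p : IsPattern Φ Ψ (ε : ℝ) τ) (t : IsTracePair φ ψ Φ Ψ) (h : IsSpectral φ ψ r G 1)
    (hφ : φ.Monic) (hφ_deg : φ.natDegree = 22)
    (hQ : IsHyperPair 21 (φ.map (Int.castRingHom ℚ)) (ψ.map (Int.castRingHom ℚ)))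
    (hr : IsReflectionVector 22 φ ψ r) (hG : IsNormalizedInvariantForm 22 φ ψ r G)
    (hU : IsUnimodular G (lattice 22 φ r)) :
    IsK3Lattice (renormalize G) (lattice 22 φ r) ∧ ∃ H : HodgeStructure (renormalize G),
      H.IsPositiveHodgeIsometry (lattice 22 φ r) (companion 22 φ) := by
  obtain ⟨δ, hδ1, hδτ⟩ := exists_norm_eq_one_add_inv_eq p.neg_two_lt.le p.lt_two.le
  have hL := lattice_map_companion (r := r) hφ hφ_deg hQ
  have hE := isEven_lattice hQ hφ hr hG
  have hrank := finrank_lattice hQ hr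
  have hspan := span_lattice hQ hr
  rcases hε with rfl | rfl
  · rw [Int.cast_one] at p
    obtain ⟨hsig, hH⟩ := p.exists_hodgeStructure t h hδ1 hδτ hφ hL hG.2.1
    rw [renormalize_eq_self (by norm_num) hsig]
    exact ⟨⟨hrank, hspan, hE, hU, hsig⟩, hH⟩
  · rw [Int.cast_neg, Int.cast_one] at p
    obtain ⟨hsig, hH⟩ := p.exists_hodgeStructure t h.neg hδ1 hδτ hφ hL (by
      rw [Matrix.mul_neg, Matrix.neg_mul, hG.2.1])
    have hsig' := hsig.neg hG.1.neg
    rw [neg_neg] at hsig'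
    rw [renormalize_eq_neg (by norm_num) hsig']
    exact ⟨⟨hrank, hspan, hE.neg, hU.neg, hsig⟩, hH⟩

end Criterion

end HyperK3

theorem theorem1p2 (φ ψ Φ Ψ : ℤ[X])
    -- `φ` and `ψ` are monic of degree 22, anti-palindromic and palindromic, and coprime
    (hφ : φ.Monic) (hφ_deg : φ.natDegree = 22) (hφ_anti : φ.reflect 22 = -φ)
    (hψ : ψ.Monic) (hψ_deg : ψ.natDegree = 22) (hψ_pal : ψ.reflect 22 = ψ)
    (hcop : IsCoprime (φ.map (Int.castRingHom ℚ)) (ψ.map (Int.castRingHom ℚ)))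
    -- `Φ` and `Ψ` are their trace polynomials
    (hΦ : Φ.Monic) (hΦ_deg : Φ.natDegree = 10)
    (hφΦ : ∀ z : ℂ, z ≠ 0 → aeval z φ = (z ^ 2 - 1) * z ^ 10 * aeval (z + z⁻¹) Φ)
    (hΨ : Ψ.Monic) (hΨ_deg : Ψ.natDegree = 11)
    (hψΨ : ∀ z : ℂ, z ≠ 0 → aeval z ψ = z ^ 11 * aeval (z + z⁻¹) Ψ) :
    -- the vector `r` and the invariant form exist, and the form is unique
    (∃ r, IsReflectionVector 22 φ ψ r) ∧
    ∀ r, IsReflectionVector 22 φ ψ r →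
      ∃ G, IsNormalizedInvariantForm 22 φ ψ r G ∧
        (∀ G', IsNormalizedInvariantForm 22 φ ψ r G' → G' = G) ∧
        (IsUnimodular G (lattice 22 φ r) →
          -- criterion
          ((IsK3Lattice (renormalize G) (lattice 22 φ r) ∧
              ∃ H : HodgeStructure (renormalize G),
                H.IsPositiveHodgeIsometry (lattice 22 φ r) (companion 22 φ)) ↔
            (Φ.eval (-2) ≠ 0 ∧ SimpleRoots Φ ∧ SimpleRoots Ψ ∧
              (ConfigE Φ Ψ ∨ ConfigP Φ Ψ ∨ ConfigH Φ Ψ))) ∧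
          -- the types
          (∀ H : HodgeStructure (renormalize G),
            H.IsPositiveHodgeIsometry (lattice 22 φ r) (companion 22 φ) →
              (H.IsElliptic (companion 22 φ) ↔ ConfigE Φ Ψ) ∧
              (H.IsParabolic (companion 22 φ) ↔ ConfigP Φ Ψ) ∧
              (HodgeStructure.IsHyperbolic (companion 22 φ) ↔ ConfigH Φ Ψ)) ∧
          -- uniqueness of the Hodge structure up to complex conjugation
          (∀ H H' : HodgeStructure (renormalize G),
            H.IsPositiveHodgeIsometry (lattice 22 φ r) (companion 22 φ) →
            H'.IsPositiveHodgeIsometry (lattice 22 φ r) (companion 22 φ) →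
              (H'.H20 = H.H20 ∧ H'.H11 = H.H11 ∧ H'.H02 = H.H02) ∨
              (H'.H20 = H.H02 ∧ H'.H11 = H.H11 ∧ H'.H02 = H.H20)) ∧
          -- uniqueness and location of the special trace
          ((∃ H : HodgeStructure (renormalize G),
              H.IsPositiveHodgeIsometry (lattice 22 φ r) (companion 22 φ)) →
            ∃ τ : ℝ,
              (∀ H : HodgeStructure (renormalize G),
                H.IsPositiveHodgeIsometry (lattice 22 φ r) (companion 22 φ) →
                  ∀ t : ℝ, H.IsSpecialTrace (companion 22 φ) t ↔ t = τ) ∧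
              ∀ (T : TraceClusters (rootsOn Φ) (rootsOn Ψ)) (k : ℕ),
                (T.EPEntry (rootsOff Ψ).card k → T.EPLocation τ k) ∧
                (T.HypEntry (rootsGtTwo Φ).card (rootsOff Ψ).card k → T.HypLocation τ k))) := by
  have hQ := isHyperPair_map (K := ℚ) hφ hφ_deg hφ_anti hψ hψ_deg hψ_pal hcop
  have hC := isHyperPair_map (K := ℂ) hφ hφ_deg hφ_anti hψ hψ_deg hψ_pal hcop
  have t : IsTracePair φ ψ Φ Ψ := ⟨hΦ, hΦ_deg, hΨ, hΨ_deg, hφΦ, hψΨ⟩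
  refine ⟨exists_isReflectionVector hQ, fun r hr => ?_⟩
  obtain ⟨G, hG, huniq⟩ := hr.existsUnique_form hQ
  refine ⟨G, hG, huniq, fun hU => ?_⟩
  have hS := isSpectral_of_normalized hQ hC hr hG
  obtain ⟨c, h⟩ := hS.exists_renormalize
  obtain ⟨hunit, hΨeq⟩ := eval_two_of_unimodular hφ hφ_deg hQ t hr hS hU
  have hunit' : IsUnit (Ψ.eval (-2)) := hΨeq ▸ hunit
  have hΨ2 : aeval (2 : ℝ) Ψ = aeval (-2 : ℝ) Ψ := by
    rw [aeval_two_eq, aeval_neg_two_eq, hΨeq]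
  -- a positive Hodge isometry determines a sign pattern
  have hpat : ∀ H : HodgeStructure (renormalize G),
      H.IsPositiveHodgeIsometry (lattice 22 φ r) (companion 22 φ) →
        ∃ δ, IsPeriod φ r H δ ∧ IsPattern Φ Ψ c (2 * δ.re) := by
    intro H hH
    obtain ⟨δ, hδ⟩ := exists_isPeriod h H hH.1
    exact ⟨δ, hδ, hδ.isPattern h t hH hΨ2⟩
  refine ⟨⟨?_, ?_⟩, ?_, ?_, ?_⟩
  · rintro ⟨-, H, hH⟩
    obtain ⟨δ, -, p⟩ := hpat H hH
    obtain ⟨hE, hP, hHyp⟩ := p.configs hΦ hΦ_deg hΨ hΨ_deg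
    have hneg2 := eval_neg_two_pos hΦ (by rw [hΦ_deg]) p.real
    rw [aeval_neg_two_eq] at hneg2
    refine ⟨fun h0 => ?_, p.simple, p.simpleRoots_right hΦ hΦ_deg hΨ hΨ_deg hunit hunit', ?_⟩
    · rw [h0] at hneg2
      simp at hneg2
    · rw [hE, hP, hHyp]
      have := p.card_rootsGtTwo_le
      by_cases h2 : Φ.eval 2 = 0
      · exact .inr (.inl h2)
      · rcases (by omega : (rootsGtTwo Φ).card = 0 ∨ (rootsGtTwo Φ).card = 1) with h3 | h3
        · exact .inl ⟨h3, h2⟩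
        · exact .inr (.inr h3)
  · rintro ⟨hneg2, hs, hs', hconf⟩
    -- the sign is chosen so that the form is negative on the eigenvector of the eigenvalue `-1`
    have hsign : 0 < ((Ψ.eval 2 : ℤ) : ℝ) * aeval (2 : ℝ) Ψ := by
      rw [aeval_two_eq]
      exact mul_self_pos.2 (Int.cast_ne_zero.2 hunit.ne_zero)
    obtain ⟨τ, p⟩ := exists_isPattern_of_config hΦ hΦ_deg hΨ hneg2 hs hs'
      (fun w hw => t.right_ne_zero hC.coprime hw) hsign (by
        rw [aeval_neg_two_eq]
        exact Int.cast_ne_zero.2 hunit'.ne_zero) hconf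
    exact p.isK3Lattice (Int.isUnit_iff.1 hunit) t hS hφ hφ_deg hQ hr hG hU
  · intro H hH
    obtain ⟨δ, hδ, p⟩ := hpat H hH
    obtain ⟨hE, hP, hHyp⟩ := p.configs hΦ hΦ_deg hΨ hΨ_deg
    rw [hE, hP, hHyp, hδ.isElliptic_iff h t p hH, hδ.isParabolic_iff h t p hH,
      p.isHyperbolic_iff t h, p.eval_two_pos_iff hΦ, aeval_two_eq, Ne, Int.cast_eq_zero]
    exact ⟨Iff.rfl, Iff.rfl, Iff.rfl⟩
  · intro H H' hH hH'
    obtain ⟨δ, hδ, p⟩ := hpat H hH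
    obtain ⟨δ', hδ', p'⟩ := hpat H' hH'
    have := (p'.isParity hΦ hΨ).unique (p.isParity hΦ hΨ)
    exact hδ.eq_or_conj h.symm hδ' (by linarith)
  · rintro ⟨H, hH⟩
    obtain ⟨δ, hδ, p⟩ := hpat H hH
    refine ⟨2 * δ.re, fun H' hH' x => ?_, fun T k => p.location hΦ hΨ
      (p.simpleRoots_right hΦ hΦ_deg hΨ hΨ_deg hunit hunit') T k hΦ_deg⟩
    obtain ⟨δ', hδ', p'⟩ := hpat H' hH'
    rw [hδ'.isSpecialTrace_iff h, (p'.isParity hΦ hΨ).unique (p.isParity hΦ hΨ)]
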